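/- **Setting.** Let $\Omega\subset\mathbb R^2$ be a bounded simply connected polygonal domain with Lipschitz boundary, $k\ge 0$ an integer, $\nu>0$, $f\in[L^2(\Omega)]^2$. A staggered mesh of $\Omega$ is a partition $\mathcal S$ of $\Omega$ into star-shaped polygons $S$ (a vertex of one polygon on a side of another counts as a vertex of both), with a point $x_S$ in the interior of the kernel of each $S$; joining $x_S$ to the vertices of $S$ gives a conforming triangulation $\mathcal T_h$. The edges of the polygons are the primal edges $\mathcal F_{pr}$ and the added edges the dual edges $\mathcal F_{dl}$; $\mathcal F_h=\mathcal F_{pr}\cup\mathcal F_{dl}$ and $\mathcal F_h^0$, $\mathcal F_{pr}^0$ are the edges of $\mathcal F_h$, $\mathcal F_{pr}$ not on $\partial\Omega$. Each edge $e$ has length $h_e$ and the unit outward normal $n$ and counterclockwise tangent $t$ of one chosen adjacent triangle $\tau_+$; $[v]=v|_{\tau_+}-v|_{\tau_-}$ and $\{v\}=(v|_{\tau_+}+v|_{\tau_-})/2$ on interior edges, $[v]=\{v\}=v$ on boundary edges. The mesh is $(\rho_E,\rho_B)$-regular if, with $h_S=\operatorname{diam}S$, every edge of every $S$ has length $\ge\rho_E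 h_S$ and $S$ is star-shaped with respect to the ball of radius $\rho_B h_S$ about $x_S$. With $\mathbb P_k(\mathcal T_h)$ the piecewise polynomials of degree $\le k$, let $$H_h=\{H\in[\mathbb P_k(\mathcal T_h)]^{2\times2}:[Hn]=0\text{ on }\mathcal F_{pr}^0,\ [t\cdot Hn]=0\text{ on }\mathcal F_{dl}\},$$ $$V_h=\{v\in[\mathbb P_k(\mathcal T_h)]^2:[v\cdot n]=0\text{ on }\mathcal F_{dl}\},\qquad Q_h=\{q\in\mathbb P_k(\mathcal T_h):[q]=0\text{ on }\mathcal F_{pr}^0\},$$ $Q_h^0=\{q\in Q_h:\int_\Omega q=0\}$ and $V_h^{\rm div}=\{v\in V_h: v\in H({\rm div};\Omega),\ \nabla\cdot v=0\}$. Put $$\|v\|_h^2=\|\nabla v\|_{L^2(\mathcal T_h)}^2+\sum_{e\in\mathcal F_{pr}}h_e^{-1}\|[v]\|_{L^2(e)}^2+\sum_{e\in\mathcal F_{dl}}h_e^{-1}\|[v\cdot t]\|^2_{L^2(e)},$$ $$B_h(H,v)=\sum_\tau(H,\nabla v)_\tau-\sum_{\mathcal F_{pr}}\langle Hn,[v]\rangle_e-\sum_{\mathcal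 F_{dl}}\langle t\cdot Hn,[v\cdot t]\rangle_e,$$ $$B_h^*(v,H)=\sum_\tau(v,{\rm div}H)_\tau-\sum_{\mathcal F_{dl}}\langle v\cdot n,[n\cdot Hn]\rangle_e,$$ $$b_h(v,q)=-\sum_\tau(v,\nabla q)_\tau+\sum_{\mathcal F_{dl}}\langle v\cdot n,[q]\rangle_e,\qquad b_h^*(q,v)=-\sum_\tau(q,\nabla\cdot v)_\tau+\sum_{\mathcal F_{pr}}\langle q,[v\cdot n]\rangle_e,$$ $$N_h(w;\psi,v)=-\sum_\tau(\psi\otimes w,\nabla v)_\tau+\sum_{\mathcal F_h^0}\langle\{w\cdot n\},\{\psi\}\cdot[v]\rangle_e+\sum_{\mathcal F_h}\langle|\{w\cdot n\}|,[\psi]\cdot[v]\rangle_e .$$ The scheme is: find $(G_h,u_h,p_h)\in H_h\times V_h\times Q_h^0$ with $$\nu^{-1}(G_h,H)+B_h^*(u_h,H)=0,\quad B_h(G_h,v)+N_h(u_h;u_h,v)+b_h^*(p_h,v)=(f,v),\quad b_h(u_h,q)=0$$ for all $H\in H_h$, $v\in V_h$, $q\in Q_h^0$. The linearized solution map $T_h$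 sends $z\in V_h^{\rm div}$ to the $w\in V_h$ for which there are $S\in H_h$, $r\in Q_h^0$ with $$\nu^{-1}(S,H)+B_h^*(w,H)+B_h(S,v)+b_h^*(r,v)+b_h(w,q)+N_h(z;w,v)=(f,v)\quad\forall (H,v,q)\in H_h\times V_h\times Q_h.$$ Let $W_h^\rho=\{v\in V_h^{\rm div}:\|v\|_h\le\rho\}$. Write $f=f_0+\nabla\chi$ for any decomposition with $f_0\in H({\rm div};\Omega)$, $\nabla\cdot f_0=0$, $\chi\in H^1(\Omega)$, $\int_\Omega\chi=0$. **Theorem.** (0) On every staggered mesh $T_h$ is a well-defined map from $V_h^{\rm div}$ into $V_h^{\rm div}$, and $u$ is a fixed point of $T_h$ in $V_h^{\rm div}$ if and only if $(G,u,p)$ solves the scheme for some $G,p$. (1) For all $\rho_E,\rho_B>0$ there are constants $C_B,C_N>0$, depending only on $\Omega,k,\rho_E,\rho_B$, such that on every $(\rho_E,\rho_B)$-regular staggered mesh of $\Omega$ $$C_B\le\inf_{0\ne v\in V_h}\ \sup_{0\ne H\in H_h}\frac{B_h(H,v)}{\|H\|_{L^2(\Omega)}\|v\|_h},\qquad N_h(z;v,w)\le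 C_N\|z\|_h\|v\|_h\|w\|_h\quad\forall z,v,w\in V_h,$$ and such that for all $\nu>0$, $f$ and $f=f_0+\nabla\chi$ as above: if $$\|f_0\|_{L^2(\Omega)}<C_B^4C_N^{-1}\nu^2,$$ then for every $\rho$ with $C_B^{-2}\nu^{-1}\|f_0\|_{L^2(\Omega)}\le\rho<C_B^2C_N^{-1}\nu$ the map $T_h$ has a unique fixed point in $W_h^\rho$, and the scheme has a unique solution $(G_h,u_h,p_h)$ with $u_h\in W_h^\rho$. (2) On any staggered mesh, let $C_B,C_N,C_P>0$ be any constants for which the inf-sup inequality in (1) holds and $$N_h(z_1;v,w)-N_h(z_2;v,w)\le C_N\|z_1-z_2\|_h\|v\|_h\|w\|_h,\qquad\|v\|_{L^2(\Omega)}\le C_P\|v\|_h\qquad\forall z_1,z_2,v,w\in V_h .$$ If $C_P\|f_0\|_{L^2(\Omega)}<C_B^4C_N^{-1}\nu^2$, then the conclusion of (1) holds for every $\rho$ with $C_B^{-2}\nu^{-1}C_P\|f_0\|_{L^2(\Omega)}\le\rho<C_B^2C_N^{-1}\nu$. -/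

import Mathlib

open MeasureTheory Topology
open scoped NNReal ENNReal ContDiff Matrix

noncomputable section

namespace SDG

/-- The Euclidean plane. -/
abbrev Plane : Type := EuclideanSpace ℝ (Fin 2)

/-- Polynomials in the two coordinates of the plane. -/
abbrev Poly : Type := MvPolynomial (Fin 2) ℝ

/-- Value of a polynomial at a point of the plane. -/
def pval (p : Poly) (x : Plane) : ℝ := MvPolynomial.eval (fun i => x i) p

/-! ### Domains -/

/-- Near each of its boundary points, in suitable rotated coordinates, the set is the region
strictly above the graph of a Lipschitz function. -/
def HasLipschitzBoundary (Ω : Set Plane) : Prop :=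
  ∀ x ∈ frontier Ω, ∃ (R : Plane ≃ₗᵢ[ℝ] Plane) (K : ℝ≥0) (γ : ℝ → ℝ),
    LipschitzWith K γ ∧ ∃ U ∈ 𝓝 x, ∀ y ∈ U, y ∈ Ω ↔ γ (R y 0) < R y 1

/-- Bounded simply connected polygonal domains with Lipschitz boundary. -/
structure IsPolygonalDomain (Ω : Set Plane) : Prop where
  isOpen : IsOpen Ω
  isBounded : Bornology.IsBounded Ω
  isSimplyConnected : IsSimplyConnected Ω
  polygonal : ∃ s : Finset (Plane × Plane), frontier Ω = ⋃ e ∈ s, segment ℝ e.1 e.2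
  lipschitz : HasLipschitzBoundary Ω

/-! ### Weak derivatives and the Helmholtz-Hodge decomposition -/

/-- Test functions `C_c^∞(Ω)`. -/
def IsTest (Ω : Set Plane) (φ : Plane → ℝ) : Prop :=
  ContDiff ℝ ∞ φ ∧ HasCompactSupport φ ∧ tsupport φ ⊆ Ω

/-- The partial derivative `∂_i φ`. -/
def partialD (i : Fin 2) (φ : Plane → ℝ) (x : Plane) : ℝ :=
  fderiv ℝ φ x (EuclideanSpace.single i 1)

/-- Square-integrable fields on `Ω`, respectively functions on `Ω`. -/
def IsL2 {F : Type*} [NormedAddCommGroup F] (Ω : Set Plane) (u : Plane → F) : Prop :=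
  MemLp u 2 (volume.restrict Ω)

/-- The norm of `L^2(Ω)`. -/
def normL2 {F : Type*} [NormedAddCommGroup F] (Ω : Set Plane) (u : Plane → F) : ℝ :=
  (eLpNorm u 2 (volume.restrict Ω)).toReal

/-- `u ∈ H(div; Ω)` with `∇ · u = 0`: the field is square-integrable and its distributional
divergence vanishes. -/
def IsDivFree (Ω : Set Plane) (u : Plane → Plane) : Prop :=
  IsL2 Ω u ∧ ∀ φ, IsTest Ω φ → ∫ x in Ω, ∑ i, u x i * partialD i φ x = 0

/-- `g` is the weak gradient of `χ` in `Ω`. -/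
def IsWeakGrad (Ω : Set Plane) (χ : Plane → ℝ) (g : Plane → Plane) : Prop :=
  ∀ φ, IsTest Ω φ → ∀ i, ∫ x in Ω, χ x * partialD i φ x = -∫ x in Ω, g x i * φ x

/-- `f = f₀ + ∇χ` with `f₀ ∈ H(div; Ω)`, `∇ · f₀ = 0`, and `χ ∈ H^1(Ω)` of mean zero. -/
def IsHelmholtzHodge (Ω : Set Plane) (f f₀ : Plane → Plane) (χ : Plane → ℝ) : Prop :=
  IsDivFree Ω f₀ ∧ IsL2 Ω χ ∧ ∫ x in Ω, χ x = 0 ∧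
    ∃ g : Plane → Plane, IsL2 Ω g ∧ IsWeakGrad Ω χ g ∧
      ∀ᵐ x ∂(volume.restrict Ω), f x = f₀ x + g x

/-! ### Staggered meshes -/

/-- The union of the triangles `c, v j, v (j+1)` (cyclic indices): the closed polygon with
vertices `v` when `c` lies in the interior of its kernel. -/
def polygonCell {n : ℕ} (c : Plane) (v : Fin n → Plane) : Set Plane :=
  ⋃ j, convexHull ℝ {c, v j, v (finRotate n j)}

/-- A partition of `Ω` into star-shaped polygons, with a chosen point in each of them and the
triangulation that joins these points to the vertices. A vertex of one polygon lying on a side of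
another one counts as a vertex of both. Also chosen is, for each primal edge, the triangle
whose outward normal and counterclockwise tangent are used on this edge. -/
structure Mesh (Ω : Set Plane) where
  /-- number of primal elements -/
  N : ℕ
  /-- number of vertices of a primal element -/
  nv : Fin N → ℕ
  three_le : ∀ i, 3 ≤ nv i
  /-- the selected point of a primal element -/
  center : Fin N → Plane
  /-- the vertices of a primal element in cyclic order -/
  vert : ∀ i, Fin (nv i) → Plane
  /-- the vertices run counterclockwise around the selected point -/
  ccw : ∀ i j,
    0 < (vert i j 0 - center i 0) * (vert i (finRotate _ j) 1 - center i 1) -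
        (vert i j 1 - center i 1) * (vert i (finRotate _ j) 0 - center i 0)
  /-- the selected point is interior to the kernel of the element -/
  center_mem : ∀ i, center i ∈
    interior {y | y ∈ polygonCell (center i) (vert i) ∧
      StarConvex ℝ y (polygonCell (center i) (vert i))}
  /-- the triangles do not overlap -/
  disjoint : ∀ τ σ : (Σ i, Fin (nv i)), τ ≠ σ → Disjoint
    (interior (convexHull ℝ {center τ.1, vert τ.1 τ.2, vert τ.1 (finRotate _ τ.2)}))
    (interior (convexHull ℝ {center σ.1, vert σ.1 σ.2, vert σ.1 (finRotate _ σ.2)}))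
  /-- two triangles meet in the hull of their common vertices -/
  conforming : ∀ τ σ : (Σ i, Fin (nv i)), τ ≠ σ →
    convexHull ℝ {center τ.1, vert τ.1 τ.2, vert τ.1 (finRotate _ τ.2)} ∩
      convexHull ℝ {center σ.1, vert σ.1 σ.2, vert σ.1 (finRotate _ σ.2)} =
    convexHull ℝ (({center τ.1, vert τ.1 τ.2, vert τ.1 (finRotate _ τ.2)} : Set Plane) ∩
      {center σ.1, vert σ.1 σ.2, vert σ.1 (finRotate _ σ.2)})
  cover : ⋃ i, polygonCell (center i) (vert i) = closure Ω
  /-- the triangle on the other side of the primal edge of a triangle, if there is one -/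
  nbr : (Σ i, Fin (nv i)) → Option (Σ i, Fin (nv i))
  nbr_spec : ∀ τ σ, nbr τ = some σ ↔
    vert σ.1 σ.2 = vert τ.1 (finRotate _ τ.2) ∧ vert σ.1 (finRotate _ σ.2) = vert τ.1 τ.2
  /-- the triangles that fix the orientation of their primal edge -/
  plus : Finset (Σ i, Fin (nv i))
  plus_of_boundary : ∀ τ, nbr τ = none → τ ∈ plus
  plus_of_interior : ∀ τ σ, nbr τ = some σ → (τ ∈ plus ↔ σ ∉ plus)

namespace Mesh

variable {Ω : Set Plane} (M : Mesh Ω)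

/-- The triangles of `T_h`; the triangle `(i, j)` joins the centre of the `i`-th primal
element to its `j`-th edge. So the triangles in `plus` also enumerate the primal edges without
repetition, and all triangles `τ` enumerate the dual edges, as `[centre, a τ]`. -/
abbrev Tri : Type := Σ i, Fin (M.nv i)

/-- The primal element `S(x)`. -/
def cell (i : Fin M.N) : Set Plane := polygonCell (M.center i) (M.vert i)

def c (τ : M.Tri) : Plane := M.center τ.1
def a (τ : M.Tri) : Plane := M.vert τ.1 τ.2
def b (τ : M.Tri) : Plane := M.vert τ.1 (finRotate _ τ.2)

def tri (τ : M.Tri) : Set Plane := convexHull ℝ {M.c τ, M.a τ, M.b τ}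

/-- The triangle on the other side of the dual edge `[c τ, a τ]`. -/
def prev (τ : M.Tri) : M.Tri := ⟨τ.1, (finRotate (M.nv τ.1)).symm τ.2⟩

/-- Mesh regularity: edges are not short compared with the diameter of the primal element, which
is star-shaped with respect to a ball around the selected point that is not small. -/
def Regular (ρE ρB : ℝ) : Prop :=
  (∀ τ : M.Tri, ρE * Metric.diam (M.cell τ.1) ≤ dist (M.a τ) (M.b τ)) ∧
  ∀ i, ∀ y ∈ Metric.ball (M.center i) (ρB * Metric.diam (M.cell i)),
    y ∈ M.cell i ∧ StarConvex ℝ y (M.cell i)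

/-! ### Edges, traces, jumps and averages -/

end Mesh

/-- Unit tangent of the segment from `p` to `q`. -/
def tangent (p q : Plane) : Fin 2 → ℝ := fun i => (q i - p i) / dist p q

/-- Unit normal to the right of the segment from `p` to `q`: the outward one for a triangle
whose boundary is run through counterclockwise. -/
def normal (p q : Plane) : Fin 2 → ℝ := ![tangent p q 1, -tangent p q 0]

/-- The integral of `g` over the segment with respect to arc length. -/
def edgeInt (p q : Plane) (g : Plane → ℝ) : ℝ :=
  dist p q * ∫ s in (0 : ℝ)..1, g (AffineMap.lineMap p q s)

namespace Mesh

variable {Ω : Set Plane} (M : Mesh Ω)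

/-- Jump across the primal edge of `τ`. -/
def jumpP {F : Type*} [AddCommGroup F] (g : M.Tri → Plane → F) (τ : M.Tri) (x : Plane) : F :=
  match M.nbr τ with
  | some σ => g τ x - g σ x
  | none => g τ x

/-- Average on the primal edge of `τ`. -/
def avgP {F : Type*} [AddCommGroup F] [Module ℝ F] (g : M.Tri → Plane → F) (τ : M.Tri)
    (x : Plane) : F :=
  match M.nbr τ with
  | some σ => (2⁻¹ : ℝ) • (g τ x + g σ x)
  | none => g τ x

/-- Jump across the dual edge `[c τ, a τ]`. -/
def jumpD {F : Type*} [AddCommGroup F] (g : M.Tri → Plane → F) (τ : M.Tri) (x : Plane) : F :=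
  g τ x - g (M.prev τ) x

/-- Average on the dual edge `[c τ, a τ]`. -/
def avgD {F : Type*} [AddCommGroup F] [Module ℝ F] (g : M.Tri → Plane → F) (τ : M.Tri)
    (x : Plane) : F :=
  (2⁻¹ : ℝ) • (g τ x + g (M.prev τ) x)

/-- Normal, tangent, length and integral for the primal edge of `τ`. -/
def nP (τ : M.Tri) : Fin 2 → ℝ := normal (M.a τ) (M.b τ)
def hP (τ : M.Tri) : ℝ := dist (M.a τ) (M.b τ)
def intP (τ : M.Tri) (g : Plane → ℝ) : ℝ := edgeInt (M.a τ) (M.b τ) g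

/-- Normal, tangent, length and integral for the dual edge `[c τ, a τ]`. -/
def nD (τ : M.Tri) : Fin 2 → ℝ := normal (M.c τ) (M.a τ)
def tD (τ : M.Tri) : Fin 2 → ℝ := tangent (M.c τ) (M.a τ)
def hD (τ : M.Tri) : ℝ := dist (M.c τ) (M.a τ)
def intD (τ : M.Tri) (g : Plane → ℝ) : ℝ := edgeInt (M.c τ) (M.a τ) g

/-! ### Piecewise polynomials -/

/-- Piecewise polynomial scalars, vectors and tensors. -/
abbrev PS : Type := M.Tri → Poly
abbrev PV : Type := M.Tri → Fin 2 → Poly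
abbrev PT : Type := M.Tri → Fin 2 → Fin 2 → Poly

def sv (q : M.PS) (τ : M.Tri) (x : Plane) : ℝ := pval (q τ) x
def vv (v : M.PV) (τ : M.Tri) (x : Plane) : Fin 2 → ℝ := fun i => pval (v τ i) x
def tv (H : M.PT) (τ : M.Tri) (x : Plane) : Matrix (Fin 2) (Fin 2) ℝ :=
  Matrix.of fun i j => pval (H τ i j) x

/-- Piecewise gradient of a scalar. -/
def gradS (q : M.PS) : M.PV := fun τ i => MvPolynomial.pderiv i (q τ)
/-- Piecewise gradient of a vector, `(∇v)_{ij} = ∂_j v_i`. -/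
def gradV (v : M.PV) : M.PT := fun τ i j => MvPolynomial.pderiv j (v τ i)
/-- Piecewise divergence of a vector. -/
def divV (v : M.PV) : M.PS := fun τ => ∑ i, MvPolynomial.pderiv i (v τ i)
/-- Piecewise row-wise divergence of a tensor. -/
def divT (H : M.PT) : M.PV := fun τ i => ∑ j, MvPolynomial.pderiv j (H τ i j)

/-- The vector field on the plane given by a piecewise polynomial (zero on the edges, which
form a null set, and outside the mesh). -/
def toField (v : M.PV) (x : Plane) : Plane :=
  WithLp.toLp 2 (∑ τ, (interior (M.tri τ)).indicator (M.vv v τ) x)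

/-- `L^2` inner products, as sums over the triangles. -/
def ipS (p q : M.PS) : ℝ := ∑ τ, ∫ x in M.tri τ, M.sv p τ x * M.sv q τ x
def ipV (u v : M.PV) : ℝ := ∑ τ, ∫ x in M.tri τ, M.vv u τ x ⬝ᵥ M.vv v τ x
def ipT (G H : M.PT) : ℝ :=
  ∑ τ, ∫ x in M.tri τ, ∑ i, ∑ j, M.tv G τ x i j * M.tv H τ x i j

/-- The load `(f, v)`. -/
def load (f : Plane → Plane) (v : M.PV) : ℝ :=
  ∑ τ, ∫ x in M.tri τ, (fun i => f x i) ⬝ᵥ M.vv v τ x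

/-- `L^2` norms of tensors and vectors. -/
def normT (H : M.PT) : ℝ := Real.sqrt (M.ipT H H)
def normV (v : M.PV) : ℝ := Real.sqrt (M.ipV v v)

/-! ### Discrete spaces -/

def Hh (k : ℕ) : Set M.PT :=
  {H | (∀ τ i j, (H τ i j).totalDegree ≤ k) ∧
    (∀ τ, M.nbr τ ≠ none → ∀ x ∈ segment ℝ (M.a τ) (M.b τ),
      M.jumpP (M.tv H) τ x *ᵥ M.nP τ = 0) ∧
    (∀ τ, ∀ x ∈ segment ℝ (M.c τ) (M.a τ),
      M.tD τ ⬝ᵥ (M.jumpD (M.tv H) τ x *ᵥ M.nD τ) = 0)}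

def Vh (k : ℕ) : Set M.PV :=
  {v | (∀ τ i, (v τ i).totalDegree ≤ k) ∧
    (∀ τ, ∀ x ∈ segment ℝ (M.c τ) (M.a τ), M.jumpD (M.vv v) τ x ⬝ᵥ M.nD τ = 0)}

def Qh (k : ℕ) : Set M.PS :=
  {q | (∀ τ, (q τ).totalDegree ≤ k) ∧
    (∀ τ, M.nbr τ ≠ none → ∀ x ∈ segment ℝ (M.a τ) (M.b τ), M.jumpP (M.sv q) τ x = 0)}

def Qh0 (k : ℕ) : Set M.PS := {q | q ∈ M.Qh k ∧ ∑ τ, ∫ x in M.tri τ, M.sv q τ x = 0}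

/-- The divergence-free subspace `V_h^div`. -/
def VhDiv (k : ℕ) : Set M.PV := {v | v ∈ M.Vh k ∧ IsDivFree Ω (M.toField v)}

/-- The norm `‖·‖_h`. -/
def normh (v : M.PV) : ℝ :=
  Real.sqrt (M.ipT (M.gradV v) (M.gradV v)
    + ∑ τ ∈ M.plus, (M.hP τ)⁻¹ * M.intP τ (fun x => M.jumpP (M.vv v) τ x ⬝ᵥ M.jumpP (M.vv v) τ x)
    + ∑ τ, (M.hD τ)⁻¹ * M.intD τ (fun x => (M.jumpD (M.vv v) τ x ⬝ᵥ M.tD τ) ^ 2))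

/-! ### Discrete forms

On functions that are single-valued on an edge the average is the common value, so averages stand
below for such traces. -/

def Bh (H : M.PT) (v : M.PV) : ℝ :=
  M.ipT H (M.gradV v)
    - ∑ τ ∈ M.plus, M.intP τ (fun x =>
        (M.avgP (M.tv H) τ x *ᵥ M.nP τ) ⬝ᵥ M.jumpP (M.vv v) τ x)
    - ∑ τ, M.intD τ (fun x =>
        (M.tD τ ⬝ᵥ (M.avgD (M.tv H) τ x *ᵥ M.nD τ)) * (M.jumpD (M.vv v) τ x ⬝ᵥ M.tD τ))

def BhStar (v : M.PV) (H : M.PT) : ℝ :=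
  M.ipV v (M.divT H)
    - ∑ τ, M.intD τ (fun x =>
        (M.avgD (M.vv v) τ x ⬝ᵥ M.nD τ) * (M.nD τ ⬝ᵥ (M.jumpD (M.tv H) τ x *ᵥ M.nD τ)))

def bh (v : M.PV) (q : M.PS) : ℝ :=
  -M.ipV v (M.gradS q)
    + ∑ τ, M.intD τ (fun x => (M.avgD (M.vv v) τ x ⬝ᵥ M.nD τ) * M.jumpD (M.sv q) τ x)

def bhStar (q : M.PS) (v : M.PV) : ℝ :=
  -M.ipS q (M.divV v)
    + ∑ τ ∈ M.plus, M.intP τ (fun x => M.avgP (M.sv q) τ x * (M.jumpP (M.vv v) τ x ⬝ᵥ M.nP τ))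

/-- The convective form `N_h(w; ψ, v)`. Its three parts are the volume term, the central flux on
interior primal and dual edges, and the upwind term on all edges. -/
def Nh (w ψ v : M.PV) : ℝ :=
  -(∑ τ, ∫ x in M.tri τ, ∑ i, ∑ j,
      M.vv ψ τ x i * M.vv w τ x j * M.tv (M.gradV v) τ x i j)
    + ((∑ τ ∈ M.plus with M.nbr τ ≠ none, M.intP τ (fun x =>
          (M.avgP (M.vv w) τ x ⬝ᵥ M.nP τ) * (M.avgP (M.vv ψ) τ x ⬝ᵥ M.jumpP (M.vv v) τ x)))
      + ∑ τ, M.intD τ (fun x =>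
          (M.avgD (M.vv w) τ x ⬝ᵥ M.nD τ) * (M.avgD (M.vv ψ) τ x ⬝ᵥ M.jumpD (M.vv v) τ x)))
    + ((∑ τ ∈ M.plus, M.intP τ (fun x =>
          |M.avgP (M.vv w) τ x ⬝ᵥ M.nP τ| * (M.jumpP (M.vv ψ) τ x ⬝ᵥ M.jumpP (M.vv v) τ x)))
      + ∑ τ, M.intD τ (fun x =>
          |M.avgD (M.vv w) τ x ⬝ᵥ M.nD τ| * (M.jumpD (M.vv ψ) τ x ⬝ᵥ M.jumpD (M.vv v) τ x)))

def Ah (ν : ℝ) (S : M.PT) (w : M.PV) (r : M.PS) (H : M.PT) (v : M.PV) (q : M.PS) : ℝ :=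
  ν⁻¹ * M.ipT S H + M.BhStar w H + M.Bh S v + M.bhStar r v + M.bh w q

/-! ### The nonlinear scheme and the linearized solution map -/

/-- `(G, u, p)` solves the staggered DG scheme (with homogeneous boundary data). -/
def IsSolution (k : ℕ) (ν : ℝ) (f : Plane → Plane) (G : M.PT) (u : M.PV) (p : M.PS) : Prop :=
  G ∈ M.Hh k ∧ u ∈ M.Vh k ∧ p ∈ M.Qh0 k ∧
    (∀ H ∈ M.Hh k, ν⁻¹ * M.ipT G H + M.BhStar u H = 0) ∧
    (∀ v ∈ M.Vh k, M.Bh G v + M.Nh u u v + M.bhStar p v = M.load f v) ∧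
    (∀ q ∈ M.Qh0 k, M.bh u q = 0)

/-- `w` is the velocity component of a solution of the problem linearized at `z`. -/
def IsLinSol (k : ℕ) (ν : ℝ) (f : Plane → Plane) (z w : M.PV) : Prop :=
  w ∈ M.Vh k ∧ ∃ S ∈ M.Hh k, ∃ r ∈ M.Qh0 k,
    ∀ H ∈ M.Hh k, ∀ v ∈ M.Vh k, ∀ q ∈ M.Qh k,
      M.Ah ν S w r H v q + M.Nh z w v = M.load f v

/-- The linearized solution map `T_h`: the value at `z` is the `w` with `IsLinSol k ν f z w`. -/
def Th (k : ℕ) (ν : ℝ) (f : Plane → Plane) (z : M.PV) : M.PV :=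
  Classical.epsilon fun w => M.IsLinSol k ν f z w

/-- The ball `W_h^ρ` in `V_h^div`. -/
def Wh (k : ℕ) (ρ : ℝ) : Set M.PV := {v | v ∈ M.VhDiv k ∧ M.normh v ≤ ρ}

/-- `T_h` has a unique fixed point in the ball of radius `ρ`, and the nonlinear scheme has a unique
solution whose velocity is in this ball. -/
def UniquelySolvable (k : ℕ) (ν : ℝ) (f : Plane → Plane) (ρ : ℝ) : Prop :=
  (∃! u : M.PV, u ∈ M.Wh k ρ ∧ M.Th k ν f u = u) ∧
  (∃! s : M.PT × M.PV × M.PS, M.IsSolution k ν f s.1 s.2.1 s.2.2 ∧ s.2.1 ∈ M.Wh k ρ)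

/-! ### Constants -/

/-- `C ≤ inf_{v ∈ V_h} sup_{H ∈ H_h} B_h(H, v) / (‖H‖ ‖v‖_h)`, over nonzero `v` and `H`. -/
def InfSup (k : ℕ) (C : ℝ) : Prop :=
  (C : EReal) ≤ ⨅ v ∈ {v | v ∈ M.Vh k ∧ v ≠ 0}, ⨆ H ∈ {H | H ∈ M.Hh k ∧ H ≠ 0},
    ((M.Bh H v / (M.normT H * M.normh v) : ℝ) : EReal)

/-- Boundedness of the convective form. -/
def NhBound (k : ℕ) (C : ℝ) : Prop :=
  ∀ z ∈ M.Vh k, ∀ v ∈ M.Vh k, ∀ w ∈ M.Vh k,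
    M.Nh z v w ≤ C * M.normh z * M.normh v * M.normh w

/-- Boundedness of the increments of the convective form in its first argument, in which it is
not linear. At `z₂ = 0` this is `NhBound`. -/
def NhLipschitz (k : ℕ) (C : ℝ) : Prop :=
  ∀ z₁ ∈ M.Vh k, ∀ z₂ ∈ M.Vh k, ∀ v ∈ M.Vh k, ∀ w ∈ M.Vh k,
    M.Nh z₁ v w - M.Nh z₂ v w ≤ C * M.normh (z₁ - z₂) * M.normh v * M.normh w

/-- Discrete Poincaré inequality. -/
def Poincare (k : ℕ) (C : ℝ) : Prop := ∀ v ∈ M.Vh k, M.normV v ≤ C * M.normh v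

end Mesh

end SDG

end

open MeasureTheory Topology
open scoped NNReal ENNReal ContDiff Matrix

noncomputable section

namespace SDG

/-! ### Triangles -/

/-! The solutions of the scheme correspond to the fixed points of `Th`, which come from Banach's
theorem in a ball. For z in V_h^div the linearized problem is a square linear system. When it is
tested with its own solution (S, w, r), the pairs B_h, B_h^* and b_h, b_h^* cancel; these are two
instances of the divergence theorem on the triangles, `Bh_eq_neg_BhStar` and `bh_eq_neg_bhStar`.
What remains is ν⁻¹‖S‖² + N_h(z; w, w) = (f, w). The convective term is nonnegative because z is
divergence-free with continuous normal component (`Nh_self_nonneg`). The flux equation and the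
inf-sup condition give C_B ‖w‖_h ≤ ν⁻¹‖S‖, so that C_B² ν ‖w‖_h² ≤ (f, w). For zero data this forces
S = 0 and w = 0; the pressure is then constant on each element, constant on the connected domain,
and zero by its mean (`eq_zero_of_bhStar`). Hence `exists_linearized`.

The discrete constraint b_h(w, ·) = 0 makes w exactly solenoidal with vanishing normal trace on ∂Ω
(`solenoidal_of_bh_eq_zero`). Its extension by zero then has no divergence on the plane, and w is
orthogonal to every weak gradient (`Solenoidal.weakGrad_eq_zero`), although the gradient is defined
only through test functions supported in Ω: w is localized, pushed into Ω along the graph direction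
of the Lipschitz boundary, and mollified. So only f₀ acts, and ‖T_h z‖_h ≤ C_B⁻² ν⁻¹ C_P ‖f₀‖; this
is the lower bound on ρ. Subtracting the problems for z₁ and z₂ gives C_B² ν ‖T_h z₁ − T_h z₂‖_h ≤
C_N ‖z₁ − z₂‖_h ‖T_h z₂‖_h, so T_h contracts the ball when ρ is below the upper bound. The smallness
condition on f₀ says that the two bounds leave room for ρ.

The constants come from two sources. For C_N and C_P, the L² norm of a piecewise polynomial is
bounded by its total variation on the plane (`exists_sobolev`); applied to q this is a Poincaré
inequality, applied to q² an L⁴ inequality (`exists_poincare`), and Hölder's inequality does the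
rest. For C_B, explicit tensors are built in the affine frame of each triangle, one that sees the
gradient and one that sees the jumps (`interior_test`, `edge_test`), and combined in `exists_test`.
Both depend on the mesh only through the ratio of squared edge lengths to triangle areas, which mesh
regularity controls (`Regular.shape`). -/

/-- The determinant of two plane vectors. -/
def cross (u v : Plane) : ℝ := u 0 * v 1 - u 1 * v 0

/-- The affine map that sends `(0,0)`, `(1,0)`, `(0,1)` to `c`, `a`, `b`. -/
def triMap (c a b : Plane) (s t : ℝ) : Plane := c + s • (a - c) + t • (b - c)

theorem triMap_apply (c a b : Plane) (s t : ℝ) (i : Fin 2) :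
    triMap c a b s t i = c i + s * (a i - c i) + t * (b i - c i) := by
  simp [triMap]

theorem mem_convexHull_triple {c a b x : Plane} :
    x ∈ convexHull ℝ {c, a, b} ↔ ∃ s t : ℝ, 0 ≤ s ∧ 0 ≤ t ∧ s + t ≤ 1 ∧ x = triMap c a b s t := by
  constructor
  · intro hx
    rw [convexHull_insert ⟨a, by simp⟩, convexHull_pair, mem_convexJoin] at hx
    obtain ⟨p, hp, q, hq, hx⟩ := hx
    rw [Set.mem_singleton_iff] at hp
    subst hp
    obtain ⟨α, β, hα, hβ, hαβ, rfl⟩ := hq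
    obtain ⟨γ, δ, hγ, hδ, hγδ, rfl⟩ := hx
    refine ⟨δ * α, δ * β, by positivity, by positivity, ?_, ?_⟩
    · rw [← mul_add, hαβ]; linarith
    · unfold triMap
      have h1 : γ = 1 - δ := by linarith
      have h2 : α = 1 - β := by linarith
      subst h1 h2
      module
  · rintro ⟨s, t, hs, ht, hst, rfl⟩
    have hc : c ∈ convexHull ℝ ({c, a, b} : Set Plane) := subset_convexHull _ _ (by simp)
    have ha : a ∈ convexHull ℝ ({c, a, b} : Set Plane) := subset_convexHull _ _ (by simp)
    have hb : b ∈ convexHull ℝ ({c, a, b} : Set Plane) := subset_convexHull _ _ (by simp)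
    have hconv := convex_convexHull ℝ ({c, a, b} : Set Plane)
    have := hconv.sum_mem (t := Finset.univ) (w := ![1 - s - t, s, t]) (z := ![c, a, b])
      (by intro i _; fin_cases i <;> simp <;> linarith)
      (by simp only [Fin.sum_univ_three, Matrix.cons_val_zero, Matrix.cons_val_one,
        Matrix.cons_val]; ring)
      (by intro i _; fin_cases i <;> simp [hc, ha, hb])
    simp only [Fin.sum_univ_three, Matrix.cons_val_zero, Matrix.cons_val_one,
      Matrix.cons_val] at this
    convert this using 1
    unfold triMap
    module

/-- The linear part of `triMap`. -/
def triLin (c a b : Plane) : Plane →L[ℝ] Plane :=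
  (EuclideanSpace.proj (0 : Fin 2)).smulRight (a - c) +
    (EuclideanSpace.proj (1 : Fin 2)).smulRight (b - c)

theorem triLin_apply (c a b x : Plane) : triLin c a b x = x 0 • (a - c) + x 1 • (b - c) := by
  simp [triLin]

theorem det_triLin (c a b : Plane) : (triLin c a b).det = cross (a - c) (b - c) := by
  rw [ContinuousLinearMap.det, ← LinearMap.det_toMatrix (EuclideanSpace.basisFun (Fin 2) ℝ).toBasis,
    Matrix.det_fin_two]
  simp [LinearMap.toMatrix_apply, triLin_apply, cross]
  try ring

theorem triMap_injective {c a b : Plane} (hD : cross (a - c) (b - c) ≠ 0) {s t s' t' : ℝ}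
    (h : triMap c a b s t = triMap c a b s' t') : s = s' ∧ t = t' := by
  have h0 := congrArg (fun x : Plane => x 0) h
  have h1 := congrArg (fun x : Plane => x 1) h
  simp only [triMap_apply] at h0 h1
  simp only [cross, PiLp.sub_apply] at hD
  constructor
  · have : (s - s') * ((a 0 - c 0) * (b 1 - c 1) - (a 1 - c 1) * (b 0 - c 0)) = 0 := by
      linear_combination (b 1 - c 1) * h0 - (b 0 - c 0) * h1
    rcases mul_eq_zero.1 this with h | h
    · linarith
    · exact absurd h hD
  · have : (t - t') * ((a 0 - c 0) * (b 1 - c 1) - (a 1 - c 1) * (b 0 - c 0)) = 0 := by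
      linear_combination -(a 1 - c 1) * h0 + (a 0 - c 0) * h1
    rcases mul_eq_zero.1 this with h | h
    · linarith
    · exact absurd h hD

/-- The reference triangle. -/
def refTri : Set (ℝ × ℝ) := {ξ | 0 ≤ ξ.1 ∧ 0 ≤ ξ.2 ∧ ξ.1 + ξ.2 ≤ 1}

theorem isClosed_refTri : IsClosed refTri :=
  (isClosed_le continuous_const continuous_fst).inter
    ((isClosed_le continuous_const continuous_snd).inter
      (isClosed_le (continuous_fst.add continuous_snd) continuous_const))

theorem isCompact_refTri : IsCompact refTri := by
  refine (isCompact_Icc (a := ((0 : ℝ), (0 : ℝ))) (b := ((1 : ℝ), (1 : ℝ)))).of_isClosed_subset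
    isClosed_refTri ?_
  rintro ⟨s, t⟩ ⟨h1, h2, h3⟩
  simp only at h1 h2 h3
  exact ⟨⟨h1, h2⟩, ⟨by simp only; linarith, by simp only; linarith⟩⟩

/-- Integral over the reference triangle. -/
theorem setIntegral_refTri {g : ℝ × ℝ → ℝ} (hg : Continuous g) :
    ∫ ξ in refTri, g ξ = ∫ s in (0 : ℝ)..1, ∫ t in (0 : ℝ)..(1 - s), g (s, t) := by
  have hm := isClosed_refTri.measurableSet
  have hi : IntegrableOn g refTri := hg.continuousOn.integrableOn_compact isCompact_refTri
  rw [← integral_indicator hm, Measure.volume_eq_prod, integral_prod]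
  swap
  · rw [← Measure.volume_eq_prod]; exact (integrable_indicator_iff hm).2 hi
  rw [intervalIntegral.integral_of_le zero_le_one, ← integral_Icc_eq_integral_Ioc,
    ← integral_indicator measurableSet_Icc]
  congr 1
  ext s
  by_cases hs : s ∈ Set.Icc (0 : ℝ) 1
  · rw [Set.indicator_of_mem hs, intervalIntegral.integral_of_le (by linarith [hs.2]),
      ← integral_Icc_eq_integral_Ioc, ← integral_indicator measurableSet_Icc]
    congr 1
    ext t
    by_cases ht : t ∈ Set.Icc 0 (1 - s)
    · rw [Set.indicator_of_mem ht, Set.indicator_of_mem]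
      exact ⟨hs.1, ht.1, by have := ht.2; simp only; linarith⟩
    · rw [Set.indicator_of_notMem ht, Set.indicator_of_notMem]
      rintro ⟨h1, h2, h3⟩
      simp only at h1 h2 h3
      exact ht ⟨h2, by linarith⟩
  · rw [Set.indicator_of_notMem hs]
    convert integral_zero ℝ ℝ using 2
    ext t
    rw [Set.indicator_of_notMem]
    rintro ⟨h1, h2, h3⟩
    simp only at h1 h2 h3
    exact hs ⟨h1, by linarith⟩

theorem continuous_triMap (c a b : Plane) : Continuous fun ξ : ℝ × ℝ => triMap c a b ξ.1 ξ.2 := by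
  unfold triMap; fun_prop

/-- Change of variables on a triangle. -/
theorem setIntegral_triangle {c a b : Plane} (hD : cross (a - c) (b - c) ≠ 0) (g : Plane → ℝ) :
    ∫ x in convexHull ℝ {c, a, b}, g x =
      |cross (a - c) (b - c)| * ∫ ξ in refTri, g (triMap c a b ξ.1 ξ.2) := by
  let e : Plane ≃ᵐ ℝ × ℝ :=
    (MeasurableEquiv.toLp 2 (Fin 2 → ℝ)).symm.trans (MeasurableEquiv.finTwoArrow)
  have he : MeasurePreserving e volume volume :=
    (EuclideanSpace.volume_preserving_symm_measurableEquiv_toLp (Fin 2)).trans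
      (volume_preserving_finTwoArrow ℝ)
  have hea : ∀ x, e x = (x 0, x 1) := fun x => rfl
  have h1 : ∫ ξ in refTri, g (triMap c a b ξ.1 ξ.2) =
      ∫ x in e ⁻¹' refTri, g (triMap c a b (x 0) (x 1)) := by
    rw [← he.setIntegral_preimage_emb e.measurableEmbedding]
    rfl
  have himg : convexHull ℝ {c, a, b} = (fun x : Plane => triMap c a b (x 0) (x 1)) '' (e ⁻¹' refTri) := by
    ext x
    rw [mem_convexHull_triple]
    constructor
    · rintro ⟨s, t, hs, ht, hst, rfl⟩
      exact ⟨!₂[s, t], ⟨hs, ht, hst⟩, by simp⟩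
    · rintro ⟨y, ⟨h1, h2, h3⟩, rfl⟩
      exact ⟨y 0, y 1, h1, h2, h3, rfl⟩
  have hder : ∀ x ∈ e ⁻¹' refTri, HasFDerivWithinAt (fun x : Plane => triMap c a b (x 0) (x 1))
      (triLin c a b) (e ⁻¹' refTri) x := by
    intro x _
    have : (fun x : Plane => triMap c a b (x 0) (x 1)) = fun x => c + triLin c a b x := by
      ext1 x
      rw [triLin_apply, triMap, add_assoc]
    rw [this]
    exact ((triLin c a b).hasFDerivAt.const_add c).hasFDerivWithinAt
  have hinj : Set.InjOn (fun x : Plane => triMap c a b (x 0) (x 1)) (e ⁻¹' refTri) := by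
    intro x _ y _ hxy
    obtain ⟨h0, h1⟩ := triMap_injective hD hxy
    ext i
    fin_cases i
    · exact h0
    · exact h1
  rw [himg, integral_image_eq_integral_abs_det_fderiv_smul volume
    (e.measurable isClosed_refTri.measurableSet) hder hinj, h1, det_triLin]
  simp only [smul_eq_mul]
  rw [integral_const_mul]

theorem setIntegral_triangle_iterated {c a b : Plane} (hD : cross (a - c) (b - c) ≠ 0)
    {g : Plane → ℝ} (hg : Continuous g) :
    ∫ x in convexHull ℝ {c, a, b}, g x = |cross (a - c) (b - c)| *
      ∫ s in (0 : ℝ)..1, ∫ t in (0 : ℝ)..(1 - s), g (triMap c a b s t) := by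
  rw [setIntegral_triangle hD, setIntegral_refTri (g := fun ξ => g (triMap c a b ξ.1 ξ.2))
    (hg.comp (continuous_triMap c a b))]

theorem cross_swap (u v : Plane) : cross u v = -cross v u := by unfold cross; ring

/-- Integral of a directional derivative along a side. -/
theorem setIntegral_fderiv_side {c a b : Plane} (hD : cross (a - c) (b - c) ≠ 0)
    {f : Plane → ℝ} (hf : ContDiff ℝ 1 f) :
    ∫ x in convexHull ℝ {c, a, b}, fderiv ℝ f x (b - c) = |cross (a - c) (b - c)| *
      ∫ s in (0 : ℝ)..1, (f (triMap c a b s (1 - s)) - f (triMap c a b s 0)) := by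
  rw [setIntegral_triangle_iterated hD
    (((hf.continuous_fderiv (by norm_num)).clm_apply continuous_const))]
  congr 1
  apply intervalIntegral.integral_congr
  intro s _
  simp only
  have hd : ∀ t, HasDerivAt (fun t => f (triMap c a b s t))
      (fderiv ℝ f (triMap c a b s t) (b - c)) t := by
    intro t
    have h1 : HasDerivAt (fun t => triMap c a b s t) (b - c) t := by
      unfold triMap
      simpa using ((hasDerivAt_id t).smul_const (b - c)).const_add (c + s • (a - c))
    exact ((hf.differentiable (by norm_num)) _).hasFDerivAt.comp_hasDerivAt t h1
  apply intervalIntegral.integral_eq_sub_of_hasDerivAt (fun t _ => hd t)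
  apply Continuous.intervalIntegrable
  have hc : Continuous fun t => triMap c a b s t := by unfold triMap; fun_prop
  exact ((hf.continuous_fderiv (by norm_num)).comp hc).clm_apply continuous_const

theorem lineMap_eq_add_smul (p q : Plane) (s : ℝ) : AffineMap.lineMap p q s = p + s • (q - p) := by
  rw [AffineMap.lineMap_apply]; simp [add_comm]

theorem integral_lineMap_symm (p q : Plane) (g : Plane → ℝ) :
    ∫ s in (0 : ℝ)..1, g (AffineMap.lineMap q p s) = ∫ s in (0 : ℝ)..1, g (AffineMap.lineMap p q s) := by
  have := intervalIntegral.integral_comp_sub_left (a := 0) (b := 1)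
    (fun s => g (AffineMap.lineMap p q s)) (1 : ℝ)
  simp only [AffineMap.lineMap_apply_one_sub, sub_self, sub_zero] at this
  exact this

theorem edgeInt_symm (p q : Plane) (g : Plane → ℝ) : edgeInt q p g = edgeInt p q g := by
  unfold edgeInt
  rw [dist_comm, integral_lineMap_symm]

theorem normal_symm (p q : Plane) : normal q p = -normal p q := by
  ext i; fin_cases i <;> simp [normal, tangent, dist_comm q p] <;> ring

/-- Green's formula in a direction `d`. -/
theorem green_direction {c a b : Plane} (hD : 0 < cross (a - c) (b - c))
    {f : Plane → ℝ} (hf : ContDiff ℝ 1 f) (d : Plane) :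
    ∫ x in convexHull ℝ {c, a, b}, fderiv ℝ f x d =
      cross d (a - c) * (∫ s in (0 : ℝ)..1, f (AffineMap.lineMap c a s)) +
      cross d (b - a) * (∫ s in (0 : ℝ)..1, f (AffineMap.lineMap a b s)) +
      cross d (c - b) * (∫ s in (0 : ℝ)..1, f (AffineMap.lineMap b c s)) := by
  have hfl : ∀ p q : Plane, IntervalIntegrable (fun s => f (AffineMap.lineMap p q s)) volume 0 1 := by
    intro p q
    apply Continuous.intervalIntegrable
    exact hf.continuous.comp AffineMap.lineMap_continuous
  have hb := setIntegral_fderiv_side hD.ne' hf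
  have ha := setIntegral_fderiv_side (c := c) (a := b) (b := a) (by rw [cross_swap]; linarith) hf
  have e1 : ∀ s : ℝ, triMap c a b s (1 - s) = AffineMap.lineMap b a s := by
    intro s; rw [lineMap_eq_add_smul]; unfold triMap; module
  have e2 : ∀ s : ℝ, triMap c a b s 0 = AffineMap.lineMap c a s := by
    intro s; rw [lineMap_eq_add_smul]; unfold triMap; module
  have e3 : ∀ s : ℝ, triMap c b a s (1 - s) = AffineMap.lineMap a b s := by
    intro s; rw [lineMap_eq_add_smul]; unfold triMap; module
  have e4 : ∀ s : ℝ, triMap c b a s 0 = AffineMap.lineMap c b s := by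
    intro s; rw [lineMap_eq_add_smul]; unfold triMap; module
  simp only [e1, e2] at hb
  simp only [e3, e4] at ha
  rw [intervalIntegral.integral_sub (hfl _ _) (hfl _ _), integral_lineMap_symm a b, abs_of_pos hD] at hb
  rw [intervalIntegral.integral_sub (hfl _ _) (hfl _ _), integral_lineMap_symm b c, cross_swap,
    abs_neg, abs_of_pos hD] at ha
  rw [show ({c, b, a} : Set Plane) = {c, a, b} by rw [Set.pair_comm]] at ha
  -- Cramer's rule resolves d along the two sides issuing from c, and for these two directions the
  -- integral is known from the fundamental theorem of calculus.
  have hd : cross (a - c) (b - c) • d = cross d (b - c) • (a - c) + cross (a - c) d • (b - c) := by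
    ext i
    fin_cases i <;> simp [cross] <;> ring
  have hd' : d = (cross d (b - c) / cross (a - c) (b - c)) • (a - c) +
      (cross (a - c) d / cross (a - c) (b - c)) • (b - c) := by
    rw [div_eq_inv_mul, div_eq_inv_mul, mul_smul, mul_smul, ← smul_add, ← hd, smul_smul,
      inv_mul_cancel₀ hD.ne', one_smul]
  have hfi : ∀ v : Plane, IntegrableOn (fun x => fderiv ℝ f x v) (convexHull ℝ {c, a, b}) := by
    intro v
    have hcomp : IsCompact (convexHull ℝ ({c, a, b} : Set Plane)) :=
      (Set.toFinite _).isCompact_convexHull ℝ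
    exact ((hf.continuous_fderiv (by norm_num)).clm_apply continuous_const).continuousOn.integrableOn_compact hcomp
  have hsplit : ∫ x in convexHull ℝ {c, a, b}, fderiv ℝ f x d =
      (cross d (b - c) / cross (a - c) (b - c)) * (∫ x in convexHull ℝ {c, a, b}, fderiv ℝ f x (a - c)) +
      (cross (a - c) d / cross (a - c) (b - c)) * (∫ x in convexHull ℝ {c, a, b}, fderiv ℝ f x (b - c)) := by
    rw [← integral_const_mul, ← integral_const_mul, ← integral_add ((hfi _).const_mul _) ((hfi _).const_mul _)]
    congr 1
    ext x
    conv_lhs => rw [hd']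
    simp
  rw [hsplit, ha, hb, div_mul_eq_mul_div, div_mul_eq_mul_div, ← add_div, div_eq_iff hD.ne']
  have : cross d (b - a) = cross d (b - c) + cross (a - c) d := by
    simp [cross]; ring
  have h2 : cross d (c - b) = - cross d (b - c) := by simp [cross]; ring
  have h3 : cross d (a - c) = - cross (a - c) d := by simp [cross]; ring
  rw [this, h2, h3]
  ring

/-- The length of the segment cancels the denominator of its unit normal, so the formula covers
degenerate segments too, and its coefficients are those of `green_direction`. -/
theorem edgeInt_mul_normal (p q : Plane) (g : Plane → Fin 2 → ℝ) (hg : Continuous g) :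
    edgeInt p q (fun x => g x ⬝ᵥ normal p q) =
      cross (EuclideanSpace.single 0 1) (q - p) * (∫ s in (0 : ℝ)..1, g (AffineMap.lineMap p q s) 0) +
      cross (EuclideanSpace.single 1 1) (q - p) * (∫ s in (0 : ℝ)..1, g (AffineMap.lineMap p q s) 1) := by
  have hc : ∀ i, Continuous fun s : ℝ => g (AffineMap.lineMap p q s) i := fun i =>
    (continuous_apply i).comp (hg.comp AffineMap.lineMap_continuous)
  have : ∀ s : ℝ, g (AffineMap.lineMap p q s) ⬝ᵥ normal p q =
      normal p q 0 * g (AffineMap.lineMap p q s) 0 + normal p q 1 * g (AffineMap.lineMap p q s) 1 := by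
    intro s; simp [dotProduct, Fin.sum_univ_two]; ring
  unfold edgeInt
  simp only [this]
  rw [intervalIntegral.integral_add (((hc 0).const_mul _).intervalIntegrable _ _)
    (((hc 1).const_mul _).intervalIntegrable _ _), intervalIntegral.integral_const_mul,
    intervalIntegral.integral_const_mul]
  by_cases h : p = q
  · subst h; simp [cross]
  · have hd : dist p q ≠ 0 := dist_ne_zero.2 h
    simp [cross, normal, tangent]
    field_simp
    ring

/-- The divergence theorem on a triangle. -/
theorem green_triangle {c a b : Plane} (hD : 0 < cross (a - c) (b - c))
    {g : Plane → Fin 2 → ℝ} (hg : ContDiff ℝ 1 g) :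
    ∫ x in convexHull ℝ {c, a, b}, ∑ i, fderiv ℝ (fun y => g y i) x (EuclideanSpace.single i 1) =
      edgeInt c a (fun x => g x ⬝ᵥ normal c a) + edgeInt a b (fun x => g x ⬝ᵥ normal a b) +
        edgeInt b c (fun x => g x ⬝ᵥ normal b c) := by
  have hgi : ∀ i, ContDiff ℝ 1 fun y => g y i := fun i => contDiff_pi.1 hg i
  have hcomp : IsCompact (convexHull ℝ ({c, a, b} : Set Plane)) :=
    (Set.toFinite _).isCompact_convexHull ℝ
  rw [integral_finsetSum]
  swap
  · intro i _
    exact (((hgi i).continuous_fderiv (by norm_num)).clm_apply continuous_const).continuousOn.integrableOn_compact hcomp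
  rw [Fin.sum_univ_two, green_direction hD (hgi 0), green_direction hD (hgi 1),
    edgeInt_mul_normal _ _ _ hg.continuous, edgeInt_mul_normal _ _ _ hg.continuous,
    edgeInt_mul_normal _ _ _ hg.continuous]
  ring

/-! ### Polynomials as functions on the plane -/

theorem contDiff_pval (p : Poly) : ContDiff ℝ ∞ (pval p) := by
  induction p using MvPolynomial.induction_on with
  | C r =>
    have : pval (MvPolynomial.C r) = fun _ => r := by ext x; simp [pval]
    rw [this]; exact contDiff_const
  | add p q hp hq =>
    have : pval (p + q) = fun x => pval p x + pval q x := by ext x; simp [pval]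
    rw [this]; exact hp.add hq
  | mul_X p i hp =>
    have : pval (p * MvPolynomial.X i) = fun x => pval p x * x i := by ext x; simp [pval]
    rw [this]
    exact hp.mul (EuclideanSpace.proj i : Plane →L[ℝ] ℝ).contDiff

@[fun_prop]
theorem continuous_pval (p : Poly) : Continuous (pval p) := (contDiff_pval p).continuous

theorem differentiable_pval (p : Poly) : Differentiable ℝ (pval p) :=
  (contDiff_pval p).differentiable (by simp)

theorem pval_add (p q : Poly) (x : Plane) : pval (p + q) x = pval p x + pval q x := by simp [pval]
theorem pval_sub (p q : Poly) (x : Plane) : pval (p - q) x = pval p x - pval q x := by simp [pval]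
theorem pval_mul (p q : Poly) (x : Plane) : pval (p * q) x = pval p x * pval q x := by simp [pval]
theorem pval_smul (r : ℝ) (p : Poly) (x : Plane) : pval (r • p) x = r * pval p x := by simp [pval]
@[simp] theorem pval_zero (x : Plane) : pval 0 x = 0 := by simp [pval]
@[simp] theorem pval_C (r : ℝ) (x : Plane) : pval (MvPolynomial.C r) x = r := by simp [pval]
@[simp] theorem pval_X (i : Fin 2) (x : Plane) : pval (MvPolynomial.X i) x = x i := by simp [pval]
theorem pval_sum {ι : Type*} (s : Finset ι) (p : ι → Poly) (x : Plane) :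
    pval (∑ i ∈ s, p i) x = ∑ i ∈ s, pval (p i) x := by simp [pval]

theorem fderiv_pval (p : Poly) (x : Plane) (i : Fin 2) :
    fderiv ℝ (pval p) x (EuclideanSpace.single i 1) = pval (MvPolynomial.pderiv i p) x := by
  induction p using MvPolynomial.induction_on with
  | C r =>
    have : pval (MvPolynomial.C r) = fun _ => r := by ext x; simp
    rw [this]; simp
  | add p q hp hq =>
    have : pval (p + q) = pval p + pval q := by ext x; simp [pval]
    rw [this, fderiv_add (differentiable_pval p x) (differentiable_pval q x), map_add, pval_add,
      ← hp, ← hq]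
    rfl
  | mul_X p j hp =>
    have : pval (p * MvPolynomial.X j) = fun x => pval p x * (EuclideanSpace.proj j : Plane →L[ℝ] ℝ) x := by
      ext x; simp [pval]
    rw [this, fderiv_fun_mul (differentiable_pval p x) (EuclideanSpace.proj j : Plane →L[ℝ] ℝ).differentiableAt]
    rw [ContinuousLinearMap.fderiv]
    simp only [_root_.add_apply, _root_.smul_apply, hp, smul_eq_mul,
      Derivation.leibniz, pval_add, MvPolynomial.pderiv_X, pval_mul, pval_X, PiLp.proj_apply]
    by_cases h : i = j
    · subst h; simp [pval]
    · have h' : j ≠ i := fun h' => h h'.symm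
      simp [h', pval]

theorem partialD_pval (p : Poly) (i : Fin 2) (x : Plane) :
    partialD i (pval p) x = pval (MvPolynomial.pderiv i p) x := fderiv_pval p x i

/-- A polynomial that vanishes on a nonempty open set is zero. -/
theorem poly_eq_zero_of_isOpen {U : Set Plane} (hU : IsOpen U) (hne : U.Nonempty) {p : Poly}
    (h : ∀ x ∈ U, pval p x = 0) : p = 0 := by
  obtain ⟨x₀, hx₀⟩ := hne
  have hc : Continuous fun y : Fin 2 → ℝ => (WithLp.toLp 2 y : Plane) := PiLp.continuous_toLp 2 _
  have hV : (fun y : Fin 2 → ℝ => (WithLp.toLp 2 y : Plane)) ⁻¹' U ∈ 𝓝 (fun i => x₀ i) :=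
    (hU.preimage hc).mem_nhds (by simpa using hx₀)
  obtain ⟨ε, hε, hball⟩ := Metric.mem_nhds_iff.1 hV
  refine MvPolynomial.funext_set (s := fun i => Metric.ball (x₀ i) ε) (fun i => ?_) ?_
  · rw [Real.ball_eq_Ioo]
    exact Set.Ioo_infinite (by linarith)
  · intro y hy
    have : y ∈ Metric.ball (fun i => x₀ i) ε := by
      rw [ball_pi _ hε]; exact hy
    have := h _ (hball this)
    simpa [pval] using this

namespace Mesh

variable {Ω : Set Plane} (M : Mesh Ω)

/-! ### Triangles of a mesh -/

/-- Twice the area of a triangle. -/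
def D (τ : M.Tri) : ℝ := cross (M.a τ - M.c τ) (M.b τ - M.c τ)

theorem D_pos (τ : M.Tri) : 0 < M.D τ := by
  have := M.ccw τ.1 τ.2
  simpa [D, cross, a, b, c] using this

/-- The next triangle of the same primal element. -/
def next (τ : M.Tri) : M.Tri := ⟨τ.1, finRotate (M.nv τ.1) τ.2⟩

@[simp] theorem next_prev (τ : M.Tri) : M.next (M.prev τ) = τ := by
  exact Sigma.ext rfl (heq_of_eq (Equiv.apply_symm_apply _ _))

@[simp] theorem prev_next (τ : M.Tri) : M.prev (M.next τ) = τ := by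
  exact Sigma.ext rfl (heq_of_eq (Equiv.symm_apply_apply _ _))

def nextEquiv : M.Tri ≃ M.Tri := ⟨M.next, M.prev, M.prev_next, M.next_prev⟩

@[simp] theorem a_next (τ : M.Tri) : M.a (M.next τ) = M.b τ := rfl
@[simp] theorem c_next (τ : M.Tri) : M.c (M.next τ) = M.c τ := rfl
@[simp] theorem c_prev (τ : M.Tri) : M.c (M.prev τ) = M.c τ := rfl
@[simp] theorem b_prev (τ : M.Tri) : M.b (M.prev τ) = M.a τ := by
  conv_rhs => rw [← M.next_prev τ]
  rfl

theorem sum_next {F : Type*} [AddCommMonoid F] (g : M.Tri → F) : ∑ τ, g (M.next τ) = ∑ τ, g τ :=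
  M.nextEquiv.sum_comp g

theorem sum_prev {F : Type*} [AddCommMonoid F] (g : M.Tri → F) : ∑ τ, g (M.prev τ) = ∑ τ, g τ :=
  M.nextEquiv.symm.sum_comp g

theorem nbr_symm {τ σ : M.Tri} (h : M.nbr τ = some σ) : M.nbr σ = some τ := by
  rw [M.nbr_spec] at h ⊢
  exact ⟨h.2.symm, h.1.symm⟩

theorem nbr_a {τ σ : M.Tri} (h : M.nbr τ = some σ) : M.a σ = M.b τ := ((M.nbr_spec _ _).1 h).1
theorem nbr_b {τ σ : M.Tri} (h : M.nbr τ = some σ) : M.b σ = M.a τ := ((M.nbr_spec _ _).1 h).2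

/-- Value at the neighbour across the primal edge, zero if there is none. -/
def atNbr {F : Type*} [Zero F] (g : M.Tri → F) (τ : M.Tri) : F :=
  match M.nbr τ with
  | some σ => g σ
  | none => 0

/-- Exactly one of the two triangles at an interior primal edge is in `plus`, and every boundary
triangle is. So `nbr` maps the triangles of `plus` that have a neighbour bijectively onto the
complement of `plus`. -/
theorem sum_eq_sum_plus {F : Type*} [AddCommMonoid F] (g : M.Tri → F) :
    ∑ τ, g τ = ∑ τ ∈ M.plus, (g τ + M.atNbr g τ) := by
  classical
  rw [Finset.sum_add_distrib, ← Finset.sum_add_sum_compl M.plus g]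
  congr 1
  symm
  rw [← Finset.sum_filter_add_sum_filter_not M.plus (fun τ => M.nbr τ = none)]
  rw [Finset.sum_eq_zero, zero_add]
  swap
  · intro τ hτ
    rw [Finset.mem_filter] at hτ
    simp [atNbr, hτ.2]
  refine Finset.sum_bij' (fun τ _ => (M.nbr τ).getD τ) (fun τ _ => (M.nbr τ).getD τ) ?_ ?_ ?_ ?_ ?_
  · intro τ hτ
    rw [Finset.mem_filter] at hτ
    obtain ⟨σ, hσ⟩ := Option.ne_none_iff_exists'.1 hτ.2
    simp only [hσ, Option.getD_some, Finset.mem_compl]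
    exact (M.plus_of_interior _ _ hσ).1 hτ.1
  · intro τ hτ
    rw [Finset.mem_compl] at hτ
    have : M.nbr τ ≠ none := fun h => hτ (M.plus_of_boundary _ h)
    obtain ⟨σ, hσ⟩ := Option.ne_none_iff_exists'.1 this
    simp only [hσ, Option.getD_some, Finset.mem_filter]
    refine ⟨by_contra fun h => hτ ((M.plus_of_interior _ _ hσ).2 h), ?_⟩
    rw [M.nbr_symm hσ]; simp
  · intro τ hτ
    rw [Finset.mem_filter] at hτ
    obtain ⟨σ, hσ⟩ := Option.ne_none_iff_exists'.1 hτ.2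
    simp [hσ, M.nbr_symm hσ]
  · intro τ hτ
    rw [Finset.mem_compl] at hτ
    have : M.nbr τ ≠ none := fun h => hτ (M.plus_of_boundary _ h)
    obtain ⟨σ, hσ⟩ := Option.ne_none_iff_exists'.1 this
    simp [hσ, M.nbr_symm hσ]
  · intro τ hτ
    rw [Finset.mem_filter] at hτ
    obtain ⟨σ, hσ⟩ := Option.ne_none_iff_exists'.1 hτ.2
    simp [hσ, atNbr]

theorem isCompact_tri (τ : M.Tri) : IsCompact (M.tri τ) :=
  (Set.toFinite _).isCompact_convexHull ℝ

theorem integrableOn_tri (τ : M.Tri) {F : Type*} [NormedAddCommGroup F] {g : Plane → F}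
    (hg : Continuous g) : IntegrableOn g (M.tri τ) :=
  hg.continuousOn.integrableOn_compact (M.isCompact_tri τ)

/-! ### Integrals over edges and their collection over the mesh. -/

theorem _root_.SDG.edgeInt_intervalIntegrable {p q : Plane} {g : Plane → ℝ} (hg : Continuous g) :
    IntervalIntegrable (fun s : ℝ => g (AffineMap.lineMap p q s)) volume 0 1 :=
  (hg.comp AffineMap.lineMap_continuous).intervalIntegrable _ _

theorem _root_.SDG.edgeInt_add {p q : Plane} {g h : Plane → ℝ} (hg : Continuous g) (hh : Continuous h) :
    edgeInt p q (fun x => g x + h x) = edgeInt p q g + edgeInt p q h := by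
  unfold edgeInt
  rw [intervalIntegral.integral_add (edgeInt_intervalIntegrable hg) (edgeInt_intervalIntegrable hh),
    mul_add]

theorem _root_.SDG.edgeInt_sub {p q : Plane} {g h : Plane → ℝ} (hg : Continuous g) (hh : Continuous h) :
    edgeInt p q (fun x => g x - h x) = edgeInt p q g - edgeInt p q h := by
  unfold edgeInt
  rw [intervalIntegral.integral_sub (edgeInt_intervalIntegrable hg) (edgeInt_intervalIntegrable hh),
    mul_sub]

theorem _root_.SDG.edgeInt_const_mul (p q : Plane) (r : ℝ) (g : Plane → ℝ) :
    edgeInt p q (fun x => r * g x) = r * edgeInt p q g := by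
  unfold edgeInt
  rw [intervalIntegral.integral_const_mul]; ring

theorem _root_.SDG.edgeInt_congr {p q : Plane} {g h : Plane → ℝ} (H : ∀ x ∈ segment ℝ p q, g x = h x) :
    edgeInt p q g = edgeInt p q h := by
  unfold edgeInt
  congr 1
  apply intervalIntegral.integral_congr
  intro s hs
  rw [Set.uIcc_of_le zero_le_one] at hs
  apply H
  rw [segment_eq_image_lineMap]
  exact ⟨s, hs, rfl⟩

theorem _root_.SDG.edgeInt_neg (p q : Plane) (g : Plane → ℝ) :
    edgeInt p q (fun x => -g x) = -edgeInt p q g := by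
  simpa using edgeInt_const_mul p q (-1) g

theorem _root_.SDG.edgeInt_nonneg {p q : Plane} {g : Plane → ℝ} (H : ∀ x ∈ segment ℝ p q, 0 ≤ g x) :
    0 ≤ edgeInt p q g := by
  unfold edgeInt
  refine mul_nonneg dist_nonneg (intervalIntegral.integral_nonneg zero_le_one ?_)
  intro s hs
  apply H
  rw [segment_eq_image_lineMap]
  exact ⟨s, hs, rfl⟩

theorem intP_congr {τ : M.Tri} {g h : Plane → ℝ} (H : ∀ x ∈ segment ℝ (M.a τ) (M.b τ), g x = h x) :
    M.intP τ g = M.intP τ h := edgeInt_congr H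

theorem intD_congr {τ : M.Tri} {g h : Plane → ℝ} (H : ∀ x ∈ segment ℝ (M.c τ) (M.a τ), g x = h x) :
    M.intD τ g = M.intD τ h := edgeInt_congr H

theorem nP_nbr {τ σ : M.Tri} (h : M.nbr τ = some σ) : M.nP σ = -M.nP τ := by
  unfold nP
  rw [M.nbr_a h, M.nbr_b h, normal_symm]

theorem intP_nbr {τ σ : M.Tri} (h : M.nbr τ = some σ) (g : Plane → ℝ) :
    M.intP σ g = M.intP τ g := by
  unfold intP
  rw [M.nbr_a h, M.nbr_b h, edgeInt_symm]

/-- The boundary integrals of all triangles, collected by edges. -/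
theorem sum_boundary (X : M.Tri → Plane → Fin 2 → ℝ) (hX : ∀ τ, Continuous (X τ)) :
    ∑ τ, (edgeInt (M.c τ) (M.a τ) (fun x => X τ x ⬝ᵥ normal (M.c τ) (M.a τ)) +
      edgeInt (M.a τ) (M.b τ) (fun x => X τ x ⬝ᵥ normal (M.a τ) (M.b τ)) +
      edgeInt (M.b τ) (M.c τ) (fun x => X τ x ⬝ᵥ normal (M.b τ) (M.c τ))) =
    ∑ τ ∈ M.plus, M.intP τ (fun x => M.jumpP X τ x ⬝ᵥ M.nP τ) +
      ∑ τ, M.intD τ (fun x => M.jumpD X τ x ⬝ᵥ M.nD τ) := by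
  have hdot : ∀ τ (w : Fin 2 → ℝ), Continuous fun x => X τ x ⬝ᵥ w := fun τ w =>
    (hX τ).dotProduct continuous_const
  simp only [Finset.sum_add_distrib]
  -- The third side of a triangle is the dual edge of the next triangle, run through backwards;
  -- reindexing by `prev` turns it into the minus part of a dual jump.
  have e1 : ∑ τ, edgeInt (M.b τ) (M.c τ) (fun x => X τ x ⬝ᵥ normal (M.b τ) (M.c τ)) =
      ∑ τ, -edgeInt (M.c τ) (M.a τ) (fun x => X (M.prev τ) x ⬝ᵥ normal (M.c τ) (M.a τ)) := by
    rw [← M.sum_prev]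
    refine Finset.sum_congr rfl fun τ _ => ?_
    rw [M.b_prev, M.c_prev, edgeInt_symm, normal_symm (M.c τ)]
    rw [← edgeInt_neg]
    congr 1
    ext x
    simp
  have e2 : ∑ τ, edgeInt (M.a τ) (M.b τ) (fun x => X τ x ⬝ᵥ normal (M.a τ) (M.b τ)) =
      ∑ τ ∈ M.plus, M.intP τ (fun x => M.jumpP X τ x ⬝ᵥ M.nP τ) := by
    rw [M.sum_eq_sum_plus]
    refine Finset.sum_congr rfl fun τ _ => ?_
    rcases hn : M.nbr τ with _ | σ
    · simp [atNbr, hn, jumpP, intP, nP]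
    · simp only [atNbr, hn, jumpP]
      have h1 : edgeInt (M.a σ) (M.b σ) (fun x => X σ x ⬝ᵥ normal (M.a σ) (M.b σ)) =
          -M.intP τ (fun x => X σ x ⬝ᵥ M.nP τ) := by
        rw [← M.intP_nbr hn, intP, ← edgeInt_neg]
        congr 1
        ext x
        rw [← dotProduct_neg, ← M.nP_nbr hn]
        rfl
      rw [h1, ← sub_eq_add_neg]
      unfold intP
      rw [← nP, ← edgeInt_sub (hdot _ _) (hdot _ _)]
      simp only [sub_dotProduct]
  rw [e1, e2, add_right_comm, ← Finset.sum_add_distrib, add_comm]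
  congr 1
  refine Finset.sum_congr rfl fun τ _ => ?_
  rw [← sub_eq_add_neg, ← edgeInt_sub (hdot _ _) (hdot _ _)]
  simp only [← sub_dotProduct]
  rfl

/-- The divergence theorem on all triangles, with the boundary integrals collected by edges. -/
theorem sum_green (X : M.Tri → Plane → Fin 2 → ℝ) (hX : ∀ τ, ContDiff ℝ 1 (X τ)) :
    ∑ τ, ∫ x in M.tri τ, ∑ i, partialD i (fun y => X τ y i) x =
    ∑ τ ∈ M.plus, M.intP τ (fun x => M.jumpP X τ x ⬝ᵥ M.nP τ) +
      ∑ τ, M.intD τ (fun x => M.jumpD X τ x ⬝ᵥ M.nD τ) := by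
  rw [← M.sum_boundary X fun τ => (hX τ).continuous]
  exact Finset.sum_congr rfl fun τ _ => green_triangle (M.D_pos τ) (hX τ)

end Mesh

namespace Mesh

variable {Ω : Set Plane} (M : Mesh Ω)

/-! ### Linearity of the discrete forms -/

section Linearity

theorem sv_add (p q : M.PS) : M.sv (p + q) = M.sv p + M.sv q := by
  ext τ x; simp [sv, pval_add]
theorem sv_smul (r : ℝ) (p : M.PS) : M.sv (r • p) = r • M.sv p := by
  ext τ x; simp [sv, pval_smul]
theorem vv_add (p q : M.PV) : M.vv (p + q) = M.vv p + M.vv q := by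
  ext τ x; simp [vv, pval_add]
theorem vv_smul (r : ℝ) (p : M.PV) : M.vv (r • p) = r • M.vv p := by
  ext τ x; simp [vv, pval_smul]
theorem tv_add (p q : M.PT) : M.tv (p + q) = M.tv p + M.tv q := by
  ext τ x; simp [tv, pval_add]
theorem tv_smul (r : ℝ) (p : M.PT) : M.tv (r • p) = r • M.tv p := by
  ext τ x; simp [tv, pval_smul]
theorem vv_sub (p q : M.PV) : M.vv (p - q) = M.vv p - M.vv q := by
  ext τ x; simp [vv, pval_sub]

theorem gradS_add (p q : M.PS) : M.gradS (p + q) = M.gradS p + M.gradS q := by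
  ext1 τ; ext1 i; simp [gradS]
theorem gradS_smul (r : ℝ) (p : M.PS) : M.gradS (r • p) = r • M.gradS p := by
  ext1 τ; ext1 i; simp [gradS]
theorem gradV_add (p q : M.PV) : M.gradV (p + q) = M.gradV p + M.gradV q := by
  ext1 τ; ext1 i; ext1 j; simp [gradV]
theorem gradV_smul (r : ℝ) (p : M.PV) : M.gradV (r • p) = r • M.gradV p := by
  ext1 τ; ext1 i; ext1 j; simp [gradV]
theorem divV_add (p q : M.PV) : M.divV (p + q) = M.divV p + M.divV q := by
  ext1 τ; simp [divV, Finset.sum_add_distrib]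
theorem divV_smul (r : ℝ) (p : M.PV) : M.divV (r • p) = r • M.divV p := by
  ext1 τ; simp [divV]
theorem divT_add (p q : M.PT) : M.divT (p + q) = M.divT p + M.divT q := by
  ext1 τ; ext1 i; simp [divT, Finset.sum_add_distrib]
theorem divT_smul (r : ℝ) (p : M.PT) : M.divT (r • p) = r • M.divT p := by
  ext1 τ; ext1 i; simp [divT]

section Jumps

variable {F : Type*} [AddCommGroup F]

theorem jumpP_add (g h : M.Tri → Plane → F) (τ : M.Tri) (x : Plane) :
    M.jumpP (g + h) τ x = M.jumpP g τ x + M.jumpP h τ x := by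
  unfold jumpP; split
  · simp only [Pi.add_apply]; abel
  · rfl

theorem jumpD_add (g h : M.Tri → Plane → F) (τ : M.Tri) (x : Plane) :
    M.jumpD (g + h) τ x = M.jumpD g τ x + M.jumpD h τ x := by
  unfold jumpD; simp only [Pi.add_apply]; abel

variable [Module ℝ F]

theorem jumpP_smul (r : ℝ) (g : M.Tri → Plane → F) (τ : M.Tri) (x : Plane) :
    M.jumpP (r • g) τ x = r • M.jumpP g τ x := by
  unfold jumpP; split
  · simp only [Pi.smul_apply, smul_sub]
  · rfl

theorem jumpD_smul (r : ℝ) (g : M.Tri → Plane → F) (τ : M.Tri) (x : Plane) :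
    M.jumpD (r • g) τ x = r • M.jumpD g τ x := by
  unfold jumpD; simp only [Pi.smul_apply, smul_sub]

theorem avgP_add (g h : M.Tri → Plane → F) (τ : M.Tri) (x : Plane) :
    M.avgP (g + h) τ x = M.avgP g τ x + M.avgP h τ x := by
  unfold avgP; split
  · simp only [Pi.add_apply]; module
  · rfl

theorem avgP_smul (r : ℝ) (g : M.Tri → Plane → F) (τ : M.Tri) (x : Plane) :
    M.avgP (r • g) τ x = r • M.avgP g τ x := by
  unfold avgP; split
  · simp only [Pi.smul_apply]; module
  · rfl

theorem avgD_add (g h : M.Tri → Plane → F) (τ : M.Tri) (x : Plane) :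
    M.avgD (g + h) τ x = M.avgD g τ x + M.avgD h τ x := by
  unfold avgD; simp only [Pi.add_apply]; module

theorem avgD_smul (r : ℝ) (g : M.Tri → Plane → F) (τ : M.Tri) (x : Plane) :
    M.avgD (r • g) τ x = r • M.avgD g τ x := by
  unfold avgD; simp only [Pi.smul_apply]; module

end Jumps

section Continuity

variable {F : Type*} [AddCommGroup F] [TopologicalSpace F] [IsTopologicalAddGroup F]
  {g : M.Tri → Plane → F}

theorem continuous_jumpP (hg : ∀ τ, Continuous (g τ)) (τ : M.Tri) : Continuous (M.jumpP g τ) := by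
  unfold jumpP; split
  · exact (hg _).sub (hg _)
  · exact hg _

theorem continuous_jumpD (hg : ∀ τ, Continuous (g τ)) (τ : M.Tri) : Continuous (M.jumpD g τ) :=
  (hg _).sub (hg _)

variable [Module ℝ F] [ContinuousSMul ℝ F]

theorem continuous_avgP (hg : ∀ τ, Continuous (g τ)) (τ : M.Tri) : Continuous (M.avgP g τ) := by
  unfold avgP; split
  · exact continuous_const.smul ((hg _).add (hg _))
  · exact hg _

theorem continuous_avgD (hg : ∀ τ, Continuous (g τ)) (τ : M.Tri) : Continuous (M.avgD g τ) :=
  continuous_const.smul ((hg _).add (hg _))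

theorem continuous_sv (q : M.PS) (τ : M.Tri) : Continuous (M.sv q τ) := continuous_pval _
theorem continuous_vv (v : M.PV) (τ : M.Tri) : Continuous (M.vv v τ) :=
  continuous_pi fun _ => continuous_pval _
theorem continuous_tv (H : M.PT) (τ : M.Tri) : Continuous (M.tv H τ) :=
  continuous_matrix fun _ _ => continuous_pval _

end Continuity

@[fun_prop] theorem continuous_sv' (q : M.PS) (τ : M.Tri) : Continuous fun x => M.sv q τ x :=
  M.continuous_sv q τ
@[fun_prop] theorem continuous_vv' (v : M.PV) (τ : M.Tri) : Continuous fun x => M.vv v τ x :=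
  M.continuous_vv v τ
@[fun_prop] theorem continuous_tv' (H : M.PT) (τ : M.Tri) : Continuous fun x => M.tv H τ x :=
  M.continuous_tv H τ
@[fun_prop] theorem continuous_jumpP_sv (v : M.PS) (τ : M.Tri) :
    Continuous fun x => M.jumpP (M.sv v) τ x := M.continuous_jumpP (M.continuous_sv v) τ
@[fun_prop] theorem continuous_jumpD_sv (v : M.PS) (τ : M.Tri) :
    Continuous fun x => M.jumpD (M.sv v) τ x := M.continuous_jumpD (M.continuous_sv v) τ
@[fun_prop] theorem continuous_avgP_sv (v : M.PS) (τ : M.Tri) :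
    Continuous fun x => M.avgP (M.sv v) τ x := M.continuous_avgP (M.continuous_sv v) τ
@[fun_prop] theorem continuous_jumpP_vv (v : M.PV) (τ : M.Tri) :
    Continuous fun x => M.jumpP (M.vv v) τ x := M.continuous_jumpP (M.continuous_vv v) τ
@[fun_prop] theorem continuous_jumpD_vv (v : M.PV) (τ : M.Tri) :
    Continuous fun x => M.jumpD (M.vv v) τ x := M.continuous_jumpD (M.continuous_vv v) τ
@[fun_prop] theorem continuous_avgP_vv (v : M.PV) (τ : M.Tri) :
    Continuous fun x => M.avgP (M.vv v) τ x := M.continuous_avgP (M.continuous_vv v) τ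
@[fun_prop] theorem continuous_avgD_vv (v : M.PV) (τ : M.Tri) :
    Continuous fun x => M.avgD (M.vv v) τ x := M.continuous_avgD (M.continuous_vv v) τ
@[fun_prop] theorem continuous_jumpD_tv (v : M.PT) (τ : M.Tri) :
    Continuous fun x => M.jumpD (M.tv v) τ x := M.continuous_jumpD (M.continuous_tv v) τ
@[fun_prop] theorem continuous_avgP_tv (v : M.PT) (τ : M.Tri) :
    Continuous fun x => M.avgP (M.tv v) τ x := M.continuous_avgP (M.continuous_tv v) τ
@[fun_prop] theorem continuous_avgD_tv (v : M.PT) (τ : M.Tri) :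
    Continuous fun x => M.avgD (M.tv v) τ x := M.continuous_avgD (M.continuous_tv v) τ

theorem _root_.SDG.continuous_dotProduct {u v : Plane → Fin 2 → ℝ} (hu : Continuous u)
    (hv : Continuous v) : Continuous fun x => u x ⬝ᵥ v x := hu.dotProduct hv

theorem _root_.SDG.continuous_mulVec {u : Plane → Matrix (Fin 2) (Fin 2) ℝ} (hu : Continuous u)
    (w : Fin 2 → ℝ) : Continuous fun x => u x *ᵥ w := hu.matrix_mulVec continuous_const

attribute [fun_prop] SDG.continuous_dotProduct SDG.continuous_mulVec

variable {V : Type*} [AddCommGroup V] [Module ℝ V]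

theorem _root_.SDG.isLinearMap_setIntegral {X : Type*} [MeasureSpace X] {K : Set X} {g : V → X → ℝ}
    (hc : ∀ v, IntegrableOn (g v) K) (hl : ∀ x, IsLinearMap ℝ fun v => g v x) :
    IsLinearMap ℝ fun v => ∫ x in K, g v x where
  map_add u v := by
    rw [← integral_add (hc u) (hc v)]
    simp only [(hl _).map_add]
  map_smul r v := by
    simp only [(hl _).map_smul, smul_eq_mul]
    rw [integral_const_mul]

theorem isLinearMap_tri (τ : M.Tri) {g : V → Plane → ℝ} (hc : ∀ v, Continuous (g v))
    (hl : ∀ x, IsLinearMap ℝ fun v => g v x) : IsLinearMap ℝ fun v => ∫ x in M.tri τ, g v x :=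
  isLinearMap_setIntegral (fun v => M.integrableOn_tri τ (hc v)) hl

theorem _root_.SDG.isLinearMap_edgeInt (p q : Plane) {g : V → Plane → ℝ} (hc : ∀ v, Continuous (g v))
    (hl : ∀ x, IsLinearMap ℝ fun v => g v x) : IsLinearMap ℝ fun v => edgeInt p q (g v) where
  map_add u v := by
    rw [← edgeInt_add (hc u) (hc v)]
    simp only [← (hl _).map_add]
  map_smul r v := by
    rw [smul_eq_mul, ← edgeInt_const_mul]
    congr 1
    ext x
    exact (hl x).map_smul r v

theorem _root_.SDG.isLinearMap_sum {ι : Type*} (s : Finset ι) {g : ι → V → ℝ}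
    (h : ∀ i ∈ s, IsLinearMap ℝ (g i)) : IsLinearMap ℝ fun v => ∑ i ∈ s, g i v where
  map_add u v := by
    rw [← Finset.sum_add_distrib]
    exact Finset.sum_congr rfl fun i hi => (h i hi).map_add u v
  map_smul r v := by
    rw [Finset.smul_sum]
    exact Finset.sum_congr rfl fun i hi => (h i hi).map_smul r v

theorem _root_.SDG.isLinearMap_add {f g : V → ℝ} (hf : IsLinearMap ℝ f) (hg : IsLinearMap ℝ g) :
    IsLinearMap ℝ fun v => f v + g v where
  map_add u v := by rw [hf.map_add, hg.map_add]; ring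
  map_smul r v := by rw [hf.map_smul, hg.map_smul, smul_add]

theorem _root_.SDG.isLinearMap_neg {f : V → ℝ} (hf : IsLinearMap ℝ f) :
    IsLinearMap ℝ fun v => -f v where
  map_add u v := by rw [hf.map_add]; ring
  map_smul r v := by rw [hf.map_smul, smul_neg]

theorem _root_.SDG.isLinearMap_sub {f g : V → ℝ} (hf : IsLinearMap ℝ f) (hg : IsLinearMap ℝ g) :
    IsLinearMap ℝ fun v => f v - g v where
  map_add u v := by rw [hf.map_add, hg.map_add]; ring
  map_smul r v := by rw [hf.map_smul, hg.map_smul, smul_sub]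

theorem isLinear_ipS_left (q : M.PS) : IsLinearMap ℝ fun p => M.ipS p q := by
  refine isLinearMap_sum _ fun τ _ => M.isLinearMap_tri τ (fun v => by fun_prop) fun x => ⟨?_, ?_⟩ <;>
    intros <;> simp [sv_add, sv_smul] <;> ring

theorem ipS_comm (p q : M.PS) : M.ipS p q = M.ipS q p := by simp only [ipS, mul_comm]
theorem ipV_comm (p q : M.PV) : M.ipV p q = M.ipV q p := by simp only [ipV, dotProduct_comm]
theorem ipT_comm (p q : M.PT) : M.ipT p q = M.ipT q p := by simp only [ipT, mul_comm]

theorem isLinear_ipV_left (q : M.PV) : IsLinearMap ℝ fun p => M.ipV p q := by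
  refine isLinearMap_sum _ fun τ _ => M.isLinearMap_tri τ (fun v => by fun_prop) fun x => ⟨?_, ?_⟩ <;>
    intros <;> simp [vv_add, vv_smul]

theorem continuous_ipT_integrand (G H : M.PT) (τ : M.Tri) :
    Continuous fun x => ∑ i, ∑ j, M.tv G τ x i j * M.tv H τ x i j :=
  continuous_finsetSum _ fun _ _ => continuous_finsetSum _ fun _ _ =>
    (continuous_pval _).mul (continuous_pval _)

theorem isLinear_ipT_left (q : M.PT) : IsLinearMap ℝ fun p => M.ipT p q := by
  refine isLinearMap_sum _ fun τ _ => M.isLinearMap_tri τ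
    (fun v => M.continuous_ipT_integrand _ _ _) fun x => ⟨?_, ?_⟩ <;>
    intros <;> simp [tv_add, tv_smul] <;> ring

theorem isLinear_ipS_right (q : M.PS) : IsLinearMap ℝ fun p => M.ipS q p := by
  simpa only [M.ipS_comm] using M.isLinear_ipS_left q
theorem isLinear_ipV_right (q : M.PV) : IsLinearMap ℝ fun p => M.ipV q p := by
  simpa only [M.ipV_comm q] using M.isLinear_ipV_left q
theorem isLinear_ipT_right (q : M.PT) : IsLinearMap ℝ fun p => M.ipT q p := by
  simpa only [M.ipT_comm q] using M.isLinear_ipT_left q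

theorem _root_.IsLinearMap.comp_of {W : Type*} [AddCommGroup W] [Module ℝ W] {f : W → ℝ}
    (hf : IsLinearMap ℝ f) {g : V → W} (h1 : ∀ u v, g (u + v) = g u + g v)
    (h2 : ∀ (r : ℝ) v, g (r • v) = r • g v) : IsLinearMap ℝ fun v => f (g v) where
  map_add u v := by rw [h1, hf.map_add]
  map_smul r v := by rw [h2, hf.map_smul]

theorem isLinear_Bh_left (v : M.PV) : IsLinearMap ℝ fun H => M.Bh H v := by
  refine isLinearMap_sub (isLinearMap_sub (M.isLinear_ipT_left _)
    (isLinearMap_sum _ fun τ _ => isLinearMap_edgeInt _ _ (fun v => by fun_prop) fun x => ⟨?_, ?_⟩))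
    (isLinearMap_sum _ fun τ _ => isLinearMap_edgeInt _ _ (fun v => by fun_prop) fun x => ⟨?_, ?_⟩) <;>
    intros <;>
    simp [tv_add, tv_smul, avgP_add, avgP_smul, avgD_add, avgD_smul, Matrix.add_mulVec,
      Matrix.smul_mulVec] <;> ring

theorem isLinear_Bh_right (H : M.PT) : IsLinearMap ℝ fun v => M.Bh H v := by
  refine isLinearMap_sub (isLinearMap_sub
    ((M.isLinear_ipT_right _).comp_of M.gradV_add M.gradV_smul)
    (isLinearMap_sum _ fun τ _ => isLinearMap_edgeInt _ _ (fun v => by fun_prop) fun x => ⟨?_, ?_⟩))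
    (isLinearMap_sum _ fun τ _ => isLinearMap_edgeInt _ _ (fun v => by fun_prop) fun x => ⟨?_, ?_⟩) <;>
    intros <;>
    simp [vv_add, vv_smul, jumpP_add, jumpP_smul, jumpD_add, jumpD_smul] <;> ring

theorem isLinear_BhStar_left (H : M.PT) : IsLinearMap ℝ fun v => M.BhStar v H := by
  refine isLinearMap_sub (M.isLinear_ipV_left _)
    (isLinearMap_sum _ fun τ _ => isLinearMap_edgeInt _ _ (fun v => by fun_prop) fun x => ⟨?_, ?_⟩) <;>
    intros <;>
    simp [vv_add, vv_smul, avgD_add, avgD_smul] <;> ring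

theorem isLinear_BhStar_right (v : M.PV) : IsLinearMap ℝ fun H => M.BhStar v H := by
  refine isLinearMap_sub ((M.isLinear_ipV_right _).comp_of M.divT_add M.divT_smul)
    (isLinearMap_sum _ fun τ _ => isLinearMap_edgeInt _ _ (fun v => by fun_prop) fun x => ⟨?_, ?_⟩) <;>
    intros <;>
    simp [tv_add, tv_smul, jumpD_add, jumpD_smul, Matrix.add_mulVec,
      Matrix.smul_mulVec] <;> ring

theorem isLinear_bh_left (q : M.PS) : IsLinearMap ℝ fun v => M.bh v q := by
  refine isLinearMap_add (isLinearMap_neg (M.isLinear_ipV_left _))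
    (isLinearMap_sum _ fun τ _ => isLinearMap_edgeInt _ _ (fun v => by fun_prop) fun x => ⟨?_, ?_⟩) <;>
    intros <;>
    simp [vv_add, vv_smul, avgD_add, avgD_smul] <;> ring

theorem isLinear_bh_right (v : M.PV) : IsLinearMap ℝ fun q => M.bh v q := by
  refine isLinearMap_add (isLinearMap_neg ((M.isLinear_ipV_right _).comp_of M.gradS_add M.gradS_smul))
    (isLinearMap_sum _ fun τ _ => isLinearMap_edgeInt _ _ (fun v => by fun_prop) fun x => ⟨?_, ?_⟩) <;>
    intros <;>
    simp [sv_add, sv_smul, jumpD_add, jumpD_smul] <;> ring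

theorem isLinear_bhStar_left (v : M.PV) : IsLinearMap ℝ fun q => M.bhStar q v := by
  refine isLinearMap_add (isLinearMap_neg (M.isLinear_ipS_left _))
    (isLinearMap_sum _ fun τ _ => isLinearMap_edgeInt _ _ (fun v => by fun_prop) fun x => ⟨?_, ?_⟩) <;>
    intros <;>
    simp [sv_add, sv_smul, avgP_add, avgP_smul] <;> ring

theorem isLinear_bhStar_right (q : M.PS) : IsLinearMap ℝ fun v => M.bhStar q v := by
  refine isLinearMap_add (isLinearMap_neg ((M.isLinear_ipS_right _).comp_of M.divV_add M.divV_smul))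
    (isLinearMap_sum _ fun τ _ => isLinearMap_edgeInt _ _ (fun v => by fun_prop) fun x => ⟨?_, ?_⟩) <;>
    intros <;>
    simp [vv_add, vv_smul, jumpP_add, jumpP_smul] <;> ring

theorem continuous_Nh_integrand (w ψ v : M.PV) (τ : M.Tri) :
    Continuous fun x => ∑ i, ∑ j, M.vv ψ τ x i * M.vv w τ x j * M.tv (M.gradV v) τ x i j :=
  continuous_finsetSum _ fun _ _ => continuous_finsetSum _ fun _ _ =>
    ((continuous_pval _).mul (continuous_pval _)).mul (continuous_pval _)

theorem isLinear_Nh_mid (w v : M.PV) : IsLinearMap ℝ fun ψ => M.Nh w ψ v := by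
  refine isLinearMap_add (isLinearMap_add (isLinearMap_neg (isLinearMap_sum _ fun τ _ =>
      M.isLinearMap_tri τ (fun v => M.continuous_Nh_integrand _ _ _ _) fun x => ⟨?_, ?_⟩))
    (isLinearMap_add
      (isLinearMap_sum _ fun τ _ => isLinearMap_edgeInt _ _ (fun v => by fun_prop) fun x => ⟨?_, ?_⟩)
      (isLinearMap_sum _ fun τ _ => isLinearMap_edgeInt _ _ (fun v => by fun_prop) fun x => ⟨?_, ?_⟩)))
    (isLinearMap_add
      (isLinearMap_sum _ fun τ _ => isLinearMap_edgeInt _ _ (fun v => by fun_prop) fun x => ⟨?_, ?_⟩)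
      (isLinearMap_sum _ fun τ _ => isLinearMap_edgeInt _ _ (fun v => by fun_prop) fun x => ⟨?_, ?_⟩)) <;>
    intros <;>
    simp [vv_add, vv_smul, avgP_add, avgP_smul, avgD_add, avgD_smul, jumpP_add, jumpP_smul,
      jumpD_add, jumpD_smul] <;> ring

theorem isLinear_Nh_right (w ψ : M.PV) : IsLinearMap ℝ fun v => M.Nh w ψ v := by
  refine isLinearMap_add (isLinearMap_add (isLinearMap_neg (isLinearMap_sum _ fun τ _ =>
      M.isLinearMap_tri τ (fun v => M.continuous_Nh_integrand _ _ _ _) fun x => ⟨?_, ?_⟩))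
    (isLinearMap_add
      (isLinearMap_sum _ fun τ _ => isLinearMap_edgeInt _ _ (fun v => by fun_prop) fun x => ⟨?_, ?_⟩)
      (isLinearMap_sum _ fun τ _ => isLinearMap_edgeInt _ _ (fun v => by fun_prop) fun x => ⟨?_, ?_⟩)))
    (isLinearMap_add
      (isLinearMap_sum _ fun τ _ => isLinearMap_edgeInt _ _ (fun v => by fun_prop) fun x => ⟨?_, ?_⟩)
      (isLinearMap_sum _ fun τ _ => isLinearMap_edgeInt _ _ (fun v => by fun_prop) fun x => ⟨?_, ?_⟩)) <;>
    intros <;>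
    simp [vv_add, vv_smul, gradV_add, gradV_smul, tv_add, tv_smul, jumpP_add, jumpP_smul,
      jumpD_add, jumpD_smul] <;> ring

end Linearity

end Mesh

/-! ### The orthonormal frame of an edge and integration by parts. -/

theorem tangent_sq {p q : Plane} (h : p ≠ q) : tangent p q 0 ^ 2 + tangent p q 1 ^ 2 = 1 := by
  have hd : dist p q ≠ 0 := dist_ne_zero.2 h
  have : dist p q ^ 2 = (q 0 - p 0) ^ 2 + (q 1 - p 1) ^ 2 := by
    rw [dist_comm, EuclideanSpace.dist_eq, Real.sq_sqrt (by positivity), Fin.sum_univ_two,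
      Real.dist_eq, Real.dist_eq, sq_abs, sq_abs]
  simp only [tangent, div_pow, ← add_div]
  rw [← this, div_self (pow_ne_zero _ hd)]

theorem dotProduct_eq_normal_tangent {p q : Plane} (h : p ≠ q) (u v : Fin 2 → ℝ) :
    u ⬝ᵥ v = (u ⬝ᵥ normal p q) * (v ⬝ᵥ normal p q) + (u ⬝ᵥ tangent p q) * (v ⬝ᵥ tangent p q) := by
  have := tangent_sq h
  simp only [dotProduct, Fin.sum_univ_two, normal, Matrix.cons_val_zero, Matrix.cons_val_one]
  linear_combination (-(u 0 * v 0) - u 1 * v 1) * this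

namespace Mesh

variable {Ω : Set Plane} (M : Mesh Ω)

theorem c_ne_a (τ : M.Tri) : M.c τ ≠ M.a τ := by
  intro h
  have := M.D_pos τ
  simp [D, h, cross] at this

theorem c_ne_b (τ : M.Tri) : M.c τ ≠ M.b τ := by
  intro h
  have := M.D_pos τ
  simp [D, h, cross] at this

theorem a_ne_b (τ : M.Tri) : M.a τ ≠ M.b τ := by
  intro h
  have := M.D_pos τ
  simp only [D, h, cross] at this
  linarith [mul_comm ((M.b τ - M.c τ) 0) ((M.b τ - M.c τ) 1)]

/-! ### Integration by parts -/

theorem contDiff_vv (v : M.PV) (τ : M.Tri) : ContDiff ℝ 1 (M.vv v τ) :=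
  contDiff_pi.2 fun _ => (contDiff_pval _).of_le (by exact_mod_cast le_top)

theorem sum_green_poly (X : M.PV) :
    ∑ τ, ∫ x in M.tri τ, M.sv (M.divV X) τ x =
    ∑ τ ∈ M.plus, M.intP τ (fun x => M.jumpP (M.vv X) τ x ⬝ᵥ M.nP τ) +
      ∑ τ, M.intD τ (fun x => M.jumpD (M.vv X) τ x ⬝ᵥ M.nD τ) := by
  rw [← M.sum_green (M.vv X) fun τ => M.contDiff_vv X τ]
  refine Finset.sum_congr rfl fun τ _ => ?_
  congr 1
  ext x
  simp only [sv, divV, pval_sum]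
  exact Finset.sum_congr rfl fun i _ => (partialD_pval _ _ _).symm

/-- The divergence theorem for the field Hᵀv. On interior primal edges [Hn] = 0 leaves Hn·[v]. On
dual edges v·Hn splits into a normal and a tangential product; in each of them one factor is
continuous, since [v·n] = 0 and [t·Hn] = 0, and the jumps of the other factors are the edge terms of
the two forms. -/
theorem Bh_eq_neg_BhStar {k : ℕ} {H : M.PT} (hH : H ∈ M.Hh k) {v : M.PV} (hv : v ∈ M.Vh k) :
    M.Bh H v = -M.BhStar v H := by
  let X : M.PV := fun τ j => ∑ i, v τ i * H τ i j
  have hX : ∀ τ x j, M.vv X τ x j = ∑ i, M.vv v τ x i * M.tv H τ x i j := by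
    intro τ x j; simp [X, vv, tv, Fin.sum_univ_two, pval_add, pval_mul]
  have h1 := M.sum_green_poly X
  have h2 : ∑ τ, ∫ x in M.tri τ, M.sv (M.divV X) τ x = M.ipT H (M.gradV v) + M.ipV v (M.divT H) := by
    unfold ipT ipV
    rw [← Finset.sum_add_distrib]
    refine Finset.sum_congr rfl fun τ _ => ?_
    rw [← integral_add (M.integrableOn_tri τ (M.continuous_ipT_integrand _ _ _))
      (M.integrableOn_tri τ (by fun_prop))]
    congr 1
    ext x
    simp [X, sv, divV, tv, vv, gradV, divT, dotProduct, Fin.sum_univ_two, pval_add, pval_mul]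
    ring
  have h3 : ∀ τ ∈ M.plus, M.intP τ (fun x => M.jumpP (M.vv X) τ x ⬝ᵥ M.nP τ) =
      M.intP τ (fun x => (M.avgP (M.tv H) τ x *ᵥ M.nP τ) ⬝ᵥ M.jumpP (M.vv v) τ x) := by
    intro τ _
    apply M.intP_congr
    intro x hx
    rcases hn : M.nbr τ with _ | σ
    · simp only [jumpP, avgP, hn, dotProduct, Matrix.mulVec, hX, Fin.sum_univ_two]
      ring
    · have := hH.2.1 τ (by simp [hn]) x hx
      have h0 := congrFun this 0
      have h1 := congrFun this 1
      simp only [jumpP, hn, Matrix.mulVec, dotProduct, Fin.sum_univ_two, Matrix.sub_apply,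
        Pi.zero_apply] at h0 h1
      simp only [jumpP, avgP, hn, dotProduct, Matrix.mulVec, Fin.sum_univ_two, Pi.sub_apply,
        Matrix.add_apply, Matrix.smul_apply, smul_eq_mul, hX]
      linear_combination (1 / 2) * (M.vv v τ x 0 + M.vv v σ x 0) * h0 +
        (1 / 2) * (M.vv v τ x 1 + M.vv v σ x 1) * h1
  have h4 : ∀ τ, M.intD τ (fun x => M.jumpD (M.vv X) τ x ⬝ᵥ M.nD τ) =
      M.intD τ (fun x => (M.tD τ ⬝ᵥ (M.avgD (M.tv H) τ x *ᵥ M.nD τ)) *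
        (M.jumpD (M.vv v) τ x ⬝ᵥ M.tD τ)) +
      M.intD τ (fun x => (M.avgD (M.vv v) τ x ⬝ᵥ M.nD τ) *
        (M.nD τ ⬝ᵥ (M.jumpD (M.tv H) τ x *ᵥ M.nD τ))) := by
    intro τ
    unfold intD
    rw [← edgeInt_add (by fun_prop) (by fun_prop)]
    apply edgeInt_congr
    intro x hx
    have e1 := hv.2 τ x hx
    have e2 := hH.2.2 τ x hx
    have key : ∀ σ, M.vv X σ x ⬝ᵥ M.nD τ =
        (M.vv v σ x ⬝ᵥ M.nD τ) * (M.nD τ ⬝ᵥ (M.tv H σ x *ᵥ M.nD τ)) +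
        (M.vv v σ x ⬝ᵥ M.tD τ) * (M.tD τ ⬝ᵥ (M.tv H σ x *ᵥ M.nD τ)) := by
      intro σ
      have := dotProduct_eq_normal_tangent (M.c_ne_a τ) (M.vv v σ x) (M.tv H σ x *ᵥ M.nD τ)
      rw [dotProduct_comm (M.tv H σ x *ᵥ M.nD τ), dotProduct_comm (M.tv H σ x *ᵥ M.nD τ)] at this
      have this : M.vv v σ x ⬝ᵥ (M.tv H σ x *ᵥ M.nD τ) =
          (M.vv v σ x ⬝ᵥ M.nD τ) * (M.nD τ ⬝ᵥ (M.tv H σ x *ᵥ M.nD τ)) +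
          (M.vv v σ x ⬝ᵥ M.tD τ) * (M.tD τ ⬝ᵥ (M.tv H σ x *ᵥ M.nD τ)) := this
      rw [← this]
      simp only [dotProduct, Matrix.mulVec, hX, Fin.sum_univ_two]
      ring
    unfold jumpD at e1 e2 ⊢
    unfold avgD
    simp only [sub_dotProduct, Matrix.sub_mulVec, dotProduct_sub, smul_dotProduct, add_dotProduct,
      Matrix.smul_mulVec, Matrix.add_mulVec, dotProduct_smul, dotProduct_add, smul_eq_mul] at e1 e2 ⊢
    rw [key, key]
    linear_combination
      (1 / 2) * (M.nD τ ⬝ᵥ M.tv H τ x *ᵥ M.nD τ + M.nD τ ⬝ᵥ M.tv H (M.prev τ) x *ᵥ M.nD τ) * e1 +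
      (1 / 2) * (M.vv v τ x ⬝ᵥ M.tD τ + M.vv v (M.prev τ) x ⬝ᵥ M.tD τ) * e2
  rw [h2, Finset.sum_congr rfl h3, Finset.sum_congr rfl (fun τ _ => h4 τ), Finset.sum_add_distrib] at h1
  unfold Bh BhStar
  linarith

/-- The divergence theorem for qv: q is continuous across primal edges and v·n across dual edges, so
each edge carries one jump only. -/
theorem bh_eq_neg_bhStar {k : ℕ} {v : M.PV} (hv : v ∈ M.Vh k) {q : M.PS} (hq : q ∈ M.Qh k) :
    M.bh v q = -M.bhStar q v := by
  let X : M.PV := fun τ j => q τ * v τ j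
  have hX : ∀ τ x j, M.vv X τ x j = M.sv q τ x * M.vv v τ x j := by
    intro τ x j; simp [X, vv, sv, pval_mul]
  have h1 := M.sum_green_poly X
  have h2 : ∑ τ, ∫ x in M.tri τ, M.sv (M.divV X) τ x = M.ipS q (M.divV v) + M.ipV v (M.gradS q) := by
    unfold ipS ipV
    rw [← Finset.sum_add_distrib]
    refine Finset.sum_congr rfl fun τ _ => ?_
    rw [← integral_add (M.integrableOn_tri τ (by fun_prop)) (M.integrableOn_tri τ (by fun_prop))]
    congr 1
    ext x
    simp [X, sv, divV, vv, gradS, dotProduct, Fin.sum_univ_two, pval_add, pval_mul]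
    ring
  have h3 : ∀ τ ∈ M.plus, M.intP τ (fun x => M.jumpP (M.vv X) τ x ⬝ᵥ M.nP τ) =
      M.intP τ (fun x => M.avgP (M.sv q) τ x * (M.jumpP (M.vv v) τ x ⬝ᵥ M.nP τ)) := by
    intro τ _
    apply M.intP_congr
    intro x hx
    rcases hn : M.nbr τ with _ | σ
    · simp only [jumpP, avgP, hn, dotProduct, hX, Fin.sum_univ_two]
      ring
    · have h0 := hq.2 τ (by simp [hn]) x hx
      simp only [jumpP, hn] at h0
      simp only [jumpP, avgP, hn, dotProduct, Fin.sum_univ_two, Pi.sub_apply, smul_eq_mul, hX]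
      linear_combination (1 / 2) * ((M.vv v τ x 0 + M.vv v σ x 0) * M.nP τ 0 +
        (M.vv v τ x 1 + M.vv v σ x 1) * M.nP τ 1) * h0
  have h4 : ∀ τ, M.intD τ (fun x => M.jumpD (M.vv X) τ x ⬝ᵥ M.nD τ) =
      M.intD τ (fun x => (M.avgD (M.vv v) τ x ⬝ᵥ M.nD τ) * M.jumpD (M.sv q) τ x) := by
    intro τ
    apply M.intD_congr
    intro x hx
    have e1 := hv.2 τ x hx
    unfold jumpD at e1 ⊢
    unfold avgD
    simp only [dotProduct, Fin.sum_univ_two, Pi.sub_apply, Pi.smul_apply, Pi.add_apply, smul_eq_mul,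
      hX] at e1 ⊢
    linear_combination (1 / 2) * (M.sv q τ x + M.sv q (M.prev τ) x) * e1
  rw [h2, Finset.sum_congr rfl h3, Finset.sum_congr rfl (fun τ _ => h4 τ)] at h1
  unfold bh bhStar
  linarith

/-! ### Coercivity of the convective form -/

/-- Vanishing divergence on each triangle and continuous normal components on interior primal
edges. -/
def PiecewiseDivFree (z : M.PV) : Prop :=
  (∀ τ, M.divV z τ = 0) ∧ ∀ τ, M.nbr τ ≠ none → ∀ x ∈ segment ℝ (M.a τ) (M.b τ),
    M.jumpP (M.vv z) τ x ⬝ᵥ M.nP τ = 0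

/-- The divergence theorem for |w|²z, with ∇·z = 0, equates twice the volume term with edge
integrals of z·n [|w|²]. On interior edges [|w|²] = 2{w}·[w] cancels the central flux. On the
boundary half of z·n|w|² survives with a minus sign, and the upwind term |z·n||w|² dominates it
whatever the sign of z·n. -/
theorem Nh_self_nonneg {k : ℕ} {z : M.PV} (hz : z ∈ M.Vh k) (hdiv : M.PiecewiseDivFree z) (w : M.PV) :
    0 ≤ M.Nh z w w := by
  let X : M.PV := fun τ j => z τ j * ∑ i, w τ i ^ 2
  have hX : ∀ τ x j, M.vv X τ x j = M.vv z τ x j * (M.vv w τ x 0 ^ 2 + M.vv w τ x 1 ^ 2) := by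
    intro τ x j; simp [X, vv, pval]
  have h1 := M.sum_green_poly X
  have h2 : ∑ τ, ∫ x in M.tri τ, M.sv (M.divV X) τ x =
      2 * ∑ τ, ∫ x in M.tri τ, ∑ i, ∑ j,
        M.vv w τ x i * M.vv z τ x j * M.tv (M.gradV w) τ x i j := by
    rw [Finset.mul_sum]
    refine Finset.sum_congr rfl fun τ _ => ?_
    rw [← integral_const_mul]
    congr 1
    ext x
    have h0 := congrArg (fun p => pval p x) (hdiv.1 τ)
    simp only [divV, Fin.sum_univ_two, pval_add, pval_zero] at h0
    simp [X, sv, divV, tv, vv, gradV, Fin.sum_univ_two, pval_add, pval_mul, sq]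
    linear_combination (pval (w τ 0) x ^ 2 + pval (w τ 1) x ^ 2) * h0
  have h3 : ∀ τ ∈ M.plus.filter (fun τ => M.nbr τ ≠ none), M.intP τ (fun x => M.jumpP (M.vv X) τ x ⬝ᵥ M.nP τ) =
      2 * M.intP τ (fun x =>
        (M.avgP (M.vv z) τ x ⬝ᵥ M.nP τ) * (M.avgP (M.vv w) τ x ⬝ᵥ M.jumpP (M.vv w) τ x)) := by
    intro τ hτ
    rw [Finset.mem_filter] at hτ
    unfold intP
    rw [← edgeInt_const_mul]
    apply edgeInt_congr
    intro x hx
    obtain ⟨σ, hn⟩ := Option.ne_none_iff_exists'.1 hτ.2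
    have h0 := hdiv.2 τ hτ.2 x hx
    simp only [jumpP, hn, dotProduct, Fin.sum_univ_two, Pi.sub_apply] at h0
    simp only [jumpP, avgP, hn, dotProduct, Fin.sum_univ_two, Pi.sub_apply, smul_eq_mul, hX,
      Pi.smul_apply, Pi.add_apply]
    linear_combination (1 / 2) * (M.vv w τ x 0 ^ 2 + M.vv w τ x 1 ^ 2 +
      M.vv w σ x 0 ^ 2 + M.vv w σ x 1 ^ 2) * h0
  have h4 : ∀ τ, M.intD τ (fun x => M.jumpD (M.vv X) τ x ⬝ᵥ M.nD τ) =
      2 * M.intD τ (fun x => (M.avgD (M.vv z) τ x ⬝ᵥ M.nD τ) *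
        (M.avgD (M.vv w) τ x ⬝ᵥ M.jumpD (M.vv w) τ x)) := by
    intro τ
    unfold intD
    rw [← edgeInt_const_mul]
    apply edgeInt_congr
    intro x hx
    have e1 := hz.2 τ x hx
    unfold jumpD at e1 ⊢
    unfold avgD
    simp only [dotProduct, Fin.sum_univ_two, Pi.sub_apply, Pi.smul_apply, Pi.add_apply, smul_eq_mul,
      hX] at e1 ⊢
    linear_combination (1 / 2) * (M.vv w τ x 0 ^ 2 + M.vv w τ x 1 ^ 2 +
      M.vv w (M.prev τ) x 0 ^ 2 + M.vv w (M.prev τ) x 1 ^ 2) * e1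
  have h5 : 0 ≤ ∑ τ ∈ M.plus with ¬ M.nbr τ ≠ none, (2 * M.intP τ (fun x =>
      |M.avgP (M.vv z) τ x ⬝ᵥ M.nP τ| * (M.jumpP (M.vv w) τ x ⬝ᵥ M.jumpP (M.vv w) τ x)) -
      M.intP τ (fun x => M.jumpP (M.vv X) τ x ⬝ᵥ M.nP τ)) := by
    refine Finset.sum_nonneg fun τ hτ => ?_
    rw [Finset.mem_filter, not_not] at hτ
    unfold intP
    rw [← edgeInt_const_mul, ← edgeInt_sub (by fun_prop) (by fun_prop)]
    apply edgeInt_nonneg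
    intro x hx
    simp only [jumpP, avgP, hτ.2, dotProduct, Fin.sum_univ_two, hX]
    have := le_abs_self (M.vv z τ x 0 * M.nP τ 0 + M.vv z τ x 1 * M.nP τ 1)
    have h6 : 0 ≤ |M.vv z τ x 0 * M.nP τ 0 + M.vv z τ x 1 * M.nP τ 1| := abs_nonneg _
    have h7 : 0 ≤ M.vv w τ x 0 ^ 2 + M.vv w τ x 1 ^ 2 := by positivity
    nlinarith
  have h6 : 0 ≤ ∑ τ ∈ M.plus with M.nbr τ ≠ none, M.intP τ (fun x =>
      |M.avgP (M.vv z) τ x ⬝ᵥ M.nP τ| * (M.jumpP (M.vv w) τ x ⬝ᵥ M.jumpP (M.vv w) τ x)) :=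
    Finset.sum_nonneg fun τ _ => edgeInt_nonneg fun x _ =>
      mul_nonneg (abs_nonneg _) (Finset.sum_nonneg fun i _ => mul_self_nonneg _)
  have h7 : 0 ≤ ∑ τ, M.intD τ (fun x =>
      |M.avgD (M.vv z) τ x ⬝ᵥ M.nD τ| * (M.jumpD (M.vv w) τ x ⬝ᵥ M.jumpD (M.vv w) τ x)) :=
    Finset.sum_nonneg fun τ _ => edgeInt_nonneg fun x _ =>
      mul_nonneg (abs_nonneg _) (Finset.sum_nonneg fun i _ => mul_self_nonneg _)
  rw [h2, ← Finset.sum_filter_add_sum_filter_not M.plus (fun τ => M.nbr τ ≠ none),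
    Finset.sum_congr rfl h3, Finset.sum_congr rfl (fun τ _ => h4 τ), ← Finset.mul_sum,
    ← Finset.mul_sum] at h1
  rw [Finset.sum_sub_distrib, ← Finset.mul_sum] at h5
  unfold Nh
  have h8 := Finset.sum_filter_add_sum_filter_not M.plus (fun τ => M.nbr τ ≠ none) (fun τ =>
    M.intP τ (fun x =>
      |M.avgP (M.vv z) τ x ⬝ᵥ M.nP τ| * (M.jumpP (M.vv w) τ x ⬝ᵥ M.jumpP (M.vv w) τ x)))
  linarith

end Mesh

/-! ### Degrees and barycentric coordinates -/

theorem totalDegree_pderiv_le (i : Fin 2) {p : Poly} {k : ℕ} (h : p.totalDegree ≤ k) :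
    (MvPolynomial.pderiv i p).totalDegree ≤ k - 1 := by
  rw [p.as_sum, map_sum]
  refine MvPolynomial.totalDegree_finsetSum_le fun s hs => ?_
  rw [MvPolynomial.pderiv_monomial]
  by_cases hi : s i = 0
  · simp [hi]
  · refine (MvPolynomial.totalDegree_monomial_le _ _).trans ?_
    have h1 : s.degree ≤ k := (MvPolynomial.le_totalDegree hs).trans h
    have h2 : s - Finsupp.single i 1 + Finsupp.single i 1 = s :=
      tsub_add_cancel_of_le (Finsupp.single_le_iff.2 (Nat.one_le_iff_ne_zero.2 hi))
    have h3 := congrArg Finsupp.degree h2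
    rw [map_add, Finsupp.degree_single] at h3
    change (s - Finsupp.single i 1).degree ≤ k - 1
    omega

theorem pderiv_eq_zero_of_totalDegree (i : Fin 2) {p : Poly} (h : p.totalDegree ≤ 0) :
    MvPolynomial.pderiv i p = 0 := by
  rw [MvPolynomial.totalDegree_eq_zero_iff_eq_C.1 (Nat.le_zero.1 h), MvPolynomial.pderiv_C]

/-- An affine weight restores the degree that differentiation takes away; this keeps all weighted
test functions below inside degree k. For k = 0 the truncated k - 1 is no help, but the derivative
itself is zero. -/
theorem totalDegree_mul_pderiv_le (i : Fin 2) {L p : Poly} {k : ℕ} (hL : L.totalDegree ≤ 1)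
    (h : p.totalDegree ≤ k) : (L * MvPolynomial.pderiv i p).totalDegree ≤ k := by
  rcases Nat.eq_zero_or_pos k with rfl | hk
  · rw [pderiv_eq_zero_of_totalDegree i h, mul_zero]; simp
  · refine (MvPolynomial.totalDegree_mul _ _).trans ?_
    have := totalDegree_pderiv_le i h
    omega

/-- The polynomial `x ↦ cross (q - p) (x - p)`. -/
def crossPoly (p q : Plane) : Poly :=
  MvPolynomial.C (q 0 - p 0) * (MvPolynomial.X 1 - MvPolynomial.C (p 1)) -
    MvPolynomial.C (q 1 - p 1) * (MvPolynomial.X 0 - MvPolynomial.C (p 0))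

theorem pval_crossPoly (p q x : Plane) : pval (crossPoly p q) x = cross (q - p) (x - p) := by
  simp [crossPoly, pval_sub, pval_mul, cross]

theorem totalDegree_crossPoly (p q : Plane) : (crossPoly p q).totalDegree ≤ 1 := by
  have h : ∀ (r : ℝ) (i : Fin 2) (s : ℝ),
      (MvPolynomial.C r * (MvPolynomial.X i - MvPolynomial.C s) : Poly).totalDegree ≤ 1 := by
    intro r i s
    refine (MvPolynomial.totalDegree_mul _ _).trans ?_
    rw [MvPolynomial.totalDegree_C, zero_add]
    refine (MvPolynomial.totalDegree_sub _ _).trans ?_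
    rw [MvPolynomial.totalDegree_C, MvPolynomial.totalDegree_X]
    simp
  exact (MvPolynomial.totalDegree_sub _ _).trans (max_le (h _ _ _) (h _ _ _))

/-- A continuous nonnegative function with vanishing integral over an edge vanishes there. -/
theorem eq_zero_of_edgeInt_eq_zero {p q : Plane} (hpq : p ≠ q) {g : Plane → ℝ} (hg : Continuous g)
    (h0 : ∀ x, 0 ≤ g x) (h : edgeInt p q g = 0) : ∀ x ∈ segment ℝ p q, g x = 0 := by
  have h1 : ∫ s in (0 : ℝ)..1, g (AffineMap.lineMap p q s) = 0 :=
    (mul_eq_zero.1 h).resolve_left (dist_ne_zero.2 hpq)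
  intro x hx
  rw [segment_eq_image_lineMap] at hx
  obtain ⟨s, hs, rfl⟩ := hx
  by_contra hne
  have := intervalIntegral.integral_pos (zero_lt_one)
    (hg.comp (AffineMap.lineMap_continuous (p := p) (q := q))).continuousOn (fun _ _ => h0 _)
    ⟨s, hs, lt_of_le_of_ne (h0 _) (Ne.symm hne)⟩
  simp only [Function.comp_def] at this
  exact this.ne' h1

theorem eq_zero_of_setIntegral_eq_zero {K U : Set Plane} (hK : IsCompact K) (hU : IsOpen U)
    (hUK : U ⊆ K) {g : Plane → ℝ} (hg : Continuous g) (h0 : ∀ x ∈ K, 0 ≤ g x)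
    (h : ∫ x in K, g x = 0) : ∀ x ∈ U, g x = 0 := by
  have h1 : g =ᵐ[volume.restrict K] 0 := by
    refine (setIntegral_eq_zero_iff_of_nonneg_ae ?_ (hg.continuousOn.integrableOn_compact hK)).1 h
    exact (ae_restrict_iff' hK.measurableSet).2 (Filter.Eventually.of_forall h0)
  have h2 : g =ᵐ[volume.restrict U] 0 := ae_restrict_of_ae_restrict_of_subset hUK h1
  exact Measure.eqOn_open_of_ae_eq h2 hU hg.continuousOn continuousOn_const

namespace Mesh

variable {Ω : Set Plane} (M : Mesh Ω)

/-- The barycentric coordinates of a triangle, as polynomials. -/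
def lamC (τ : M.Tri) : Poly := MvPolynomial.C (M.D τ)⁻¹ * crossPoly (M.a τ) (M.b τ)
def lamA (τ : M.Tri) : Poly := MvPolynomial.C (M.D τ)⁻¹ * crossPoly (M.b τ) (M.c τ)
def lamB (τ : M.Tri) : Poly := MvPolynomial.C (M.D τ)⁻¹ * crossPoly (M.c τ) (M.a τ)

theorem totalDegree_C_mul_crossPoly (r : ℝ) (p q : Plane) :
    (MvPolynomial.C r * crossPoly p q).totalDegree ≤ 1 := by
  refine (MvPolynomial.totalDegree_mul _ _).trans ?_
  rw [MvPolynomial.totalDegree_C, zero_add]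
  exact totalDegree_crossPoly _ _

theorem pval_lamC (τ : M.Tri) (s t : ℝ) :
    pval (M.lamC τ) (triMap (M.c τ) (M.a τ) (M.b τ) s t) = 1 - s - t := by
  have hD := (M.D_pos τ).ne'
  rw [lamC, pval_mul, pval_C, pval_crossPoly]
  field_simp
  simp [cross, D, triMap_apply]
  ring

theorem pval_lamA (τ : M.Tri) (s t : ℝ) :
    pval (M.lamA τ) (triMap (M.c τ) (M.a τ) (M.b τ) s t) = s := by
  have hD := (M.D_pos τ).ne'
  rw [lamA, pval_mul, pval_C, pval_crossPoly]
  field_simp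
  simp [cross, D, triMap_apply]
  ring

theorem pval_lamB (τ : M.Tri) (s t : ℝ) :
    pval (M.lamB τ) (triMap (M.c τ) (M.a τ) (M.b τ) s t) = t := by
  have hD := (M.D_pos τ).ne'
  rw [lamB, pval_mul, pval_C, pval_crossPoly]
  field_simp
  simp [cross, D, triMap_apply]
  ring

theorem triMap_lam (τ : M.Tri) (x : Plane) :
    triMap (M.c τ) (M.a τ) (M.b τ) (pval (M.lamA τ) x) (pval (M.lamB τ) x) = x := by
  have hD := M.D_pos τ
  ext i
  simp only [triMap_apply, lamA, lamB, pval_mul, pval_C, pval_crossPoly]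
  simp only [D, cross, PiLp.sub_apply] at hD ⊢
  rw [mul_assoc, mul_assoc, add_assoc, ← mul_add]
  rw [← eq_sub_iff_add_eq', inv_mul_eq_iff_eq_mul₀ hD.ne']
  fin_cases i <;> simp <;> ring

theorem lam_sum (τ : M.Tri) (x : Plane) :
    pval (M.lamC τ) x = 1 - pval (M.lamA τ) x - pval (M.lamB τ) x := by
  conv_lhs => rw [← M.triMap_lam τ x]
  rw [pval_lamC]

theorem mem_tri_iff (τ : M.Tri) (x : Plane) : x ∈ M.tri τ ↔
    0 ≤ pval (M.lamA τ) x ∧ 0 ≤ pval (M.lamB τ) x ∧ 0 ≤ pval (M.lamC τ) x := by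
  rw [tri, mem_convexHull_triple]
  constructor
  · rintro ⟨s, t, hs, ht, hst, rfl⟩
    rw [pval_lamA, pval_lamB, pval_lamC]
    exact ⟨hs, ht, by linarith⟩
  · rintro ⟨h1, h2, h3⟩
    refine ⟨_, _, h1, h2, ?_, (M.triMap_lam τ x).symm⟩
    have := M.lam_sum τ x
    linarith

/-- The open triangle. -/
def openTri (τ : M.Tri) : Set Plane :=
  {x | 0 < pval (M.lamA τ) x ∧ 0 < pval (M.lamB τ) x ∧ 0 < pval (M.lamC τ) x}

theorem isOpen_openTri (τ : M.Tri) : IsOpen (M.openTri τ) :=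
  (isOpen_lt continuous_const (continuous_pval _)).inter
    ((isOpen_lt continuous_const (continuous_pval _)).inter
      (isOpen_lt continuous_const (continuous_pval _)))

theorem openTri_subset (τ : M.Tri) : M.openTri τ ⊆ M.tri τ := fun x hx =>
  (M.mem_tri_iff τ x).2 ⟨hx.1.le, hx.2.1.le, hx.2.2.le⟩

theorem openTri_subset_interior (τ : M.Tri) : M.openTri τ ⊆ interior (M.tri τ) :=
  interior_maximal (M.openTri_subset τ) (M.isOpen_openTri τ)

theorem openTri_nonempty (τ : M.Tri) : (M.openTri τ).Nonempty := by
  refine ⟨triMap (M.c τ) (M.a τ) (M.b τ) (1/3) (1/3), ?_, ?_, ?_⟩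
  · rw [pval_lamA]; norm_num
  · rw [pval_lamB]; norm_num
  · rw [pval_lamC]; norm_num

theorem lineMap_ca (τ : M.Tri) (s : ℝ) :
    AffineMap.lineMap (M.c τ) (M.a τ) s = triMap (M.c τ) (M.a τ) (M.b τ) s 0 := by
  rw [lineMap_eq_add_smul]; unfold triMap; module
theorem lineMap_cb (τ : M.Tri) (s : ℝ) :
    AffineMap.lineMap (M.c τ) (M.b τ) s = triMap (M.c τ) (M.a τ) (M.b τ) 0 s := by
  rw [lineMap_eq_add_smul]; unfold triMap; module
theorem lineMap_ab (τ : M.Tri) (s : ℝ) :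
    AffineMap.lineMap (M.a τ) (M.b τ) s = triMap (M.c τ) (M.a τ) (M.b τ) (1 - s) s := by
  rw [lineMap_eq_add_smul]; unfold triMap; module

theorem lamC_eq_zero {τ : M.Tri} {x : Plane} (hx : x ∈ segment ℝ (M.a τ) (M.b τ)) :
    pval (M.lamC τ) x = 0 := by
  rw [segment_eq_image_lineMap] at hx
  obtain ⟨s, -, rfl⟩ := hx
  rw [lineMap_ab, pval_lamC]; ring
theorem lamB_eq_zero {τ : M.Tri} {x : Plane} (hx : x ∈ segment ℝ (M.c τ) (M.a τ)) :
    pval (M.lamB τ) x = 0 := by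
  rw [segment_eq_image_lineMap] at hx
  obtain ⟨s, -, rfl⟩ := hx
  rw [lineMap_ca, pval_lamB]
theorem lamA_eq_zero {τ : M.Tri} {x : Plane} (hx : x ∈ segment ℝ (M.c τ) (M.b τ)) :
    pval (M.lamA τ) x = 0 := by
  rw [segment_eq_image_lineMap] at hx
  obtain ⟨s, -, rfl⟩ := hx
  rw [lineMap_cb, pval_lamA]

theorem poly_eq_zero_of_sq_integral {τ : M.Tri} {L p : Poly}
    (hL : ∀ x ∈ M.tri τ, 0 ≤ pval L x) (hL' : ∀ x ∈ M.openTri τ, 0 < pval L x)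
    (h : ∫ x in M.tri τ, pval L x * pval p x ^ 2 = 0) : p = 0 := by
  refine poly_eq_zero_of_isOpen (M.isOpen_openTri τ) (M.openTri_nonempty τ) fun x hx => ?_
  have := eq_zero_of_setIntegral_eq_zero (M.isCompact_tri τ) (M.isOpen_openTri τ)
    (M.openTri_subset τ) (by fun_prop) (fun x hx => mul_nonneg (hL x hx) (sq_nonneg _)) h x hx
  simpa [(hL' x hx).ne'] using this

/-! ### The domain as the union of the triangles -/

theorem cell_eq (i : Fin M.N) : M.cell i = ⋃ j, M.tri ⟨i, j⟩ := rfl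

theorem iUnion_tri : ⋃ τ, M.tri τ = closure Ω := by
  rw [← M.cover]
  ext x
  simp only [Set.mem_iUnion, polygonCell, Sigma.exists]
  rfl

theorem tri_subset_closure (τ : M.Tri) : M.tri τ ⊆ closure Ω := by
  rw [← M.iUnion_tri]; exact Set.subset_iUnion _ τ

theorem interior_tri_ae (τ : M.Tri) : interior (M.tri τ) =ᵐ[volume] M.tri τ := by
  refine (interior_subset.eventuallyLE).antisymm ?_
  rw [ae_le_set]
  refine measure_mono_null ?_ ((convex_convexHull ℝ ({M.c τ, M.a τ, M.b τ} : Set Plane)).addHaar_frontier volume)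
  exact Set.sdiff_subset_sdiff_left subset_closure

theorem tri_disjoint {τ σ : M.Tri} (h : τ ≠ σ) : Disjoint (interior (M.tri τ)) (interior (M.tri σ)) :=
  M.disjoint τ σ h

theorem volume_tri_inter {τ σ : M.Tri} (h : τ ≠ σ) : volume (M.tri τ ∩ M.tri σ) = 0 := by
  have h1 : (interior (M.tri τ) ∩ interior (M.tri σ) : Set Plane) =ᵐ[volume] (M.tri τ ∩ M.tri σ : Set Plane) :=
    (M.interior_tri_ae τ).inter (M.interior_tri_ae σ)
  rw [← measure_congr h1, (M.tri_disjoint h).inter_eq, measure_empty]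

theorem toField_eq {v : M.PV} {τ : M.Tri} {x : Plane} (hx : x ∈ interior (M.tri τ)) (i : Fin 2) :
    M.toField v x i = M.vv v τ x i := by
  simp only [toField]
  rw [Finset.sum_eq_single τ]
  · rw [Set.indicator_of_mem hx]
  · intro σ _ hσ
    rw [Set.indicator_of_notMem]
    exact fun h => Set.disjoint_left.1 (M.tri_disjoint hσ) h hx
  · simp

theorem _root_.SDG.IsPolygonalDomain.volume_frontier (hΩ : IsPolygonalDomain Ω) : volume (frontier Ω) = 0 := by
  obtain ⟨s, hs⟩ := hΩ.polygonal
  rw [hs]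
  refine (measure_biUnion_null_iff s.countable_toSet).2 fun e _ => ?_
  refine measure_mono_null (t := (line[ℝ, e.1, e.2] : AffineSubspace ℝ Plane)) ?_
    (Measure.addHaar_affineSubspace _ _ ?_)
  · rw [← convexHull_pair]; exact convexHull_subset_affineSpan _
  · intro h
    have h1 : Module.finrank ℝ (vectorSpan ℝ ({e.1, e.2} : Set Plane)) ≤ 1 :=
      collinear_iff_finrank_le_one.1 (collinear_pair ℝ e.1 e.2)
    have h2 : vectorSpan ℝ ({e.1, e.2} : Set Plane) = ⊤ := by
      rw [← direction_affineSpan, h, AffineSubspace.direction_top]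
    rw [h2, finrank_top, finrank_euclideanSpace_fin] at h1
    omega

theorem _root_.SDG.IsPolygonalDomain.closure_ae (hΩ : IsPolygonalDomain Ω) : closure Ω =ᵐ[volume] Ω := by
  refine Filter.EventuallyLE.antisymm ?_ subset_closure.eventuallyLE
  have := hΩ.volume_frontier
  rwa [frontier, hΩ.isOpen.interior_eq, ← ae_le_set] at this

/-- Near a boundary point the open region strictly below the graph contains no point of Ω, hence
none of its closure, yet it accumulates at the boundary point. Slits are thereby excluded, and the
interiors of the triangles lie in Ω and not only in its closure. -/
theorem _root_.SDG.IsPolygonalDomain.interior_closure_subset (hΩ : IsPolygonalDomain Ω) : interior (closure Ω) ⊆ Ω := by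
  intro x hx
  by_contra hxΩ
  have hfr : x ∈ frontier Ω := ⟨interior_subset hx, by rwa [hΩ.isOpen.interior_eq]⟩
  obtain ⟨R, K, γ, hγ, U, hU, hUΩ⟩ := hΩ.lipschitz x hfr
  have hle : R x 1 ≤ γ (R x 0) := by
    by_contra h
    exact hxΩ ((hUΩ x (mem_of_mem_nhds hU)).2 (not_le.1 h))
  have hV : interior U ∩ interior (closure Ω) ∈ 𝓝 x :=
    Filter.inter_mem (interior_mem_nhds.2 hU) (isOpen_interior.mem_nhds hx)
  have hcurve : Filter.Tendsto (fun t : ℝ => x - t • R.symm (EuclideanSpace.single 1 1)) (𝓝[>] 0) (𝓝 x) := by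
    have : Continuous fun t : ℝ => x - t • R.symm (EuclideanSpace.single 1 1) := by fun_prop
    have h := this.tendsto 0
    simp only [zero_smul, sub_zero] at h
    exact h.mono_left nhdsWithin_le_nhds
  obtain ⟨t, ht, ht0⟩ := ((hcurve.eventually_mem hV).and self_mem_nhdsWithin).exists
  set y := x - t • R.symm (EuclideanSpace.single 1 1) with hy
  have hRy : R y = R x - t • EuclideanSpace.single 1 1 := by
    rw [hy, map_sub, map_smul, LinearIsometryEquiv.apply_symm_apply]
  have hy0 : R y 0 = R x 0 := by rw [hRy]; simp
  have hy1 : R y 1 < γ (R y 0) := by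
    rw [hy0, hRy]
    have : (0 : ℝ) < t := ht0
    simp only [PiLp.sub_apply, PiLp.smul_apply, PiLp.single_apply, if_true, smul_eq_mul, mul_one]
    linarith
  have hW : {z | R z 1 < γ (R z 0)} ∩ interior U ∈ 𝓝 y := by
    refine (IsOpen.inter ?_ isOpen_interior).mem_nhds ⟨hy1, ht.1⟩
    have h0 : Continuous fun z => R z 0 := (EuclideanSpace.proj (0 : Fin 2) : Plane →L[ℝ] ℝ).continuous.comp R.continuous
    have h1 : Continuous fun z => R z 1 := (EuclideanSpace.proj (1 : Fin 2) : Plane →L[ℝ] ℝ).continuous.comp R.continuous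
    exact isOpen_lt h1 (hγ.continuous.comp h0)
  obtain ⟨z, hz, hzΩ⟩ := mem_closure_iff_nhds.1 (interior_subset ht.2) _ hW
  have := (hUΩ z (interior_subset hz.2)).1 hzΩ
  exact absurd this (not_lt.2 (le_of_lt hz.1))

theorem interior_tri_subset (hΩ : IsPolygonalDomain Ω) (τ : M.Tri) : interior (M.tri τ) ⊆ Ω :=
  (interior_mono (M.tri_subset_closure τ)).trans hΩ.interior_closure_subset

theorem iUnion_interior_ae (hΩ : IsPolygonalDomain Ω) : (⋃ τ, interior (M.tri τ) : Set Plane) =ᵐ[volume] Ω := by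
  refine Filter.EventuallyEq.trans ?_ hΩ.closure_ae
  rw [← M.iUnion_tri]
  exact Filter.EventuallyEq.countable_iUnion fun τ => M.interior_tri_ae τ

/-- Integrals over the domain are sums over the triangles. -/
theorem setIntegral_eq_sum (hΩ : IsPolygonalDomain Ω) {g : Plane → ℝ} (hg : ∀ τ, IntegrableOn g (M.tri τ)) :
    ∫ x in Ω, g x = ∑ τ, ∫ x in M.tri τ, g x := by
  rw [← setIntegral_congr_set (M.iUnion_interior_ae hΩ),
    integral_iUnion_fintype (fun τ => isOpen_interior.measurableSet)
      (fun τ σ h => M.tri_disjoint h) (fun τ => (hg τ).mono_set interior_subset)]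
  exact Finset.sum_congr rfl fun τ _ => setIntegral_congr_set (M.interior_tri_ae τ)

theorem setIntegral_tri_congr {τ : M.Tri} {g h : Plane → ℝ} (H : ∀ x ∈ interior (M.tri τ), g x = h x) :
    ∫ x in M.tri τ, g x = ∫ x in M.tri τ, h x := by
  rw [← setIntegral_congr_set (M.interior_tri_ae τ), ← setIntegral_congr_set (M.interior_tri_ae τ)]
  exact setIntegral_congr_fun isOpen_interior.measurableSet H

theorem integrableOn_tri_congr {τ : M.Tri} {F : Type*} [NormedAddCommGroup F]
    {g h : Plane → F} (H : ∀ x ∈ interior (M.tri τ), g x = h x)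
    (hh : Continuous h) : IntegrableOn g (M.tri τ) := by
  refine IntegrableOn.congr_set_ae ?_ (M.interior_tri_ae τ).symm
  exact ((M.integrableOn_tri τ hh).mono_set interior_subset).congr_fun
    (fun x hx => (H x hx).symm) isOpen_interior.measurableSet

/-- Pairing of a piecewise polynomial field with a continuous field. -/
theorem setIntegral_toField (hΩ : IsPolygonalDomain Ω) (v : M.PV) {g : Plane → Fin 2 → ℝ} (hg : Continuous g) :
    ∫ x in Ω, ∑ i, M.toField v x i * g x i = ∑ τ, ∫ x in M.tri τ, ∑ i, M.vv v τ x i * g x i := by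
  have H : ∀ τ, ∀ x ∈ interior (M.tri τ), ∑ i, M.toField v x i * g x i = ∑ i, M.vv v τ x i * g x i := by
    intro τ x hx
    exact Finset.sum_congr rfl fun i _ => by rw [M.toField_eq hx]
  have hc : ∀ τ, Continuous fun x => ∑ i, M.vv v τ x i * g x i := fun τ =>
    continuous_finsetSum _ fun i _ => (continuous_pval _).mul ((continuous_apply i).comp hg)
  rw [M.setIntegral_eq_sum hΩ fun τ => M.integrableOn_tri_congr (H τ) (hc τ)]
  exact Finset.sum_congr rfl fun τ _ => M.setIntegral_tri_congr (H τ)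

theorem isL2_toField (hΩ : IsPolygonalDomain Ω) (v : M.PV) : IsL2 Ω (M.toField v) := by
  have hm : Measurable (M.toField v) := by
    unfold toField
    refine (PiLp.continuous_toLp 2 _).measurable.comp ?_
    refine Finset.measurable_sum _ fun τ _ => ?_
    exact (M.continuous_vv v τ).measurable.indicator isOpen_interior.measurableSet
  have hfin : volume Ω < ⊤ := hΩ.isBounded.measure_lt_top
  have : IsFiniteMeasure (volume.restrict Ω) := ⟨by simpa using hfin⟩
  obtain ⟨C, hC⟩ : ∃ C, ∀ x, ‖M.toField v x‖ ≤ C := by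
    have : ∀ τ, ∃ C, ∀ x ∈ M.tri τ, ‖M.vv v τ x‖ ≤ C := fun τ =>
      (M.isCompact_tri τ).exists_bound_of_continuousOn (M.continuous_vv v τ).continuousOn
    choose C hC using this
    have hB : ∀ x, ‖∑ τ, (interior (M.tri τ)).indicator (M.vv v τ) x‖ ≤ ∑ τ, |C τ| := by
      intro x
      refine (norm_sum_le _ _).trans (Finset.sum_le_sum fun τ _ => ?_)
      by_cases hx : x ∈ interior (M.tri τ)
      · rw [Set.indicator_of_mem hx]
        exact (hC τ x (interior_subset hx)).trans (le_abs_self _)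
      · rw [Set.indicator_of_notMem hx]; simp
    refine ⟨Real.sqrt 2 * ∑ τ, |C τ|, fun x => ?_⟩
    rw [toField, EuclideanSpace.norm_eq]
    have h2 : ∀ i, ‖(∑ τ, (interior (M.tri τ)).indicator (M.vv v τ) x) i‖ ≤ ∑ τ, |C τ| := fun i =>
      (norm_le_pi_norm _ i).trans (hB x)
    have h3 : 0 ≤ ∑ τ, |C τ| := Finset.sum_nonneg fun _ _ => abs_nonneg _
    rw [← Real.sqrt_sq h3, ← Real.sqrt_mul (by norm_num)]
    apply Real.sqrt_le_sqrt
    rw [Fin.sum_univ_two]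
    have := pow_le_pow_left₀ (norm_nonneg _) (h2 0) 2
    have := pow_le_pow_left₀ (norm_nonneg _) (h2 1) 2
    linarith
  exact MemLp.of_bound hm.aestronglyMeasurable C (Filter.Eventually.of_forall hC)

end Mesh

namespace Mesh

variable {Ω : Set Plane} (M : Mesh Ω)

/-! ### Discrete and distributional divergence -/

theorem continuous_partialD {φ : Plane → ℝ} (hφ : ContDiff ℝ 1 φ) (i : Fin 2) :
    Continuous fun x => partialD i φ x :=
  (hφ.continuous_fderiv (by norm_num)).clm_apply continuous_const

theorem partialD_mul {φ ψ : Plane → ℝ} (hφ : ContDiff ℝ 1 φ) (hψ : ContDiff ℝ 1 ψ) (i : Fin 2) (x : Plane) :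
    partialD i (fun y => φ y * ψ y) x = φ x * partialD i ψ x + ψ x * partialD i φ x := by
  unfold partialD
  rw [fderiv_fun_mul (hφ.differentiable (by norm_num) x) (hψ.differentiable (by norm_num) x)]
  simp

theorem contDiff_mul_vv {φ : Plane → ℝ} (hφ : ContDiff ℝ 1 φ) (w : M.PV) (τ : M.Tri) :
    ContDiff ℝ 1 fun x => φ x • M.vv w τ x := hφ.smul (M.contDiff_vv w τ)

theorem sum_partialD_mul_vv {φ : Plane → ℝ} (hφ : ContDiff ℝ 1 φ) (w : M.PV) (τ : M.Tri) (x : Plane) :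
    ∑ i, partialD i (fun y => (φ y • M.vv w τ y) i) x =
      φ x * M.sv (M.divV w) τ x + ∑ i, M.vv w τ x i * partialD i φ x := by
  have : ∀ i, partialD i (fun y => (φ y • M.vv w τ y) i) x =
      φ x * pval (MvPolynomial.pderiv i (w τ i)) x + M.vv w τ x i * partialD i φ x := by
    intro i
    rw [← partialD_pval]
    exact partialD_mul hφ ((contDiff_pval (w τ i)).of_le (by exact_mod_cast le_top)) i x
  simp only [this, Finset.sum_add_distrib, sv, divV, pval_sum, Finset.mul_sum]

theorem continuous_pairing (w : M.PV) (τ : M.Tri) {φ : Plane → ℝ} (hφ : ContDiff ℝ 1 φ) :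
    Continuous fun x => ∑ i, M.vv w τ x i * partialD i φ x :=
  continuous_finsetSum _ fun i _ => (continuous_pval _).mul (continuous_partialD hφ i)

/-- Vanishing divergence and vanishing jumps of the normal component on all primal edges. -/
def Solenoidal (z : M.PV) : Prop :=
  (∀ τ, M.divV z τ = 0) ∧ ∀ τ, ∀ x ∈ segment ℝ (M.a τ) (M.b τ), M.jumpP (M.vv z) τ x ⬝ᵥ M.nP τ = 0

variable {M}

/-- The extension by zero of a solenoidal piecewise polynomial has no divergence on the plane. -/
theorem Solenoidal.sum_eq_zero {k : ℕ} {z : M.PV} (h : M.Solenoidal z) (hz : z ∈ M.Vh k)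
    {φ : Plane → ℝ} (hφ : ContDiff ℝ 1 φ) :
    ∑ τ, ∫ x in M.tri τ, ∑ i, M.vv z τ x i * partialD i φ x = 0 := by
  have h1 := M.sum_green (fun τ x => φ x • M.vv z τ x) (M.contDiff_mul_vv hφ z)
  have h2 : ∀ τ, ∫ x in M.tri τ, ∑ i, partialD i (fun y => (φ y • M.vv z τ y) i) x =
      ∫ x in M.tri τ, ∑ i, M.vv z τ x i * partialD i φ x := by
    intro τ
    congr 1
    ext x
    rw [M.sum_partialD_mul_vv hφ, sv, h.1 τ]
    simp
  simp only [h2] at h1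
  rw [h1, Finset.sum_eq_zero, Finset.sum_eq_zero, add_zero]
  · intro τ _
    rw [M.intD_congr (h := fun _ => 0)]
    · simp [intD, edgeInt]
    · intro x hx
      have := hz.2 τ x hx
      simp only [jumpD] at this ⊢
      rw [← smul_sub, smul_dotProduct, this, smul_zero]
  · intro τ _
    rw [M.intP_congr (h := fun _ => 0)]
    · simp [intP, edgeInt]
    · intro x hx
      have := h.2 τ x hx
      rcases hn : M.nbr τ with _ | σ
      · simp only [jumpP, hn] at this ⊢
        rw [smul_dotProduct, this, smul_zero]
      · simp only [jumpP, hn] at this ⊢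
        rw [← smul_sub, smul_dotProduct, this, smul_zero]

theorem Solenoidal.isDivFree (hΩ : IsPolygonalDomain Ω) {k : ℕ} {z : M.PV} (h : M.Solenoidal z)
    (hz : z ∈ M.Vh k) : IsDivFree Ω (M.toField z) := by
  refine ⟨M.isL2_toField hΩ z, fun φ hφ => ?_⟩
  have hφ1 : ContDiff ℝ 1 φ := hφ.1.of_le (by exact_mod_cast le_top)
  rw [M.setIntegral_toField hΩ z (g := fun x i => partialD i φ x)
    (continuous_pi fun i => continuous_partialD hφ1 i)]
  exact h.sum_eq_zero hz hφ1

variable (M)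

theorem lamC_nonneg {τ : M.Tri} : ∀ x ∈ M.tri τ, 0 ≤ pval (M.lamC τ) x := fun x hx =>
  ((M.mem_tri_iff τ x).1 hx).2.2

/-- Membership in Q_h requires continuity across primal edges only, and each triangle has one such
edge. So a polynomial that vanishes there may be extended by zero from its triangle. -/
theorem jumpP_single [DecidableEq M.Tri] {τ ρ : M.Tri} {p : Poly}
    (hp : ∀ x ∈ segment ℝ (M.a τ) (M.b τ), pval p x = 0) {x : Plane}
    (hx : x ∈ segment ℝ (M.a ρ) (M.b ρ)) : M.jumpP (M.sv (Pi.single τ p)) ρ x = 0 := by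
  have key : ∀ σ : M.Tri, x ∈ segment ℝ (M.a σ) (M.b σ) → M.sv (Pi.single τ p) σ x = 0 := by
    intro σ hσ
    by_cases h : σ = τ
    · subst h; simp [sv, hp x hσ]
    · simp [sv, Pi.single_eq_of_ne h]
  unfold jumpP
  rcases hn : M.nbr ρ with _ | σ
  · exact key ρ hx
  · have : x ∈ segment ℝ (M.a σ) (M.b σ) := by
      rwa [M.nbr_a hn, M.nbr_b hn, segment_symm]
    simp [key ρ hx, key σ this]

theorem avgP_single [DecidableEq M.Tri] {τ ρ : M.Tri} {p : Poly}
    (hp : ∀ x ∈ segment ℝ (M.a τ) (M.b τ), pval p x = 0) {x : Plane}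
    (hx : x ∈ segment ℝ (M.a ρ) (M.b ρ)) : M.avgP (M.sv (Pi.single τ p)) ρ x = 0 := by
  have key : ∀ σ : M.Tri, x ∈ segment ℝ (M.a σ) (M.b σ) → M.sv (Pi.single τ p) σ x = 0 := by
    intro σ hσ
    by_cases h : σ = τ
    · subst h; simp [sv, hp x hσ]
    · simp [sv, Pi.single_eq_of_ne h]
  unfold avgP
  rcases hn : M.nbr ρ with _ | σ
  · exact key ρ hx
  · have : x ∈ segment ℝ (M.a σ) (M.b σ) := by
      rwa [M.nbr_a hn, M.nbr_b hn, segment_symm]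
    simp [key ρ hx, key σ this]

theorem jumpP_nbr {F : Type*} [AddCommGroup F] {g : M.Tri → Plane → F} {τ σ : M.Tri}
    (h : M.nbr τ = some σ) (x : Plane) : M.jumpP g σ x = -M.jumpP g τ x := by
  simp [jumpP, h, M.nbr_symm h]

theorem segment_nbr {τ σ : M.Tri} (h : M.nbr τ = some σ) :
    segment ℝ (M.a σ) (M.b σ) = segment ℝ (M.a τ) (M.b τ) := by
  rw [M.nbr_a h, M.nbr_b h, segment_symm]

/-- The discrete incompressibility constraint makes a velocity exactly solenoidal. -/
theorem solenoidal_of_bh_eq_zero {k : ℕ} {w : M.PV} (hw : w ∈ M.Vh k)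
    (h : ∀ q ∈ M.Qh k, M.bh w q = 0) : M.Solenoidal w := by
  classical
  have h' : ∀ q ∈ M.Qh k, M.ipS q (M.divV w) =
      ∑ τ ∈ M.plus, M.intP τ (fun x => M.avgP (M.sv q) τ x * (M.jumpP (M.vv w) τ x ⬝ᵥ M.nP τ)) := by
    intro q hq
    have h1 := h q hq
    rw [M.bh_eq_neg_bhStar hw hq, bhStar] at h1
    linarith
  have hdiv : ∀ τ, M.divV w τ = 0 := by
    intro τ
    -- The weight `lamC` vanishes on the primal edge and compensates the degree lost by the
    -- divergence. Testing with this function leaves a weighted square of the divergence on one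
    -- triangle.
    let q : M.PS := Pi.single τ (M.lamC τ * M.divV w τ)
    have hp : ∀ x ∈ segment ℝ (M.a τ) (M.b τ), pval (M.lamC τ * M.divV w τ) x = 0 := by
      intro x hx; rw [pval_mul, M.lamC_eq_zero hx, zero_mul]
    have hq : q ∈ M.Qh k := by
      refine ⟨fun σ => ?_, fun ρ _ x hx => M.jumpP_single hp hx⟩
      by_cases hσ : σ = τ
      · subst hσ
        simp only [q, Pi.single_eq_same, divV, Finset.mul_sum]
        exact MvPolynomial.totalDegree_finsetSum_le fun i _ =>
          totalDegree_mul_pderiv_le i (totalDegree_C_mul_crossPoly _ _ _) (hw.1 σ i)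
      · simp [q, Pi.single_eq_of_ne hσ]
    have h1 := h' q hq
    rw [Finset.sum_eq_zero] at h1
    swap
    · intro ρ _
      rw [M.intP_congr (h := fun _ => 0)]
      · simp [intP, edgeInt]
      · intro x hx; rw [M.avgP_single hp hx, zero_mul]
    rw [ipS, Finset.sum_eq_single τ] at h1
    · refine M.poly_eq_zero_of_sq_integral (τ := τ) (L := M.lamC τ) M.lamC_nonneg (fun x hx => hx.2.2) (Eq.trans ?_ h1)
      congr 1
      ext x
      simp only [q, sv, Pi.single_eq_same, pval_mul]
      ring
    · intro σ _ hσ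
      simp [q, sv, Pi.single_eq_of_ne hσ]
    · simp
  refine ⟨hdiv, ?_⟩
  have hplus : ∀ τ ∈ M.plus, ∀ x ∈ segment ℝ (M.a τ) (M.b τ), M.jumpP (M.vv w) τ x ⬝ᵥ M.nP τ = 0 := by
    intro τ hτ
    let P : Poly := ∑ i, MvPolynomial.C (M.nP τ i) * (w τ i - M.atNbr w τ i)
    have hP : ∀ x, pval P x = M.jumpP (M.vv w) τ x ⬝ᵥ M.nP τ := by
      intro x
      rcases hn : M.nbr τ with _ | σ
      · simp [P, pval_mul, atNbr, jumpP, hn, dotProduct, vv, Fin.sum_univ_two,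
          pval_add]; ring
      · simp [P, pval_mul, pval_sub, atNbr, jumpP, hn, dotProduct, vv, Fin.sum_univ_two,
          pval_add]; ring
    have hPdeg : P.totalDegree ≤ k := by
      refine MvPolynomial.totalDegree_finsetSum_le fun i _ => ?_
      refine (MvPolynomial.totalDegree_mul _ _).trans ?_
      rw [MvPolynomial.totalDegree_C, zero_add]
      refine (MvPolynomial.totalDegree_sub _ _).trans (max_le (hw.1 τ i) ?_)
      rcases hn : M.nbr τ with _ | σ
      · simp [atNbr, hn]
      · simpa [atNbr, hn] using hw.1 σ i
    -- The normal jump, as a polynomial on the plane, is put on both triangles of the edge and zero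
    -- elsewhere. It is continuous across this edge and vanishes on all other primal edges, so the
    -- test leaves the integral of the squared jump.
    let q : M.PS := fun ρ => if ρ = τ ∨ M.nbr τ = some ρ then P else 0
    have hqn : ∀ ρ σ, M.nbr ρ = some σ → q σ = q ρ := by
      intro ρ σ hn
      have h1 : (σ = τ ∨ M.nbr τ = some σ) ↔ (ρ = τ ∨ M.nbr τ = some ρ) := by
        constructor
        · rintro (rfl | h1)
          · exact Or.inr (M.nbr_symm hn)
          · left
            have := M.nbr_symm h1
            rw [M.nbr_symm hn] at this
            exact Option.some.inj this
        · rintro (rfl | h1)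
          · exact Or.inr hn
          · left
            have := M.nbr_symm h1
            rw [hn] at this
            exact Option.some.inj this
      simp only [q, h1]
    have hq : q ∈ M.Qh k := by
      refine ⟨fun ρ => ?_, fun ρ _ x _ => ?_⟩
      · simp only [q]; split
        · exact hPdeg
        · simp
      · rcases hn : M.nbr ρ with _ | σ
        · exact absurd hn (by assumption)
        · simp [jumpP, hn, sv, hqn ρ σ hn]
    have h1 := h' q hq
    have h2 : M.ipS q (M.divV w) = 0 := by simp [ipS, sv, hdiv]
    rw [h2, Finset.sum_eq_single τ] at h1
    · have h3 := eq_zero_of_edgeInt_eq_zero (M.a_ne_b τ) (g := fun x => pval P x ^ 2) (by fun_prop)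
        (fun x => sq_nonneg _) (by
          rw [h1]
          apply edgeInt_congr
          intro x _
          rw [← hP x, sq]
          congr 1
          rcases hn : M.nbr τ with _ | σ
          · simp [avgP, hn, sv, q]
          · simp [avgP, hn, sv, q]; ring)
      intro x hx
      rw [← hP]
      exact pow_eq_zero_iff two_ne_zero |>.1 (h3 x hx)
    · intro ρ hρ hne
      have hqρ : q ρ = 0 := by
        simp only [q]
        rw [if_neg]
        rintro (h | h)
        · exact hne h
        · exact ((M.plus_of_interior _ _ h).1 hτ) hρ
      rw [intP, edgeInt_congr (h := fun _ => 0)]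
      · simp [edgeInt]
      · intro x _
        rcases hn : M.nbr ρ with _ | σ
        · simp [avgP, hn, sv, hqρ]
        · simp [avgP, hn, sv, hqρ, hqn ρ σ hn]
    · exact fun h => absurd hτ h
  intro τ x hx
  by_cases hτ : τ ∈ M.plus
  · exact hplus τ hτ x hx
  · have hne : M.nbr τ ≠ none := fun h => hτ (M.plus_of_boundary _ h)
    obtain ⟨σ, hσ⟩ := Option.ne_none_iff_exists'.1 hne
    have hσp : σ ∈ M.plus := by_contra fun h => hτ ((M.plus_of_interior _ _ hσ).2 h)
    have := hplus σ hσp x (by rwa [M.segment_nbr hσ])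
    rw [M.jumpP_nbr hσ, M.nP_nbr hσ] at this
    simpa using this

/-- For testing an identity against a polynomial P times a bump: the result is the integral of the
bump times P², which forces P to vanish at the centre. -/
theorem isTest_mul_pval {U : Set Plane} {x₀ : Plane} (hU : U ∈ 𝓝 x₀) (p : Poly) :
    ∃ f : Plane → ℝ, ContDiff ℝ ∞ f ∧ (∀ x, 0 ≤ f x) ∧ f x₀ = 1 ∧ tsupport f ⊆ U ∧
      IsTest U (fun x => f x * pval p x) := by
  obtain ⟨f, hf1, hf2, hf3, hf4, hf5⟩ := exists_contDiff_tsupport_subset (n := ⊤) hU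
  refine ⟨f, hf3, fun x => (hf4 (Set.mem_range_self x)).1, hf5, hf1, hf3.mul (contDiff_pval p),
    hf2.mul_right, ?_⟩
  exact (closure_mono (Function.support_mul_subset_left _ _)).trans hf1

theorem green_mul (w : M.PV) {φ : Plane → ℝ} (hφ : ContDiff ℝ 1 φ) (τ : M.Tri) :
    ∫ x in M.tri τ, ∑ i, M.vv w τ x i * partialD i φ x =
      edgeInt (M.c τ) (M.a τ) (fun x => (φ x • M.vv w τ x) ⬝ᵥ normal (M.c τ) (M.a τ)) +
      edgeInt (M.a τ) (M.b τ) (fun x => (φ x • M.vv w τ x) ⬝ᵥ normal (M.a τ) (M.b τ)) +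
      edgeInt (M.b τ) (M.c τ) (fun x => (φ x • M.vv w τ x) ⬝ᵥ normal (M.b τ) (M.c τ)) -
      ∫ x in M.tri τ, φ x * M.sv (M.divV w) τ x := by
  have hcφ : Continuous φ := hφ.continuous
  rw [← green_triangle (M.D_pos τ) (M.contDiff_mul_vv hφ w τ), eq_sub_iff_add_eq, add_comm,
    ← integral_add (M.integrableOn_tri τ (by fun_prop))
      (M.integrableOn_tri τ (M.continuous_pairing w τ hφ))]
  refine setIntegral_congr_fun (M.isCompact_tri τ).measurableSet fun x _ => ?_
  exact (M.sum_partialD_mul_vv hφ w τ x).symm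

theorem partialD_eq_zero_of_notMem {φ : Plane → ℝ} {x : Plane} (hx : x ∉ tsupport φ) (i : Fin 2) :
    partialD i φ x = 0 := by
  unfold partialD
  rw [image_eq_zero_of_notMem_tsupport (f := fderiv ℝ φ)
    (fun h => hx (tsupport_fderiv_subset ℝ h))]
  rfl

theorem setIntegral_pairing_eq_zero (w : M.PV) {φ : Plane → ℝ} {U : Set Plane}
    (hφ : tsupport φ ⊆ U) {ρ : M.Tri} (hU : volume (U ∩ M.tri ρ) = 0) :
    ∫ x in M.tri ρ, ∑ i, M.vv w ρ x i * partialD i φ x = 0 := by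
  apply setIntegral_eq_zero_of_ae_eq_zero
  rw [ae_iff]
  refine measure_mono_null ?_ hU
  intro x hx
  simp only [Set.mem_ofPred_eq, Classical.not_imp] at hx
  refine ⟨by_contra fun h => hx.2 ?_, hx.1⟩
  exact Finset.sum_eq_zero fun i _ => by
    rw [partialD_eq_zero_of_notMem (fun h' => h (hφ h')), mul_zero]

theorem edgeInt_eq_zero_of_tsupport {φ : Plane → ℝ} {U : Set Plane} (hφ : tsupport φ ⊆ U) {p q : Plane}
    (h : ∀ x ∈ segment ℝ p q, x ∉ U) (g : Plane → Fin 2 → ℝ) (n : Fin 2 → ℝ) :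
    edgeInt p q (fun x => (φ x • g x) ⬝ᵥ n) = 0 := by
  rw [edgeInt_congr (h := fun _ => 0)]
  · simp [edgeInt]
  · intro x hx
    rw [image_eq_zero_of_notMem_tsupport (fun h' => h x hx (hφ h')), zero_smul, zero_dotProduct]

/-- On the side opposite to the triangle the barycentric coordinate of the neighbour is
positive. -/
theorem lamC_nbr {τ σ : M.Tri} (h : M.nbr τ = some σ) (x : Plane) :
    M.D σ * pval (M.lamC σ) x = -(M.D τ * pval (M.lamC τ) x) := by
  have h1 := (M.D_pos τ).ne'
  have h2 := (M.D_pos σ).ne'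
  rw [lamC, lamC, pval_mul, pval_mul, pval_C, pval_C, mul_inv_cancel_left₀ h1,
    mul_inv_cancel_left₀ h2, pval_crossPoly, pval_crossPoly, M.nbr_a h, M.nbr_b h]
  simp [cross]; ring

/-- The distributional divergence is tested locally. Supports inside one triangle detect the
pointwise divergence; supports around a point of an open interior primal edge meet its two triangles
only and detect the normal jump, and the end points follow by continuity. Tests supported in Ω say
nothing about normal traces on ∂Ω, whence `PiecewiseDivFree` and not `Solenoidal`. -/
theorem isDivFree_piecewiseDivFree (hΩ : IsPolygonalDomain Ω) {w : M.PV}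
    (h : IsDivFree Ω (M.toField w)) : M.PiecewiseDivFree w := by
  have h' : ∀ φ, IsTest Ω φ → ∑ τ, ∫ x in M.tri τ, ∑ i, M.vv w τ x i * partialD i φ x = 0 := by
    intro φ hφ
    have hφ1 : ContDiff ℝ 1 φ := hφ.1.of_le (by exact_mod_cast le_top)
    rw [← M.setIntegral_toField hΩ w (g := fun x i => partialD i φ x)
      (continuous_pi fun i => continuous_partialD hφ1 i)]
    exact h.2 φ hφ
  have hdiv : ∀ τ, M.divV w τ = 0 := by
    intro τ
    refine poly_eq_zero_of_isOpen (M.isOpen_openTri τ) (M.openTri_nonempty τ) fun x₀ hx₀ => ?_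
    obtain ⟨f, hfs, hf0, hf1, hfU, hφ⟩ := isTest_mul_pval ((M.isOpen_openTri τ).mem_nhds hx₀) (M.divV w τ)
    set φ := fun x => f x * pval (M.divV w τ) x with hφdef
    have hφ1 : ContDiff ℝ 1 φ := hφ.1.of_le (by exact_mod_cast le_top)
    have h1 := h' φ ⟨hφ.1, hφ.2.1, hφ.2.2.trans ((M.openTri_subset_interior τ).trans
      (M.interior_tri_subset hΩ τ))⟩
    rw [Finset.sum_eq_single τ, M.green_mul w hφ1,
      edgeInt_eq_zero_of_tsupport hφ.2.2, edgeInt_eq_zero_of_tsupport hφ.2.2,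
      edgeInt_eq_zero_of_tsupport hφ.2.2] at h1
    · have h2 : ∫ x in M.tri τ, f x * pval (M.divV w τ) x ^ 2 = 0 := by
        have h3 : ∫ x in M.tri τ, φ x * M.sv (M.divV w) τ x = 0 := by linarith
        rw [← h3]
        congr 1
        ext x
        simp only [hφdef, sv]; ring
      have := eq_zero_of_setIntegral_eq_zero (M.isCompact_tri τ) (M.isOpen_openTri τ)
        (M.openTri_subset τ) (g := fun x => f x * pval (M.divV w τ) x ^ 2) (by have := hfs.continuous; fun_prop)
        (fun x _ => mul_nonneg (hf0 x) (sq_nonneg _)) h2 x₀ hx₀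
      rw [hf1, one_mul] at this
      exact pow_eq_zero_iff two_ne_zero |>.1 this
    · intro x hx hxU
      rw [segment_symm] at hx
      exact hxU.1.ne' (M.lamA_eq_zero hx)
    · exact fun x hx hxU => hxU.2.2.ne' (M.lamC_eq_zero hx)
    · exact fun x hx hxU => hxU.2.1.ne' (M.lamB_eq_zero hx)
    · intro ρ _ hρ
      refine M.setIntegral_pairing_eq_zero w hφ.2.2 (measure_mono_null ?_ (M.volume_tri_inter hρ.symm))
      exact Set.inter_subset_inter_left _ (M.openTri_subset τ)
    · simp
  refine ⟨hdiv, fun τ hτ => ?_⟩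
  obtain ⟨σ, hσ⟩ := Option.ne_none_iff_exists'.1 hτ
  let P : Poly := ∑ i, MvPolynomial.C (M.nP τ i) * (w τ i - w σ i)
  have hP : ∀ x, pval P x = M.jumpP (M.vv w) τ x ⬝ᵥ M.nP τ := by
    intro x
    simp [P, pval_mul, pval_sub, jumpP, hσ, dotProduct, vv, Fin.sum_univ_two, pval_add]
    ring
  have hne : τ ≠ σ := by
    rintro rfl
    exact M.a_ne_b τ (M.nbr_a hσ)
  have hopen : ∀ x₀ ∈ openSegment ℝ (M.a τ) (M.b τ), pval P x₀ = 0 := by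
    intro x₀ hx₀
    -- Positivity of the coordinates of both end points in both triangles keeps U away from the dual
    -- edges. The signs of the two `lamC` are opposite by `lamC_nbr`, so every point of U lies in
    -- one of the two triangles.
    let U : Set Plane := {x | (0 < pval (M.lamA τ) x ∧ 0 < pval (M.lamB τ) x) ∧
      (0 < pval (M.lamA σ) x ∧ 0 < pval (M.lamB σ) x)}
    have hU : IsOpen U :=
      ((isOpen_lt continuous_const (continuous_pval _)).inter
        (isOpen_lt continuous_const (continuous_pval _))).inter
      ((isOpen_lt continuous_const (continuous_pval _)).inter
        (isOpen_lt continuous_const (continuous_pval _)))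
    have hpos : ∀ ρ : M.Tri, x₀ ∈ openSegment ℝ (M.a ρ) (M.b ρ) →
        0 < pval (M.lamA ρ) x₀ ∧ 0 < pval (M.lamB ρ) x₀ := by
      intro ρ hρ
      rw [openSegment_eq_image_lineMap] at hρ
      obtain ⟨s, hs, rfl⟩ := hρ
      rw [lineMap_ab, pval_lamA, pval_lamB]
      exact ⟨by linarith [hs.2], hs.1⟩
    have hx₀U : x₀ ∈ U := by
      refine ⟨hpos τ hx₀, hpos σ ?_⟩
      rwa [M.nbr_a hσ, M.nbr_b hσ, openSegment_symm]
    have hUsub : U ⊆ M.tri τ ∪ M.tri σ := by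
      intro x hx
      rcases le_or_gt 0 (pval (M.lamC τ) x) with h0 | h0
      · exact Or.inl ((M.mem_tri_iff τ x).2 ⟨hx.1.1.le, hx.1.2.le, h0⟩)
      · refine Or.inr ((M.mem_tri_iff σ x).2 ⟨hx.2.1.le, hx.2.2.le, ?_⟩)
        have h1 := M.lamC_nbr hσ x
        have h2 := M.D_pos τ
        have h3 := M.D_pos σ
        by_contra hc
        push Not at hc
        nlinarith
    have hUΩ : U ⊆ Ω := by
      refine (interior_maximal ?_ hU).trans hΩ.interior_closure_subset
      exact hUsub.trans (Set.union_subset (M.tri_subset_closure _) (M.tri_subset_closure _))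
    obtain ⟨f, hfs, hf0, hf1, hfU, hφ⟩ := isTest_mul_pval (hU.mem_nhds hx₀U) P
    set φ := fun x => f x * pval P x with hφdef
    have hφ1 : ContDiff ℝ 1 φ := hφ.1.of_le (by exact_mod_cast le_top)
    have h1 := h' φ ⟨hφ.1, hφ.2.1, hφ.2.2.trans hUΩ⟩
    rw [← Finset.sum_subset (Finset.subset_univ {τ, σ}), Finset.sum_pair hne, M.green_mul w hφ1,
      M.green_mul w hφ1, edgeInt_eq_zero_of_tsupport (p := M.c τ) hφ.2.2,
      edgeInt_eq_zero_of_tsupport (p := M.b τ) hφ.2.2,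
      edgeInt_eq_zero_of_tsupport (p := M.c σ) hφ.2.2,
      edgeInt_eq_zero_of_tsupport (p := M.b σ) hφ.2.2] at h1
    · simp only [sv, hdiv, pval_zero, mul_zero, integral_zero, zero_add, add_zero, sub_zero] at h1
      have h2 : edgeInt (M.a τ) (M.b τ) (fun x => f x * pval P x ^ 2) = 0 := by
        rw [← h1]
        have e1 : edgeInt (M.a σ) (M.b σ) (fun x => (φ x • M.vv w σ x) ⬝ᵥ normal (M.a σ) (M.b σ)) =
            edgeInt (M.a τ) (M.b τ) (fun x => -((φ x • M.vv w σ x) ⬝ᵥ normal (M.a τ) (M.b τ))) := by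
          rw [M.nbr_a hσ, M.nbr_b hσ, edgeInt_symm, normal_symm]
          congr 1
          ext x; simp
        have hcφ : Continuous φ := hφ1.continuous
        rw [e1, ← edgeInt_add (by fun_prop) (by fun_prop)]
        congr 1
        ext x
        have := hP x
        simp only [jumpP, hσ, sub_dotProduct, nP] at this
        simp only [smul_dotProduct, smul_eq_mul, hφdef]
        linear_combination (f x * pval P x) * this
      have := eq_zero_of_edgeInt_eq_zero (M.a_ne_b τ) (g := fun x => f x * pval P x ^ 2) (by have := hfs.continuous; fun_prop)
        (fun x => mul_nonneg (hf0 x) (sq_nonneg _)) h2 x₀ (openSegment_subset_segment _ _ _ hx₀)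
      rw [hf1, one_mul] at this
      exact pow_eq_zero_iff two_ne_zero |>.1 this
    · intro x hx hxU
      rw [segment_symm] at hx
      exact hxU.2.1.ne' (M.lamA_eq_zero hx)
    · exact fun x hx hxU => hxU.2.2.ne' (M.lamB_eq_zero hx)
    · intro x hx hxU
      rw [segment_symm] at hx
      exact hxU.1.1.ne' (M.lamA_eq_zero hx)
    · exact fun x hx hxU => hxU.1.2.ne' (M.lamB_eq_zero hx)
    · intro ρ _ hρ
      simp only [Finset.mem_insert, Finset.mem_singleton, not_or] at hρ
      refine M.setIntegral_pairing_eq_zero w hφ.2.2 (measure_mono_null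
        (Set.inter_subset_inter_left _ hUsub) ?_)
      rw [Set.union_inter_distrib_right]
      exact measure_union_null (M.volume_tri_inter (Ne.symm hρ.1)) (M.volume_tri_inter (Ne.symm hρ.2))
  intro x hx
  rw [← hP]
  have hcl : IsClosed {x | pval P x = 0} := isClosed_eq (continuous_pval _) continuous_const
  have : segment ℝ (M.a τ) (M.b τ) ⊆ {x | pval P x = 0} := by
    rw [← closure_openSegment]
    exact hcl.closure_subset_iff.2 hopen
  exact this hx

end Mesh

/-! ### A Gagliardo-Nirenberg inequality for piecewise polynomials -/

theorem stronglyMeasurable_smear {Y : Type*} [MeasurableSpace Y] (m : Measure Y) [SFinite m]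
    {γ : Y → Plane} (hγ : Measurable γ) {h : Y → ℝ} (hh : Measurable h) {φ : Plane → ℝ}
    (hφ : Continuous φ) : StronglyMeasurable fun x => ∫ y, φ (x - γ y) * h y ∂m := by
  apply StronglyMeasurable.integral_prod_right (f := fun x y => φ (x - γ y) * h y)
  apply Measurable.stronglyMeasurable
  exact (hφ.measurable.comp (measurable_fst.sub (hγ.comp measurable_snd))).mul (hh.comp measurable_snd)

/-- The L¹ bound for the convolution of a normalized kernel with the image under γ of the measure h
dm, by Tonelli's theorem and translation invariance. With γ the identity on a triangle or the
parametrization of an edge it covers the absolutely continuous and the singular part of the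
gradient. -/
theorem lintegral_smear_le {Y : Type*} [MeasurableSpace Y] (m : Measure Y) [SFinite m]
    {γ : Y → Plane} (hγ : Measurable γ) {h : Y → ℝ} (hh : Measurable h) {φ : Plane → ℝ}
    (hφ : Continuous φ) (h1 : ∫⁻ x, ‖φ x‖ₑ = 1) :
    ∫⁻ x, ‖∫ y, φ (x - γ y) * h y ∂m‖ₑ ≤ ∫⁻ y, ‖h y‖ₑ ∂m := by
  have hm : Measurable fun p : Plane × Y => ‖φ (p.1 - γ p.2)‖ₑ * ‖h p.2‖ₑ :=
    ((hφ.measurable.comp (measurable_fst.sub (hγ.comp measurable_snd))).enorm).mul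
      (hh.comp measurable_snd).enorm
  calc ∫⁻ x, ‖∫ y, φ (x - γ y) * h y ∂m‖ₑ
      ≤ ∫⁻ x, ∫⁻ y, ‖φ (x - γ y)‖ₑ * ‖h y‖ₑ ∂m := by
        refine lintegral_mono fun x => (enorm_integral_le_lintegral_enorm _).trans_eq ?_
        simp only [enorm_mul]
    _ = ∫⁻ y, (∫⁻ x : Plane, ‖φ (x - γ y)‖ₑ * ‖h y‖ₑ) ∂m := lintegral_lintegral_swap hm.aemeasurable
    _ = ∫⁻ y, ‖h y‖ₑ ∂m := by
        refine lintegral_congr fun y => ?_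
        have hm' : Measurable fun x : Plane => ‖φ (x - γ y)‖ₑ :=
          (hφ.measurable.comp (measurable_id.sub_const _)).enorm
        rw [lintegral_mul_const _ hm', lintegral_sub_right_eq_self (fun x => ‖φ x‖ₑ) (γ y), h1, one_mul]

theorem enorm_le_sum_basis (L : Plane →L[ℝ] ℝ) :
    ‖L‖ₑ ≤ ∑ i, ‖L (EuclideanSpace.single i 1)‖ₑ := by
  have h : ‖L‖ ≤ ∑ i, ‖L (EuclideanSpace.single i 1)‖ := by
    refine L.opNorm_le_bound (Finset.sum_nonneg fun _ _ => norm_nonneg _) fun x => ?_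
    have hx : x = ∑ i, x i • EuclideanSpace.single i (1 : ℝ) := by
      ext j; fin_cases j <;> simp
    conv_lhs => rw [hx, map_sum]
    rw [Finset.sum_mul]
    refine (norm_sum_le _ _).trans (Finset.sum_le_sum fun i _ => ?_)
    rw [map_smul, norm_smul, mul_comm]
    exact mul_le_mul_of_nonneg_left (PiLp.norm_apply_le x i) (norm_nonneg _)
  calc ‖L‖ₑ = ENNReal.ofReal ‖L‖ := (ofReal_norm _).symm
    _ ≤ ENNReal.ofReal (∑ i, ‖L (EuclideanSpace.single i 1)‖) := ENNReal.ofReal_le_ofReal h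
    _ = ∑ i, ‖L (EuclideanSpace.single i 1)‖ₑ := by
      rw [ENNReal.ofReal_sum_of_nonneg fun _ _ => norm_nonneg _]
      simp only [ofReal_norm]

theorem abs_tangent_le (p q : Plane) (i : Fin 2) : |tangent p q i| ≤ 1 := by
  by_cases h : p = q
  · simp [tangent, h]
  · have := tangent_sq h
    rw [abs_le_one_iff_mul_self_le_one]
    fin_cases i
    · simp only [Fin.zero_eta]; nlinarith [sq_nonneg (tangent p q 1)]
    · simp only [Fin.mk_one]; nlinarith [sq_nonneg (tangent p q 0)]

theorem abs_normal_le (p q : Plane) (i : Fin 2) : |normal p q i| ≤ 1 := by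
  fin_cases i
  · exact abs_tangent_le p q 1
  · simpa [normal] using abs_tangent_le p q 0

namespace Mesh

variable {Ω : Set Plane} (M : Mesh Ω)

/-- The function given by a piecewise polynomial. -/
def toFun (q : M.PS) (x : Plane) : ℝ := ∑ τ, (interior (M.tri τ)).indicator (M.sv q τ) x

/-- A bound for the total variation of a piecewise polynomial. -/
def variation (q : M.PS) : ℝ :=
  (∑ τ, ∫ x in M.tri τ, ∑ i, |pval (MvPolynomial.pderiv i (q τ)) x|) +
    ∑ τ ∈ M.plus, M.intP τ (fun x => |M.jumpP (M.sv q) τ x|) +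
    ∑ τ, M.intD τ (fun x => |M.jumpD (M.sv q) τ x|)

theorem toFun_eq {q : M.PS} {τ : M.Tri} {x : Plane} (hx : x ∈ interior (M.tri τ)) :
    M.toFun q x = M.sv q τ x := by
  simp only [toFun]
  rw [Finset.sum_eq_single τ]
  · rw [Set.indicator_of_mem hx]
  · intro σ _ hσ
    rw [Set.indicator_of_notMem]
    exact fun h => Set.disjoint_left.1 (M.tri_disjoint hσ) h hx
  · simp

theorem integrable_indicator_sv (q : M.PS) (τ : M.Tri) {g : Plane → ℝ} (hg : Continuous g) :
    Integrable fun x => (interior (M.tri τ)).indicator (M.sv q τ) x * g x := by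
  have : (fun x => (interior (M.tri τ)).indicator (M.sv q τ) x * g x) =
      (interior (M.tri τ)).indicator fun x => M.sv q τ x * g x := by
    ext x
    by_cases hx : x ∈ interior (M.tri τ) <;> simp [hx]
  rw [this]
  exact (integrable_indicator_iff isOpen_interior.measurableSet).2
    ((M.integrableOn_tri τ (by fun_prop)).mono_set interior_subset)

theorem integral_toFun_mul (q : M.PS) {g : Plane → ℝ} (hg : Continuous g) :
    ∫ x, M.toFun q x * g x = ∑ τ, ∫ x in M.tri τ, M.sv q τ x * g x := by
  simp only [toFun, Finset.sum_mul]
  rw [integral_finsetSum _ fun τ _ => M.integrable_indicator_sv q τ hg]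
  refine Finset.sum_congr rfl fun τ _ => ?_
  rw [← setIntegral_congr_set (M.interior_tri_ae τ), ← integral_indicator isOpen_interior.measurableSet]
  congr 1
  ext x
  by_cases hx : x ∈ interior (M.tri τ) <;> simp [hx]

theorem integrable_toFun (q : M.PS) : Integrable (M.toFun q) := by
  unfold toFun
  exact integrable_finsetSum _ fun τ _ => by
    simpa using M.integrable_indicator_sv q τ (g := fun _ => 1) continuous_const

theorem measurable_toFun (q : M.PS) : Measurable (M.toFun q) := by
  unfold toFun
  exact Finset.measurable_sum _ fun τ _ =>
    (M.continuous_sv q τ).measurable.indicator isOpen_interior.measurableSet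

theorem hasCompactSupport_toFun (q : M.PS) : HasCompactSupport (M.toFun q) := by
  refine HasCompactSupport.intro (K := ⋃ τ, M.tri τ) (isCompact_iUnion M.isCompact_tri) fun x hx => ?_
  refine Finset.sum_eq_zero fun τ _ => Set.indicator_of_notMem (fun h => hx ?_) _
  exact Set.mem_iUnion.2 ⟨τ, interior_subset h⟩

/-- Integration by parts against a translated kernel. -/
theorem sum_kernel_deriv (q : M.PS) {φ : Plane → ℝ} (hφ : ContDiff ℝ 1 φ) (x : Plane) (i : Fin 2) :
    ∑ τ, ∫ y in M.tri τ, M.sv q τ y * partialD i φ (x - y) =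
      ∑ τ, (∫ y in M.tri τ, φ (x - y) * pval (MvPolynomial.pderiv i (q τ)) y) -
      ∑ τ ∈ M.plus, M.intP τ (fun y => φ (x - y) * (M.jumpP (M.sv q) τ y * M.nP τ i)) -
      ∑ τ, M.intD τ (fun y => φ (x - y) * (M.jumpD (M.sv q) τ y * M.nD τ i)) := by
  classical
  have hψ : ContDiff ℝ 1 fun y => φ (x - y) := hφ.comp (contDiff_const.sub contDiff_id)
  have hψd : ∀ y, partialD i (fun y => φ (x - y)) y = -partialD i φ (x - y) := by
    intro y
    unfold partialD
    have h1 : HasFDerivAt (fun y => x - y) (-ContinuousLinearMap.id ℝ Plane) y :=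
      (hasFDerivAt_id y).const_sub x
    have h2 : HasFDerivAt (fun y => φ (x - y)) _ y :=
      (hφ.differentiable (by norm_num) (x - y)).hasFDerivAt.comp y h1
    rw [h2.fderiv]
    simp
  have hq : ∀ τ, ContDiff ℝ 1 (M.sv q τ) := fun τ => (contDiff_pval (q τ)).of_le (by exact_mod_cast le_top)
  -- The divergence theorem for the field φ(x − ·) q e_i; the reflection in the kernel changes the
  -- sign of its derivative.
  have h1 := M.sum_green (fun τ y => Pi.single i (φ (x - y) * M.sv q τ y)) fun τ => by
    refine contDiff_pi.2 fun j => ?_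
    by_cases hj : j = i
    · subst hj; simpa using hψ.mul (hq τ)
    · simpa [Pi.single_eq_of_ne hj] using contDiff_const
  have h2 : ∀ τ y, ∑ j, partialD j (fun z => (Pi.single i (φ (x - z) * M.sv q τ z) : Fin 2 → ℝ) j) y =
      φ (x - y) * pval (MvPolynomial.pderiv i (q τ)) y - M.sv q τ y * partialD i φ (x - y) := by
    intro τ y
    rw [Finset.sum_eq_single i]
    · simp only [Pi.single_eq_same]
      rw [partialD_mul hψ (hq τ), hψd, ← partialD_pval]
      unfold sv
      ring
    · intro j _ hj
      simp [Pi.single_eq_of_ne hj, partialD]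
    · simp
  have hcφ := hφ.continuous
  have hcd : Continuous fun y => partialD i φ (x - y) := (continuous_partialD hφ i).comp (by fun_prop)
  have h3 : ∀ τ, ∫ y in M.tri τ, ∑ j, partialD j (fun z => (Pi.single i (φ (x - z) * M.sv q τ z) : Fin 2 → ℝ) j) y =
      (∫ y in M.tri τ, φ (x - y) * pval (MvPolynomial.pderiv i (q τ)) y) -
      ∫ y in M.tri τ, M.sv q τ y * partialD i φ (x - y) := by
    intro τ
    rw [← integral_sub (M.integrableOn_tri τ (by fun_prop)) (M.integrableOn_tri τ (by fun_prop))]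
    simp only [h2]
  have h4 : ∀ τ, M.intP τ (fun y => M.jumpP (fun τ y => (Pi.single i (φ (x - y) * M.sv q τ y) : Fin 2 → ℝ)) τ y ⬝ᵥ M.nP τ) =
      M.intP τ (fun y => φ (x - y) * (M.jumpP (M.sv q) τ y * M.nP τ i)) := by
    intro τ
    congr 1
    ext y
    rcases hn : M.nbr τ with _ | σ
    · simp only [jumpP, hn, single_dotProduct]; ring
    · simp only [jumpP, hn, sub_dotProduct, single_dotProduct]; ring
  have h5 : ∀ τ, M.intD τ (fun y => M.jumpD (fun τ y => (Pi.single i (φ (x - y) * M.sv q τ y) : Fin 2 → ℝ)) τ y ⬝ᵥ M.nD τ) =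
      M.intD τ (fun y => φ (x - y) * (M.jumpD (M.sv q) τ y * M.nD τ i)) := by
    intro τ
    congr 1
    ext y
    simp only [jumpD, sub_dotProduct, single_dotProduct]; ring
  simp only [h3, h4, h5, Finset.sum_sub_distrib] at h1
  linarith

theorem edgeInt_eq_setIntegral (p q : Plane) (g : Plane → ℝ) :
    edgeInt p q g = ∫ s in Set.Ioc (0 : ℝ) 1, dist p q * g (AffineMap.lineMap p q s) := by
  rw [edgeInt, intervalIntegral.integral_of_le zero_le_one, integral_const_mul]

/-- The number r stands for a component of the unit normal. -/
theorem lintegral_edge_le {p q : Plane} {φ : Plane → ℝ} (hφ : Continuous φ) (h1 : ∫⁻ x, ‖φ x‖ₑ = 1)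
    {g : Plane → ℝ} (hg : Continuous g) (r : ℝ) (hr : |r| ≤ 1) :
    ∫⁻ x, ‖edgeInt p q (fun y => φ (x - y) * (g y * r))‖ₑ ≤
      ENNReal.ofReal (edgeInt p q fun y => |g y|) := by
  have hγ : Continuous fun s : ℝ => AffineMap.lineMap p q s := AffineMap.lineMap_continuous
  have h2 := lintegral_smear_le (volume.restrict (Set.Ioc (0 : ℝ) 1)) hγ.measurable
    (h := fun s => dist p q * (g (AffineMap.lineMap p q s) * r))
    (((hg.comp hγ).mul continuous_const).const_mul _ |>.measurable) hφ h1
  have h3 : ∀ x, edgeInt p q (fun y => φ (x - y) * (g y * r)) =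
      ∫ s in Set.Ioc (0 : ℝ) 1, φ (x - AffineMap.lineMap p q s) *
        (dist p q * (g (AffineMap.lineMap p q s) * r)) := by
    intro x
    rw [edgeInt_eq_setIntegral]
    congr 1
    ext s
    ring
  simp only [h3]
  refine h2.trans ?_
  rw [edgeInt_eq_setIntegral, ofReal_integral_eq_lintegral_ofReal]
  · refine lintegral_mono fun s => ?_
    rw [← ofReal_norm]
    apply ENNReal.ofReal_le_ofReal
    rw [norm_mul, norm_mul, Real.norm_eq_abs, Real.norm_eq_abs, Real.norm_eq_abs, abs_of_nonneg dist_nonneg]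
    exact mul_le_mul_of_nonneg_left (mul_le_of_le_one_right (abs_nonneg _) hr) dist_nonneg
  · have : Continuous fun s : ℝ => dist p q * |g (AffineMap.lineMap p q s)| := by
      have := hg.comp hγ
      exact continuous_const.mul this.abs
    exact (this.integrableOn_Icc (a := 0) (b := 1)).mono_set Set.Ioc_subset_Icc_self
  · exact Filter.Eventually.of_forall fun s => mul_nonneg dist_nonneg (abs_nonneg _)

theorem measurable_edge {p q : Plane} {φ : Plane → ℝ} (hφ : Continuous φ)
    {g : Plane → ℝ} (hg : Continuous g) :
    Measurable fun x => edgeInt p q (fun y => φ (x - y) * g y) := by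
  have hγ : Continuous fun s : ℝ => AffineMap.lineMap p q s := AffineMap.lineMap_continuous
  have := stronglyMeasurable_smear (volume.restrict (Set.Ioc (0 : ℝ) 1)) hγ.measurable
    (h := fun s => dist p q * g (AffineMap.lineMap p q s))
    ((hg.comp hγ).const_mul _ |>.measurable) hφ
  have heq : (fun x => edgeInt p q (fun y => φ (x - y) * g y)) = fun x =>
      ∫ s in Set.Ioc (0 : ℝ) 1, φ (x - AffineMap.lineMap p q s) *
        (dist p q * g (AffineMap.lineMap p q s)) := by
    ext x
    rw [edgeInt_eq_setIntegral]
    congr 1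
    ext s
    ring
  rw [heq]
  exact this.measurable

/-- The mollified partial derivatives are controlled by the variation. -/
theorem lintegral_partialD_le (q : M.PS) {φ : Plane → ℝ} (hφ : ContDiff ℝ 1 φ)
    (h1 : ∫⁻ x, ‖φ x‖ₑ = 1) (i : Fin 2) :
    ∫⁻ x, ‖∑ τ, ∫ y in M.tri τ, M.sv q τ y * partialD i φ (x - y)‖ₑ ≤
      ENNReal.ofReal (M.variation q) := by
  have hcφ := hφ.continuous
  have hA : ∀ τ, ∫⁻ x, ‖∫ y in M.tri τ, φ (x - y) * pval (MvPolynomial.pderiv i (q τ)) y‖ₑ ≤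
      ENNReal.ofReal (∫ x in M.tri τ, ∑ i, |pval (MvPolynomial.pderiv i (q τ)) x|) := by
    intro τ
    refine (lintegral_smear_le (volume.restrict (M.tri τ)) measurable_id
      (continuous_pval _).measurable hcφ h1).trans ?_
    rw [ofReal_integral_eq_lintegral_ofReal]
    · refine lintegral_mono fun x => ?_
      rw [← ofReal_norm]
      apply ENNReal.ofReal_le_ofReal
      exact Finset.single_le_sum (f := fun i => |pval (MvPolynomial.pderiv i (q τ)) x|)
        (fun _ _ => abs_nonneg _) (Finset.mem_univ i)
    · exact M.integrableOn_tri τ (by fun_prop)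
    · exact Filter.Eventually.of_forall fun x => Finset.sum_nonneg fun _ _ => abs_nonneg _
  have hAm : ∀ τ, Measurable fun x => ‖∫ y in M.tri τ, φ (x - y) * pval (MvPolynomial.pderiv i (q τ)) y‖ₑ :=
    fun τ => (stronglyMeasurable_smear (volume.restrict (M.tri τ)) measurable_id
      (continuous_pval _).measurable hcφ).measurable.enorm
  have hBm : ∀ τ, Measurable fun x => ‖M.intP τ (fun y => φ (x - y) * (M.jumpP (M.sv q) τ y * M.nP τ i))‖ₑ :=
    fun τ => (measurable_edge hcφ (by fun_prop)).enorm
  have hCm : ∀ τ, Measurable fun x => ‖M.intD τ (fun y => φ (x - y) * (M.jumpD (M.sv q) τ y * M.nD τ i))‖ₑ :=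
    fun τ => (measurable_edge hcφ (by fun_prop)).enorm
  have hle : ∀ x, ‖∑ τ, ∫ y in M.tri τ, M.sv q τ y * partialD i φ (x - y)‖ₑ ≤
      ∑ τ, ‖∫ y in M.tri τ, φ (x - y) * pval (MvPolynomial.pderiv i (q τ)) y‖ₑ +
      ∑ τ ∈ M.plus, ‖M.intP τ (fun y => φ (x - y) * (M.jumpP (M.sv q) τ y * M.nP τ i))‖ₑ +
      ∑ τ, ‖M.intD τ (fun y => φ (x - y) * (M.jumpD (M.sv q) τ y * M.nD τ i))‖ₑ := by
    intro x
    rw [M.sum_kernel_deriv q hφ]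
    refine (enorm_sub_le).trans (add_le_add ((enorm_sub_le).trans (add_le_add ?_ ?_)) ?_) <;>
      exact enorm_sum_le _ _
  refine (lintegral_mono hle).trans ?_
  have hSA : Measurable fun x => ∑ τ,
      ‖∫ y in M.tri τ, φ (x - y) * pval (MvPolynomial.pderiv i (q τ)) y‖ₑ :=
    Finset.measurable_sum _ fun τ _ => hAm τ
  have hSAB : Measurable fun x => ∑ τ,
      ‖∫ y in M.tri τ, φ (x - y) * pval (MvPolynomial.pderiv i (q τ)) y‖ₑ + ∑ τ ∈ M.plus,
      ‖M.intP τ (fun y => φ (x - y) * (M.jumpP (M.sv q) τ y * M.nP τ i))‖ₑ :=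
    hSA.add (Finset.measurable_sum _ fun τ _ => hBm τ)
  rw [lintegral_add_left hSAB, lintegral_add_left hSA,
    lintegral_finsetSum _ (fun τ _ => hAm τ), lintegral_finsetSum _ (fun τ _ => hBm τ),
    lintegral_finsetSum _ (fun τ _ => hCm τ)]
  have n1 : ∀ τ, 0 ≤ ∫ x in M.tri τ, ∑ i, |pval (MvPolynomial.pderiv i (q τ)) x| := fun τ =>
    integral_nonneg fun x => Finset.sum_nonneg fun _ _ => abs_nonneg _
  have n2 : ∀ τ, 0 ≤ M.intP τ (fun x => |M.jumpP (M.sv q) τ x|) := fun τ =>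
    edgeInt_nonneg fun x _ => abs_nonneg _
  have n3 : ∀ τ, 0 ≤ M.intD τ (fun x => |M.jumpD (M.sv q) τ x|) := fun τ =>
    edgeInt_nonneg fun x _ => abs_nonneg _
  rw [variation, ENNReal.ofReal_add (add_nonneg (Finset.sum_nonneg fun τ _ => n1 τ)
      (Finset.sum_nonneg fun τ _ => n2 τ)) (Finset.sum_nonneg fun τ _ => n3 τ),
    ENNReal.ofReal_add (Finset.sum_nonneg fun τ _ => n1 τ) (Finset.sum_nonneg fun τ _ => n2 τ),
    ENNReal.ofReal_sum_of_nonneg fun τ _ => n1 τ, ENNReal.ofReal_sum_of_nonneg fun τ _ => n2 τ,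
    ENNReal.ofReal_sum_of_nonneg fun τ _ => n3 τ]
  refine add_le_add (add_le_add (Finset.sum_le_sum fun τ _ => hA τ) (Finset.sum_le_sum fun τ _ => ?_))
    (Finset.sum_le_sum fun τ _ => ?_)
  · exact lintegral_edge_le hcφ h1 (by fun_prop) _ (abs_normal_le _ _ _)
  · exact lintegral_edge_le hcφ h1 (by fun_prop) _ (abs_normal_le _ _ _)

/-- A shrinking sequence of mollifiers. -/
def bumpSeq (n : ℕ) : ContDiffBump (0 : Plane) where
  rIn := 1 / (n + 1)
  rOut := 2 / (n + 1)
  rIn_pos := by positivity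
  rIn_lt_rOut := by gcongr; norm_num

theorem tendsto_bumpSeq : Filter.Tendsto (fun n => (bumpSeq n).rOut) Filter.atTop (𝓝 0) := by
  simpa [bumpSeq] using (tendsto_one_div_add_atTop_nhds_zero_nat (𝕜 := ℝ)).const_mul 2 |>.congr
    (fun n => by ring_nf : ∀ n : ℕ, 2 * (1 / ((n : ℝ) + 1)) = 2 / ((n : ℝ) + 1))

theorem lintegral_enorm_bump (φ : ContDiffBump (0 : Plane)) :
    ∫⁻ x, ‖φ.normed volume x‖ₑ = 1 := by
  have h := φ.integral_normed (μ := (volume : Measure Plane))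
  rw [integral_eq_lintegral_of_nonneg_ae (Filter.Eventually.of_forall fun x => φ.nonneg_normed x)
    φ.continuous_normed.aestronglyMeasurable] at h
  have h2 : ∀ x, ‖φ.normed volume x‖ₑ = ENNReal.ofReal (φ.normed volume x) := fun x =>
    Real.enorm_of_nonneg (φ.nonneg_normed x)
  simp only [h2]
  rw [← ENNReal.toReal_eq_one_iff]
  exact h

/-- The bound of the mean square of a piecewise polynomial by its variation. -/
theorem exists_sobolev : ∃ C : ℝ, 0 < C ∧ ∀ {Ω : Set Plane} (M : Mesh Ω) (q : M.PS),
    ∑ τ, ∫ x in M.tri τ, M.sv q τ x ^ 2 ≤ C * M.variation q ^ 2 := by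
  -- The Gagliardo-Nirenberg exponent is n/(n − 1), which is 2 in the plane: the L² norm is bounded
  -- by the L¹ norm of the gradient.
  have hp : Real.HolderConjugate (Module.finrank ℝ Plane) 2 := by
    rw [finrank_euclideanSpace_fin]; exact_mod_cast Real.HolderConjugate.two_two
  -- Each of the two partial derivatives of a mollification has L¹ norm at most the variation, so
  -- the gradient is bounded by twice the variation and its square brings the factor 4. The summand
  -- 1 makes the constant positive.
  refine ⟨4 * lintegralPowLePowLIntegralFDerivConst (volume : Measure Plane) 2 + 1, by positivity, ?_⟩
  intro Ω M q
  set C₀ := lintegralPowLePowLIntegralFDerivConst (volume : Measure Plane) 2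
  set U := M.toFun q with hU
  have hUi : LocallyIntegrable U volume := (M.integrable_toFun q).locallyIntegrable
  let L : ℝ →L[ℝ] ℝ →L[ℝ] ℝ := ContinuousLinearMap.lsmul ℝ ℝ
  let φ : ℕ → Plane → ℝ := fun n => (bumpSeq n).normed volume
  have hφc : ∀ n, ContDiff ℝ 1 (φ n) := fun n => (bumpSeq n).contDiff_normed
  have hφs : ∀ n, HasCompactSupport (φ n) := fun n => (bumpSeq n).hasCompactSupport_normed
  let V : ℕ → Plane → ℝ := fun n => convolution U (φ n) L volume
  have hVc : ∀ n, ContDiff ℝ 1 (V n) := fun n => by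
    exact_mod_cast (hφs n).contDiff_convolution_right (n := 1) L hUi (by exact_mod_cast hφc n)
  have hVs : ∀ n, HasCompactSupport (V n) := fun n =>
    (M.hasCompactSupport_toFun q).convolution L (hφs n)
  have hvar : 0 ≤ M.variation q := by
    refine add_nonneg (add_nonneg (Finset.sum_nonneg fun τ _ => integral_nonneg fun x =>
      Finset.sum_nonneg fun _ _ => abs_nonneg _) (Finset.sum_nonneg fun τ _ =>
      edgeInt_nonneg fun x _ => abs_nonneg _)) (Finset.sum_nonneg fun τ _ =>
      edgeInt_nonneg fun x _ => abs_nonneg _)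
  have hVd : ∀ n x i, fderiv ℝ (V n) x (EuclideanSpace.single i 1) =
      ∑ τ, ∫ y in M.tri τ, M.sv q τ y * partialD i (φ n) (x - y) := by
    intro n x i
    rw [((hφs n).hasFDerivAt_convolution_right L hUi (hφc n) x).fderiv,
      convolution_precompR_apply L hUi ((hφs n).fderiv (𝕜 := ℝ)) ((hφc n).continuous_fderiv (by norm_num))]
    rw [convolution_def, ← M.integral_toFun_mul q (g := fun y => partialD i (φ n) (x - y))
      ((continuous_partialD (hφc n) i).comp (by fun_prop))]
    rfl
  have hVint : ∀ n, ∫⁻ x, ‖fderiv ℝ (V n) x‖ₑ ≤ 2 * ENNReal.ofReal (M.variation q) := by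
    intro n
    refine (lintegral_mono fun x => enorm_le_sum_basis _).trans ?_
    rw [lintegral_finsetSum]
    · simp only [hVd]
      rw [Fin.sum_univ_two, two_mul]
      exact add_le_add (M.lintegral_partialD_le q (hφc n) (lintegral_enorm_bump _) 0)
        (M.lintegral_partialD_le q (hφc n) (lintegral_enorm_bump _) 1)
    · intro i _
      exact (((hVc n).continuous_fderiv (by norm_num)).clm_apply continuous_const).measurable.enorm
  have hVb : ∀ n, ∫⁻ x, ‖V n x‖ₑ ^ (2 : ℝ) ≤ C₀ * (2 * ENNReal.ofReal (M.variation q)) ^ (2 : ℝ) := by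
    intro n
    refine (lintegral_pow_le_pow_lintegral_fderiv volume (hVc n) (hVs n) hp).trans ?_
    gcongr
    exact hVint n
  -- Almost everywhere convergence at Lebesgue points requires outer radii of the bumps bounded by a
  -- fixed multiple of the inner radii; here the ratio is 2.
  have hlim : ∀ᵐ x, Filter.Tendsto (fun n => V n x) Filter.atTop (𝓝 (U x)) := by
    have := ContDiffBump.ae_convolution_tendsto_right_of_locallyIntegrable (φ := bumpSeq)
      (K := 2) tendsto_bumpSeq (Filter.Eventually.of_forall fun n => by simp only [bumpSeq]; apply le_of_eq; ring)
      hUi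
    filter_upwards [this] with x hx
    refine hx.congr fun n => ?_
    simp only [V, convolution_eq_swap, L, ContinuousLinearMap.lsmul_apply, smul_eq_mul, φ]
    rw [← integral_sub_left_eq_self _ volume x]
    congr 1
    ext t
    rw [sub_sub_cancel, mul_comm]
  -- The bounds for the mollifications are uniform in n, so Fatou's lemma transfers them to the
  -- discontinuous limit.
  have hfatou : ∫⁻ x, ‖U x‖ₑ ^ (2 : ℝ) ≤ C₀ * (2 * ENNReal.ofReal (M.variation q)) ^ (2 : ℝ) := by
    calc ∫⁻ x, ‖U x‖ₑ ^ (2 : ℝ) = ∫⁻ x, Filter.liminf (fun n => ‖V n x‖ₑ ^ (2 : ℝ)) Filter.atTop := by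
          refine lintegral_congr_ae ?_
          filter_upwards [hlim] with x hx
          have h1 : Filter.Tendsto (fun n => ‖V n x‖ₑ ^ (2 : ℝ)) Filter.atTop (𝓝 (‖U x‖ₑ ^ (2 : ℝ))) :=
            (ENNReal.continuous_rpow_const.tendsto _).comp hx.enorm
          exact h1.liminf_eq.symm
      _ ≤ Filter.liminf (fun n => ∫⁻ x, ‖V n x‖ₑ ^ (2 : ℝ)) Filter.atTop :=
          lintegral_liminf_le fun n => ((hVc n).continuous.measurable.enorm).pow_const _
      _ ≤ C₀ * (2 * ENNReal.ofReal (M.variation q)) ^ (2 : ℝ) :=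
          Filter.liminf_le_of_le (by isBoundedDefault) fun b hb => by
            obtain ⟨n, hn⟩ := hb.exists
            exact hn.trans (hVb n)
  have hreal : ∑ τ, ∫ x in M.tri τ, M.sv q τ x ^ 2 = ∫ x, U x ^ 2 := by
    have h1 : ∫ x, U x ^ 2 = ∑ τ, ∫ x in M.tri τ, M.sv q τ x ^ 2 := by
      have h2 : ∀ x, U x ^ 2 = ∑ τ, (interior (M.tri τ)).indicator (fun y => M.sv q τ y ^ 2) x := by
        intro x
        by_cases hx : ∃ τ, x ∈ interior (M.tri τ)
        · obtain ⟨τ, hτ⟩ := hx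
          rw [hU, M.toFun_eq hτ, Finset.sum_eq_single τ]
          · rw [Set.indicator_of_mem hτ]
          · intro σ _ hσ
            rw [Set.indicator_of_notMem]
            exact fun h => Set.disjoint_left.1 (M.tri_disjoint hσ) h hτ
          · simp
        · push Not at hx
          rw [hU, toFun, Finset.sum_eq_zero fun τ _ => Set.indicator_of_notMem (hx τ) _,
            Finset.sum_eq_zero fun τ _ => Set.indicator_of_notMem (hx τ) _]
          simp
      simp only [h2]
      rw [integral_finsetSum]
      · refine Finset.sum_congr rfl fun τ _ => ?_
        rw [integral_indicator isOpen_interior.measurableSet, setIntegral_congr_set (M.interior_tri_ae τ)]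
      · intro τ _
        exact (integrable_indicator_iff isOpen_interior.measurableSet).2
          ((M.integrableOn_tri τ (by fun_prop)).mono_set interior_subset)
    exact h1.symm
  rw [hreal, integral_eq_lintegral_of_nonneg_ae (Filter.Eventually.of_forall fun x => sq_nonneg _)
    ((M.measurable_toFun q).pow_const 2).aestronglyMeasurable]
  have h3 : ∫⁻ x, ENNReal.ofReal (U x ^ 2) = ∫⁻ x, ‖U x‖ₑ ^ (2 : ℝ) := by
    refine lintegral_congr fun x => ?_
    rw [← ofReal_norm, ENNReal.ofReal_rpow_of_nonneg (norm_nonneg _) (by norm_num)]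
    simp
  rw [h3]
  have h4 : C₀ * (2 * ENNReal.ofReal (M.variation q)) ^ (2 : ℝ) =
      ENNReal.ofReal (C₀ * (2 * M.variation q) ^ 2) := by
    rw [ENNReal.ofReal_mul (by positivity), ENNReal.ofReal_coe_nnreal, ENNReal.ofReal_pow (by positivity),
      ENNReal.ofReal_mul (by norm_num)]
    simp
  rw [h4] at hfatou
  refine (ENNReal.toReal_le_of_le_ofReal (by positivity) hfatou).trans ?_
  nlinarith [sq_nonneg (M.variation q)]

end Mesh

/-! ### Scaled inequalities for polynomials on triangles -/

/-- On a finite-dimensional space any quadratic form is bounded by a definite one. -/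
theorem exists_bilin_le {V : Type*} [AddCommGroup V] [Module ℝ V] [Module.Finite ℝ V]
    (B₁ B₂ : V →ₗ[ℝ] V →ₗ[ℝ] ℝ) (h : ∀ v, v ≠ 0 → 0 < B₂ v v) :
    ∃ C : ℝ, 0 < C ∧ ∀ v, B₁ v v ≤ C * B₂ v v := by
  let b := Module.finBasis ℝ V
  let n := Module.finrank ℝ V
  let e : (Fin n → ℝ) → V := fun x => ∑ i, x i • b i
  have hexp : ∀ (B : V →ₗ[ℝ] V →ₗ[ℝ] ℝ) x, B (e x) (e x) = ∑ i, ∑ j, x i * (x j * B (b i) (b j)) := by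
    intro B x
    simp only [e, map_sum, LinearMap.sum_apply, map_smul, LinearMap.smul_apply, smul_eq_mul,
      Finset.mul_sum]
    rw [Finset.sum_comm]
    refine Finset.sum_congr rfl fun i _ => Finset.sum_congr rfl fun j _ => ?_
    ring
  have hcont : ∀ B : V →ₗ[ℝ] V →ₗ[ℝ] ℝ, Continuous fun x => B (e x) (e x) := by
    intro B
    simp only [hexp]
    fun_prop
  have hb : ∀ v, ∃ x, e x = v := fun v => ⟨b.equivFun v, b.sum_equivFun v⟩
  have hsm : ∀ (r : ℝ) x, e (r • x) = r • e x := by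
    intro r x; simp [e, Finset.smul_sum, smul_smul]
  have h0 : ∀ x, e x = 0 → x = 0 := by
    intro x hx
    have := b.linearIndependent
    rw [Fintype.linearIndependent_iff] at this
    ext i; exact this x hx i
  have hK : IsCompact (Metric.sphere (0 : Fin n → ℝ) 1) := isCompact_sphere _ _
  -- The unit sphere of the coordinate space is empty in dimension zero only, where both forms
  -- vanish.
  rcases (Metric.sphere (0 : Fin n → ℝ) 1).eq_empty_or_nonempty with hE | hE
  · refine ⟨1, one_pos, fun v => ?_⟩
    obtain ⟨x, rfl⟩ := hb v
    have hx : x = 0 := by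
      by_contra hx
      have : (‖x‖⁻¹ • x) ∈ Metric.sphere (0 : Fin n → ℝ) 1 := by
        simp [norm_smul, inv_mul_cancel₀ (norm_ne_zero_iff.2 hx)]
      rw [hE] at this; exact this
    subst hx
    simp [e]
  · obtain ⟨x₂, hx₂, hmin⟩ := hK.exists_isMinOn hE (hcont B₂).continuousOn
    obtain ⟨x₁, hx₁, hmax⟩ := hK.exists_isMaxOn hE (hcont B₁).continuousOn
    set m := B₂ (e x₂) (e x₂) with hm
    set K := B₁ (e x₁) (e x₁) with hKdef
    have hmpos : 0 < m := h _ fun h' => by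
      have := h0 _ h'
      subst this
      simp at hx₂
    -- The maximum of the first form over the minimum of the second on the unit sphere, enlarged to
    -- be positive; homogeneity of degree two extends the bound to all vectors.
    refine ⟨(|K| + 1) / m, by positivity, fun v => ?_⟩
    obtain ⟨x, rfl⟩ := hb v
    by_cases hx : x = 0
    · subst hx; simp [e]
    · have hxn : 0 < ‖x‖ := norm_pos_iff.2 hx
      have hy : (‖x‖⁻¹ • x) ∈ Metric.sphere (0 : Fin n → ℝ) 1 := by
        simp [norm_smul, inv_mul_cancel₀ hxn.ne']
      have e1 := hmin hy
      have e2 := hmax hy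
      simp only [Set.mem_ofPred_eq, hsm, map_smul, LinearMap.smul_apply, smul_eq_mul, ← mul_assoc] at e1 e2
      rw [← hm] at e1
      rw [← hKdef] at e2
      have hi : 0 < ‖x‖⁻¹ * ‖x‖⁻¹ := by positivity
      have : ‖x‖⁻¹ * ‖x‖⁻¹ * B₁ (e x) (e x) ≤ ‖x‖⁻¹ * ‖x‖⁻¹ * ((|K| + 1) / m * B₂ (e x) (e x)) := by
        calc ‖x‖⁻¹ * ‖x‖⁻¹ * B₁ (e x) (e x) ≤ K := e2
          _ ≤ (|K| + 1) / m * m := by rw [div_mul_cancel₀ _ hmpos.ne']; linarith [le_abs_self K]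
          _ ≤ (|K| + 1) / m * (‖x‖⁻¹ * ‖x‖⁻¹ * B₂ (e x) (e x)) := by gcongr
          _ = _ := by ring
      exact le_of_mul_le_mul_left this hi

/-- A polynomial as a function of the pair of coordinates. -/
def rval (p : Poly) (ξ : ℝ × ℝ) : ℝ := pval p !₂[ξ.1, ξ.2]

@[fun_prop]
theorem continuous_rval (p : Poly) : Continuous (rval p) := by
  unfold rval
  refine (continuous_pval p).comp ((PiLp.continuous_toLp 2 _).comp (continuous_pi fun i => ?_))
  fin_cases i
  · exact continuous_fst
  · exact continuous_snd

theorem rval_add (p q : Poly) (ξ : ℝ × ℝ) : rval (p + q) ξ = rval p ξ + rval q ξ := pval_add _ _ _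
theorem rval_smul (r : ℝ) (p : Poly) (ξ : ℝ × ℝ) : rval (r • p) ξ = r * rval p ξ := pval_smul _ _ _

/-- Polynomials of bounded degree. -/
abbrev PolyLE (k : ℕ) : Type := MvPolynomial.restrictTotalDegree (Fin 2) ℝ k

/-- The weighted inner product on the reference triangle. -/
def refForm (k : ℕ) (w : ℝ × ℝ → ℝ) (hw : Continuous w) : PolyLE k →ₗ[ℝ] PolyLE k →ₗ[ℝ] ℝ :=
  LinearMap.mk₂ ℝ (fun p q => ∫ ξ in refTri, w ξ * (rval p ξ * rval q ξ))
    (fun p p' q => (isLinearMap_setIntegral (V := PolyLE k) (g := fun p ξ => w ξ * (rval p ξ * rval q ξ))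
      (fun p => ContinuousOn.integrableOn_compact isCompact_refTri (by fun_prop))
      (fun ξ => ⟨fun a b => by simp [rval_add]; ring, fun a b => by simp [rval_smul]; ring⟩)).map_add p p')
    (fun r p q => (isLinearMap_setIntegral (V := PolyLE k) (g := fun p ξ => w ξ * (rval p ξ * rval q ξ))
      (fun p => ContinuousOn.integrableOn_compact isCompact_refTri (by fun_prop))
      (fun ξ => ⟨fun a b => by simp [rval_add]; ring, fun a b => by simp [rval_smul]; ring⟩)).map_smul r p)
    (fun p q q' => (isLinearMap_setIntegral (V := PolyLE k) (g := fun q ξ => w ξ * (rval p ξ * rval q ξ))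
      (fun p => ContinuousOn.integrableOn_compact isCompact_refTri (by fun_prop))
      (fun ξ => ⟨fun a b => by simp [rval_add]; ring, fun a b => by simp [rval_smul]; ring⟩)).map_add q q')
    (fun r p q => (isLinearMap_setIntegral (V := PolyLE k) (g := fun q ξ => w ξ * (rval p ξ * rval q ξ))
      (fun p => ContinuousOn.integrableOn_compact isCompact_refTri (by fun_prop))
      (fun ξ => ⟨fun a b => by simp [rval_add]; ring, fun a b => by simp [rval_smul]; ring⟩)).map_smul r q)

/-- The inner product on a curve in the reference triangle. -/
def curveForm (k : ℕ) (γ : ℝ → ℝ × ℝ) (hγ : Continuous γ) : PolyLE k →ₗ[ℝ] PolyLE k →ₗ[ℝ] ℝ :=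
  have hl : ∀ g : PolyLE k → ℝ → ℝ, (∀ p, Continuous (g p)) → (∀ s, IsLinearMap ℝ fun p => g p s) →
      IsLinearMap ℝ fun p => ∫ s in (0 : ℝ)..1, g p s := fun g hg hl =>
    { map_add := fun p q => by
        rw [← intervalIntegral.integral_add ((hg p).intervalIntegrable _ _) ((hg q).intervalIntegrable _ _)]
        simp only [(hl _).map_add]
      map_smul := fun r p => by
        rw [smul_eq_mul, ← intervalIntegral.integral_const_mul]
        simp only [(hl _).map_smul, smul_eq_mul] }
  LinearMap.mk₂ ℝ (fun p q => ∫ s in (0 : ℝ)..1, rval p (γ s) * rval q (γ s))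
    (fun p p' q => (hl (fun p s => rval p (γ s) * rval q (γ s)) (fun p => by fun_prop)
      (fun ξ => ⟨fun a b => by simp [rval_add]; ring, fun a b => by simp [rval_smul]; ring⟩)).map_add p p')
    (fun r p q => (hl (fun p s => rval p (γ s) * rval q (γ s)) (fun p => by fun_prop)
      (fun ξ => ⟨fun a b => by simp [rval_add]; ring, fun a b => by simp [rval_smul]; ring⟩)).map_smul r p)
    (fun p q q' => (hl (fun q s => rval p (γ s) * rval q (γ s)) (fun p => by fun_prop)
      (fun ξ => ⟨fun a b => by simp [rval_add]; ring, fun a b => by simp [rval_smul]; ring⟩)).map_add q q')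
    (fun r p q => (hl (fun q s => rval p (γ s) * rval q (γ s)) (fun p => by fun_prop)
      (fun ξ => ⟨fun a b => by simp [rval_add]; ring, fun a b => by simp [rval_smul]; ring⟩)).map_smul r q)

/-- Positivity of the weight in the open triangle is enough, because a polynomial that vanishes on
an open set is zero. The weight may vanish on the sides, as barycentric coordinates do. -/
theorem refForm_pos (k : ℕ) {w : ℝ × ℝ → ℝ} (hw : Continuous w) (hw0 : ∀ ξ ∈ refTri, 0 ≤ w ξ)
    (hw1 : ∀ ξ : ℝ × ℝ, 0 < ξ.1 → 0 < ξ.2 → ξ.1 + ξ.2 < 1 → 0 < w ξ) (p : PolyLE k) (hp : p ≠ 0) :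
    0 < refForm k w hw p p := by
  have hnn : ∀ ξ ∈ refTri, 0 ≤ w ξ * (rval p ξ * rval p ξ) := fun ξ hξ =>
    mul_nonneg (hw0 ξ hξ) (mul_self_nonneg _)
  have hc : Continuous fun ξ => w ξ * (rval (p : Poly) ξ * rval p ξ) := by fun_prop
  have hm := isClosed_refTri.measurableSet
  refine lt_of_le_of_ne (setIntegral_nonneg hm hnn) fun h => hp ?_
  have h1 : (fun ξ => w ξ * (rval (p : Poly) ξ * rval p ξ)) =ᵐ[volume.restrict refTri] 0 :=
    (setIntegral_eq_zero_iff_of_nonneg_ae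
      ((ae_restrict_iff' hm).2 (Filter.Eventually.of_forall hnn))
      (hc.continuousOn.integrableOn_compact isCompact_refTri)).1 h.symm
  let U : Set (ℝ × ℝ) := {ξ | 0 < ξ.1 ∧ 0 < ξ.2 ∧ ξ.1 + ξ.2 < 1}
  have hU : IsOpen U := (isOpen_lt continuous_const continuous_fst).inter
    ((isOpen_lt continuous_const continuous_snd).inter
      (isOpen_lt (continuous_fst.add continuous_snd) continuous_const))
  have hUr : U ⊆ refTri := fun ξ hξ => ⟨hξ.1.le, hξ.2.1.le, hξ.2.2.le⟩
  have h2 := Measure.eqOn_open_of_ae_eq (ae_restrict_of_ae_restrict_of_subset hUr h1) hU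
    hc.continuousOn continuousOn_const
  let W : Set Plane := {x | 0 < x 0 ∧ 0 < x 1 ∧ x 0 + x 1 < 1}
  have hW : IsOpen W := by
    have c0 : Continuous fun x : Plane => x 0 := (EuclideanSpace.proj (0 : Fin 2) : Plane →L[ℝ] ℝ).continuous
    have c1 : Continuous fun x : Plane => x 1 := (EuclideanSpace.proj (1 : Fin 2) : Plane →L[ℝ] ℝ).continuous
    exact (isOpen_lt continuous_const c0).inter
      ((isOpen_lt continuous_const c1).inter (isOpen_lt (c0.add c1) continuous_const))
  have hp0 : (p : Poly) = 0 := by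
    refine poly_eq_zero_of_isOpen hW ⟨!₂[1/4, 1/4], by norm_num [W]⟩ fun x hx => ?_
    have h3 := h2 (x := (x 0, x 1)) hx
    have h4 := hw1 (x 0, x 1) hx.1 hx.2.1 hx.2.2
    have h5 : rval (p : Poly) (x 0, x 1) = pval p x := by
      unfold rval
      congr 1
      ext i; fin_cases i <;> rfl
    simpa [h4.ne', h5] using h3
  exact Subtype.ext hp0

theorem exists_ref_trace (k : ℕ) {γ : ℝ → ℝ × ℝ} (hγ : Continuous γ) : ∃ C : ℝ, 0 < C ∧
    ∀ p : Poly, p.totalDegree ≤ k →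
      ∫ s in (0 : ℝ)..1, rval p (γ s) ^ 2 ≤ C * ∫ ξ in refTri, rval p ξ ^ 2 := by
  obtain ⟨C, hC, h⟩ := exists_bilin_le (curveForm k γ hγ) (refForm k (fun _ => 1) continuous_const)
    (refForm_pos k _ (fun _ _ => zero_le_one) fun _ _ _ _ => one_pos)
  refine ⟨C, hC, fun p hp => ?_⟩
  have := h ⟨p, (MvPolynomial.mem_restrictTotalDegree _ _ _).2 hp⟩
  simp only [curveForm, refForm, LinearMap.mk₂_apply, one_mul] at this
  simpa only [sq] using this

theorem exists_ref_weight (k : ℕ) {w : ℝ × ℝ → ℝ} (hw : Continuous w) (hw0 : ∀ ξ ∈ refTri, 0 ≤ w ξ)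
    (hw1 : ∀ ξ : ℝ × ℝ, 0 < ξ.1 → 0 < ξ.2 → ξ.1 + ξ.2 < 1 → 0 < w ξ) : ∃ C : ℝ, 0 < C ∧
    ∀ p : Poly, p.totalDegree ≤ k →
      ∫ ξ in refTri, rval p ξ ^ 2 ≤ C * ∫ ξ in refTri, w ξ * rval p ξ ^ 2 := by
  obtain ⟨C, hC, h⟩ := exists_bilin_le (refForm k (fun _ => 1) continuous_const) (refForm k w hw)
    (refForm_pos k _ hw0 hw1)
  refine ⟨C, hC, fun p hp => ?_⟩
  have := h ⟨p, (MvPolynomial.mem_restrictTotalDegree _ _ _).2 hp⟩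
  simp only [refForm, LinearMap.mk₂_apply, one_mul] at this
  simpa only [sq] using this

theorem totalDegree_bind₁_le {f : Fin 2 → Poly} (hf : ∀ i, (f i).totalDegree ≤ 1) (p : Poly) :
    (MvPolynomial.bind₁ f p).totalDegree ≤ p.totalDegree := by
  conv_lhs => rw [p.as_sum, map_sum]
  refine MvPolynomial.totalDegree_finsetSum_le fun s hs => ?_
  rw [MvPolynomial.bind₁_monomial]
  refine (MvPolynomial.totalDegree_mul _ _).trans ?_
  rw [MvPolynomial.totalDegree_C, zero_add]
  refine (MvPolynomial.totalDegree_finsetProd _ _).trans ?_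
  refine le_trans ?_ (MvPolynomial.le_totalDegree hs)
  refine Finset.sum_le_sum fun i _ => ?_
  refine (MvPolynomial.totalDegree_pow _ _).trans ?_
  exact (Nat.mul_le_mul_left _ (hf i)).trans (by simp)

theorem pval_bind₁ (f : Fin 2 → Poly) (p : Poly) (x : Plane) :
    pval (MvPolynomial.bind₁ f p) x = pval p (WithLp.toLp 2 fun i => pval (f i) x) := by
  unfold pval
  rw [← MvPolynomial.coe_aeval_eq_eval, ← MvPolynomial.coe_aeval_eq_eval]
  simp only [RingHom.coe_coe]
  rw [MvPolynomial.aeval_bind₁]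

/-- The affine polynomial with given values at the origin and the two unit points. -/
def affPoly (r s t : ℝ) : Poly :=
  MvPolynomial.C r + MvPolynomial.C (s - r) * MvPolynomial.X 0 + MvPolynomial.C (t - r) * MvPolynomial.X 1

theorem totalDegree_affPoly (r s t : ℝ) : (affPoly r s t).totalDegree ≤ 1 := by
  have h : ∀ (r : ℝ) (i : Fin 2), (MvPolynomial.C r * MvPolynomial.X i : Poly).totalDegree ≤ 1 := by
    intro r i
    refine (MvPolynomial.totalDegree_mul _ _).trans ?_
    rw [MvPolynomial.totalDegree_C, MvPolynomial.totalDegree_X]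
  refine (MvPolynomial.totalDegree_add _ _).trans (max_le ?_ (h _ _))
  refine (MvPolynomial.totalDegree_add _ _).trans (max_le ?_ (h _ _))
  simp

/-- The polynomial in the coordinates of the reference triangle. -/
def pullPoly (c a b : Plane) (p : Poly) : Poly :=
  MvPolynomial.bind₁ (fun i => affPoly (c i) (a i) (b i)) p

theorem rval_pullPoly (c a b : Plane) (p : Poly) (ξ : ℝ × ℝ) :
    rval (pullPoly c a b p) ξ = pval p (triMap c a b ξ.1 ξ.2) := by
  unfold rval pullPoly
  rw [pval_bind₁]
  congr 1
  ext i
  simp [affPoly, pval_add, pval_mul, pval_sub, triMap_apply]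
  ring

namespace Mesh

variable {Ω : Set Plane} (M : Mesh Ω)

theorem setIntegral_tri (τ : M.Tri) (g : Plane → ℝ) : ∫ x in M.tri τ, g x =
    M.D τ * ∫ ξ in refTri, g (triMap (M.c τ) (M.a τ) (M.b τ) ξ.1 ξ.2) := by
  have := setIntegral_triangle (M.D_pos τ).ne' g
  rwa [abs_of_pos (show 0 < cross (M.a τ - M.c τ) (M.b τ - M.c τ) from M.D_pos τ)] at this

/-- On the reference triangle all norms on polynomials of degree k are comparable. The affine map
multiplies the integral over the triangle by D and leaves the mean over a side unchanged, so with
the factor D on the left the constant depends on k alone and not on the shape. -/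
theorem _root_.SDG.exists_trace (k : ℕ) : ∃ C : ℝ, 0 < C ∧ ∀ {Ω : Set Plane} (M : Mesh Ω) (τ : M.Tri) (p : Poly),
    p.totalDegree ≤ k →
      M.D τ * (∫ s in (0 : ℝ)..1, pval p (AffineMap.lineMap (M.c τ) (M.a τ) s) ^ 2) ≤
        C * ∫ x in M.tri τ, pval p x ^ 2 ∧
      M.D τ * (∫ s in (0 : ℝ)..1, pval p (AffineMap.lineMap (M.c τ) (M.b τ) s) ^ 2) ≤
        C * ∫ x in M.tri τ, pval p x ^ 2 ∧
      M.D τ * (∫ s in (0 : ℝ)..1, pval p (AffineMap.lineMap (M.a τ) (M.b τ) s) ^ 2) ≤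
        C * ∫ x in M.tri τ, pval p x ^ 2 := by
  obtain ⟨C₁, hC₁, h₁⟩ := exists_ref_trace k (γ := fun s => (s, 0)) (by fun_prop)
  obtain ⟨C₂, hC₂, h₂⟩ := exists_ref_trace k (γ := fun s => (0, s)) (by fun_prop)
  obtain ⟨C₃, hC₃, h₃⟩ := exists_ref_trace k (γ := fun s => (1 - s, s)) (by fun_prop)
  refine ⟨max C₁ (max C₂ C₃), by positivity, ?_⟩
  intro Ω M τ p hp
  have hD := M.D_pos τ
  have hdeg : (pullPoly (M.c τ) (M.a τ) (M.b τ) p).totalDegree ≤ k :=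
    (totalDegree_bind₁_le (fun i => totalDegree_affPoly _ _ _) p).trans hp
  have e1 := h₁ _ hdeg
  have e2 := h₂ _ hdeg
  have e3 := h₃ _ hdeg
  simp only [rval_pullPoly] at e1 e2 e3
  have hnn : 0 ≤ ∫ ξ in refTri, pval p (triMap (M.c τ) (M.a τ) (M.b τ) ξ.1 ξ.2) ^ 2 :=
    integral_nonneg fun _ => sq_nonneg _
  rw [M.setIntegral_tri]
  simp only [lineMap_ca, lineMap_cb, lineMap_ab]
  have key : ∀ C I : ℝ, C ≤ max C₁ (max C₂ C₃) →
      I ≤ C * ∫ ξ in refTri, pval p (triMap (M.c τ) (M.a τ) (M.b τ) ξ.1 ξ.2) ^ 2 →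
      M.D τ * I ≤ max C₁ (max C₂ C₃) *
        (M.D τ * ∫ ξ in refTri, pval p (triMap (M.c τ) (M.a τ) (M.b τ) ξ.1 ξ.2) ^ 2) := by
    intro C I hC hI
    calc M.D τ * I ≤ M.D τ * (C * ∫ ξ in refTri, pval p (triMap (M.c τ) (M.a τ) (M.b τ) ξ.1 ξ.2) ^ 2) := by
          gcongr
      _ ≤ M.D τ * (max C₁ (max C₂ C₃) * ∫ ξ in refTri, pval p (triMap (M.c τ) (M.a τ) (M.b τ) ξ.1 ξ.2) ^ 2) := by
          gcongr
      _ = _ := by ring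
  exact ⟨key _ _ (le_max_left _ _) e1, key _ _ ((le_max_left _ _).trans (le_max_right _ _)) e2,
    key _ _ ((le_max_right _ _).trans (le_max_right _ _)) e3⟩

/-- Barycentric coordinates are affine invariants and both sides scale by D, so the constant of the
reference triangle serves for every triangle. It removes the weights from the interior test tensor.
-/
theorem _root_.SDG.exists_weight (k : ℕ) : ∃ C : ℝ, 0 < C ∧ ∀ {Ω : Set Plane} (M : Mesh Ω) (τ : M.Tri) (p : Poly),
    p.totalDegree ≤ k →
      (∫ x in M.tri τ, pval p x ^ 2) ≤ C * (∫ x in M.tri τ, pval (M.lamA τ) x * pval p x ^ 2) ∧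
      (∫ x in M.tri τ, pval p x ^ 2) ≤ C * (∫ x in M.tri τ, pval (M.lamB τ) x * pval p x ^ 2) ∧
      (∫ x in M.tri τ, pval p x ^ 2) ≤ C * (∫ x in M.tri τ, pval (M.lamC τ) x * pval p x ^ 2) := by
  obtain ⟨C₁, hC₁, h₁⟩ := exists_ref_weight k (w := fun ξ => ξ.1) (by fun_prop) (fun ξ h => h.1)
    (fun ξ h _ _ => h)
  obtain ⟨C₂, hC₂, h₂⟩ := exists_ref_weight k (w := fun ξ => ξ.2) (by fun_prop) (fun ξ h => h.2.1)
    (fun ξ _ h _ => h)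
  obtain ⟨C₃, hC₃, h₃⟩ := exists_ref_weight k (w := fun ξ => 1 - ξ.1 - ξ.2) (by fun_prop)
    (fun ξ h => by have := h.2.2; linarith) (fun ξ _ _ h => by linarith)
  refine ⟨max C₁ (max C₂ C₃), by positivity, ?_⟩
  intro Ω M τ p hp
  have hD := M.D_pos τ
  have hdeg : (pullPoly (M.c τ) (M.a τ) (M.b τ) p).totalDegree ≤ k :=
    (totalDegree_bind₁_le (fun i => totalDegree_affPoly _ _ _) p).trans hp
  have e1 := h₁ _ hdeg
  have e2 := h₂ _ hdeg
  have e3 := h₃ _ hdeg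
  simp only [rval_pullPoly] at e1 e2 e3
  simp only [M.setIntegral_tri, pval_lamA, pval_lamB, pval_lamC]
  have hm := isClosed_refTri.measurableSet
  have n1 : 0 ≤ ∫ ξ in refTri, ξ.1 * pval p (triMap (M.c τ) (M.a τ) (M.b τ) ξ.1 ξ.2) ^ 2 :=
    setIntegral_nonneg hm fun ξ h => mul_nonneg h.1 (sq_nonneg _)
  have n2 : 0 ≤ ∫ ξ in refTri, ξ.2 * pval p (triMap (M.c τ) (M.a τ) (M.b τ) ξ.1 ξ.2) ^ 2 :=
    setIntegral_nonneg hm fun ξ h => mul_nonneg h.2.1 (sq_nonneg _)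
  have n3 : 0 ≤ ∫ ξ in refTri, (1 - ξ.1 - ξ.2) * pval p (triMap (M.c τ) (M.a τ) (M.b τ) ξ.1 ξ.2) ^ 2 :=
    setIntegral_nonneg hm fun ξ h => mul_nonneg (by have := h.2.2; linarith) (sq_nonneg _)
  have key : ∀ C I J : ℝ, C ≤ max C₁ (max C₂ C₃) → 0 ≤ J → I ≤ C * J →
      M.D τ * I ≤ max C₁ (max C₂ C₃) * (M.D τ * J) := by
    intro C I J hC hJ hI
    calc M.D τ * I ≤ M.D τ * (C * J) := by gcongr
      _ ≤ M.D τ * (max C₁ (max C₂ C₃) * J) := by gcongr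
      _ = _ := by ring
  exact ⟨key _ _ _ (le_max_left _ _) n1 e1, key _ _ _ ((le_max_left _ _).trans (le_max_right _ _)) n2 e2,
    key _ _ _ ((le_max_right _ _).trans (le_max_right _ _)) n3 e3⟩

end Mesh

/-! ### Discrete Sobolev inequalities -/

/-- A Cauchy-Schwarz inequality for sums, from weighted inequalities for the terms. -/
theorem sum_le_sqrt_mul_sqrt {ι : Type*} (s : Finset ι) {X A B : ι → ℝ} (hA : ∀ i ∈ s, 0 ≤ A i)
    (hB : ∀ i ∈ s, 0 ≤ B i) (h : ∀ i ∈ s, ∀ t : ℝ, 0 < t → 2 * X i ≤ t * A i + t⁻¹ * B i) :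
    ∑ i ∈ s, X i ≤ √(∑ i ∈ s, A i) * √(∑ i ∈ s, B i) := by
  have hsum : ∀ t : ℝ, 0 < t → 2 * ∑ i ∈ s, X i ≤ t * ∑ i ∈ s, A i + t⁻¹ * ∑ i ∈ s, B i := by
    intro t ht
    rw [Finset.mul_sum, Finset.mul_sum, Finset.mul_sum, ← Finset.sum_add_distrib]
    exact Finset.sum_le_sum fun i hi => h i hi t ht
  have ha := Real.sq_sqrt (Finset.sum_nonneg hA)
  have hb := Real.sq_sqrt (Finset.sum_nonneg hB)
  set a := √(∑ i ∈ s, A i)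
  set b := √(∑ i ∈ s, B i)
  have ha0 : 0 ≤ a := Real.sqrt_nonneg _
  have hb0 : 0 ≤ b := Real.sqrt_nonneg _
  rw [← ha, ← hb] at hsum
  refine le_of_forall_pos_le_add fun δ hδ => ?_
  -- The optimal t is b / a. The perturbation keeps it positive and finite when a or b vanishes, at
  -- a cost of at most ε(a + b) ≤ δ.
  set ε := δ / (a + b + 1) with hε
  have hε0 : 0 < ε := by positivity
  have h1 := hsum ((b + ε) / (a + ε)) (by positivity)
  have h2 : (b + ε) / (a + ε) * a ^ 2 ≤ (b + ε) * a := by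
    rw [div_mul_eq_mul_div, div_le_iff₀ (by positivity)]
    nlinarith [mul_nonneg (mul_nonneg (add_nonneg hb0 hε0.le) ha0) hε0.le]
  have h3 : ((b + ε) / (a + ε))⁻¹ * b ^ 2 ≤ (a + ε) * b := by
    rw [inv_div, div_mul_eq_mul_div, div_le_iff₀ (by positivity)]
    nlinarith [mul_nonneg (mul_nonneg (add_nonneg ha0 hε0.le) hb0) hε0.le]
  have h4 : ε * (a + b) ≤ δ := by
    rw [hε, div_mul_eq_mul_div, div_le_iff₀ (by positivity)]
    nlinarith
  nlinarith

/-- The mean value over a segment. -/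
def segMean (p q : Plane) (f : Plane → ℝ) : ℝ := ∫ s in (0 : ℝ)..1, f (AffineMap.lineMap p q s)

theorem edgeInt_eq (p q : Plane) (f : Plane → ℝ) : edgeInt p q f = dist p q * segMean p q f := rfl

theorem segMean_add {p q : Plane} {f g : Plane → ℝ} (hf : Continuous f) (hg : Continuous g) :
    segMean p q (fun x => f x + g x) = segMean p q f + segMean p q g :=
  intervalIntegral.integral_add (edgeInt_intervalIntegrable hf) (edgeInt_intervalIntegrable hg)

theorem segMean_const_mul (p q : Plane) (r : ℝ) (f : Plane → ℝ) :
    segMean p q (fun x => r * f x) = r * segMean p q f :=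
  intervalIntegral.integral_const_mul _ _

theorem segMean_symm (p q : Plane) (f : Plane → ℝ) : segMean q p f = segMean p q f :=
  integral_lineMap_symm _ _ _

theorem segMean_mono {p q : Plane} {f g : Plane → ℝ} (hf : Continuous f) (hg : Continuous g)
    (h : ∀ x ∈ segment ℝ p q, f x ≤ g x) : segMean p q f ≤ segMean p q g := by
  refine intervalIntegral.integral_mono_on zero_le_one (edgeInt_intervalIntegrable hf)
    (edgeInt_intervalIntegrable hg) fun s hs => h _ ?_
  rw [segment_eq_image_lineMap]
  exact ⟨s, hs, rfl⟩

theorem segMean_nonneg {p q : Plane} {f : Plane → ℝ} (h : ∀ x ∈ segment ℝ p q, 0 ≤ f x) :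
    0 ≤ segMean p q f := by
  refine intervalIntegral.integral_nonneg zero_le_one fun s hs => h _ ?_
  rw [segment_eq_image_lineMap]
  exact ⟨s, hs, rfl⟩

theorem two_mul_mul_le {t : ℝ} (ht : 0 < t) (x y : ℝ) : 2 * (x * y) ≤ t * x ^ 2 + t⁻¹ * y ^ 2 := by
  have h : t⁻¹ * (t * x - y) ^ 2 = t * x ^ 2 + t⁻¹ * y ^ 2 - 2 * (x * y) := by
    field_simp; ring
  have : 0 ≤ t⁻¹ * (t * x - y) ^ 2 := by positivity
  linarith

namespace Mesh

variable {Ω : Set Plane} (M : Mesh Ω)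

/-- A common name for primal and dual edges. -/
abbrev Edge : Type := M.Tri ⊕ M.Tri

def edges : Finset M.Edge := M.plus.disjSum Finset.univ

def src : M.Edge → Plane := Sum.elim M.a M.c
def tgt : M.Edge → Plane := Sum.elim M.b M.a

def len (e : M.Edge) : ℝ := dist (M.src e) (M.tgt e)

def mean (e : M.Edge) (f : Plane → ℝ) : ℝ := segMean (M.src e) (M.tgt e) f

def jump {F : Type*} [AddCommGroup F] (g : M.Tri → Plane → F) : M.Edge → Plane → F
  | .inl τ => M.jumpP g τ
  | .inr τ => M.jumpD g τ

/-- The sum of the absolute values from both sides of an edge. -/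
def mag (q : M.PS) : M.Edge → Plane → ℝ
  | .inl τ => fun x => |M.sv q τ x| + M.atNbr (fun σ => |M.sv q σ x|) τ
  | .inr τ => fun x => |M.sv q τ x| + |M.sv q (M.prev τ) x|

theorem sum_edges (g : M.Edge → ℝ) :
    ∑ e ∈ M.edges, g e = (∑ τ ∈ M.plus, g (.inl τ)) + ∑ τ, g (.inr τ) :=
  Finset.sum_disjSum _ _ _

@[fun_prop]
theorem continuous_jump (q : M.PS) (e : M.Edge) : Continuous fun x => M.jump (M.sv q) e x := by
  cases e
  · exact M.continuous_jumpP_sv q _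
  · exact M.continuous_jumpD_sv q _

@[fun_prop]
theorem continuous_mag (q : M.PS) (e : M.Edge) : Continuous fun x => M.mag q e x := by
  cases e with
  | inl τ =>
    unfold mag atNbr
    dsimp only
    split <;> fun_prop
  | inr τ =>
    unfold mag
    dsimp only
    fun_prop

theorem mag_nonneg (q : M.PS) (e : M.Edge) (x : Plane) : 0 ≤ M.mag q e x := by
  cases e with
  | inl τ =>
    unfold mag atNbr
    dsimp only
    split <;> positivity
  | inr τ => exact add_nonneg (abs_nonneg _) (abs_nonneg _)

/-- The square of the discrete `H^1` norm of a piecewise polynomial. -/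
def energy (q : M.PS) : ℝ :=
  (∑ τ, ∫ x in M.tri τ, ∑ i, pval (MvPolynomial.pderiv i (q τ)) x ^ 2) +
    ∑ e ∈ M.edges, M.mean e (fun x => M.jump (M.sv q) e x ^ 2)

/-- Shape regularity: no edge of a triangle is long compared with the area. -/
def Shape (κ : ℝ) : Prop := ∀ τ, dist (M.a τ) (M.b τ) ^ 2 ≤ κ * M.D τ ∧
  dist (M.c τ) (M.a τ) ^ 2 ≤ κ * M.D τ ∧ dist (M.c τ) (M.b τ) ^ 2 ≤ κ * M.D τ

/-- A mesh has finitely many triangles, so it is shape regular with a constant of its own.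
Qualitative facts such as definiteness and unique solvability thus follow from the quantitative ones
on every mesh. -/
theorem exists_shape : ∃ κ : ℝ, 0 < κ ∧ M.Shape κ := by
  let r : M.Tri → ℝ := fun τ =>
    (dist (M.a τ) (M.b τ) ^ 2 + dist (M.c τ) (M.a τ) ^ 2 + dist (M.c τ) (M.b τ) ^ 2) / M.D τ
  have hr : ∀ τ, 0 ≤ r τ := fun τ => div_nonneg (by positivity) (M.D_pos τ).le
  refine ⟨∑ τ, r τ + 1, by have := Finset.sum_nonneg fun τ (_ : τ ∈ Finset.univ) => hr τ; linarith,
    fun τ => ?_⟩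
  have h1 : r τ ≤ ∑ τ, r τ + 1 :=
    (Finset.single_le_sum (fun σ _ => hr σ) (Finset.mem_univ τ)).trans (by linarith)
  have h2 := (div_le_iff₀ (M.D_pos τ)).1 h1
  refine ⟨?_, ?_, ?_⟩ <;> nlinarith [sq_nonneg (dist (M.a τ) (M.b τ)),
    sq_nonneg (dist (M.c τ) (M.a τ)), sq_nonneg (dist (M.c τ) (M.b τ))]

theorem sum_sqrt_tri {f g h : M.Tri → Plane → ℝ} (hf : ∀ τ, Continuous (f τ))
    (hg : ∀ τ, Continuous (g τ)) (hh : ∀ τ, Continuous (h τ))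
    (H : ∀ τ, ∀ x ∈ M.tri τ, h τ x ≤ f τ x * g τ x) :
    (∑ τ, ∫ x in M.tri τ, h τ x) ≤
      √(∑ τ, ∫ x in M.tri τ, f τ x ^ 2) * √(∑ τ, ∫ x in M.tri τ, g τ x ^ 2) := by
  refine sum_le_sqrt_mul_sqrt _ (fun τ _ => integral_nonneg fun x => sq_nonneg _)
    (fun τ _ => integral_nonneg fun x => sq_nonneg _) fun τ _ t ht => ?_
  rw [← integral_const_mul, ← integral_const_mul, ← integral_const_mul,
    ← integral_add (M.integrableOn_tri τ (by fun_prop)) (M.integrableOn_tri τ (by fun_prop))]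
  refine setIntegral_mono_on (M.integrableOn_tri τ (by fun_prop)) (M.integrableOn_tri τ (by fun_prop))
    (M.isCompact_tri τ).isClosed.measurableSet fun x hx => ?_
  exact (mul_le_mul_of_nonneg_left (H τ x hx) two_pos.le).trans (two_mul_mul_le ht _ _)

/-- The edge length is attached to f alone, so that g is left with the mean over the edge, which is
the scaling h_e⁻¹‖·‖² of the jumps in `energy`. -/
theorem sum_sqrt_edges {s : Finset M.Edge} {f g h : M.Edge → Plane → ℝ} (hf : ∀ e, Continuous (f e))
    (hg : ∀ e, Continuous (g e)) (hh : ∀ e, Continuous (h e))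
    (H : ∀ e, ∀ x ∈ segment ℝ (M.src e) (M.tgt e), h e x ≤ f e x * g e x) :
    ∑ e ∈ s, edgeInt (M.src e) (M.tgt e) (h e) ≤
      √(∑ e ∈ s, M.len e ^ 2 * M.mean e (fun x => f e x ^ 2)) *
        √(∑ e ∈ s, M.mean e (fun x => g e x ^ 2)) := by
  refine sum_le_sqrt_mul_sqrt _
    (fun e _ => mul_nonneg (sq_nonneg _) (segMean_nonneg fun x _ => sq_nonneg _))
    (fun e _ => segMean_nonneg fun x _ => sq_nonneg _) fun e _ t ht => ?_
  have hlen : 0 ≤ M.len e := dist_nonneg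
  have hfe := hf e
  have hge := hg e
  have hhe := hh e
  rw [edgeInt_eq]
  unfold mean
  change 2 * (M.len e * _) ≤ _
  rw [← segMean_const_mul, ← segMean_const_mul, ← segMean_const_mul, ← segMean_const_mul,
    ← segMean_const_mul, ← segMean_add (by fun_prop) (by fun_prop)]
  refine segMean_mono (by fun_prop) (by fun_prop) fun x hx => ?_
  calc 2 * (M.len e * h e x) ≤ 2 * (M.len e * (f e x * g e x)) := by
        have := H e x hx
        gcongr
    _ = 2 * ((M.len e * f e x) * g e x) := by ring
    _ ≤ t * (M.len e * f e x) ^ 2 + t⁻¹ * g e x ^ 2 := two_mul_mul_le ht _ _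
    _ = _ := by ring

theorem variation_eq (q : M.PS) : M.variation q =
    (∑ τ, ∫ x in M.tri τ, ∑ i, |pval (MvPolynomial.pderiv i (q τ)) x|) +
      ∑ e ∈ M.edges, edgeInt (M.src e) (M.tgt e) (fun x => |M.jump (M.sv q) e x|) := by
  rw [sum_edges, ← add_assoc]
  rfl

theorem energy_nonneg (q : M.PS) : 0 ≤ M.energy q :=
  add_nonneg (Finset.sum_nonneg fun τ _ => integral_nonneg fun x =>
    Finset.sum_nonneg fun i _ => sq_nonneg _)
    (Finset.sum_nonneg fun e _ => segMean_nonneg fun x _ => sq_nonneg _)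

theorem sum_grad_le_energy (q : M.PS) :
    (∑ τ, ∫ x in M.tri τ, ∑ i, pval (MvPolynomial.pderiv i (q τ)) x ^ 2) ≤ M.energy q :=
  le_add_of_nonneg_right (Finset.sum_nonneg fun e _ => segMean_nonneg fun x _ => sq_nonneg _)

theorem sum_jump_le_energy (q : M.PS) :
    ∑ e ∈ M.edges, M.mean e (fun x => M.jump (M.sv q) e x ^ 2) ≤ M.energy q :=
  le_add_of_nonneg_left (Finset.sum_nonneg fun τ _ => integral_nonneg fun x =>
    Finset.sum_nonneg fun i _ => sq_nonneg _)

/-- Meant for p = q with unit weights, which gives the Poincaré inequality, and for p = q² with the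
weights |2q| and `mag` from the product rule, which gives the L⁴ inequality. Both parts are
Cauchy-Schwarz against the energy of q. -/
theorem variation_le (p q : M.PS) {f : M.Tri → Plane → ℝ} {g : M.Edge → Plane → ℝ}
    (hf : ∀ τ, Continuous (f τ)) (hg : ∀ e, Continuous (g e))
    (h1 : ∀ τ x, ∑ i, |pval (MvPolynomial.pderiv i (p τ)) x| ≤
      f τ x * ∑ i, |pval (MvPolynomial.pderiv i (q τ)) x|)
    (h2 : ∀ e x, |M.jump (M.sv p) e x| ≤ g e x * |M.jump (M.sv q) e x|) :
    M.variation p ≤ (2 * √(∑ τ, ∫ x in M.tri τ, f τ x ^ 2) +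
      √(∑ e ∈ M.edges, M.len e ^ 2 * M.mean e (fun x => g e x ^ 2))) * √(M.energy q) := by
  rw [variation_eq, add_mul]
  refine add_le_add ?_ ?_
  · refine (M.sum_sqrt_tri hf (g := fun τ x => ∑ i, |pval (MvPolynomial.pderiv i (q τ)) x|)
      (fun τ => by fun_prop) (fun τ => by fun_prop) fun τ x _ => h1 τ x).trans ?_
    rw [mul_comm 2, mul_assoc]
    refine mul_le_mul_of_nonneg_left ?_ (Real.sqrt_nonneg _)
    have h4 : (2 : ℝ) = √4 := by rw [show (4 : ℝ) = 2 ^ 2 by norm_num, Real.sqrt_sq two_pos.le]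
    rw [h4, ← Real.sqrt_mul (by norm_num)]
    refine Real.sqrt_le_sqrt ?_
    refine le_trans ?_ (mul_le_mul_of_nonneg_left (M.sum_grad_le_energy q) (by norm_num))
    rw [Finset.mul_sum]
    refine Finset.sum_le_sum fun τ _ => ?_
    rw [← integral_const_mul]
    refine integral_mono (M.integrableOn_tri τ (by fun_prop)) (M.integrableOn_tri τ (by fun_prop)) fun x => ?_
    simp only [Fin.sum_univ_two]
    have e0 := sq_abs (pval (MvPolynomial.pderiv 0 (q τ)) x)
    have e1 := sq_abs (pval (MvPolynomial.pderiv 1 (q τ)) x)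
    nlinarith [sq_nonneg (|pval (MvPolynomial.pderiv 0 (q τ)) x| - |pval (MvPolynomial.pderiv 1 (q τ)) x|)]
  · refine (M.sum_sqrt_edges hg (g := fun e x => |M.jump (M.sv q) e x|)
      (fun e => by fun_prop) (fun e => by fun_prop) fun e x _ => h2 e x).trans ?_
    refine mul_le_mul_of_nonneg_left (Real.sqrt_le_sqrt ?_) (Real.sqrt_nonneg _)
    simp only [sq_abs]
    exact M.sum_jump_le_energy q

theorem segMean_nbr {τ σ : M.Tri} (h : M.nbr τ = some σ) (f : Plane → ℝ) :
    segMean (M.a σ) (M.b σ) f = segMean (M.a τ) (M.b τ) f := by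
  rw [M.nbr_a h, M.nbr_b h, segMean_symm]

/-- Squaring the sum of the two one-sided traces costs a factor 2; then each side of each triangle
is counted at most once. -/
theorem sum_mag_le (q : M.PS) : ∑ e ∈ M.edges, M.len e ^ 2 * M.mean e (fun x => M.mag q e x ^ 2) ≤
    2 * ∑ τ, (dist (M.a τ) (M.b τ) ^ 2 * segMean (M.a τ) (M.b τ) (fun x => M.sv q τ x ^ 2) +
      dist (M.c τ) (M.a τ) ^ 2 * segMean (M.c τ) (M.a τ) (fun x => M.sv q τ x ^ 2) +
      dist (M.c τ) (M.b τ) ^ 2 * segMean (M.c τ) (M.b τ) (fun x => M.sv q τ x ^ 2)) := by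
  have hsq : ∀ x y : ℝ, (|x| + |y|) ^ 2 ≤ 2 * x ^ 2 + 2 * y ^ 2 := fun x y => by
    have := sq_abs x; have := sq_abs y
    nlinarith [sq_nonneg (|x| - |y|)]
  rw [sum_edges, Finset.mul_sum]
  simp only [mul_add]
  rw [Finset.sum_add_distrib, Finset.sum_add_distrib, add_assoc]
  refine add_le_add ?_ ?_
  · rw [M.sum_eq_sum_plus]
    refine Finset.sum_le_sum fun τ _ => ?_
    change dist (M.a τ) (M.b τ) ^ 2 * segMean (M.a τ) (M.b τ) _ ≤ _
    rcases hn : M.nbr τ with _ | σ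
    · simp only [mag, atNbr, hn, add_zero]
      simp only [sq_abs]
      have : 0 ≤ dist (M.a τ) (M.b τ) ^ 2 * segMean (M.a τ) (M.b τ) (fun x => M.sv q τ x ^ 2) :=
        mul_nonneg (sq_nonneg _) (segMean_nonneg fun x _ => sq_nonneg _)
      linarith
    · simp only [mag, atNbr, hn]
      rw [M.segMean_nbr hn, M.nbr_a hn, M.nbr_b hn, dist_comm (M.b τ), ← mul_add, ← mul_add,
        mul_left_comm]
      refine mul_le_mul_of_nonneg_left ?_ (sq_nonneg _)
      rw [mul_add, ← segMean_const_mul, ← segMean_const_mul, ← segMean_add (by fun_prop) (by fun_prop)]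
      exact segMean_mono (by fun_prop) (by fun_prop) fun x _ => hsq _ _
  · rw [← M.sum_prev (fun τ => 2 * (dist (M.c τ) (M.b τ) ^ 2 * _)), ← Finset.sum_add_distrib]
    refine Finset.sum_le_sum fun τ _ => ?_
    change dist (M.c τ) (M.a τ) ^ 2 * segMean (M.c τ) (M.a τ) _ ≤ _
    simp only [c_prev, b_prev]
    rw [← mul_add, ← mul_add, mul_left_comm]
    refine mul_le_mul_of_nonneg_left ?_ (sq_nonneg _)
    rw [mul_add, ← segMean_const_mul, ← segMean_const_mul, ← segMean_add (by fun_prop) (by fun_prop)]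
    exact segMean_mono (by unfold mag; fun_prop) (by fun_prop) fun x _ => hsq _ _

/-- Shape regularity replaces a squared edge length by κD, and the trace inequality absorbs the
factor D. The constant 6 is 2 from the two sides of an edge times 3 sides of a triangle. -/
theorem _root_.SDG.exists_sum_mag_le (k : ℕ) : ∃ C : ℝ, 0 < C ∧ ∀ {Ω : Set Plane} (M : Mesh Ω) (κ : ℝ),
    M.Shape κ → ∀ q : M.PS, (∀ τ, (q τ).totalDegree ≤ k) →
      ∑ e ∈ M.edges, M.len e ^ 2 * M.mean e (fun x => M.mag q e x ^ 2) ≤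
        C * κ * ∑ τ, ∫ x in M.tri τ, M.sv q τ x ^ 2 := by
  obtain ⟨C, hC, h⟩ := exists_trace k
  refine ⟨6 * C, by positivity, fun {Ω} M κ hκ q hq => (M.sum_mag_le q).trans ?_⟩
  rw [Finset.mul_sum, Finset.mul_sum]
  refine Finset.sum_le_sum fun τ _ => ?_
  obtain ⟨h1, h2, h3⟩ := h M τ (q τ) (hq τ)
  obtain ⟨s1, s2, s3⟩ := hκ τ
  have hκ0 : 0 ≤ κ := by
    by_contra hneg
    have := mul_neg_of_neg_of_pos (not_le.1 hneg) (M.D_pos τ)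
    linarith [sq_nonneg (dist (M.a τ) (M.b τ))]
  have key : ∀ d m I : ℝ, d ≤ κ * M.D τ → 0 ≤ m → M.D τ * m ≤ C * I → d * m ≤ κ * (C * I) := by
    intro d m I hd hm hI
    calc d * m ≤ κ * M.D τ * m := by gcongr
      _ = κ * (M.D τ * m) := by ring
      _ ≤ κ * (C * I) := by gcongr
  have k1 := key _ _ _ s2 (segMean_nonneg fun x _ => sq_nonneg _) h1
  have k2 := key _ _ _ s3 (segMean_nonneg fun x _ => sq_nonneg _) h2
  have k3 := key _ _ _ s1 (segMean_nonneg fun x _ => sq_nonneg _) h3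
  unfold sv
  linarith

theorem sum_D (hΩ : IsPolygonalDomain Ω) : ∑ τ, M.D τ = 2 * volume.real Ω := by
  have h1 := M.setIntegral_eq_sum hΩ (g := fun _ => 1) fun τ => M.integrableOn_tri τ continuous_const
  have h2 : ∫ ξ in refTri, (1 : ℝ) = 1 / 2 := by
    rw [setIntegral_refTri continuous_const]
    simp only [intervalIntegral.integral_const, smul_eq_mul, mul_one, sub_zero]
    rw [intervalIntegral.integral_sub (by simp) (by simp)]
    simp
    norm_num
  simp only [M.setIntegral_tri, h2] at h1
  rw [setIntegral_const, ← Finset.sum_mul] at h1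
  simp only [smul_eq_mul, mul_one] at h1
  linarith

theorem sum_len_sq_le (hΩ : IsPolygonalDomain Ω) {κ : ℝ} (hκ : M.Shape κ) :
    ∑ e ∈ M.edges, M.len e ^ 2 ≤ 4 * κ * volume.real Ω := by
  have h1 : ∑ τ ∈ M.plus, M.len (.inl τ) ^ 2 ≤ ∑ τ, κ * M.D τ :=
    (Finset.sum_le_sum_of_subset_of_nonneg (Finset.subset_univ _) fun _ _ _ => sq_nonneg _).trans
      (Finset.sum_le_sum fun τ _ => (hκ τ).1)
  have h2 : ∑ τ, M.len (.inr τ) ^ 2 ≤ ∑ τ, κ * M.D τ := Finset.sum_le_sum fun τ _ => (hκ τ).2.1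
  rw [← Finset.mul_sum, M.sum_D hΩ] at h1 h2
  rw [sum_edges]
  linarith

/-- The jump of q² factors as the sum of the two traces times the jump of q; on a boundary edge the
missing trace counts as zero. -/
theorem abs_jump_sq_le (q : M.PS) (e : M.Edge) (x : Plane) :
    |M.jump (M.sv fun τ => q τ * q τ) e x| ≤ M.mag q e x * |M.jump (M.sv q) e x| := by
  have h : ∀ y z : ℝ, |y * y - z * z| ≤ (|y| + |z|) * |y - z| := fun y z => by
    rw [show y * y - z * z = (y + z) * (y - z) by ring, abs_mul]
    exact mul_le_mul_of_nonneg_right (abs_add_le _ _) (abs_nonneg _)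
  cases e with
  | inl τ =>
    rcases hn : M.nbr τ with _ | σ
    · simp only [jump, mag, jumpP, atNbr, hn, sv, pval_mul, abs_mul, add_zero]; exact le_rfl
    · simp only [jump, mag, jumpP, atNbr, hn, sv, pval_mul]; exact h _ _
  | inr τ =>
    unfold jump mag jumpD
    simp only [sv, pval_mul]; exact h _ _

theorem mag_sq_le (q : M.PS) (e : M.Edge) (x : Plane) :
    M.mag q e x ^ 2 ≤ 2 * M.mag (fun τ => q τ * q τ) e x := by
  have h : ∀ y z : ℝ, (|y| + |z|) ^ 2 ≤ 2 * (|y * y| + |z * z|) := fun y z => by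
    rw [abs_mul, abs_mul]
    nlinarith [sq_nonneg (|y| - |z|)]
  cases e with
  | inl τ =>
    unfold mag atNbr
    dsimp only
    split
    · simp only [sv, pval_mul]; exact h _ _
    · simp only [sv, pval_mul]
      simpa using h (pval (q τ) x) 0
  | inr τ =>
    unfold mag
    simp only [sv, pval_mul]; exact h _ _

theorem sum_abs_pderiv_sq (q : M.PS) (τ : M.Tri) (x : Plane) :
    ∑ i, |pval (MvPolynomial.pderiv i (q τ * q τ)) x| =
      |2 * M.sv q τ x| * ∑ i, |pval (MvPolynomial.pderiv i (q τ)) x| := by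
  rw [Finset.mul_sum]
  refine Finset.sum_congr rfl fun i _ => ?_
  rw [Derivation.leibniz, smul_eq_mul, pval_add, pval_mul, ← two_mul, ← mul_assoc, abs_mul]
  rfl

/-- Discrete Poincaré and `L^4` inequalities, with the `L^4` inequality also on the edges. -/
theorem exists_poincare (hΩ : IsPolygonalDomain Ω) (k : ℕ) (κ : ℝ) (hκ0 : 0 < κ) : ∃ C : ℝ, 0 < C ∧
    ∀ (M : Mesh Ω), M.Shape κ → ∀ q : M.PS, (∀ τ, (q τ).totalDegree ≤ k) →
      (∑ τ, ∫ x in M.tri τ, M.sv q τ x ^ 2) ≤ C * M.energy q ∧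
      (∑ τ, ∫ x in M.tri τ, M.sv q τ x ^ 4) ≤ C * M.energy q ^ 2 ∧
      ∑ e ∈ M.edges, M.len e ^ 2 * M.mean e (fun x => M.mag q e x ^ 4) ≤ C * M.energy q ^ 2 := by
  obtain ⟨C₀, hC₀, h₀⟩ := exists_sobolev
  obtain ⟨C₁, hC₁, h₁⟩ := exists_sum_mag_le k
  -- The L⁴ bound on the edges is a trace bound for q², whose degree is at most 2k.
  obtain ⟨C₂, hC₂, h₂⟩ := exists_sum_mag_le (2 * k)
  set V := volume.real Ω with hV
  have hV0 : 0 ≤ V := measureReal_nonneg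
  -- Unit weights in `variation_le`: their squared norm is the area of Ω on the triangles, and on
  -- the edges the sum of the squared lengths, at most 4κ times the area.
  set P := C₀ * (2 * √V + √(4 * κ * V)) ^ 2 with hP
  have hP0 : 0 ≤ P := by positivity
  -- The weights for q² in `variation_le`: |2q| has squared norm at most 4P times the energy, and
  -- `mag` at most C₁κP times the energy, both by the Poincaré inequality.
  set Q := C₀ * (4 * √P + √(C₁ * κ * P)) ^ 2 with hQ
  have hQ0 : 0 ≤ Q := by positivity
  refine ⟨P + Q + 4 * (C₂ * κ * Q) + 1, by positivity, fun M hM q hq => ?_⟩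
  have hE := M.energy_nonneg q
  have hE2 := Real.sq_sqrt hE
  have p1 : (∑ τ, ∫ x in M.tri τ, M.sv q τ x ^ 2) ≤ P * M.energy q := by
    have hv := M.variation_le q q (f := fun _ _ => 1) (g := fun _ _ => 1)
      (fun _ => continuous_const) (fun _ => continuous_const) (fun _ _ => by simp) (fun _ _ => by simp)
    have e1 : (∑ τ, ∫ x in M.tri τ, (1 : ℝ) ^ 2) = V := by
      simp only [one_pow]
      rw [← M.setIntegral_eq_sum hΩ (fun τ => M.integrableOn_tri τ continuous_const), setIntegral_const]
      simp [hV]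
    have e2 : ∑ e ∈ M.edges, M.len e ^ 2 * M.mean e (fun x => (1 : ℝ) ^ 2) ≤ 4 * κ * V := by
      simpa [mean, segMean] using M.sum_len_sq_le hΩ hM
    rw [e1] at hv
    have hv0 : 0 ≤ M.variation q := by
      rw [variation_eq]
      exact add_nonneg (Finset.sum_nonneg fun τ _ => integral_nonneg fun x =>
        Finset.sum_nonneg fun i _ => abs_nonneg _) (Finset.sum_nonneg fun e _ =>
        edgeInt_nonneg fun x _ => abs_nonneg _)
    calc _ ≤ C₀ * M.variation q ^ 2 := h₀ M q
      _ ≤ C₀ * ((2 * √V + √(4 * κ * V)) * √(M.energy q)) ^ 2 := by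
        have := Real.sqrt_le_sqrt e2
        gcongr
        refine hv.trans ?_
        gcongr
      _ = P * M.energy q := by rw [mul_pow, hE2]; ring
  have p2 : (∑ τ, ∫ x in M.tri τ, M.sv q τ x ^ 4) ≤ Q * M.energy q ^ 2 := by
    have hv := M.variation_le (fun τ => q τ * q τ) q (f := fun τ x => |2 * M.sv q τ x|) (g := M.mag q)
      (fun _ => by fun_prop) (fun _ => by fun_prop) (fun τ x => (M.sum_abs_pderiv_sq q τ x).le)
      (M.abs_jump_sq_le q)
    have e1 : (∑ τ, ∫ x in M.tri τ, |2 * M.sv q τ x| ^ 2) ≤ 4 * (P * M.energy q) := by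
      simp only [sq_abs, mul_pow]
      simp only [integral_const_mul]
      rw [← Finset.mul_sum]
      norm_num
      linarith
    have e2 := h₁ M κ hM q hq
    have e3 : C₁ * κ * (∑ τ, ∫ x in M.tri τ, M.sv q τ x ^ 2) ≤ C₁ * κ * P * M.energy q := by
      rw [mul_assoc (C₁ * κ)]
      gcongr
    have hv0 : 0 ≤ M.variation fun τ => q τ * q τ := by
      rw [variation_eq]
      exact add_nonneg (Finset.sum_nonneg fun τ _ => integral_nonneg fun x =>
        Finset.sum_nonneg fun i _ => abs_nonneg _) (Finset.sum_nonneg fun e _ =>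
        edgeInt_nonneg fun x _ => abs_nonneg _)
    have s1 : √(4 * (P * M.energy q)) = 2 * (√P * √(M.energy q)) := by
      rw [Real.sqrt_mul (by norm_num), Real.sqrt_mul hP0, show (4 : ℝ) = 2 ^ 2 by norm_num,
        Real.sqrt_sq two_pos.le]
    have s2 : √(C₁ * κ * P * M.energy q) = √(C₁ * κ * P) * √(M.energy q) :=
      Real.sqrt_mul (by positivity) _
    have t1 := (Real.sqrt_le_sqrt e1).trans_eq s1
    have t2 := (Real.sqrt_le_sqrt (e2.trans e3)).trans_eq s2
    have e4 : (∑ τ, ∫ x in M.tri τ, M.sv q τ x ^ 4) =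
        ∑ τ, ∫ x in M.tri τ, M.sv (fun τ => q τ * q τ) τ x ^ 2 := by
      refine Finset.sum_congr rfl fun τ _ => ?_
      congr 1
      ext x
      simp only [sv, pval_mul]; ring
    rw [e4]
    calc _ ≤ C₀ * (M.variation fun τ => q τ * q τ) ^ 2 := h₀ M _
      _ ≤ C₀ * ((2 * (2 * (√P * √(M.energy q))) + √(C₁ * κ * P) * √(M.energy q)) *
            √(M.energy q)) ^ 2 := by
        gcongr
        refine hv.trans ?_
        gcongr
      _ = C₀ * (4 * √P + √(C₁ * κ * P)) ^ 2 * (√(M.energy q) ^ 2) ^ 2 := by ring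
      _ = Q * M.energy q ^ 2 := by rw [hE2]
  have p3 : ∑ e ∈ M.edges, M.len e ^ 2 * M.mean e (fun x => M.mag q e x ^ 4) ≤
      4 * (C₂ * κ * Q) * M.energy q ^ 2 := by
    have hdeg : ∀ τ, (q τ * q τ).totalDegree ≤ 2 * k := fun τ =>
      (MvPolynomial.totalDegree_mul _ _).trans (by have := hq τ; omega)
    have e1 := h₂ M κ hM (fun τ => q τ * q τ) hdeg
    have e4 : (∑ τ, ∫ x in M.tri τ, M.sv q τ x ^ 4) =
        ∑ τ, ∫ x in M.tri τ, M.sv (fun τ => q τ * q τ) τ x ^ 2 := by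
      refine Finset.sum_congr rfl fun τ _ => ?_
      congr 1
      ext x
      simp only [sv, pval_mul]; ring
    rw [← e4] at e1
    calc _ ≤ ∑ e ∈ M.edges, 4 * (M.len e ^ 2 * M.mean e (fun x => M.mag (fun τ => q τ * q τ) e x ^ 2)) := by
          refine Finset.sum_le_sum fun e _ => ?_
          rw [mul_left_comm]
          refine mul_le_mul_of_nonneg_left ?_ (sq_nonneg _)
          unfold mean
          rw [← segMean_const_mul]
          refine segMean_mono (by fun_prop) (by fun_prop) fun x _ => ?_
          have := pow_le_pow_left₀ (sq_nonneg _) (M.mag_sq_le q e x) 2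
          nlinarith
      _ = 4 * ∑ e ∈ M.edges, M.len e ^ 2 * M.mean e (fun x => M.mag (fun τ => q τ * q τ) e x ^ 2) := by
          rw [Finset.mul_sum]
      _ ≤ 4 * (C₂ * κ * (Q * M.energy q ^ 2)) := by
          refine mul_le_mul_of_nonneg_left (e1.trans ?_) (by norm_num)
          gcongr
      _ = _ := by ring
  have hC2 : 0 ≤ 4 * (C₂ * κ * Q) := by positivity
  refine ⟨p1.trans ?_, p2.trans ?_, p3.trans ?_⟩ <;> gcongr <;> linarith

end Mesh

namespace Mesh

variable {Ω : Set Plane} (M : Mesh Ω)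

/-! ### The norm of discrete velocities and the convective form -/

/-- A component of a piecewise polynomial vector. -/
def comp (v : M.PV) (i : Fin 2) : M.PS := fun τ => v τ i

theorem jumpP_vv_apply (v : M.PV) (τ : M.Tri) (x : Plane) (i : Fin 2) :
    M.jumpP (M.vv v) τ x i = M.jumpP (M.sv (M.comp v i)) τ x := by
  rcases hn : M.nbr τ with _ | σ <;> simp only [jumpP, hn] <;> rfl

theorem hP_pos (τ : M.Tri) : 0 < M.hP τ := dist_pos.2 (M.a_ne_b τ)
theorem hD_pos (τ : M.Tri) : 0 < M.hD τ := dist_pos.2 (M.c_ne_a τ)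

theorem inv_hP_mul_intP (τ : M.Tri) (f : Plane → ℝ) :
    (M.hP τ)⁻¹ * M.intP τ f = segMean (M.a τ) (M.b τ) f :=
  inv_mul_cancel_left₀ (M.hP_pos τ).ne' _

theorem inv_hD_mul_intD (τ : M.Tri) (f : Plane → ℝ) :
    (M.hD τ)⁻¹ * M.intD τ f = segMean (M.c τ) (M.a τ) f :=
  inv_mul_cancel_left₀ (M.hD_pos τ).ne' _

/-- The part of the norm of a velocity that comes from its jumps. -/
def jumpEnergy (v : M.PV) : ℝ :=
  (∑ τ ∈ M.plus, segMean (M.a τ) (M.b τ) (fun x => M.jumpP (M.vv v) τ x ⬝ᵥ M.jumpP (M.vv v) τ x)) +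
    ∑ τ, segMean (M.c τ) (M.a τ) (fun x => (M.jumpD (M.vv v) τ x ⬝ᵥ M.tD τ) ^ 2)

theorem dot_self_nonneg (u : Fin 2 → ℝ) : 0 ≤ u ⬝ᵥ u :=
  Finset.sum_nonneg fun _ _ => mul_self_nonneg _

theorem sq_le_dot_self (u : Fin 2 → ℝ) (i : Fin 2) : u i ^ 2 ≤ u ⬝ᵥ u := by
  rw [sq]
  exact Finset.single_le_sum (f := fun j => u j * u j) (fun j _ => mul_self_nonneg _) (Finset.mem_univ i)

theorem ipT_self_nonneg (H : M.PT) : 0 ≤ M.ipT H H :=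
  Finset.sum_nonneg fun _ _ => integral_nonneg fun _ =>
    Finset.sum_nonneg fun _ _ => Finset.sum_nonneg fun _ _ => mul_self_nonneg _

theorem ipV_self_nonneg (v : M.PV) : 0 ≤ M.ipV v v :=
  Finset.sum_nonneg fun _ _ => integral_nonneg fun _ => dot_self_nonneg _

theorem jumpEnergy_nonneg (v : M.PV) : 0 ≤ M.jumpEnergy v :=
  add_nonneg (Finset.sum_nonneg fun _ _ => segMean_nonneg fun _ _ => dot_self_nonneg _)
    (Finset.sum_nonneg fun _ _ => segMean_nonneg fun _ _ => sq_nonneg _)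

theorem normh_eq (v : M.PV) : M.normh v = √(M.ipT (M.gradV v) (M.gradV v) + M.jumpEnergy v) := by
  unfold normh jumpEnergy
  simp only [inv_hP_mul_intP, inv_hD_mul_intD, add_assoc]

theorem normh_nonneg (v : M.PV) : 0 ≤ M.normh v := Real.sqrt_nonneg _

theorem normh_sq (v : M.PV) :
    M.normh v ^ 2 = M.ipT (M.gradV v) (M.gradV v) + M.jumpEnergy v := by
  rw [normh_eq, Real.sq_sqrt (add_nonneg (M.ipT_self_nonneg _) (M.jumpEnergy_nonneg _))]

theorem jumpD_eq {k : ℕ} {v : M.PV} (hv : v ∈ M.Vh k) {τ : M.Tri} {x : Plane}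
    (hx : x ∈ segment ℝ (M.c τ) (M.a τ)) (i : Fin 2) :
    M.jumpD (M.vv v) τ x i = (M.jumpD (M.vv v) τ x ⬝ᵥ M.tD τ) * M.tD τ i := by
  have h1 := dotProduct_eq_normal_tangent (M.c_ne_a τ) (M.jumpD (M.vv v) τ x) (Pi.single i 1)
  rw [dotProduct_single, single_dotProduct, single_dotProduct] at h1
  have h2 : M.jumpD (M.vv v) τ x ⬝ᵥ normal (M.c τ) (M.a τ) = 0 := hv.2 τ x hx
  rw [h2, zero_mul, zero_add, mul_one, one_mul] at h1
  exact h1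

theorem jumpD_sq_le {k : ℕ} {v : M.PV} (hv : v ∈ M.Vh k) {τ : M.Tri} {x : Plane}
    (hx : x ∈ segment ℝ (M.c τ) (M.a τ)) (i : Fin 2) :
    M.jumpD (M.vv v) τ x i ^ 2 ≤ (M.jumpD (M.vv v) τ x ⬝ᵥ M.tD τ) ^ 2 := by
  rw [M.jumpD_eq hv hx i, mul_pow]
  have := (sq_le_one_iff_abs_le_one _).2 (abs_tangent_le (M.c τ) (M.a τ) i)
  exact mul_le_of_le_one_right (sq_nonneg _) this

/-- The norm ‖·‖_h contains only tangential jumps on dual edges, but for elements of V_h the normal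
jumps vanish there, so it controls the full jumps and every scalar estimate applies to the
components. -/
theorem energy_comp_le {k : ℕ} {v : M.PV} (hv : v ∈ M.Vh k) (i : Fin 2) :
    M.energy (M.comp v i) ≤ M.normh v ^ 2 := by
  rw [normh_sq]
  refine add_le_add ?_ ?_
  · refine Finset.sum_le_sum fun τ _ => ?_
    refine integral_mono (M.integrableOn_tri τ (by fun_prop))
      (M.integrableOn_tri τ (M.continuous_ipT_integrand _ _ τ)) fun x => ?_
    dsimp only
    refine le_trans (le_of_eq ?_) (Finset.single_le_sum (f := fun i => ∑ j, M.tv (M.gradV v) τ x i j *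
      M.tv (M.gradV v) τ x i j) (fun j _ => Finset.sum_nonneg fun _ _ => mul_self_nonneg _) (Finset.mem_univ i))
    simp only [sq]
    rfl
  · rw [sum_edges]
    refine add_le_add (Finset.sum_le_sum fun τ _ => ?_) (Finset.sum_le_sum fun τ _ => ?_)
    · refine segMean_mono (by fun_prop) (by fun_prop) fun x _ => ?_
      change M.jumpP (M.sv (M.comp v i)) τ x ^ 2 ≤ _
      rw [← jumpP_vv_apply]
      exact sq_le_dot_self _ _
    · exact segMean_mono (by fun_prop) (by fun_prop) fun x hx => M.jumpD_sq_le hv hx i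

/-- The sum of the magnitudes of the components. -/
def vmag (v : M.PV) (e : M.Edge) (x : Plane) : ℝ := ∑ i, M.mag (M.comp v i) e x

/-- The integrand on the edges of the convective form. -/
def flux (w ψ v : M.PV) : M.Edge → Plane → ℝ
  | .inl τ => fun x => (if M.nbr τ ≠ none then
        (M.avgP (M.vv w) τ x ⬝ᵥ M.nP τ) * (M.avgP (M.vv ψ) τ x ⬝ᵥ M.jumpP (M.vv v) τ x) else 0) +
      |M.avgP (M.vv w) τ x ⬝ᵥ M.nP τ| * (M.jumpP (M.vv ψ) τ x ⬝ᵥ M.jumpP (M.vv v) τ x)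
  | .inr τ => fun x =>
      (M.avgD (M.vv w) τ x ⬝ᵥ M.nD τ) * (M.avgD (M.vv ψ) τ x ⬝ᵥ M.jumpD (M.vv v) τ x) +
      |M.avgD (M.vv w) τ x ⬝ᵥ M.nD τ| * (M.jumpD (M.vv ψ) τ x ⬝ᵥ M.jumpD (M.vv v) τ x)

theorem continuous_flux (w ψ v : M.PV) (e : M.Edge) : Continuous (M.flux w ψ v e) := by
  cases e with
  | inl τ =>
    unfold flux
    dsimp only
    split <;> fun_prop
  | inr τ =>
    unfold flux
    dsimp only
    fun_prop

theorem Nh_eq (w ψ v : M.PV) : M.Nh w ψ v =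
    -(∑ τ, ∫ x in M.tri τ, ∑ i, ∑ j,
      M.vv ψ τ x i * M.vv w τ x j * M.tv (M.gradV v) τ x i j) +
    ∑ e ∈ M.edges, edgeInt (M.src e) (M.tgt e) (M.flux w ψ v e) := by
  unfold Nh
  rw [add_assoc, add_add_add_comm, sum_edges]
  congr 2
  · rw [Finset.sum_filter, ← Finset.sum_add_distrib]
    refine Finset.sum_congr rfl fun τ _ => ?_
    change _ = edgeInt (M.a τ) (M.b τ) (M.flux w ψ v (.inl τ))
    by_cases hn : M.nbr τ ≠ none
    · simp only [flux, if_pos hn]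
      exact (edgeInt_add (by fun_prop) (by fun_prop)).symm
    · simp only [flux, if_neg hn, zero_add]
      rfl
  · rw [← Finset.sum_add_distrib]
    refine Finset.sum_congr rfl fun τ _ => ?_
    exact (edgeInt_add (by fun_prop) (by fun_prop)).symm

theorem abs_avgP_le (v : M.PV) (τ : M.Tri) (x : Plane) (i : Fin 2) :
    |M.avgP (M.vv v) τ x i| ≤ M.mag (M.comp v i) (.inl τ) x := by
  rcases hn : M.nbr τ with _ | σ
  · simp only [avgP, mag, atNbr, hn, add_zero]; exact le_rfl
  · simp only [avgP, mag, atNbr, hn, Pi.smul_apply, Pi.add_apply, smul_eq_mul]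
    change |2⁻¹ * (M.sv (M.comp v i) τ x + M.sv (M.comp v i) σ x)| ≤ _
    rw [abs_mul, abs_of_pos (by norm_num : (0 : ℝ) < 2⁻¹)]
    have := abs_add_le (M.sv (M.comp v i) τ x) (M.sv (M.comp v i) σ x)
    have h0 := abs_nonneg (M.sv (M.comp v i) τ x + M.sv (M.comp v i) σ x)
    linarith

theorem abs_jumpP_le (v : M.PV) (τ : M.Tri) (x : Plane) (i : Fin 2) :
    |M.jumpP (M.vv v) τ x i| ≤ M.mag (M.comp v i) (.inl τ) x := by
  rcases hn : M.nbr τ with _ | σ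
  · simp only [jumpP, mag, atNbr, hn, add_zero]; exact le_rfl
  · simp only [jumpP, mag, atNbr, hn]
    exact abs_sub (M.sv (M.comp v i) τ x) (M.sv (M.comp v i) σ x)

theorem abs_avgD_le (v : M.PV) (τ : M.Tri) (x : Plane) (i : Fin 2) :
    |M.avgD (M.vv v) τ x i| ≤ M.mag (M.comp v i) (.inr τ) x := by
  simp only [avgD, mag, Pi.smul_apply, Pi.add_apply, smul_eq_mul]
  change |2⁻¹ * (M.sv (M.comp v i) τ x + M.sv (M.comp v i) (M.prev τ) x)| ≤ _
  rw [abs_mul, abs_of_pos (by norm_num : (0 : ℝ) < 2⁻¹)]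
  have := abs_add_le (M.sv (M.comp v i) τ x) (M.sv (M.comp v i) (M.prev τ) x)
  have h0 := abs_nonneg (M.sv (M.comp v i) τ x + M.sv (M.comp v i) (M.prev τ) x)
  linarith

theorem abs_jumpD_le (v : M.PV) (τ : M.Tri) (x : Plane) (i : Fin 2) :
    |M.jumpD (M.vv v) τ x i| ≤ M.mag (M.comp v i) (.inr τ) x :=
  abs_sub (M.sv (M.comp v i) τ x) (M.sv (M.comp v i) (M.prev τ) x)

theorem avgP_vv_sub (z₁ z₂ : M.PV) (τ : M.Tri) (x : Plane) :
    M.avgP (M.vv (z₁ - z₂)) τ x = M.avgP (M.vv z₁) τ x - M.avgP (M.vv z₂) τ x := by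
  rw [eq_sub_iff_add_eq, ← avgP_add, ← vv_add, sub_add_cancel]

theorem avgD_vv_sub (z₁ z₂ : M.PV) (τ : M.Tri) (x : Plane) :
    M.avgD (M.vv (z₁ - z₂)) τ x = M.avgD (M.vv z₁) τ x - M.avgD (M.vv z₂) τ x := by
  rw [eq_sub_iff_add_eq, ← avgD_add, ← vv_add, sub_add_cancel]

theorem abs_dot_le {u w m : Fin 2 → ℝ} (h : ∀ i, |u i| ≤ m i) :
    |u ⬝ᵥ w| ≤ (∑ i, m i) * ∑ i, |w i| := by
  have hm : ∀ i, 0 ≤ m i := fun i => (abs_nonneg _).trans (h i)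
  calc |u ⬝ᵥ w| ≤ ∑ i, |u i * w i| := Finset.abs_sum_le_sum_abs _ _
    _ ≤ ∑ i, (∑ j, m j) * |w i| := by
        refine Finset.sum_le_sum fun i _ => ?_
        rw [abs_mul]
        exact mul_le_mul_of_nonneg_right ((h i).trans
          (Finset.single_le_sum (fun j _ => hm j) (Finset.mem_univ i))) (abs_nonneg _)
    _ = _ := by rw [Finset.mul_sum]

theorem abs_dot_normal_le {u m : Fin 2 → ℝ} (h : ∀ i, |u i| ≤ m i) (p q : Plane) :
    |u ⬝ᵥ normal p q| ≤ ∑ i, m i := by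
  refine (Finset.abs_sum_le_sum_abs _ _).trans (Finset.sum_le_sum fun i _ => ?_)
  rw [abs_mul]
  exact (mul_le_of_le_one_right (abs_nonneg _) (abs_normal_le _ _ _)).trans (h i)

/-- The central weight is linear in {z·n} and the upwind weight satisfies ||A| − |A'|| ≤ |A − A'|.
So the difference is governed by z₁ − z₂ in spite of the absolute value; the factor 2 counts the two
terms. -/
theorem flux_sub_le (z₁ z₂ ψ v : M.PV) (e : M.Edge) (x : Plane) :
    M.flux z₁ ψ v e x - M.flux z₂ ψ v e x ≤
      (2 * (M.vmag (z₁ - z₂) e x * M.vmag ψ e x)) * ∑ i, |M.jump (M.sv (M.comp v i)) e x| := by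
  have key : ∀ {A A' B B' m s : ℝ}, |A - A'| ≤ m → |B| ≤ s → |B'| ≤ s →
      A * B + |A| * B' - (A' * B + |A'| * B') ≤ 2 * (m * s) := by
    intro A A' B B' m s h h1 h2
    have h3 : (A - A') * B ≤ m * s := (le_abs_self _).trans (by
      rw [abs_mul]; exact mul_le_mul h h1 (abs_nonneg _) ((abs_nonneg _).trans h))
    have h4 : (|A| - |A'|) * B' ≤ m * s := (le_abs_self _).trans (by
      rw [abs_mul]
      exact mul_le_mul ((abs_abs_sub_abs_le _ _).trans h) h2 (abs_nonneg _) ((abs_nonneg _).trans h))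
    linarith
  have hmag : ∀ (w : M.PV) e, 0 ≤ M.vmag w e x := fun w e =>
    Finset.sum_nonneg fun i _ => M.mag_nonneg _ _ _
  rw [mul_assoc, mul_assoc]
  cases e with
  | inl τ =>
    have hJ : (∑ i, |M.jump (M.sv (M.comp v i)) (.inl τ) x|) = ∑ i, |M.jumpP (M.vv v) τ x i| :=
      Finset.sum_congr rfl fun i _ => by rw [jumpP_vv_apply]; rfl
    rw [hJ]
    have h1 : |M.avgP (M.vv z₁) τ x ⬝ᵥ M.nP τ - M.avgP (M.vv z₂) τ x ⬝ᵥ M.nP τ| ≤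
        M.vmag (z₁ - z₂) (.inl τ) x := by
      rw [← sub_dotProduct, ← avgP_vv_sub]
      exact abs_dot_normal_le (M.abs_avgP_le _ _ _) _ _
    have h2 := abs_dot_le (w := M.jumpP (M.vv v) τ x) (M.abs_avgP_le ψ τ x)
    have h3 := abs_dot_le (w := M.jumpP (M.vv v) τ x) (M.abs_jumpP_le ψ τ x)
    unfold flux
    dsimp only
    split
    · exact key h1 h2 h3
    · have := key (B := 0) h1 (by rw [abs_zero]; exact (abs_nonneg _).trans h2) h3
      rw [mul_zero, mul_zero, zero_add, zero_add] at this
      rw [zero_add, zero_add]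
      exact this
  | inr τ =>
    have h1 : |M.avgD (M.vv z₁) τ x ⬝ᵥ M.nD τ - M.avgD (M.vv z₂) τ x ⬝ᵥ M.nD τ| ≤
        M.vmag (z₁ - z₂) (.inr τ) x := by
      rw [← sub_dotProduct, ← avgD_vv_sub]
      exact abs_dot_normal_le (M.abs_avgD_le _ _ _) _ _
    exact key h1 (abs_dot_le (w := M.jumpD (M.vv v) τ x) (M.abs_avgD_le ψ τ x))
      (abs_dot_le (w := M.jumpD (M.vv v) τ x) (M.abs_jumpD_le ψ τ x))

theorem sum_sqrt_edges_weighted {f g : M.Edge → Plane → ℝ} (hf : ∀ e, Continuous (f e))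
    (hg : ∀ e, Continuous (g e)) (r : M.Edge → ℝ) (hr : ∀ e, 0 ≤ r e) :
    ∑ e ∈ M.edges, r e * M.mean e (fun x => f e x * g e x) ≤
      √(∑ e ∈ M.edges, r e * M.mean e (fun x => f e x ^ 2)) *
        √(∑ e ∈ M.edges, r e * M.mean e (fun x => g e x ^ 2)) := by
  refine sum_le_sqrt_mul_sqrt _
    (fun e _ => mul_nonneg (hr e) (segMean_nonneg fun x _ => sq_nonneg _))
    (fun e _ => mul_nonneg (hr e) (segMean_nonneg fun x _ => sq_nonneg _)) fun e _ t ht => ?_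
  have hfe := hf e
  have hge := hg e
  unfold mean
  rw [← segMean_const_mul, ← segMean_const_mul, ← segMean_const_mul, ← segMean_const_mul,
    ← segMean_const_mul, ← segMean_const_mul, ← segMean_add (by fun_prop) (by fun_prop)]
  refine segMean_mono (by fun_prop) (by fun_prop) fun x _ => ?_
  have := mul_le_mul_of_nonneg_left (two_mul_mul_le ht (f e x) (g e x)) (hr e)
  linarith

/-- Discrete Poincaré and `L^4` inequalities with constant `C`. -/
def SobolevBound (k : ℕ) (C : ℝ) : Prop := ∀ q : M.PS, (∀ τ, (q τ).totalDegree ≤ k) →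
  (∑ τ, ∫ x in M.tri τ, M.sv q τ x ^ 2) ≤ C * M.energy q ∧
  (∑ τ, ∫ x in M.tri τ, M.sv q τ x ^ 4) ≤ C * M.energy q ^ 2 ∧
  ∑ e ∈ M.edges, M.len e ^ 2 * M.mean e (fun x => M.mag q e x ^ 4) ≤ C * M.energy q ^ 2

theorem add_abs_pow_four_le (a b : ℝ) : (|a| + |b|) ^ 4 ≤ 8 * (a ^ 4 + b ^ 4) := by
  have e1 : (|a| + |b|) ^ 2 ≤ 2 * (a ^ 2 + b ^ 2) := by
    have := sq_abs a; have := sq_abs b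
    nlinarith [sq_nonneg (|a| - |b|)]
  have e2 := pow_le_pow_left₀ (sq_nonneg _) e1 2
  nlinarith [sq_nonneg (a ^ 2 - b ^ 2)]

theorem sqrt_sixteen {C : ℝ} (hC : 0 ≤ C) (r : ℝ) : √(16 * C * (r ^ 2) ^ 2) = 4 * √C * r ^ 2 := by
  rw [Real.sqrt_mul (by positivity), Real.sqrt_sq (sq_nonneg _), Real.sqrt_mul (by norm_num),
    show (16 : ℝ) = 4 ^ 2 by norm_num, Real.sqrt_sq (by norm_num)]

theorem sum_tri_pow_four_le {k : ℕ} {C : ℝ} (hC : 0 < C) (h : M.SobolevBound k C) {w : M.PV} (hw : w ∈ M.Vh k) :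
    (∑ τ, ∫ x in M.tri τ, ((∑ i, |M.vv w τ x i|) ^ 2) ^ 2) ≤ 16 * C * (M.normh w ^ 2) ^ 2 := by
  have e : ∀ i, (∑ τ, ∫ x in M.tri τ, M.sv (M.comp w i) τ x ^ 4) ≤ C * (M.normh w ^ 2) ^ 2 := fun i =>
    (h (M.comp w i) fun τ => hw.1 τ i).2.1.trans (by
      have := M.energy_comp_le hw i
      have := M.energy_nonneg (M.comp w i)
      gcongr)
  have e0 := e 0
  have e1 := e 1
  calc _ ≤ ∑ τ, (8 * (∫ x in M.tri τ, M.sv (M.comp w 0) τ x ^ 4) +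
        8 * ∫ x in M.tri τ, M.sv (M.comp w 1) τ x ^ 4) := by
        refine Finset.sum_le_sum fun τ _ => ?_
        rw [← integral_const_mul, ← integral_const_mul,
          ← integral_add (M.integrableOn_tri τ (by fun_prop)) (M.integrableOn_tri τ (by fun_prop))]
        refine integral_mono (M.integrableOn_tri τ (by fun_prop)) (M.integrableOn_tri τ (by fun_prop))
          fun x => ?_
        simp only [Fin.sum_univ_two, ← pow_mul, ← mul_add]
        exact add_abs_pow_four_le _ _
    _ = 8 * (∑ τ, ∫ x in M.tri τ, M.sv (M.comp w 0) τ x ^ 4) +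
        8 * ∑ τ, ∫ x in M.tri τ, M.sv (M.comp w 1) τ x ^ 4 := by
        rw [Finset.sum_add_distrib, Finset.mul_sum, Finset.mul_sum]
    _ ≤ _ := by linarith

theorem sum_edges_pow_four_le {k : ℕ} {C : ℝ} (hC : 0 < C) (h : M.SobolevBound k C) {w : M.PV} (hw : w ∈ M.Vh k) :
    ∑ e ∈ M.edges, M.len e ^ 2 * M.mean e (fun x => (M.vmag w e x ^ 2) ^ 2) ≤
      16 * C * (M.normh w ^ 2) ^ 2 := by
  have e : ∀ i, ∑ e ∈ M.edges, M.len e ^ 2 * M.mean e (fun x => M.mag (M.comp w i) e x ^ 4) ≤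
      C * (M.normh w ^ 2) ^ 2 := fun i =>
    (h (M.comp w i) fun τ => hw.1 τ i).2.2.trans (by
      have := M.energy_comp_le hw i
      have := M.energy_nonneg (M.comp w i)
      gcongr)
  have e0 := e 0
  have e1 := e 1
  calc _ ≤ ∑ e ∈ M.edges, (8 * (M.len e ^ 2 * M.mean e (fun x => M.mag (M.comp w 0) e x ^ 4)) +
        8 * (M.len e ^ 2 * M.mean e (fun x => M.mag (M.comp w 1) e x ^ 4))) := by
        refine Finset.sum_le_sum fun e _ => ?_
        rw [mul_left_comm, mul_left_comm (8 : ℝ), ← mul_add]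
        refine mul_le_mul_of_nonneg_left ?_ (sq_nonneg _)
        unfold mean
        rw [← segMean_const_mul, ← segMean_const_mul, ← segMean_add (by fun_prop) (by fun_prop)]
        refine segMean_mono (by unfold vmag; fun_prop) (by fun_prop) fun x _ => ?_
        have := add_abs_pow_four_le (M.mag (M.comp w 0) e x) (M.mag (M.comp w 1) e x)
        rw [abs_of_nonneg (M.mag_nonneg _ _ _), abs_of_nonneg (M.mag_nonneg _ _ _)] at this
        simp only [vmag, Fin.sum_univ_two, ← pow_mul, ← mul_add]
        exact this
    _ = 8 * (∑ e ∈ M.edges, M.len e ^ 2 * M.mean e (fun x => M.mag (M.comp w 0) e x ^ 4)) +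
        8 * ∑ e ∈ M.edges, M.len e ^ 2 * M.mean e (fun x => M.mag (M.comp w 1) e x ^ 4) := by
        rw [Finset.sum_add_distrib, Finset.mul_sum, Finset.mul_sum]
    _ ≤ _ := by linarith

theorem sum_grad_sq_le (v : M.PV) :
    (∑ τ, ∫ x in M.tri τ, (∑ i, ∑ j, |M.tv (M.gradV v) τ x i j|) ^ 2) ≤ 4 * M.normh v ^ 2 := by
  have key : ∀ p q r s : ℝ, (|p| + |q| + (|r| + |s|)) ^ 2 ≤ 4 * (p * p + q * q + (r * r + s * s)) := by
    intro p q r s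
    rw [← abs_mul_abs_self p, ← abs_mul_abs_self q, ← abs_mul_abs_self r, ← abs_mul_abs_self s]
    nlinarith [sq_nonneg (|p| - |q|), sq_nonneg (|p| - |r|), sq_nonneg (|p| - |s|), sq_nonneg (|q| - |r|),
      sq_nonneg (|q| - |s|), sq_nonneg (|r| - |s|)]
  have : (∑ τ, ∫ x in M.tri τ, (∑ i, ∑ j, |M.tv (M.gradV v) τ x i j|) ^ 2) ≤
      4 * M.ipT (M.gradV v) (M.gradV v) := by
    unfold ipT
    rw [Finset.mul_sum]
    refine Finset.sum_le_sum fun τ _ => ?_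
    have hc : ∀ i j, Continuous fun x => M.tv (M.gradV v) τ x i j := fun i j => continuous_pval _
    rw [← integral_const_mul]
    refine integral_mono (M.integrableOn_tri τ (by fun_prop))
      (M.integrableOn_tri τ ((M.continuous_ipT_integrand _ _ τ).const_mul 4)) fun x => ?_
    simp only [Fin.sum_univ_two]
    exact key _ _ _ _
  have := M.jumpEnergy_nonneg v
  rw [normh_sq]
  linarith

theorem sum_jump_sq_le {k : ℕ} {v : M.PV} (hv : v ∈ M.Vh k) :
    ∑ e ∈ M.edges, M.mean e (fun x => (∑ i, |M.jump (M.sv (M.comp v i)) e x|) ^ 2) ≤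
      4 * M.normh v ^ 2 := by
  have e5 : ∀ i, ∑ e ∈ M.edges, M.mean e (fun x => M.jump (M.sv (M.comp v i)) e x ^ 2) ≤ M.normh v ^ 2 :=
    fun i => (M.sum_jump_le_energy _).trans (M.energy_comp_le hv i)
  have e50 := e5 0
  have e51 := e5 1
  calc _ ≤ ∑ e ∈ M.edges, (2 * M.mean e (fun x => M.jump (M.sv (M.comp v 0)) e x ^ 2) +
        2 * M.mean e (fun x => M.jump (M.sv (M.comp v 1)) e x ^ 2)) := by
        refine Finset.sum_le_sum fun e _ => ?_
        unfold mean
        rw [← segMean_const_mul, ← segMean_const_mul, ← segMean_add (by fun_prop) (by fun_prop)]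
        refine segMean_mono (by fun_prop) (by fun_prop) fun x _ => ?_
        simp only [Fin.sum_univ_two]
        have q0 := sq_abs (M.jump (M.sv (M.comp v 0)) e x)
        have q1 := sq_abs (M.jump (M.sv (M.comp v 1)) e x)
        nlinarith [sq_nonneg (|M.jump (M.sv (M.comp v 0)) e x| - |M.jump (M.sv (M.comp v 1)) e x|)]
    _ = 2 * (∑ e ∈ M.edges, M.mean e (fun x => M.jump (M.sv (M.comp v 0)) e x ^ 2)) +
        2 * ∑ e ∈ M.edges, M.mean e (fun x => M.jump (M.sv (M.comp v 1)) e x ^ 2) := by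
        rw [Finset.sum_add_distrib, Finset.mul_sum, Finset.mul_sum]
    _ ≤ _ := by linarith

theorem sqrt_mul_sqrt_eq {s x y z : ℝ} (hs : 0 ≤ s) (hx : 0 ≤ x) (hy : 0 ≤ y) (hz : 0 ≤ z) (r : ℝ) (hr : 0 ≤ r) :
    √(r ^ 2 * ((4 * s * x ^ 2) * (4 * s * y ^ 2))) * √(4 * z ^ 2) = r * (8 * s * x * y * z) := by
  rw [show r ^ 2 * ((4 * s * x ^ 2) * (4 * s * y ^ 2)) = (r * (4 * s * x * y)) ^ 2 by ring,
    show 4 * z ^ 2 = (2 * z) ^ 2 by ring, Real.sqrt_sq (by positivity), Real.sqrt_sq (by positivity)]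
  ring

/-- Hölder's inequality with exponents 4, 4, 2: the discrete L⁴ inequality for z and ψ, the energy
for ∇v. -/
theorem volume_term_le {k : ℕ} {C : ℝ} (hC : 0 < C) (h : M.SobolevBound k C) {z ψ : M.PV}
    (hz : z ∈ M.Vh k) (hψ : ψ ∈ M.Vh k) (v : M.PV) :
    -(∑ τ, ∫ x in M.tri τ, ∑ i, ∑ j, M.vv ψ τ x i * M.vv z τ x j * M.tv (M.gradV v) τ x i j) ≤
      8 * √C * M.normh z * M.normh ψ * M.normh v := by
  have nz := M.normh_nonneg z
  have nψ := M.normh_nonneg ψ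
  have nv := M.normh_nonneg v
  have sC0 : 0 ≤ √C := Real.sqrt_nonneg _
  rw [← Finset.sum_neg_distrib]
  simp only [← integral_neg]
  refine (M.sum_sqrt_tri (f := fun τ x => (∑ i, |M.vv ψ τ x i|) * ∑ i, |M.vv z τ x i|)
    (g := fun τ x => ∑ i, ∑ j, |M.tv (M.gradV v) τ x i j|) (fun τ => by fun_prop)
    (fun τ => by
      have : ∀ i j, Continuous fun x => M.tv (M.gradV v) τ x i j := fun i j => continuous_pval _
      fun_prop) (h := fun τ x => -∑ i, ∑ j, M.vv ψ τ x i * M.vv z τ x j * M.tv (M.gradV v) τ x i j)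
    (fun τ => (M.continuous_Nh_integrand z ψ v τ).neg) fun τ x _ => ?_).trans ?_
  · rw [← Finset.sum_neg_distrib, Finset.mul_sum]
    refine Finset.sum_le_sum fun i _ => ?_
    rw [← Finset.sum_neg_distrib, Finset.mul_sum]
    refine Finset.sum_le_sum fun j _ => ?_
    refine (neg_le_abs _).trans ?_
    rw [abs_mul, abs_mul]
    gcongr
    · exact Finset.single_le_sum (f := fun i => |M.vv ψ τ x i|) (fun _ _ => abs_nonneg _) (Finset.mem_univ i)
    · exact Finset.single_le_sum (f := fun i => |M.vv z τ x i|) (fun _ _ => abs_nonneg _) (Finset.mem_univ j)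
  · have e1 : (∑ τ, ∫ x in M.tri τ, ((∑ i, |M.vv ψ τ x i|) * ∑ i, |M.vv z τ x i|) ^ 2) ≤
        (4 * √C * M.normh ψ ^ 2) * (4 * √C * M.normh z ^ 2) := by
      refine (M.sum_sqrt_tri (f := fun τ x => (∑ i, |M.vv ψ τ x i|) ^ 2)
        (g := fun τ x => (∑ i, |M.vv z τ x i|) ^ 2) (fun τ => by fun_prop) (fun τ => by fun_prop)
        (fun τ => by fun_prop) fun τ x _ => (mul_pow _ _ _).le).trans ?_
      rw [← sqrt_sixteen hC.le, ← sqrt_sixteen hC.le]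
      exact mul_le_mul (Real.sqrt_le_sqrt (M.sum_tri_pow_four_le hC h hψ)) (Real.sqrt_le_sqrt (M.sum_tri_pow_four_le hC h hz))
        (Real.sqrt_nonneg _) (Real.sqrt_nonneg _)
    have e2 := M.sum_grad_sq_le v
    have e3 := sqrt_mul_sqrt_eq sC0 nψ nz nv 1 zero_le_one
    rw [one_pow, one_mul, one_mul] at e3
    refine (mul_le_mul (Real.sqrt_le_sqrt e1) (Real.sqrt_le_sqrt e2) (Real.sqrt_nonneg _)
      (Real.sqrt_nonneg _)).trans (e3.trans_le ?_)
    exact le_of_eq (by ring)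

/-- Hölder's inequality with exponents 4, 4, 2 on the edges. The two L⁴ factors take the weight
h_e², and the jump of v appears in the scaling of ‖·‖_h. -/
theorem edge_term_le {k : ℕ} {C : ℝ} (hC : 0 < C) (h : M.SobolevBound k C) {z₁ z₂ ψ v : M.PV}
    (hz : z₁ - z₂ ∈ M.Vh k) (hψ : ψ ∈ M.Vh k) (hv : v ∈ M.Vh k) :
    ∑ e ∈ M.edges, edgeInt (M.src e) (M.tgt e) (fun x => M.flux z₁ ψ v e x - M.flux z₂ ψ v e x) ≤
      16 * √C * M.normh (z₁ - z₂) * M.normh ψ * M.normh v := by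
  have nz := M.normh_nonneg (z₁ - z₂)
  have nψ := M.normh_nonneg ψ
  have nv := M.normh_nonneg v
  have sC0 : 0 ≤ √C := Real.sqrt_nonneg _
  refine (M.sum_sqrt_edges (f := fun e x => 2 * (M.vmag (z₁ - z₂) e x * M.vmag ψ e x))
    (g := fun e x => ∑ i, |M.jump (M.sv (M.comp v i)) e x|) (fun e => by unfold vmag; fun_prop)
    (fun e => by fun_prop) (fun e => (M.continuous_flux _ _ _ e).sub (M.continuous_flux _ _ _ e))
    fun e x _ => M.flux_sub_le z₁ z₂ ψ v e x).trans ?_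
  have e1 : ∑ e ∈ M.edges, M.len e ^ 2 * M.mean e (fun x => (2 * (M.vmag (z₁ - z₂) e x * M.vmag ψ e x)) ^ 2) ≤
      2 ^ 2 * ((4 * √C * M.normh (z₁ - z₂) ^ 2) * (4 * √C * M.normh ψ ^ 2)) := by
    have e3 := M.sum_sqrt_edges_weighted (f := fun e x => M.vmag (z₁ - z₂) e x ^ 2)
      (g := fun e x => M.vmag ψ e x ^ 2) (fun e => by unfold vmag; fun_prop)
      (fun e => by unfold vmag; fun_prop) (fun e => M.len e ^ 2) (fun e => sq_nonneg _)
    have e4 := e3.trans (mul_le_mul (Real.sqrt_le_sqrt (M.sum_edges_pow_four_le hC h hz)) (Real.sqrt_le_sqrt (M.sum_edges_pow_four_le hC h hψ))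
        (Real.sqrt_nonneg _) (Real.sqrt_nonneg _))
    rw [sqrt_sixteen hC.le, sqrt_sixteen hC.le] at e4
    refine le_trans (le_of_eq ?_) (mul_le_mul_of_nonneg_left e4 (by norm_num))
    rw [Finset.mul_sum]
    refine Finset.sum_congr rfl fun e _ => ?_
    rw [mul_left_comm]
    unfold mean
    rw [← segMean_const_mul, ← segMean_const_mul, ← segMean_const_mul]
    refine congrArg _ (funext fun x => ?_)
    ring
  have e2 := M.sum_jump_sq_le hv
  have e3 := sqrt_mul_sqrt_eq sC0 nz nψ nv 2 two_pos.le
  refine (mul_le_mul (Real.sqrt_le_sqrt e1) (Real.sqrt_le_sqrt e2) (Real.sqrt_nonneg _)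
    (Real.sqrt_nonneg _)).trans (e3.trans_le ?_)
  exact le_of_eq (by ring)

theorem Nh_sub_eq (z₁ z₂ ψ v : M.PV) : M.Nh z₁ ψ v - M.Nh z₂ ψ v =
    -(∑ τ, ∫ x in M.tri τ, ∑ i, ∑ j,
      M.vv ψ τ x i * M.vv (z₁ - z₂) τ x j * M.tv (M.gradV v) τ x i j) +
    ∑ e ∈ M.edges, edgeInt (M.src e) (M.tgt e) (fun x => M.flux z₁ ψ v e x - M.flux z₂ ψ v e x) := by
  have e1 : ∀ e, edgeInt (M.src e) (M.tgt e) (fun x => M.flux z₁ ψ v e x - M.flux z₂ ψ v e x) =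
      edgeInt (M.src e) (M.tgt e) (M.flux z₁ ψ v e) - edgeInt (M.src e) (M.tgt e) (M.flux z₂ ψ v e) :=
    fun e => edgeInt_sub (M.continuous_flux _ _ _ e) (M.continuous_flux _ _ _ e)
  have e2 : ∀ τ, (∫ x in M.tri τ, ∑ i, ∑ j, M.vv ψ τ x i * M.vv (z₁ - z₂) τ x j * M.tv (M.gradV v) τ x i j) =
      (∫ x in M.tri τ, ∑ i, ∑ j, M.vv ψ τ x i * M.vv z₁ τ x j * M.tv (M.gradV v) τ x i j) -
      ∫ x in M.tri τ, ∑ i, ∑ j, M.vv ψ τ x i * M.vv z₂ τ x j * M.tv (M.gradV v) τ x i j := by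
    intro τ
    rw [← integral_sub (M.integrableOn_tri τ (M.continuous_Nh_integrand _ _ _ τ))
      (M.integrableOn_tri τ (M.continuous_Nh_integrand _ _ _ τ))]
    congr 1
    ext x
    simp only [← Finset.sum_sub_distrib]
    refine Finset.sum_congr rfl fun i _ => Finset.sum_congr rfl fun j _ => ?_
    rw [vv_sub]
    simp only [Pi.sub_apply]
    ring
  simp only [Nh_eq, e1, e2, Finset.sum_sub_distrib]
  ring

theorem sub_mem_Vh {k : ℕ} {z₁ z₂ : M.PV} (hz₁ : z₁ ∈ M.Vh k) (hz₂ : z₂ ∈ M.Vh k) : z₁ - z₂ ∈ M.Vh k := by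
  refine ⟨fun τ i => (MvPolynomial.totalDegree_sub _ _).trans (max_le (hz₁.1 τ i) (hz₂.1 τ i)),
    fun τ x hx => ?_⟩
  have e : M.jumpD (M.vv (z₁ - z₂)) τ x = M.jumpD (M.vv z₁) τ x - M.jumpD (M.vv z₂) τ x := by
    rw [eq_sub_iff_add_eq, ← jumpD_add, ← vv_add, sub_add_cancel]
  rw [e, sub_dotProduct, hz₁.2 τ x hx, hz₂.2 τ x hx, sub_zero]

theorem exists_Nh_le (hΩ : IsPolygonalDomain Ω) (k : ℕ) (κ : ℝ) (hκ0 : 0 < κ) : ∃ C_N C_P : ℝ,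
    0 < C_N ∧ 0 < C_P ∧ ∀ M : Mesh Ω, M.Shape κ → M.NhLipschitz k C_N ∧ M.Poincare k C_P := by
  obtain ⟨C, hC, h⟩ := exists_poincare hΩ k κ hκ0
  -- The volume and edge terms contribute 8√C and 16√C; the 2 under the root counts the two
  -- components of a velocity.
  refine ⟨24 * √C, √(2 * C), by positivity, by positivity, fun M hM => ⟨?_, ?_⟩⟩
  · intro z₁ hz₁ z₂ hz₂ ψ hψ v hv
    have hz := M.sub_mem_Vh hz₁ hz₂
    have h1 := M.volume_term_le hC (h M hM) hz hψ v
    have h2 := M.edge_term_le hC (h M hM) hz hψ hv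
    rw [Nh_sub_eq]
    linarith
  · intro v hv
    have e : ∀ i, (∑ τ, ∫ x in M.tri τ, M.sv (M.comp v i) τ x ^ 2) ≤ C * M.normh v ^ 2 := fun i =>
      (h M hM (M.comp v i) fun τ => hv.1 τ i).1.trans
        (mul_le_mul_of_nonneg_left (M.energy_comp_le hv i) hC.le)
    have e0 := e 0
    have e1 := e 1
    have e2 : M.ipV v v = (∑ τ, ∫ x in M.tri τ, M.sv (M.comp v 0) τ x ^ 2) +
        ∑ τ, ∫ x in M.tri τ, M.sv (M.comp v 1) τ x ^ 2 := by
      rw [← Finset.sum_add_distrib]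
      refine Finset.sum_congr rfl fun τ _ => ?_
      rw [← integral_add (M.integrableOn_tri τ (by fun_prop)) (M.integrableOn_tri τ (by fun_prop))]
      congr 1
      ext x
      simp only [dotProduct, Fin.sum_univ_two, sq]
      rfl
    unfold normV
    rw [← Real.sqrt_sq (M.normh_nonneg v), ← Real.sqrt_mul (by positivity)]
    exact Real.sqrt_le_sqrt (by linarith)

end Mesh

theorem totalDegree_C_mul_le (r : ℝ) {p : Poly} {k : ℕ} (h : p.totalDegree ≤ k) :
    (MvPolynomial.C r * p).totalDegree ≤ k := by
  refine (MvPolynomial.totalDegree_mul _ _).trans ?_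
  rwa [MvPolynomial.totalDegree_C, zero_add]

theorem totalDegree_smul_le' (r : ℝ) {p : Poly} {k : ℕ} (h : p.totalDegree ≤ k) :
    (r • p).totalDegree ≤ k := by
  rw [MvPolynomial.smul_eq_C_mul]
  exact totalDegree_C_mul_le r h

theorem totalDegree_add_le' {p q : Poly} {k : ℕ} (hp : p.totalDegree ≤ k) (hq : q.totalDegree ≤ k) :
    (p + q).totalDegree ≤ k :=
  (MvPolynomial.totalDegree_add _ _).trans (max_le hp hq)

namespace Mesh

variable {Ω : Set Plane} (M : Mesh Ω)

/-! ### The discrete spaces as submodules -/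

def HhS (k : ℕ) : Submodule ℝ M.PT where
  carrier := M.Hh k
  zero_mem' := by
    have h : M.tv 0 = 0 := by ext τ x i j; simp [tv]
    refine ⟨fun τ i j => by simp, fun τ _ x _ => ?_, fun τ x _ => ?_⟩
    · rw [h]; unfold jumpP; split <;> simp
    · rw [h]; simp [jumpD]
  add_mem' {H G} hH hG := by
    refine ⟨fun τ i j => totalDegree_add_le' (hH.1 τ i j) (hG.1 τ i j), fun τ hn x hx => ?_,
      fun τ x hx => ?_⟩
    · rw [tv_add, jumpP_add, Matrix.add_mulVec, hH.2.1 τ hn x hx, hG.2.1 τ hn x hx, add_zero]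
    · rw [tv_add, jumpD_add, Matrix.add_mulVec, dotProduct_add, hH.2.2 τ x hx, hG.2.2 τ x hx, add_zero]
  smul_mem' r H hH := by
    refine ⟨fun τ i j => totalDegree_smul_le' r (hH.1 τ i j), fun τ hn x hx => ?_, fun τ x hx => ?_⟩
    · rw [tv_smul, jumpP_smul, Matrix.smul_mulVec, hH.2.1 τ hn x hx, smul_zero]
    · rw [tv_smul, jumpD_smul, Matrix.smul_mulVec, dotProduct_smul, hH.2.2 τ x hx, smul_zero]

def VhS (k : ℕ) : Submodule ℝ M.PV where
  carrier := M.Vh k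
  zero_mem' := by
    have h : M.vv 0 = 0 := by ext τ x i; simp [vv]
    refine ⟨fun τ i => by simp, fun τ x _ => ?_⟩
    rw [h]; simp [jumpD]
  add_mem' {v w} hv hw := by
    refine ⟨fun τ i => totalDegree_add_le' (hv.1 τ i) (hw.1 τ i), fun τ x hx => ?_⟩
    rw [vv_add, jumpD_add, add_dotProduct, hv.2 τ x hx, hw.2 τ x hx, add_zero]
  smul_mem' r v hv := by
    refine ⟨fun τ i => totalDegree_smul_le' r (hv.1 τ i), fun τ x hx => ?_⟩
    rw [vv_smul, jumpD_smul, smul_dotProduct, hv.2 τ x hx, smul_zero]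

def QhS (k : ℕ) : Submodule ℝ M.PS where
  carrier := M.Qh k
  zero_mem' := by
    have h : M.sv 0 = 0 := by ext τ x; simp [sv]
    refine ⟨fun τ => by simp, fun τ _ x _ => ?_⟩
    rw [h]; unfold jumpP; split <;> simp
  add_mem' {p q} hp hq := by
    refine ⟨fun τ => totalDegree_add_le' (hp.1 τ) (hq.1 τ), fun τ hn x hx => ?_⟩
    rw [sv_add, jumpP_add, hp.2 τ hn x hx, hq.2 τ hn x hx, add_zero]
  smul_mem' r p hp := by
    refine ⟨fun τ => totalDegree_smul_le' r (hp.1 τ), fun τ hn x hx => ?_⟩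
    rw [sv_smul, jumpP_smul, hp.2 τ hn x hx, smul_zero]

theorem isLinear_mass : IsLinearMap ℝ fun q : M.PS => ∑ τ, ∫ x in M.tri τ, M.sv q τ x := by
  refine isLinearMap_sum _ fun τ _ => M.isLinearMap_tri τ (fun v => by fun_prop) fun x => ⟨?_, ?_⟩
  · intro p q; rw [sv_add]; rfl
  · intro r p; rw [sv_smul]; rfl

def Qh0S (k : ℕ) : Submodule ℝ M.PS where
  carrier := M.Qh0 k
  zero_mem' := ⟨(M.QhS k).zero_mem, M.isLinear_mass.map_zero⟩
  add_mem' {p q} hp hq := ⟨(M.QhS k).add_mem hp.1 hq.1, by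
    have := M.isLinear_mass.map_add p q
    rw [this, hp.2, hq.2, add_zero]⟩
  smul_mem' r p hp := ⟨(M.QhS k).smul_mem r hp.1, by
    have := M.isLinear_mass.map_smul r p
    rw [this, hp.2, smul_zero]⟩

/-! ### Tensors in the frames of the triangles -/

/-- The edge vectors of a triangle from its centre and the dual basis. -/
def t1 (τ : M.Tri) : Fin 2 → ℝ := fun i => M.a τ i - M.c τ i
def t2 (τ : M.Tri) : Fin 2 → ℝ := fun i => M.b τ i - M.c τ i
def g1 (τ : M.Tri) : Fin 2 → ℝ := ![M.t2 τ 1 / M.D τ, -M.t2 τ 0 / M.D τ]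
def g2 (τ : M.Tri) : Fin 2 → ℝ := ![-M.t1 τ 1 / M.D τ, M.t1 τ 0 / M.D τ]

theorem D_eq (τ : M.Tri) : M.D τ = M.t1 τ 0 * M.t2 τ 1 - M.t1 τ 1 * M.t2 τ 0 := by
  simp [D, cross, t1, t2]

theorem frame_identity (τ : M.Tri) (u : Fin 2 → ℝ) (i : Fin 2) :
    (M.t1 τ ⬝ᵥ u) * M.g1 τ i + (M.t2 τ ⬝ᵥ u) * M.g2 τ i = u i := by
  have hD := (M.D_pos τ).ne'
  have h := M.D_eq τ
  fin_cases i <;> simp [g1, g2, dotProduct, Fin.sum_univ_two] <;> field_simp <;> rw [h] <;> ring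

/-- The four rank-one tensors that carry the degrees of freedom of the discrete tensors. -/
def R (τ : M.Tri) : Fin 4 → Fin 2 → Fin 2 → ℝ :=
  ![fun i j => M.g1 τ i * M.t1 τ j, fun i j => M.g2 τ i * M.t2 τ j,
    fun i j => M.g1 τ i * (M.t2 τ j - M.t1 τ j), fun i j => M.g2 τ i * (M.t1 τ j - M.t2 τ j)]

/-- The tensor with given coefficients. -/
def tensor (α : Fin 4 → M.PS) : M.PT := fun τ i j => ∑ m, MvPolynomial.C (M.R τ m i j) * α m τ

theorem tv_tensor (α : Fin 4 → M.PS) (τ : M.Tri) (x : Plane) (i j : Fin 2) :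
    M.tv (M.tensor α) τ x i j = ∑ m, M.R τ m i j * pval (α m τ) x := by
  simp [tv, tensor, pval_sum, pval_mul]

theorem hP_sq (τ : M.Tri) : M.hP τ ^ 2 = (M.t2 τ 0 - M.t1 τ 0) ^ 2 + (M.t2 τ 1 - M.t1 τ 1) ^ 2 := by
  unfold hP t1 t2
  rw [dist_comm, EuclideanSpace.dist_eq, Real.sq_sqrt (by positivity), Fin.sum_univ_two,
    Real.dist_eq, Real.dist_eq, sq_abs, sq_abs]
  ring

theorem hD_sq (τ : M.Tri) : M.hD τ ^ 2 = M.t1 τ 0 ^ 2 + M.t1 τ 1 ^ 2 := by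
  unfold hD t1
  rw [dist_comm, EuclideanSpace.dist_eq, Real.sq_sqrt (by positivity), Fin.sum_univ_two,
    Real.dist_eq, Real.dist_eq, sq_abs, sq_abs]

theorem hD_next_sq (τ : M.Tri) : M.hD (M.next τ) ^ 2 = M.t2 τ 0 ^ 2 + M.t2 τ 1 ^ 2 := M.hD_sq _

theorem tangent_ab (τ : M.Tri) (i : Fin 2) : tangent (M.a τ) (M.b τ) i = (M.t2 τ i - M.t1 τ i) / M.hP τ := by
  simp [tangent, t1, t2, hP]

theorem tangent_ca (τ : M.Tri) (i : Fin 2) : M.tD τ i = M.t1 τ i / M.hD τ := rfl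

/-- The rank-one tensors decouple the traces. On the primal edge only the coefficients 0 and 1
appear, because t₂ − t₁ is tangent to it. On the dual edge along t₁ the component t·Hn sees only the
coefficient 2, and on the one along t₂ only the coefficient 3, because g₁, g₂ is the basis dual to
t₁, t₂. So traces on the three sides can be prescribed independently. -/
theorem tensor_mulVec_nP (α : Fin 4 → M.PS) (τ : M.Tri) (x : Plane) (i : Fin 2) :
    (M.tv (M.tensor α) τ x *ᵥ M.nP τ) i =
      M.D τ / M.hP τ * (pval (α 0 τ) x * M.g1 τ i + pval (α 1 τ) x * M.g2 τ i) := by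
  have hh := (M.hP_pos τ).ne'
  have h := M.D_eq τ
  simp only [Matrix.mulVec, dotProduct, Fin.sum_univ_two, tv_tensor, Fin.sum_univ_four, nP, normal,
    Matrix.cons_val_zero, Matrix.cons_val_one, tangent_ab, R, Matrix.cons_val_two, Matrix.cons_val_three,
    Matrix.tail_cons, Matrix.head_cons, Matrix.cons_val]
  rw [h]
  field_simp
  ring

theorem tensor_tangent_normal (α : Fin 4 → M.PS) (τ : M.Tri) (x : Plane) :
    M.tD τ ⬝ᵥ (M.tv (M.tensor α) τ x *ᵥ M.nD τ) = -(M.D τ / M.hD τ ^ 2 * pval (α 2 τ) x) := by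
  have hh := (M.hD_pos τ).ne'
  have h := M.D_eq τ
  have hD := (M.D_pos τ).ne'
  have h0 : ∀ i, tangent (M.c τ) (M.a τ) i = M.t1 τ i / M.hD τ := fun i => rfl
  simp only [Matrix.mulVec, dotProduct, Fin.sum_univ_two, tv_tensor, Fin.sum_univ_four, nD, normal,
    Matrix.cons_val_zero, Matrix.cons_val_one, tangent_ca, h0, R, Matrix.cons_val, g1, g2]
  field_simp
  rw [h]
  ring

theorem tensor_tangent_normal_next (α : Fin 4 → M.PS) (τ : M.Tri) (x : Plane) :
    M.tD (M.next τ) ⬝ᵥ (M.tv (M.tensor α) τ x *ᵥ M.nD (M.next τ)) =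
      M.D τ / M.hD (M.next τ) ^ 2 * pval (α 3 τ) x := by
  have hh := (M.hD_pos (M.next τ)).ne'
  have h := M.D_eq τ
  have hD := (M.D_pos τ).ne'
  have h0 : ∀ i, tangent (M.c (M.next τ)) (M.a (M.next τ)) i = M.t2 τ i / M.hD (M.next τ) := fun i => rfl
  have h1 : ∀ i, M.t1 (M.next τ) i = M.t2 τ i := fun i => rfl
  simp only [Matrix.mulVec, dotProduct, Fin.sum_univ_two, tv_tensor, Fin.sum_univ_four, nD, normal,
    Matrix.cons_val_zero, Matrix.cons_val_one, tangent_ca, h0, h1, R, Matrix.cons_val, g1, g2]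
  field_simp
  rw [h]
  ring

/-- Contraction with the rank-one tensors. -/
def contr (τ : M.Tri) (m : Fin 4) (G : Fin 2 → Fin 2 → ℝ) : ℝ := ∑ i, ∑ j, M.R τ m i j * G i j

theorem tensor_contract (α : Fin 4 → M.PS) (τ : M.Tri) (x : Plane) (G : Fin 2 → Fin 2 → ℝ) :
    ∑ i, ∑ j, M.tv (M.tensor α) τ x i j * G i j = ∑ m, pval (α m τ) x * M.contr τ m G := by
  simp only [tv_tensor, contr, Fin.sum_univ_two, Fin.sum_univ_four]
  ring

/-- The dual vectors satisfy D|g₁| = |t₂| and D|g₂| = |t₁|. Each tensor thus has as squared norm a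
product of two squared edge lengths over D², whatever the size of the triangle. -/
theorem sum_R_sq {κ : ℝ} (hκ : M.Shape κ) (τ : M.Tri) (m : Fin 4) : ∑ i, ∑ j, M.R τ m i j ^ 2 ≤ κ ^ 2 := by
  have hD := M.D_pos τ
  obtain ⟨s1, s2, s3⟩ := hκ τ
  have e1 : (M.t2 τ 0 - M.t1 τ 0) ^ 2 + (M.t2 τ 1 - M.t1 τ 1) ^ 2 ≤ κ * M.D τ := by
    rw [← M.hP_sq]; exact s1
  have e2 : M.t1 τ 0 ^ 2 + M.t1 τ 1 ^ 2 ≤ κ * M.D τ := by rw [← M.hD_sq]; exact s2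
  have e3 : M.t2 τ 0 ^ 2 + M.t2 τ 1 ^ 2 ≤ κ * M.D τ := by rw [← M.hD_next_sq]; exact s3
  have key : ∀ {u w : ℝ}, 0 ≤ u → 0 ≤ w → u ≤ κ * M.D τ → w ≤ κ * M.D τ →
      u / M.D τ ^ 2 * w ≤ κ ^ 2 := by
    intro u w hu hw h1 h2
    rw [div_mul_eq_mul_div, div_le_iff₀ (by positivity)]
    calc u * w ≤ (κ * M.D τ) * (κ * M.D τ) := mul_le_mul h1 h2 hw (hu.trans h1)
      _ = _ := by ring
  fin_cases m
  · refine le_trans (le_of_eq ?_) (key (by positivity) (by positivity) e3 e2)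
    simp [R, g1, Fin.sum_univ_two]; ring
  · refine le_trans (le_of_eq ?_) (key (by positivity) (by positivity) e2 e3)
    simp [R, g2, Fin.sum_univ_two]; ring
  · refine le_trans (le_of_eq ?_) (key (by positivity) (by positivity) e3 e1)
    simp [R, g1, Fin.sum_univ_two]; ring
  · refine le_trans (le_of_eq ?_) (key (by positivity) (by positivity) e2 e1)
    simp [R, g2, Fin.sum_univ_two]; ring

theorem contr_sq_le {κ : ℝ} (hκ : M.Shape κ) (τ : M.Tri) (m : Fin 4) (G : Fin 2 → Fin 2 → ℝ) :
    M.contr τ m G ^ 2 ≤ κ ^ 2 * ∑ i, ∑ j, G i j * G i j := by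
  have h := M.sum_R_sq hκ τ m
  have h1 := Finset.sum_mul_sq_le_sq_mul_sq Finset.univ (fun p : Fin 2 × Fin 2 => M.R τ m p.1 p.2)
    (fun p => G p.1 p.2)
  simp only [Fintype.sum_prod_type] at h1
  refine h1.trans ?_
  simp only [sq (G _ _)]
  exact mul_le_mul_of_nonneg_right h
    (Finset.sum_nonneg fun _ _ => Finset.sum_nonneg fun _ _ => mul_self_nonneg _)

theorem tensor_sq_le {κ : ℝ} (hκ : M.Shape κ) (α : Fin 4 → M.PS) (τ : M.Tri) (x : Plane) :
    ∑ i, ∑ j, M.tv (M.tensor α) τ x i j * M.tv (M.tensor α) τ x i j ≤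
      4 * κ ^ 2 * ∑ m, pval (α m τ) x ^ 2 := by
  have h : ∀ i j, M.tv (M.tensor α) τ x i j * M.tv (M.tensor α) τ x i j ≤
      (∑ m, M.R τ m i j ^ 2) * ∑ m, pval (α m τ) x ^ 2 := fun i j => by
    rw [tv_tensor, ← sq]
    exact Finset.sum_mul_sq_le_sq_mul_sq _ _ _
  calc _ ≤ ∑ i, ∑ j, (∑ m, M.R τ m i j ^ 2) * ∑ m, pval (α m τ) x ^ 2 :=
        Finset.sum_le_sum fun i _ => Finset.sum_le_sum fun j _ => h i j
    _ = (∑ m, ∑ i, ∑ j, M.R τ m i j ^ 2) * ∑ m, pval (α m τ) x ^ 2 := by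
        simp only [Fin.sum_univ_two, Fin.sum_univ_four]; ring
    _ ≤ (∑ _m : Fin 4, κ ^ 2) * ∑ m, pval (α m τ) x ^ 2 := by
        gcongr with m _
        exact M.sum_R_sq hκ τ m
    _ = _ := by simp

/-- With V the coefficients of G in the frame, the four contractions are V₀₀, V₁₁, V₀₁ − V₀₀ and V₁₀
− V₁₁. They determine V, and the sum of its squares is at most 3 times theirs. The return to the
entries of G costs κ² for each of the four pairs of frame vectors, which makes 12κ². -/
theorem grad_le_contr {κ : ℝ} (hκ : M.Shape κ) (τ : M.Tri) (G : Fin 2 → Fin 2 → ℝ) :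
    ∑ i, ∑ j, G i j * G i j ≤ 12 * κ ^ 2 * ∑ m, M.contr τ m G ^ 2 := by
  have hD := M.D_pos τ
  have h := M.D_eq τ
  obtain ⟨s1, s2, s3⟩ := hκ τ
  have e2 : M.t1 τ 0 ^ 2 + M.t1 τ 1 ^ 2 ≤ κ * M.D τ := by rw [← M.hD_sq]; exact s2
  have e3 : M.t2 τ 0 ^ 2 + M.t2 τ 1 ^ 2 ≤ κ * M.D τ := by rw [← M.hD_next_sq]; exact s3
  let T : Fin 2 → Fin 2 → ℝ := ![M.t1 τ, M.t2 τ]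
  let g : Fin 2 → Fin 2 → ℝ := ![M.g1 τ, M.g2 τ]
  have hT : ∀ p, T p 0 ^ 2 + T p 1 ^ 2 ≤ κ * M.D τ := fun p => by fin_cases p; exacts [e2, e3]
  have hg : ∀ p, (g p 0 ^ 2 + g p 1 ^ 2) * M.D τ ≤ κ := fun p => by
    rw [← mul_le_mul_iff_left₀ hD]
    fin_cases p
    · refine le_trans (le_of_eq ?_) e3
      simp [g, g1]; field_simp; ring
    · refine le_trans (le_of_eq ?_) e2
      simp [g, g2]; field_simp; ring
  let V : Fin 2 → Fin 2 → ℝ := fun p q => ∑ i, ∑ j, g p i * T q j * G i j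
  have hid : ∀ i j, G i j = ∑ p, ∑ q, V p q * (T p i * g q j) := by
    intro i j
    have hc : ∀ u : Fin 2 → ℝ, ∀ i, (M.g1 τ ⬝ᵥ u) * M.t1 τ i + (M.g2 τ ⬝ᵥ u) * M.t2 τ i = u i := by
      intro u i
      fin_cases i <;> simp [g1, g2, dotProduct, Fin.sum_univ_two] <;> field_simp <;> rw [h] <;> ring
    have h1 := hc (fun i => G i j) i
    have h2 := fun i => M.frame_identity τ (G i) j
    simp only [dotProduct, Fin.sum_univ_two] at h1 h2
    simp only [V, T, g, Fin.sum_univ_two, Matrix.cons_val_zero, Matrix.cons_val_one]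
    rw [← h1, ← h2 0, ← h2 1]
    ring
  have hκ0 : 0 ≤ κ := by
    by_contra hneg
    have := mul_neg_of_neg_of_pos (not_le.1 hneg) hD
    linarith [sq_nonneg (dist (M.a τ) (M.b τ))]
  have hTg : ∀ p q, (T p 0 ^ 2 + T p 1 ^ 2) * (g q 0 ^ 2 + g q 1 ^ 2) ≤ κ ^ 2 := by
    intro p q
    calc _ ≤ (κ * M.D τ) * (g q 0 ^ 2 + g q 1 ^ 2) := by gcongr; exact hT p
      _ = κ * ((g q 0 ^ 2 + g q 1 ^ 2) * M.D τ) := by ring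
      _ ≤ κ * κ := by gcongr; exact hg q
      _ = _ := by ring
  have hsq : ∀ i j, G i j * G i j ≤ (∑ p, ∑ q, V p q ^ 2) * ∑ p, ∑ q, (T p i * g q j) ^ 2 := by
    intro i j
    have h1 := Finset.sum_mul_sq_le_sq_mul_sq Finset.univ (fun p : Fin 2 × Fin 2 => V p.1 p.2)
      (fun p => T p.1 i * g p.2 j)
    simp only [Fintype.sum_prod_type] at h1
    rw [← sq, hid i j]
    exact h1
  have hV : ∑ p, ∑ q, V p q ^ 2 ≤ 3 * ∑ m, M.contr τ m G ^ 2 := by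
    have c0 : M.contr τ 0 G = V 0 0 := rfl
    have c1 : M.contr τ 1 G = V 1 1 := rfl
    have c2 : M.contr τ 2 G = V 0 1 - V 0 0 := by
      simp [contr, V, R, g, T, Fin.sum_univ_two]; ring
    have c3 : M.contr τ 3 G = V 1 0 - V 1 1 := by
      simp [contr, V, R, g, T, Fin.sum_univ_two]; ring
    rw [Fin.sum_univ_four, c0, c1, c2, c3]
    simp only [Fin.sum_univ_two]
    nlinarith [sq_nonneg (2 * V 0 0 - V 0 1), sq_nonneg (2 * V 1 1 - V 1 0),
      sq_nonneg (V 0 1 - V 0 0), sq_nonneg (V 1 0 - V 1 1), sq_nonneg (V 0 1 - 2 * V 0 0),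
      sq_nonneg (V 0 1 - 3 / 2 * V 0 0), sq_nonneg (V 1 0 - 3 / 2 * V 1 1)]
  calc _ ≤ ∑ i, ∑ j, (∑ p, ∑ q, V p q ^ 2) * ∑ p, ∑ q, (T p i * g q j) ^ 2 :=
        Finset.sum_le_sum fun i _ => Finset.sum_le_sum fun j _ => hsq i j
    _ = (∑ p, ∑ q, V p q ^ 2) * ∑ p, ∑ q, (T p 0 ^ 2 + T p 1 ^ 2) * (g q 0 ^ 2 + g q 1 ^ 2) := by
        simp only [Fin.sum_univ_two]; ring
    _ ≤ (3 * ∑ m, M.contr τ m G ^ 2) * ∑ p : Fin 2, ∑ q : Fin 2, κ ^ 2 := by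
        refine mul_le_mul hV (Finset.sum_le_sum fun p _ => Finset.sum_le_sum fun q _ => hTg p q)
          (Finset.sum_nonneg fun _ _ => Finset.sum_nonneg fun _ _ => by positivity) (by positivity)
    _ = _ := by simp only [Fin.sum_univ_two]; ring

/-- The form `B_h` on a tensor whose normal traces are multiples of the jumps of the velocity. -/
theorem Bh_of_traces {k : ℕ} {H : M.PT} (hdeg : ∀ τ i j, (H τ i j).totalDegree ≤ k) (v : M.PV) (θ : ℝ)
    (hP : ∀ τ, ∀ x ∈ segment ℝ (M.a τ) (M.b τ),
      M.tv H τ x *ᵥ M.nP τ = (-θ * (M.hP τ)⁻¹) • M.jumpP (M.vv v) τ x)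
    (hD : ∀ τ, ∀ x ∈ segment ℝ (M.c τ) (M.a τ), M.tD τ ⬝ᵥ (M.tv H τ x *ᵥ M.nD τ) =
      -θ * (M.hD τ)⁻¹ * (M.jumpD (M.vv v) τ x ⬝ᵥ M.tD τ))
    (hD' : ∀ τ, ∀ x ∈ segment ℝ (M.c τ) (M.a τ), M.tD τ ⬝ᵥ (M.tv H (M.prev τ) x *ᵥ M.nD τ) =
      -θ * (M.hD τ)⁻¹ * (M.jumpD (M.vv v) τ x ⬝ᵥ M.tD τ)) :
    H ∈ M.Hh k ∧ M.Bh H v = M.ipT H (M.gradV v) + θ * M.jumpEnergy v := by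
  have hPσ : ∀ τ σ, M.nbr τ = some σ → ∀ x ∈ segment ℝ (M.a τ) (M.b τ),
      M.tv H σ x *ᵥ M.nP τ = (-θ * (M.hP τ)⁻¹) • M.jumpP (M.vv v) τ x := by
    intro τ σ hn x hx
    have h1 := hP σ x (by rwa [M.segment_nbr hn])
    have h2 : M.hP σ = M.hP τ := by unfold Mesh.hP; rw [M.nbr_a hn, M.nbr_b hn, dist_comm]
    rw [M.nP_nbr hn, M.jumpP_nbr hn, h2, Matrix.mulVec_neg, smul_neg, neg_inj] at h1
    exact h1
  refine ⟨⟨hdeg, fun τ hn x hx => ?_, fun τ x hx => ?_⟩, ?_⟩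
  · obtain ⟨σ, hσ⟩ := Option.ne_none_iff_exists'.1 hn
    simp only [jumpP, hσ]
    rw [Matrix.sub_mulVec, hP τ x hx, hPσ τ σ hσ x hx, sub_self]
  · unfold jumpD
    rw [Matrix.sub_mulVec, dotProduct_sub, hD τ x hx, hD' τ x hx, sub_self]
  · have e1 : ∀ τ, M.intP τ (fun x => (M.avgP (M.tv H) τ x *ᵥ M.nP τ) ⬝ᵥ M.jumpP (M.vv v) τ x) =
        -θ * segMean (M.a τ) (M.b τ) (fun x => M.jumpP (M.vv v) τ x ⬝ᵥ M.jumpP (M.vv v) τ x) := by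
      intro τ
      rw [← inv_hP_mul_intP, ← mul_assoc]
      unfold intP
      rw [← edgeInt_const_mul]
      refine edgeInt_congr fun x hx => ?_
      have : M.avgP (M.tv H) τ x *ᵥ M.nP τ = (-θ * (M.hP τ)⁻¹) • M.jumpP (M.vv v) τ x := by
        rcases hn : M.nbr τ with _ | σ
        · have := hP τ x hx
          simp only [avgP, hn]
          exact this
        · have h1 := hP τ x hx
          have h2 := hPσ τ σ hn x hx
          simp only [avgP, hn]
          rw [Matrix.smul_mulVec, Matrix.add_mulVec, h1, h2, ← two_smul ℝ, smul_smul]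
          norm_num
      rw [this, smul_dotProduct, smul_eq_mul]
    have e2 : ∀ τ, M.intD τ (fun x => (M.tD τ ⬝ᵥ (M.avgD (M.tv H) τ x *ᵥ M.nD τ)) *
          (M.jumpD (M.vv v) τ x ⬝ᵥ M.tD τ)) =
        -θ * segMean (M.c τ) (M.a τ) (fun x => (M.jumpD (M.vv v) τ x ⬝ᵥ M.tD τ) ^ 2) := by
      intro τ
      rw [← inv_hD_mul_intD, ← mul_assoc]
      unfold intD
      rw [← edgeInt_const_mul]
      refine edgeInt_congr fun x hx => ?_
      have : M.tD τ ⬝ᵥ (M.avgD (M.tv H) τ x *ᵥ M.nD τ) =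
          -θ * (M.hD τ)⁻¹ * (M.jumpD (M.vv v) τ x ⬝ᵥ M.tD τ) := by
        unfold avgD
        rw [Matrix.smul_mulVec, Matrix.add_mulVec, dotProduct_smul, dotProduct_add, hD τ x hx, hD' τ x hx,
          smul_eq_mul]
        ring
      rw [this]
      ring
    unfold Bh jumpEnergy
    simp only [e1, e2, ← Finset.mul_sum]
    ring

end Mesh

/-! ### Test tensors for the inf-sup condition. -/

/-- The composition of a polynomial with the affine map onto a line that has coordinate `L`. -/
def extPoly (p q : Plane) (L f : Poly) : Poly :=
  MvPolynomial.bind₁ (fun i => MvPolynomial.C (p i) + MvPolynomial.C (q i - p i) * L) f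

theorem pval_extPoly (p q : Plane) (L f : Poly) (x : Plane) :
    pval (extPoly p q L f) x = pval f (AffineMap.lineMap p q (pval L x)) := by
  rw [extPoly, pval_bind₁]
  congr 1
  ext i
  simp [pval_add, pval_mul, pval_sub, AffineMap.lineMap_apply]
  ring

theorem totalDegree_extPoly {p q : Plane} {L f : Poly} {k : ℕ} (hL : L.totalDegree ≤ 1)
    (hf : f.totalDegree ≤ k) : (extPoly p q L f).totalDegree ≤ k := by
  refine (totalDegree_bind₁_le (fun i => totalDegree_add_le' ?_ (totalDegree_C_mul_le _ hL)) f).trans hf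
  rw [MvPolynomial.totalDegree_C]; exact Nat.zero_le _

theorem setIntegral_refTri_fst_le {F : ℝ → ℝ} (hF : Continuous F) (h0 : ∀ s, 0 ≤ F s) :
    ∫ ξ in refTri, F ξ.1 ≤ ∫ s in (0 : ℝ)..1, F s := by
  rw [setIntegral_refTri (g := fun ξ => F ξ.1) (by fun_prop)]
  refine intervalIntegral.integral_mono_on zero_le_one (Continuous.intervalIntegrable ?_ _ _)
    (hF.intervalIntegrable _ _) fun s hs => ?_
  · simp only [intervalIntegral.integral_const, smul_eq_mul]; fun_prop
  · simp only [intervalIntegral.integral_const, smul_eq_mul, sub_zero]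
    exact mul_le_of_le_one_left (h0 s) (by linarith [hs.1])

theorem setIntegral_refTri_snd_le {F : ℝ → ℝ} (hF : Continuous F) (h0 : ∀ s, 0 ≤ F s) :
    ∫ ξ in refTri, F ξ.2 ≤ ∫ s in (0 : ℝ)..1, F s := by
  rw [setIntegral_refTri (g := fun ξ => F ξ.2) (by fun_prop)]
  calc _ ≤ ∫ s in (0 : ℝ)..1, ∫ t in (0 : ℝ)..1, F t := by
        refine intervalIntegral.integral_mono_on zero_le_one (Continuous.intervalIntegrable ?_ _ _)
          intervalIntegrable_const fun s hs => ?_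
        · have : Continuous fun b => ∫ t in (0 : ℝ)..b, F t :=
            intervalIntegral.continuous_primitive (fun a b => hF.intervalIntegrable a b) 0
          exact this.comp (by fun_prop)
        · refine intervalIntegral.integral_mono_interval le_rfl (by linarith [hs.2]) (by linarith [hs.1])
            (Filter.Eventually.of_forall h0) (hF.intervalIntegrable _ _)
    _ = _ := by simp

namespace Mesh

variable {Ω : Set Plane} (M : Mesh Ω)

/-- The integrand is constant on the lines parallel to the side opposite to a; in the reference
triangle their parameter length 1 − s is at most 1. -/
theorem setIntegral_ext_lamA_le (τ : M.Tri) (p q : Plane) {F : Plane → ℝ} (hF : Continuous F)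
    (h0 : ∀ x, 0 ≤ F x) :
    ∫ x in M.tri τ, F (AffineMap.lineMap p q (pval (M.lamA τ) x)) ≤ M.D τ * segMean p q F := by
  rw [setIntegral_tri]
  simp only [pval_lamA]
  refine mul_le_mul_of_nonneg_left ?_ (M.D_pos τ).le
  exact setIntegral_refTri_fst_le (F := fun s => F (AffineMap.lineMap p q s))
    (hF.comp AffineMap.lineMap_continuous) fun s => h0 _

theorem setIntegral_ext_lamB_le (τ : M.Tri) (p q : Plane) {F : Plane → ℝ} (hF : Continuous F)
    (h0 : ∀ x, 0 ≤ F x) :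
    ∫ x in M.tri τ, F (AffineMap.lineMap p q (pval (M.lamB τ) x)) ≤ M.D τ * segMean p q F := by
  rw [setIntegral_tri]
  simp only [pval_lamB]
  refine mul_le_mul_of_nonneg_left ?_ (M.D_pos τ).le
  exact setIntegral_refTri_snd_le (F := fun s => F (AffineMap.lineMap p q s))
    (hF.comp AffineMap.lineMap_continuous) fun s => h0 _

/-- The weights of the interior test tensor. -/
def bub (m : Fin 4) (τ : M.Tri) : Poly := ![M.lamC τ, M.lamC τ, M.lamB τ, M.lamA τ] m

/-- The contraction of the gradient with the rank-one tensors, times a polynomial. -/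
def contrPoly (v : M.PV) (L : Poly) (m : Fin 4) (τ : M.Tri) : Poly :=
  ∑ i, ∑ j, MvPolynomial.C (M.R τ m i j) * (L * MvPolynomial.pderiv j (v τ i))

theorem pval_contrPoly (v : M.PV) (L : Poly) (m : Fin 4) (τ : M.Tri) (x : Plane) :
    pval (M.contrPoly v L m τ) x = pval L x * M.contr τ m (M.tv (M.gradV v) τ x) := by
  simp only [contrPoly, pval_sum, pval_mul, pval_C, contr, Finset.mul_sum]
  refine Finset.sum_congr rfl fun i _ => Finset.sum_congr rfl fun j _ => ?_
  simp only [tv, gradV, Matrix.of_apply]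
  ring

theorem totalDegree_contrPoly {v : M.PV} {k : ℕ} {τ : M.Tri} (hv : ∀ i, (v τ i).totalDegree ≤ k) {L : Poly}
    (hL : L.totalDegree ≤ 1) (m : Fin 4) : (M.contrPoly v L m τ).totalDegree ≤ k :=
  MvPolynomial.totalDegree_finsetSum_le fun i _ => MvPolynomial.totalDegree_finsetSum_le fun j _ =>
    totalDegree_C_mul_le _ (totalDegree_mul_pderiv_le j hL (hv i))

theorem totalDegree_lam (τ : M.Tri) : (M.lamA τ).totalDegree ≤ 1 ∧ (M.lamB τ).totalDegree ≤ 1 ∧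
    (M.lamC τ).totalDegree ≤ 1 :=
  ⟨totalDegree_C_mul_crossPoly _ _ _, totalDegree_C_mul_crossPoly _ _ _, totalDegree_C_mul_crossPoly _ _ _⟩

theorem totalDegree_bub (m : Fin 4) (τ : M.Tri) : (M.bub m τ).totalDegree ≤ 1 := by
  obtain ⟨h1, h2, h3⟩ := M.totalDegree_lam τ
  fin_cases m
  exacts [h3, h3, h2, h1]

theorem totalDegree_tensor {α : Fin 4 → M.PS} {k : ℕ} (h : ∀ m τ, (α m τ).totalDegree ≤ k) (τ : M.Tri)
    (i j : Fin 2) : (M.tensor α τ i j).totalDegree ≤ k :=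
  MvPolynomial.totalDegree_finsetSum_le fun m _ => totalDegree_C_mul_le _ (h m τ)

theorem bub_mem_Icc (m : Fin 4) {τ : M.Tri} {x : Plane} (hx : x ∈ M.tri τ) :
    pval (M.bub m τ) x ∈ Set.Icc (0 : ℝ) 1 := by
  obtain ⟨h1, h2, h3⟩ := (M.mem_tri_iff τ x).1 hx
  have h4 := M.lam_sum τ x
  fin_cases m
  · exact ⟨h3, by change pval (M.lamC τ) x ≤ 1; linarith⟩
  · exact ⟨h3, by change pval (M.lamC τ) x ≤ 1; linarith⟩
  · exact ⟨h2, by change pval (M.lamB τ) x ≤ 1; linarith⟩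
  · exact ⟨h1, by change pval (M.lamA τ) x ≤ 1; linarith⟩

/-- The coefficients are the contractions of ∇v, each weighted by the barycentric coordinate that
vanishes on the one side where this coefficient is visible. Hence all relevant traces are zero,
B_h(H, v) reduces to (H, ∇v), a sum of weighted squares of the contractions, and `exists_weight`
removes the weights. -/
theorem interior_test {v : M.PV} {k : ℕ} (hv : ∀ τ i, (v τ i).totalDegree ≤ k) {κ : ℝ} (hκ : M.Shape κ)
    {C : ℝ} (hC0 : 0 < C) (hC : ∀ (τ : M.Tri) (p : Poly), p.totalDegree ≤ k →
      (∫ x in M.tri τ, pval p x ^ 2) ≤ C * (∫ x in M.tri τ, pval (M.lamA τ) x * pval p x ^ 2) ∧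
      (∫ x in M.tri τ, pval p x ^ 2) ≤ C * (∫ x in M.tri τ, pval (M.lamB τ) x * pval p x ^ 2) ∧
      (∫ x in M.tri τ, pval p x ^ 2) ≤ C * (∫ x in M.tri τ, pval (M.lamC τ) x * pval p x ^ 2)) :
    ∃ H ∈ M.Hh k, M.ipT (M.gradV v) (M.gradV v) ≤ 12 * κ ^ 2 * C * M.Bh H v ∧
      M.ipT H H ≤ 16 * κ ^ 4 * M.ipT (M.gradV v) (M.gradV v) := by
  set α : Fin 4 → M.PS := fun m τ => M.contrPoly v (M.bub m τ) m τ with hα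
  have hval : ∀ m τ x, pval (α m τ) x = pval (M.bub m τ) x * M.contr τ m (M.tv (M.gradV v) τ x) :=
    fun m τ x => M.pval_contrPoly v _ m τ x
  have hdeg : ∀ m τ, (α m τ).totalDegree ≤ k := fun m τ =>
    M.totalDegree_contrPoly (hv τ) (M.totalDegree_bub m τ) m
  obtain ⟨hH, hB⟩ := M.Bh_of_traces (H := M.tensor α) (M.totalDegree_tensor hdeg) v 0
    (fun τ x hx => by
      have h0 : pval (M.lamC τ) x = 0 := lamC_eq_zero M hx
      ext i
      rw [tensor_mulVec_nP, hval, hval]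
      simp [bub, h0])
    (fun τ x hx => by
      have h0 : pval (M.lamB τ) x = 0 := lamB_eq_zero M hx
      rw [tensor_tangent_normal, hval]
      simp [bub, h0])
    (fun τ x hx => by
      have h0 : pval (M.lamA (M.prev τ)) x = 0 := lamA_eq_zero M (by rwa [M.c_prev, M.b_prev])
      have h1 := M.tensor_tangent_normal_next α (M.prev τ) x
      rw [M.next_prev] at h1
      rw [h1, hval]
      simp [bub, h0])
  rw [zero_mul, add_zero] at hB
  have hcc : ∀ m τ, Continuous fun x => M.contr τ m (M.tv (M.gradV v) τ x) := fun m τ => by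
    have : ∀ i j, Continuous fun x => M.tv (M.gradV v) τ x i j := fun i j => continuous_pval _
    unfold contr
    fun_prop
  refine ⟨_, hH, ?_, ?_⟩
  · rw [hB]
    unfold ipT
    rw [Finset.mul_sum]
    refine Finset.sum_le_sum fun τ _ => ?_
    have hpoly : ∀ m, (∫ x in M.tri τ, M.contr τ m (M.tv (M.gradV v) τ x) ^ 2) ≤
        C * ∫ x in M.tri τ, pval (M.bub m τ) x * M.contr τ m (M.tv (M.gradV v) τ x) ^ 2 := by
      intro m
      have h1 := hC τ (M.contrPoly v 1 m τ) (M.totalDegree_contrPoly (hv τ) (by simp) m)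
      have h2 : ∀ x, pval (M.contrPoly v 1 m τ) x = M.contr τ m (M.tv (M.gradV v) τ x) := fun x => by
        rw [pval_contrPoly]; simp [pval]
      simp only [h2] at h1
      fin_cases m
      exacts [h1.2.2, h1.2.2, h1.2.1, h1.1]
    have hcontr : ∀ x, ∑ i, ∑ j, M.tv (M.tensor α) τ x i j * M.tv (M.gradV v) τ x i j =
        ∑ m, pval (M.bub m τ) x * M.contr τ m (M.tv (M.gradV v) τ x) ^ 2 := fun x => by
      refine (M.tensor_contract α τ x (M.tv (M.gradV v) τ x)).trans ?_
      refine Finset.sum_congr rfl fun m _ => ?_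
      rw [hval, sq, mul_assoc]
    simp only [hcontr]
    have hsum : (∫ x in M.tri τ, ∑ m, pval (M.bub m τ) x * M.contr τ m (M.tv (M.gradV v) τ x) ^ 2) =
        ∑ m, ∫ x in M.tri τ, pval (M.bub m τ) x * M.contr τ m (M.tv (M.gradV v) τ x) ^ 2 :=
      integral_finsetSum _ fun m _ => M.integrableOn_tri τ (by have := hcc m τ; fun_prop)
    rw [hsum]
    calc _ ≤ ∫ x in M.tri τ, 12 * κ ^ 2 * ∑ m, M.contr τ m (M.tv (M.gradV v) τ x) ^ 2 :=
          integral_mono (M.integrableOn_tri τ (M.continuous_ipT_integrand _ _ τ))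
            (M.integrableOn_tri τ (by have := fun m => hcc m τ; fun_prop)) fun x => M.grad_le_contr hκ τ _
      _ = 12 * κ ^ 2 * ∑ m, ∫ x in M.tri τ, M.contr τ m (M.tv (M.gradV v) τ x) ^ 2 := by
          rw [integral_const_mul,
            integral_finsetSum _ fun m _ => M.integrableOn_tri τ (by have := hcc m τ; fun_prop)]
      _ ≤ 12 * κ ^ 2 * ∑ m, C * ∫ x in M.tri τ, pval (M.bub m τ) x * M.contr τ m (M.tv (M.gradV v) τ x) ^ 2 := by
          gcongr with m _
          exact hpoly m
      _ = _ := by rw [← Finset.mul_sum]; ring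
  · unfold ipT
    rw [Finset.mul_sum]
    refine Finset.sum_le_sum fun τ _ => ?_
    rw [← integral_const_mul]
    refine setIntegral_mono_on (M.integrableOn_tri τ (M.continuous_ipT_integrand _ _ τ))
      (M.integrableOn_tri τ ((M.continuous_ipT_integrand _ _ τ).const_mul _))
      (M.isCompact_tri τ).isClosed.measurableSet fun x hx => ?_
    have h1 := M.tensor_sq_le hκ α τ x
    have h2 : ∀ m, pval (α m τ) x ^ 2 ≤
        κ ^ 2 * ∑ i, ∑ j, M.tv (M.gradV v) τ x i j * M.tv (M.gradV v) τ x i j := fun m => by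
      obtain ⟨b0, b1⟩ := M.bub_mem_Icc m hx
      rw [hval, mul_pow]
      refine le_trans ?_ (M.contr_sq_le hκ τ m _)
      exact mul_le_of_le_one_left (sq_nonneg _) (pow_le_one₀ b0 b1)
    calc _ ≤ _ := h1
      _ ≤ 4 * κ ^ 2 * ∑ _m : Fin 4, κ ^ 2 * ∑ i, ∑ j, M.tv (M.gradV v) τ x i j * M.tv (M.gradV v) τ x i j := by
          gcongr with m _
          exact h2 m
      _ = _ := by simp; ring

/-- The jump across a primal edge as a polynomial. -/
def jumpPoly (v : M.PV) (τ : M.Tri) (i : Fin 2) : Poly :=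
  match M.nbr τ with
  | some σ => v τ i - v σ i
  | none => v τ i

theorem pval_jumpPoly (v : M.PV) (τ : M.Tri) (i : Fin 2) (x : Plane) :
    pval (M.jumpPoly v τ i) x = M.jumpP (M.vv v) τ x i := by
  rcases hn : M.nbr τ with _ | σ
  · simp only [jumpPoly, jumpP, hn]; rfl
  · simp only [jumpPoly, jumpP, hn, pval_sub]; rfl

theorem totalDegree_sub_le' {p q : Poly} {k : ℕ} (hp : p.totalDegree ≤ k) (hq : q.totalDegree ≤ k) :
    (p - q).totalDegree ≤ k :=
  (MvPolynomial.totalDegree_sub _ _).trans (max_le hp hq)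

/-- The coefficients of the test tensor for the jumps. -/
def edgeCoeff (v : M.PV) : Fin 4 → M.PS :=
  ![fun τ => ∑ i, MvPolynomial.C (-(M.D τ)⁻¹ * M.t1 τ i) * extPoly (M.a τ) (M.b τ) (M.lamB τ) (M.jumpPoly v τ i),
    fun τ => ∑ i, MvPolynomial.C (-(M.D τ)⁻¹ * M.t2 τ i) * extPoly (M.a τ) (M.b τ) (M.lamB τ) (M.jumpPoly v τ i),
    fun τ => ∑ i, MvPolynomial.C ((M.D τ)⁻¹ * M.t1 τ i) *
      extPoly (M.c τ) (M.a τ) (M.lamA τ) (v τ i - v (M.prev τ) i),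
    fun τ => ∑ i, MvPolynomial.C (-(M.D τ)⁻¹ * M.t2 τ i) *
      extPoly (M.c τ) (M.b τ) (M.lamB τ) (v (M.next τ) i - v τ i)]

theorem dot_sq_le (u w : Fin 2 → ℝ) : (u ⬝ᵥ w) ^ 2 ≤ (u 0 ^ 2 + u 1 ^ 2) * (w ⬝ᵥ w) := by
  simp only [dotProduct, Fin.sum_univ_two]
  nlinarith [sq_nonneg (u 0 * w 1 - u 1 * w 0)]

/-- An interior primal edge is counted from both of its triangles, and the squared jump does not
depend on the side. -/
theorem sum_segMean_jumpP_le (v : M.PV) :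
    ∑ τ, segMean (M.a τ) (M.b τ) (fun x => M.jumpP (M.vv v) τ x ⬝ᵥ M.jumpP (M.vv v) τ x) ≤
      2 * ∑ τ ∈ M.plus, segMean (M.a τ) (M.b τ) (fun x => M.jumpP (M.vv v) τ x ⬝ᵥ M.jumpP (M.vv v) τ x) := by
  rw [M.sum_eq_sum_plus, Finset.mul_sum]
  refine Finset.sum_le_sum fun τ _ => ?_
  rw [two_mul]
  refine add_le_add_right ?_ _
  rcases hn : M.nbr τ with _ | σ
  · simp only [atNbr, hn]
    exact segMean_nonneg fun x _ => dot_self_nonneg _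
  · simp only [atNbr, hn]
    rw [M.segMean_nbr hn]
    simp only [M.jumpP_nbr hn, neg_dotProduct_neg]
    exact le_rfl

-- Each jump is continued from its edge into the triangle as a function of one barycentric
-- coordinate, with the frame factors that make the traces Hn = −[v]/h_e on primal edges and t·Hn =
-- −[v·t]/h_e on dual edges. Every edge term of B_h becomes a squared jump. In the bound for ‖H‖ the
-- continuation costs a factor D and the frame factors at most κ/D, so the size of the triangle
-- cancels.
set_option maxHeartbeats 400000 in
theorem edge_test {v : M.PV} {k : ℕ} (hv : ∀ τ i, (v τ i).totalDegree ≤ k) {κ : ℝ} (hκ0 : 0 ≤ κ)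
    (hκ : M.Shape κ) :
    ∃ H ∈ M.Hh k, M.Bh H v = M.ipT H (M.gradV v) + M.jumpEnergy v ∧
      M.ipT H H ≤ 16 * κ ^ 3 * M.jumpEnergy v := by
  have hl := M.totalDegree_lam
  have hdeg : ∀ m τ, (M.edgeCoeff v m τ).totalDegree ≤ k := by
    have hj : ∀ τ i, (M.jumpPoly v τ i).totalDegree ≤ k := fun τ i => by
      unfold jumpPoly
      split
      · exact totalDegree_sub_le' (hv _ _) (hv _ _)
      · exact hv _ _
    have h0 : ∀ τ, (M.edgeCoeff v 0 τ).totalDegree ≤ k := fun τ => by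
      simp only [edgeCoeff, Matrix.cons_val]
      exact MvPolynomial.totalDegree_finsetSum_le fun i _ => totalDegree_C_mul_le _
        (totalDegree_extPoly (hl τ).2.1 (hj τ i))
    have h1 : ∀ τ, (M.edgeCoeff v 1 τ).totalDegree ≤ k := fun τ => by
      simp only [edgeCoeff, Matrix.cons_val]
      exact MvPolynomial.totalDegree_finsetSum_le fun i _ => totalDegree_C_mul_le _
        (totalDegree_extPoly (hl τ).2.1 (hj τ i))
    have h2 : ∀ τ, (M.edgeCoeff v 2 τ).totalDegree ≤ k := fun τ => by
      simp only [edgeCoeff, Matrix.cons_val]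
      exact MvPolynomial.totalDegree_finsetSum_le fun i _ => totalDegree_C_mul_le _
        (totalDegree_extPoly (hl τ).1 (totalDegree_sub_le' (hv _ _) (hv _ _)))
    have h3 : ∀ τ, (M.edgeCoeff v 3 τ).totalDegree ≤ k := fun τ => by
      simp only [edgeCoeff, Matrix.cons_val]
      exact MvPolynomial.totalDegree_finsetSum_le fun i _ => totalDegree_C_mul_le _
        (totalDegree_extPoly (hl τ).2.1 (totalDegree_sub_le' (hv _ _) (hv _ _)))
    intro m τ
    fin_cases m
    exacts [h0 τ, h1 τ, h2 τ, h3 τ]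
  have v0 : ∀ τ x, pval (M.edgeCoeff v 0 τ) x = -(M.D τ)⁻¹ * (M.t1 τ ⬝ᵥ M.jumpP (M.vv v) τ
      (AffineMap.lineMap (M.a τ) (M.b τ) (pval (M.lamB τ) x))) := fun τ x => by
    simp only [edgeCoeff, Matrix.cons_val, pval_sum, pval_mul, pval_C, pval_extPoly, pval_jumpPoly,
      dotProduct, Finset.mul_sum, mul_assoc]
  have v1 : ∀ τ x, pval (M.edgeCoeff v 1 τ) x = -(M.D τ)⁻¹ * (M.t2 τ ⬝ᵥ M.jumpP (M.vv v) τ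
      (AffineMap.lineMap (M.a τ) (M.b τ) (pval (M.lamB τ) x))) := fun τ x => by
    simp only [edgeCoeff, Matrix.cons_val, pval_sum, pval_mul, pval_C, pval_extPoly, pval_jumpPoly,
      dotProduct, Finset.mul_sum, mul_assoc]
  have htD : ∀ τ (u : Fin 2 → ℝ), M.t1 τ ⬝ᵥ u = M.hD τ * (u ⬝ᵥ M.tD τ) := fun τ u => by
    have := (M.hD_pos τ).ne'
    simp only [dotProduct, Fin.sum_univ_two, tangent_ca]
    field_simp
  have v2 : ∀ τ x, pval (M.edgeCoeff v 2 τ) x = (M.D τ)⁻¹ * (M.hD τ * (M.jumpD (M.vv v) τ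
      (AffineMap.lineMap (M.c τ) (M.a τ) (pval (M.lamA τ) x)) ⬝ᵥ M.tD τ)) := fun τ x => by
    rw [← htD]
    simp only [edgeCoeff, Matrix.cons_val, pval_sum, pval_mul, pval_C, pval_extPoly, pval_sub, jumpD,
      dotProduct, Finset.mul_sum, mul_assoc, Pi.sub_apply, vv]
  have v3 : ∀ τ x, pval (M.edgeCoeff v 3 τ) x = -(M.D τ)⁻¹ * (M.hD (M.next τ) *
      (M.jumpD (M.vv v) (M.next τ)
      (AffineMap.lineMap (M.c τ) (M.b τ) (pval (M.lamB τ) x)) ⬝ᵥ M.tD (M.next τ))) := fun τ x => by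
    rw [← htD]
    simp only [edgeCoeff, Matrix.cons_val, pval_sum, pval_mul, pval_C, pval_extPoly, pval_sub, jumpD,
      dotProduct, Finset.mul_sum, mul_assoc, Pi.sub_apply, vv, prev_next]
    rfl
  have lB : ∀ τ, ∀ x ∈ segment ℝ (M.a τ) (M.b τ), AffineMap.lineMap (M.a τ) (M.b τ) (pval (M.lamB τ) x) = x := by
    intro τ x hx
    rw [segment_eq_image_lineMap] at hx
    obtain ⟨s, -, rfl⟩ := hx
    congr 1
    rw [lineMap_ab, pval_lamB]
  have lA : ∀ τ, ∀ x ∈ segment ℝ (M.c τ) (M.a τ), AffineMap.lineMap (M.c τ) (M.a τ) (pval (M.lamA τ) x) = x := by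
    intro τ x hx
    rw [segment_eq_image_lineMap] at hx
    obtain ⟨s, -, rfl⟩ := hx
    congr 1
    rw [lineMap_ca, pval_lamA]
  have lB' : ∀ τ, ∀ x ∈ segment ℝ (M.c τ) (M.b τ), AffineMap.lineMap (M.c τ) (M.b τ) (pval (M.lamB τ) x) = x := by
    intro τ x hx
    rw [segment_eq_image_lineMap] at hx
    obtain ⟨s, -, rfl⟩ := hx
    congr 1
    rw [lineMap_cb, pval_lamB]
  obtain ⟨hH, hB⟩ := M.Bh_of_traces (H := M.tensor (M.edgeCoeff v)) (M.totalDegree_tensor hdeg) v 1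
    (fun τ x hx => by
      have hD := (M.D_pos τ).ne'
      have hh := (M.hP_pos τ).ne'
      ext i
      rw [tensor_mulVec_nP, v0, v1, lB τ x hx, Pi.smul_apply, smul_eq_mul,
        ← M.frame_identity τ (M.jumpP (M.vv v) τ x) i]
      field_simp
      ring)
    (fun τ x hx => by
      have hD := (M.D_pos τ).ne'
      have hh := (M.hD_pos τ).ne'
      rw [tensor_tangent_normal, v2, lA τ x hx]
      field_simp)
    (fun τ x hx => by
      have hD := (M.D_pos (M.prev τ)).ne'
      have hh := (M.hD_pos τ).ne'
      have h1 := M.tensor_tangent_normal_next (M.edgeCoeff v) (M.prev τ) x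
      rw [v3, lB' (M.prev τ) x (by rwa [M.c_prev, M.b_prev]), M.next_prev] at h1
      rw [h1]
      field_simp)
  rw [one_mul] at hB
  refine ⟨_, hH, hB, ?_⟩
  have hc : ∀ m τ, Continuous fun x => pval (M.edgeCoeff v m τ) x ^ 2 := fun m τ => by fun_prop
  -- the four coefficients
  have scale : ∀ {d D m : ℝ}, 0 < D → d ≤ κ * D → 0 ≤ m → D⁻¹ ^ 2 * d * (D * m) ≤ κ * m := by
    intro d D m hD hd hm
    calc D⁻¹ ^ 2 * d * (D * m) = D⁻¹ * d * m * (D⁻¹ * D) := by ring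
      _ = D⁻¹ * d * m := by rw [inv_mul_cancel₀ hD.ne', mul_one]
      _ ≤ D⁻¹ * (κ * D) * m := by gcongr
      _ = κ * m * (D⁻¹ * D) := by ring
      _ = κ * m := by rw [inv_mul_cancel₀ hD.ne', mul_one]
  have bP : ∀ (t : M.Tri → Fin 2 → ℝ) (m : Fin 4), (∀ τ, t τ 0 ^ 2 + t τ 1 ^ 2 ≤ κ * M.D τ) →
      (∀ τ x, pval (M.edgeCoeff v m τ) x = -(M.D τ)⁻¹ * (t τ ⬝ᵥ M.jumpP (M.vv v) τ
        (AffineMap.lineMap (M.a τ) (M.b τ) (pval (M.lamB τ) x)))) → ∀ τ,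
      ∫ x in M.tri τ, pval (M.edgeCoeff v m τ) x ^ 2 ≤ κ * segMean (M.a τ) (M.b τ)
        (fun x => M.jumpP (M.vv v) τ x ⬝ᵥ M.jumpP (M.vv v) τ x) := by
    intro t m ht hval τ
    have hcm := hc m τ
    have hcJ : Continuous fun x => M.jumpP (M.vv v) τ x ⬝ᵥ M.jumpP (M.vv v) τ x := by fun_prop
    calc _ ≤ ∫ x in M.tri τ, ((M.D τ)⁻¹ ^ 2 * (t τ 0 ^ 2 + t τ 1 ^ 2)) *
          (fun y => M.jumpP (M.vv v) τ y ⬝ᵥ M.jumpP (M.vv v) τ y)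
            (AffineMap.lineMap (M.a τ) (M.b τ) (pval (M.lamB τ) x)) := by
          refine integral_mono (M.integrableOn_tri τ hcm) (M.integrableOn_tri τ ?_) fun x => ?_
          · have h5 : Continuous fun x => (AffineMap.lineMap (M.a τ) (M.b τ) (pval (M.lamB τ) x) : Plane) :=
              AffineMap.lineMap_continuous.comp (continuous_pval _)
            exact (hcJ.comp h5).const_mul _
          · simp only [hval]
            rw [mul_pow, neg_sq, mul_assoc]
            exact mul_le_mul_of_nonneg_left (dot_sq_le _ _) (sq_nonneg _)
      _ ≤ ((M.D τ)⁻¹ ^ 2 * (t τ 0 ^ 2 + t τ 1 ^ 2)) * (M.D τ * segMean (M.a τ) (M.b τ)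
          (fun x => M.jumpP (M.vv v) τ x ⬝ᵥ M.jumpP (M.vv v) τ x)) := by
          rw [integral_const_mul]
          exact mul_le_mul_of_nonneg_left (M.setIntegral_ext_lamB_le τ _ _ hcJ fun x => dot_self_nonneg _)
            (by positivity)
      _ ≤ _ := scale (M.D_pos τ) (ht τ) (segMean_nonneg fun x _ => dot_self_nonneg _)
  have s2 : ∀ τ, M.t1 τ 0 ^ 2 + M.t1 τ 1 ^ 2 ≤ κ * M.D τ := fun τ => by
    rw [← M.hD_sq]; exact (hκ τ).2.1
  have s3 : ∀ τ, M.t2 τ 0 ^ 2 + M.t2 τ 1 ^ 2 ≤ κ * M.D τ := fun τ => by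
    rw [← M.hD_next_sq]; exact (hκ τ).2.2
  have b0 := bP M.t1 0 s2 v0
  have b1 := bP M.t2 1 s3 v1
  have hcD : ∀ τ, Continuous fun x => (M.jumpD (M.vv v) τ x ⬝ᵥ M.tD τ) ^ 2 := fun τ => by fun_prop
  have b2 : ∀ τ, ∫ x in M.tri τ, pval (M.edgeCoeff v 2 τ) x ^ 2 ≤ κ * segMean (M.c τ) (M.a τ)
      (fun x => (M.jumpD (M.vv v) τ x ⬝ᵥ M.tD τ) ^ 2) := by
    intro τ
    refine le_trans ?_ (scale (M.D_pos τ) (hκ τ).2.1 (segMean_nonneg fun x _ => sq_nonneg _))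
    refine le_trans (le_of_eq ?_) (mul_le_mul_of_nonneg_left
      (M.setIntegral_ext_lamA_le τ _ _ (hcD τ) fun x => sq_nonneg _)
      (mul_nonneg (sq_nonneg (M.D τ)⁻¹) (sq_nonneg _)))
    rw [← integral_const_mul]
    refine integral_congr_ae (Filter.Eventually.of_forall fun x => ?_)
    simp only [v2, hD]
    ring
  have b3 : ∀ τ, ∫ x in M.tri τ, pval (M.edgeCoeff v 3 τ) x ^ 2 ≤
      κ * segMean (M.c (M.next τ)) (M.a (M.next τ))
      (fun x => (M.jumpD (M.vv v) (M.next τ) x ⬝ᵥ M.tD (M.next τ)) ^ 2) := by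
    intro τ
    refine le_trans ?_ (scale (M.D_pos τ) (hκ τ).2.2 (segMean_nonneg fun x _ => sq_nonneg _))
    refine le_trans (le_of_eq ?_) (mul_le_mul_of_nonneg_left
      (M.setIntegral_ext_lamB_le τ _ _ (hcD (M.next τ)) fun x => sq_nonneg _)
      (mul_nonneg (sq_nonneg (M.D τ)⁻¹) (sq_nonneg _)))
    rw [← integral_const_mul]
    refine integral_congr_ae (Filter.Eventually.of_forall fun x => ?_)
    simp only [v3, hD]
    simp only [a_next, c_next]
    ring
  calc M.ipT (M.tensor (M.edgeCoeff v)) (M.tensor (M.edgeCoeff v)) ≤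
        ∑ τ, 4 * κ ^ 2 * ∑ m, ∫ x in M.tri τ, pval (M.edgeCoeff v m τ) x ^ 2 := by
        refine Finset.sum_le_sum fun τ _ => ?_
        rw [← integral_finsetSum _ fun m _ => M.integrableOn_tri τ (hc m τ), ← integral_const_mul]
        exact integral_mono (M.integrableOn_tri τ (M.continuous_ipT_integrand _ _ τ))
          (M.integrableOn_tri τ (by fun_prop)) fun x => M.tensor_sq_le hκ _ τ x
    _ ≤ ∑ τ, 4 * κ ^ 2 * (κ * (2 * segMean (M.a τ) (M.b τ)
          (fun x => M.jumpP (M.vv v) τ x ⬝ᵥ M.jumpP (M.vv v) τ x) +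
          segMean (M.c τ) (M.a τ) (fun x => (M.jumpD (M.vv v) τ x ⬝ᵥ M.tD τ) ^ 2) +
          segMean (M.c (M.next τ)) (M.a (M.next τ))
            (fun x => (M.jumpD (M.vv v) (M.next τ) x ⬝ᵥ M.tD (M.next τ)) ^ 2))) := by
        refine Finset.sum_le_sum fun τ _ => mul_le_mul_of_nonneg_left ?_ (by positivity)
        rw [Fin.sum_univ_four]
        have := b0 τ; have := b1 τ; have := b2 τ; have := b3 τ
        linarith
    _ = 4 * κ ^ 3 * (2 * (∑ τ, segMean (M.a τ) (M.b τ)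
          (fun x => M.jumpP (M.vv v) τ x ⬝ᵥ M.jumpP (M.vv v) τ x)) +
          2 * ∑ τ, segMean (M.c τ) (M.a τ) (fun x => (M.jumpD (M.vv v) τ x ⬝ᵥ M.tD τ) ^ 2)) := by
        rw [← Finset.mul_sum, ← Finset.mul_sum, Finset.sum_add_distrib, Finset.sum_add_distrib,
          M.sum_next (fun τ => segMean (M.c τ) (M.a τ) (fun x => (M.jumpD (M.vv v) τ x ⬝ᵥ M.tD τ) ^ 2)),
          ← Finset.mul_sum]
        ring
    _ ≤ 4 * κ ^ 3 * (4 * M.jumpEnergy v) := by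
        refine mul_le_mul_of_nonneg_left ?_ (by positivity)
        have h1 := M.sum_segMean_jumpP_le v
        have h2 : 0 ≤ ∑ τ, segMean (M.c τ) (M.a τ) (fun x => (M.jumpD (M.vv v) τ x ⬝ᵥ M.tD τ) ^ 2) :=
          Finset.sum_nonneg fun _ _ => segMean_nonneg fun _ _ => sq_nonneg _
        unfold jumpEnergy
        linarith
    _ = _ := by ring

/-- Every discrete velocity has a test tensor that is aligned with it. -/
theorem _root_.SDG.exists_test (k : ℕ) (κ : ℝ) (hκ0 : 0 < κ) : ∃ C : ℝ, 0 < C ∧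
    ∀ {Ω : Set Plane} (M : Mesh Ω), M.Shape κ → ∀ v : M.PV, (∀ τ i, (v τ i).totalDegree ≤ k) →
      ∃ H ∈ M.Hh k, M.normh v ^ 2 ≤ 2 * M.Bh H v ∧ M.normT H ≤ C * M.normh v := by
  obtain ⟨C₁, hC₁, h₁⟩ := exists_weight k
  -- Write A for the gradient part and J for the jump part of ‖v‖_h². The edge tensor gives J up to
  -- a cross term of at least −8κ³A − J/2. This multiple of the interior tensor contributes (8κ³ +
  -- 1/2)A, which leaves (A + J)/2.
  set K := 12 * κ ^ 2 * C₁ * (8 * κ ^ 3 + 1 / 2) with hK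
  have hK0 : 0 < K := by positivity
  -- From ‖K H₂ + H₁‖² ≤ 2K²‖H₂‖² + 2‖H₁‖² with ‖H₂‖² ≤ 16κ⁴A and ‖H₁‖² ≤ 16κ³J.
  set C₂ := 32 * K ^ 2 * κ ^ 4 + 32 * κ ^ 3 with hC₂
  have hC20 : 0 < C₂ := by positivity
  refine ⟨√C₂, by positivity, ?_⟩
  intro Ω M hM v hv
  obtain ⟨H₂, hH₂, hB₂, hn₂⟩ := M.interior_test hv hM hC₁ (fun τ p hp => h₁ M τ p hp)
  obtain ⟨H₁, hH₁, hB₁, hn₁⟩ := M.edge_test hv hκ0.le hM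
  set G := M.gradV v
  set A := M.ipT G G with hA
  set J := M.jumpEnergy v with hJ
  have hA0 : 0 ≤ A := M.ipT_self_nonneg G
  have hJ0 : 0 ≤ J := M.jumpEnergy_nonneg v
  refine ⟨K • H₂ + H₁, (M.HhS k).add_mem ((M.HhS k).smul_mem K hH₂) hH₁, ?_, ?_⟩
  · have hlin : M.Bh (K • H₂ + H₁) v = K * M.Bh H₂ v + M.Bh H₁ v := by
      have h := M.isLinear_Bh_left v
      rw [h.map_add, h.map_smul, smul_eq_mul]
    -- Young's inequality for the cross term (H₁, ∇v), with the weight matched to ‖H₁‖² ≤ 16κ³J.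
    have hy : 0 ≤ M.ipT ((16 * κ ^ 3) • G + H₁) ((16 * κ ^ 3) • G + H₁) := M.ipT_self_nonneg _
    have hexp : M.ipT ((16 * κ ^ 3) • G + H₁) ((16 * κ ^ 3) • G + H₁) =
        (16 * κ ^ 3) ^ 2 * A + 2 * (16 * κ ^ 3) * M.ipT H₁ G + M.ipT H₁ H₁ := by
      have hl := fun q => M.isLinear_ipT_left q
      have hr := fun q => M.isLinear_ipT_right q
      rw [(hl _).map_add, (hl _).map_smul, (hr _).map_add, (hr _).map_add, (hr _).map_smul, (hr _).map_smul,
        M.ipT_comm G H₁]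
      simp only [smul_eq_mul]
      ring
    rw [hexp] at hy
    have h3 : 0 < 16 * κ ^ 3 := by positivity
    have hcross : -(8 * κ ^ 3 * A) - J / 2 ≤ M.ipT H₁ G := by
      have : 0 ≤ (16 * κ ^ 3) * ((16 * κ ^ 3) * A + 2 * M.ipT H₁ G + J) := by nlinarith
      have := nonneg_of_mul_nonneg_right this h3
      linarith
    have hKB : (8 * κ ^ 3 + 1 / 2) * A ≤ K * M.Bh H₂ v := by
      calc _ ≤ (8 * κ ^ 3 + 1 / 2) * (12 * κ ^ 2 * C₁ * M.Bh H₂ v) := by gcongr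
        _ = _ := by rw [hK]; ring
    rw [hlin, hB₁, normh_sq]
    linarith
  · have hs : M.ipT (K • H₂ + H₁) (K • H₂ + H₁) ≤ 2 * K ^ 2 * M.ipT H₂ H₂ + 2 * M.ipT H₁ H₁ := by
      have hy : 0 ≤ M.ipT (K • H₂ - H₁) (K • H₂ - H₁) := M.ipT_self_nonneg _
      have hl := fun q => M.isLinear_ipT_left q
      have hr := fun q => M.isLinear_ipT_right q
      rw [(hl _).map_sub, (hr _).map_sub, (hr _).map_sub, (hl _).map_smul, (hr _).map_smul,
        (hl _).map_smul, (hr _).map_smul] at hy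
      rw [(hl _).map_add, (hr _).map_add, (hr _).map_add, (hl _).map_smul, (hr _).map_smul,
        (hl _).map_smul, (hr _).map_smul]
      simp only [smul_eq_mul] at hy ⊢
      linarith
    unfold normT
    rw [normh_eq, ← Real.sqrt_mul hC20.le]
    refine Real.sqrt_le_sqrt (hs.trans ?_)
    have e1 : 2 * K ^ 2 * M.ipT H₂ H₂ ≤ 2 * K ^ 2 * (16 * κ ^ 4 * A) := by gcongr
    have e2 : 0 ≤ 32 * K ^ 2 * κ ^ 4 * J := by positivity
    have e3 : 0 ≤ 32 * κ ^ 3 * A := by positivity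
    rw [hC₂]
    linarith

end Mesh

namespace Mesh

variable {Ω : Set Plane} (M : Mesh Ω)

/-! ### Regular meshes are shape regular -/

/-- By conformity the midpoint lies in the hull of the common vertices. If an end point of the edge
were not common, this hull would lie in a side on which one barycentric coordinate vanishes, while
at the midpoint it is 1/2. So both end points are common, as is the centre; the two triangles would
coincide as sets or have opposite orientations. -/
theorem eq_of_mem_midpoint {τ σ : M.Tri} (hc : M.c σ = M.c τ)
    (h : midpoint ℝ (M.a τ) (M.b τ) ∈ M.tri σ) : σ = τ := by
  by_contra hne
  have hD := M.D_pos τ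
  have hDσ := M.D_pos σ
  have hm : midpoint ℝ (M.a τ) (M.b τ) ∈ segment ℝ (M.a τ) (M.b τ) := midpoint_mem_segment _ _
  have hmτ : midpoint ℝ (M.a τ) (M.b τ) ∈ M.tri τ :=
    segment_subset_convexHull (by simp) (by simp) hm
  have hlm : midpoint ℝ (M.a τ) (M.b τ) = triMap (M.c τ) (M.a τ) (M.b τ) (1 - 1 / 2) (1 / 2) := by
    rw [← lineMap_ab]
    simp [midpoint]
  have hA : pval (M.lamA τ) (midpoint ℝ (M.a τ) (M.b τ)) = 1 / 2 := by
    rw [hlm, pval_lamA]; norm_num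
  have hB : pval (M.lamB τ) (midpoint ℝ (M.a τ) (M.b τ)) = 1 / 2 := by
    rw [hlm, pval_lamB]
  have hmem : midpoint ℝ (M.a τ) (M.b τ) ∈
      convexHull ℝ (({M.c τ, M.a τ, M.b τ} : Set Plane) ∩ {M.c σ, M.a σ, M.b σ}) := by
    have := M.conforming τ σ (Ne.symm hne)
    exact this ▸ ⟨hmτ, h⟩
  have ha : M.a τ ∈ ({M.c σ, M.a σ, M.b σ} : Set Plane) := by
    by_contra hna
    have hsub : (({M.c τ, M.a τ, M.b τ} : Set Plane) ∩ {M.c σ, M.a σ, M.b σ}) ⊆ {M.c τ, M.b τ} := by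
      rintro x ⟨hx1, hx2⟩
      rcases hx1 with rfl | rfl | rfl
      · simp
      · exact absurd hx2 hna
      · simp
    have := convexHull_mono hsub hmem
    rw [convexHull_pair] at this
    rw [lamA_eq_zero M this] at hA
    norm_num at hA
  have hb : M.b τ ∈ ({M.c σ, M.a σ, M.b σ} : Set Plane) := by
    by_contra hna
    have hsub : (({M.c τ, M.a τ, M.b τ} : Set Plane) ∩ {M.c σ, M.a σ, M.b σ}) ⊆ {M.c τ, M.a τ} := by
      rintro x ⟨hx1, hx2⟩
      rcases hx1 with rfl | rfl | rfl
      · simp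
      · simp
      · exact absurd hx2 hna
    have := convexHull_mono hsub hmem
    rw [convexHull_pair] at this
    rw [lamB_eq_zero M this] at hB
    norm_num at hB
  simp only [hc, Set.mem_insert_iff, Set.mem_singleton_iff, (M.c_ne_a τ).symm, (M.c_ne_b τ).symm,
    false_or] at ha hb
  rcases ha with ha | ha <;> rcases hb with hb | hb
  · exact M.a_ne_b τ (ha.trans hb.symm)
  · have htri : M.tri σ = M.tri τ := by unfold tri; rw [hc, ha, hb]
    have hd := M.tri_disjoint hne
    rw [htri, disjoint_self] at hd
    obtain ⟨x, hx⟩ := M.openTri_nonempty τ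
    have := M.openTri_subset_interior τ hx
    rw [hd] at this
    exact this
  · unfold D at hD hDσ
    rw [hc, ← ha, ← hb, cross_swap] at hDσ
    linarith
  · exact M.a_ne_b τ (ha.trans hb.symm)

/-- Were y strictly beyond the line of the edge, the segment from the midpoint of the edge to y
would stay in the element but leave the triangle at once. Points on it tending to the midpoint lie
infinitely often in one triangle of the element; that triangle is closed, contains the midpoint, and
is therefore the one just left. -/
theorem cross_nonneg_of_starConvex {τ : M.Tri} {y : Plane} (hy : StarConvex ℝ y (M.cell τ.1)) :
    0 ≤ cross (M.b τ - M.a τ) (y - M.a τ) := by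
  by_contra hneg
  rw [not_le] at hneg
  set m := midpoint ℝ (M.a τ) (M.b τ) with hm
  have hmem : m ∈ M.cell τ.1 := by
    rw [M.cell_eq]
    exact Set.mem_iUnion.2 ⟨τ.2, segment_subset_convexHull (s := {M.c τ, M.a τ, M.b τ}) (by simp) (by simp)
      (midpoint_mem_segment _ _)⟩
  let p : ℕ → Plane := fun n => AffineMap.lineMap m y ((1 : ℝ) / (n + 1))
  have hp : ∀ n, p n ∈ M.cell τ.1 := fun n => by
    have h1 : p n ∈ segment ℝ y m := by
      rw [segment_symm, segment_eq_image_lineMap]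
      exact ⟨_, ⟨by positivity, (div_le_one (by positivity)).2 (by
        have : (0 : ℝ) ≤ n := n.cast_nonneg
        linarith)⟩, rfl⟩
    exact (starConvex_iff_segment_subset.1 hy) hmem h1
  have hlim : Filter.Tendsto p Filter.atTop (𝓝 m) := by
    have h1 : Continuous fun s : ℝ => (AffineMap.lineMap m y s : Plane) := AffineMap.lineMap_continuous
    have h2 := (h1.tendsto 0).comp (tendsto_one_div_add_atTop_nhds_zero_nat (𝕜 := ℝ))
    rw [AffineMap.lineMap_apply_zero] at h2
    exact h2
  have hneg' : ∀ n, p n ∉ M.tri τ := by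
    intro n hn
    have h0 := lamC_nonneg M _ hn
    have h1 : M.D τ * pval (M.lamC τ) (p n) = cross (M.b τ - M.a τ) (p n - M.a τ) := by
      have hD := (M.D_pos τ).ne'
      rw [lamC, pval_mul, pval_C, pval_crossPoly]
      field_simp
    have h2 : cross (M.b τ - M.a τ) (p n - M.a τ) =
        (1 : ℝ) / (n + 1) * cross (M.b τ - M.a τ) (y - M.a τ) := by
      simp only [p, cross, hm, midpoint_eq_smul_add, AffineMap.lineMap_apply, PiLp.sub_apply, vsub_eq_sub,
        vadd_eq_add, PiLp.add_apply, PiLp.smul_apply, smul_eq_mul]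
      simp only [invOf_eq_inv]
      ring
    have h3 : (0 : ℝ) < 1 / (n + 1) := by positivity
    have h4 := mul_neg_of_pos_of_neg h3 hneg
    rw [← h2, ← h1] at h4
    have := mul_nonneg (M.D_pos τ).le h0
    linarith
  have hfreq : ∃ j, ∃ᶠ n in Filter.atTop, p n ∈ M.tri ⟨τ.1, j⟩ := by
    by_contra hcon
    push Not at hcon
    obtain ⟨n, hn⟩ := (Filter.eventually_all.2 hcon).exists
    have := hp n
    rw [M.cell_eq] at this
    obtain ⟨j, hj⟩ := Set.mem_iUnion.1 this
    exact hn j hj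
  obtain ⟨j, hj⟩ := hfreq
  have hmσ : m ∈ M.tri ⟨τ.1, j⟩ :=
    (M.isCompact_tri _).isClosed.mem_of_frequently_of_tendsto hj hlim
  have := M.eq_of_mem_midpoint (σ := ⟨τ.1, j⟩) (τ := τ) rfl hmσ
  obtain ⟨n, hn⟩ := hj.exists
  rw [this] at hn
  exact hneg' n hn

/-- The ball about the centre lies on the inner side of the line through each edge, so the height of
the triangle over its primal edge is at least ρ_B h_S. With the edge at least ρ_E h_S long this
gives D ≥ ρ_E ρ_B h_S², and no edge of the triangle is longer than h_S. -/
theorem Regular.shape {ρE ρB : ℝ} (hE : 0 < ρE) (hB : 0 < ρB) (h : M.Regular ρE ρB) :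
    M.Shape (ρE * ρB)⁻¹ := by
  intro τ
  set r := Metric.diam (M.cell τ.1) with hr
  have hcb : Bornology.IsBounded (M.cell τ.1) := by
    rw [M.cell_eq]
    exact (isCompact_iUnion fun j => M.isCompact_tri _).isBounded
  have hsub : M.tri τ ⊆ M.cell τ.1 := by
    rw [M.cell_eq]
    exact Set.subset_iUnion (fun j => M.tri ⟨τ.1, j⟩) τ.2
  have hcm : M.c τ ∈ M.cell τ.1 := hsub (subset_convexHull ℝ _ (by simp))
  have ham : M.a τ ∈ M.cell τ.1 := hsub (subset_convexHull ℝ _ (by simp))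
  have hbm : M.b τ ∈ M.cell τ.1 := hsub (subset_convexHull ℝ _ (by simp))
  have d1 : dist (M.a τ) (M.b τ) ≤ r := Metric.dist_le_diam_of_mem hcb ham hbm
  have d2 : dist (M.c τ) (M.a τ) ≤ r := Metric.dist_le_diam_of_mem hcb hcm ham
  have d3 : dist (M.c τ) (M.b τ) ≤ r := Metric.dist_le_diam_of_mem hcb hcm hbm
  have hlen := h.1 τ
  have hab : 0 < dist (M.a τ) (M.b τ) := dist_pos.2 (M.a_ne_b τ)
  have hr0 : 0 < r := hab.trans_le d1
  have hsq : dist (M.a τ) (M.b τ) ^ 2 = (M.b τ 0 - M.a τ 0) ^ 2 + (M.b τ 1 - M.a τ 1) ^ 2 := by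
    rw [dist_comm, EuclideanSpace.dist_eq, Real.sq_sqrt (by positivity), Fin.sum_univ_two,
      Real.dist_eq, Real.dist_eq, sq_abs, sq_abs]
  have key : ρB * r * dist (M.a τ) (M.b τ) ≤ M.D τ := by
    refine le_of_forall_lt_imp_le_of_dense fun z hz => ?_
    rcases le_or_gt z 0 with hz0 | hz0
    · exact hz0.trans (M.D_pos τ).le
    set t := z / dist (M.a τ) (M.b τ) ^ 2 with ht
    -- The outward normal scaled to the length of the edge. For z below ρ_B h_S |ab| the centre may
    -- be moved outward by z/|ab| without leaving the ball, and the sign of the determinant there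
    -- says z ≤ D.
    let u : Plane := !₂[M.b τ 1 - M.a τ 1, -(M.b τ 0 - M.a τ 0)]
    have hu : ‖u‖ = dist (M.a τ) (M.b τ) := by
      rw [← abs_of_nonneg (norm_nonneg u), ← abs_of_nonneg (dist_nonneg (x := M.a τ)), ← sq_eq_sq_iff_abs_eq_abs,
        hsq, EuclideanSpace.norm_eq, Real.sq_sqrt (by positivity), Fin.sum_univ_two]
      simp [u]; ring
    have hball : M.c τ + t • u ∈ Metric.ball (M.center τ.1) (ρB * Metric.diam (M.cell τ.1)) := by
      rw [Metric.mem_ball, dist_eq_norm]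
      change ‖M.c τ + t • u - M.c τ‖ < _
      rw [add_sub_cancel_left, norm_smul, hu, Real.norm_of_nonneg (by positivity), ht, ← hr, sq,
        ← div_div, div_mul_cancel₀ _ hab.ne', div_lt_iff₀ hab]
      exact hz
    have h1 := M.cross_nonneg_of_starConvex (h.2 τ.1 _ hball).2
    have h2 : cross (M.b τ - M.a τ) (M.c τ + t • u - M.a τ) = M.D τ - t * dist (M.a τ) (M.b τ) ^ 2 := by
      rw [hsq]
      simp [cross, u, D]
      ring
    rw [h2, ht, div_mul_cancel₀ _ (by positivity)] at h1
    linarith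
  have hfin : r ^ 2 ≤ (ρE * ρB)⁻¹ * M.D τ := by
    rw [inv_mul_eq_div, le_div_iff₀ (by positivity)]
    calc r ^ 2 * (ρE * ρB) = ρB * r * (ρE * r) := by ring
      _ ≤ ρB * r * dist (M.a τ) (M.b τ) := by gcongr
      _ ≤ _ := key
  exact ⟨(pow_le_pow_left₀ dist_nonneg d1 2).trans hfin, (pow_le_pow_left₀ dist_nonneg d2 2).trans hfin,
    (pow_le_pow_left₀ dist_nonneg d3 2).trans hfin⟩

/-! ### Definiteness and the inf-sup condition -/

theorem poly_eq_zero_of_integral_sq {τ : M.Tri} {p : Poly} (h : ∫ x in M.tri τ, pval p x ^ 2 = 0) : p = 0 :=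
  M.poly_eq_zero_of_sq_integral (L := 1) (fun x _ => by simp [pval]) (fun x _ => by simp [pval])
    (by simpa [pval] using h)

theorem eq_zero_of_normT {H : M.PT} (h : M.normT H = 0) : H = 0 := by
  have h1 : M.ipT H H = 0 := by
    rwa [normT, Real.sqrt_eq_zero (M.ipT_self_nonneg H)] at h
  have h2 : ∀ τ, ∫ x in M.tri τ, ∑ i, ∑ j, M.tv H τ x i j * M.tv H τ x i j = 0 := fun τ =>
    (Finset.sum_eq_zero_iff_of_nonneg fun σ _ => integral_nonneg fun x =>
      Finset.sum_nonneg fun _ _ => Finset.sum_nonneg fun _ _ => mul_self_nonneg _).1 h1 τ (Finset.mem_univ τ)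
  ext1 τ; ext1 i; ext1 j
  refine M.poly_eq_zero_of_integral_sq (τ := τ) (le_antisymm ?_ (integral_nonneg fun x => sq_nonneg _))
  rw [← h2 τ]
  refine integral_mono (M.integrableOn_tri τ (by fun_prop)) (M.integrableOn_tri τ
    (M.continuous_ipT_integrand _ _ τ)) fun x => ?_
  dsimp only
  rw [sq]
  refine le_trans ?_ (Finset.single_le_sum (f := fun i => ∑ j, M.tv H τ x i j * M.tv H τ x i j)
    (fun _ _ => Finset.sum_nonneg fun _ _ => mul_self_nonneg _) (Finset.mem_univ i))
  exact Finset.single_le_sum (f := fun j => M.tv H τ x i j * M.tv H τ x i j)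
    (fun _ _ => mul_self_nonneg _) (Finset.mem_univ j)

theorem eq_zero_of_normV {v : M.PV} (h : M.normV v = 0) : v = 0 := by
  have h1 : M.ipV v v = 0 := by
    rwa [normV, Real.sqrt_eq_zero (M.ipV_self_nonneg v)] at h
  have h2 : ∀ τ, ∫ x in M.tri τ, M.vv v τ x ⬝ᵥ M.vv v τ x = 0 := fun τ =>
    (Finset.sum_eq_zero_iff_of_nonneg fun σ _ => integral_nonneg fun x => dot_self_nonneg _).1 h1 τ
      (Finset.mem_univ τ)
  ext1 τ; ext1 i
  refine M.poly_eq_zero_of_integral_sq (τ := τ) (le_antisymm ?_ (integral_nonneg fun x => sq_nonneg _))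
  rw [← h2 τ]
  exact integral_mono (M.integrableOn_tri τ (by fun_prop)) (M.integrableOn_tri τ (by fun_prop))
    fun x => sq_le_dot_self (M.vv v τ x) i

/-- Definiteness is the discrete Poincaré inequality with a constant that may depend on the mesh. -/
theorem eq_zero_of_normh (hΩ : IsPolygonalDomain Ω) {k : ℕ} {v : M.PV} (hv : v ∈ M.Vh k)
    (h : M.normh v = 0) : v = 0 := by
  obtain ⟨κ, hκ0, hκ⟩ := M.exists_shape
  obtain ⟨_, C, _, hC, hb⟩ := exists_Nh_le hΩ k κ hκ0
  have h1 := (hb M hκ).2 v hv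
  rw [h, mul_zero] at h1
  exact M.eq_zero_of_normV (le_antisymm h1 (Real.sqrt_nonneg _))

theorem normT_pos {H : M.PT} (h : H ≠ 0) : 0 < M.normT H :=
  lt_of_le_of_ne (Real.sqrt_nonneg _) fun h' => h (M.eq_zero_of_normT h'.symm)

theorem normh_pos (hΩ : IsPolygonalDomain Ω) {k : ℕ} {v : M.PV} (hv : v ∈ M.Vh k) (h : v ≠ 0) :
    0 < M.normh v :=
  lt_of_le_of_ne (M.normh_nonneg v) fun h' => h (M.eq_zero_of_normh hΩ hv h'.symm)

theorem exists_infSup (hΩ : IsPolygonalDomain Ω) (k : ℕ) (κ : ℝ) (hκ0 : 0 < κ) : ∃ C : ℝ, 0 < C ∧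
    ∀ M : Mesh Ω, M.Shape κ → M.InfSup k C := by
  obtain ⟨C, hC, h⟩ := exists_test k κ hκ0
  -- The test tensor has ‖v‖_h² ≤ 2 B_h(H, v) and ‖H‖ ≤ C‖v‖_h, so the quotient is at least 1/(2C).
  refine ⟨(2 * C)⁻¹, by positivity, fun M hM => le_iInf₂ fun v hv => ?_⟩
  obtain ⟨H, hH, h1, h2⟩ := h M hM v hv.1.1
  have hn := M.normh_pos hΩ hv.1 hv.2
  have hB : 0 < M.Bh H v := by nlinarith
  have hH0 : H ≠ 0 := by
    rintro rfl
    rw [(M.isLinear_Bh_left v).map_zero] at hB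
    exact lt_irrefl _ hB
  have hT := M.normT_pos hH0
  refine le_iSup₂_of_le H ⟨hH, hH0⟩ ?_
  rw [EReal.coe_le_coe_iff, le_div_iff₀ (by positivity), inv_mul_le_iff₀ (by positivity)]
  calc M.normT H * M.normh v ≤ C * M.normh v * M.normh v := by gcongr
    _ = C * M.normh v ^ 2 := by ring
    _ ≤ C * (2 * M.Bh H v) := by gcongr
    _ = _ := by ring

theorem normh_zero : M.normh 0 = 0 := by
  have h : M.vv 0 = 0 := by ext τ x i; simp [vv]
  have h2 : M.gradV 0 = 0 := by ext1 τ; ext1 i; ext1 j; simp [gradV]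
  have h3 : ∀ τ x, M.jumpP (0 : M.Tri → Plane → Fin 2 → ℝ) τ x = 0 := fun τ x => by
    unfold jumpP; split <;> simp
  rw [normh_eq, h2, (M.isLinear_ipT_left 0).map_zero]
  unfold jumpEnergy
  simp [h, h3, jumpD, segMean]

/-- The inf-sup condition in the form in which it is used. -/
theorem InfSup.mul_normh_le (hΩ : IsPolygonalDomain Ω) {k : ℕ} {C : ℝ} (h : M.InfSup k C) {v : M.PV}
    (hv : v ∈ M.Vh k) {X : ℝ} (hX : 0 ≤ X) (hB : ∀ H ∈ M.Hh k, M.Bh H v ≤ X * M.normT H) :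
    C * M.normh v ≤ X := by
  by_cases hv0 : v = 0
  · rw [hv0, normh_zero, mul_zero]; exact hX
  have hn := M.normh_pos hΩ hv hv0
  rw [← le_div_iff₀ hn]
  have h1 := h.trans (iInf₂_le v ⟨hv, hv0⟩)
  rw [← EReal.coe_le_coe_iff]
  refine h1.trans (iSup₂_le fun H hH => ?_)
  rw [EReal.coe_le_coe_iff]
  have hT := M.normT_pos hH.2
  rw [div_le_div_iff₀ (by positivity) hn]
  have := hB H hH.1
  calc M.Bh H v * M.normh v ≤ X * M.normT H * M.normh v := by gcongr
    _ = _ := by ring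

end Mesh

/-! ### Uniqueness of the discrete pressure. -/

theorem pval_eq_of_pderiv_eq_zero {p : Poly} (h : ∀ i, MvPolynomial.pderiv i p = 0) (x y : Plane) :
    pval p x = pval p y := by
  refine is_const_of_fderiv_eq_zero (𝕜 := ℝ) (differentiable_pval p) (fun z => ?_) x y
  refine ContinuousLinearMap.coe_injective
    ((EuclideanSpace.basisFun (Fin 2) ℝ).toBasis.ext fun i => ?_)
  have := fderiv_pval p z i
  rw [h i, pval_zero] at this
  simpa using this

/-- The plane without countably many points is connected, and a ball is homeomorphic to the plane.
The set removed later is that of the vertices of the triangulation. -/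
theorem isPreconnected_ball_diff_finite (x : Plane) {r : ℝ} (hr : 0 < r) {V : Set Plane} (hV : V.Finite) :
    IsPreconnected (Metric.ball x r \ V) := by
  set e := OpenPartialHomeomorph.univBall x r with he
  have hs : e.source = Set.univ := OpenPartialHomeomorph.univBall_source x r
  have ht : e.target = Metric.ball x r := OpenPartialHomeomorph.univBall_target x hr
  have hinj : Function.Injective e := by
    rw [← Set.injOn_univ, ← hs]; exact e.injOn
  have hr2 : 1 < Module.rank ℝ Plane :=
    Module.one_lt_rank_of_one_lt_finrank (by simp)
  have h1 : IsPreconnected ((e ⁻¹' V)ᶜ) :=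
    ((hV.preimage hinj.injOn).countable.isConnected_compl_of_one_lt_rank hr2).isPreconnected
  have h2 := h1.image e (OpenPartialHomeomorph.continuous_univBall x r).continuousOn
  convert h2 using 1
  rw [← ht, ← e.image_source_eq_target, hs]
  ext y
  constructor
  · rintro ⟨⟨z, _, rfl⟩, hz⟩; exact ⟨z, hz, rfl⟩
  · rintro ⟨z, hz, rfl⟩; exact ⟨⟨z, trivial, rfl⟩, hz⟩

namespace Mesh

variable {Ω : Set Plane} (M : Mesh Ω)

theorem t1_dot_nD (τ : M.Tri) : M.t1 τ ⬝ᵥ M.nD τ = 0 := by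
  simp [nD, normal, tangent, t1, dotProduct, Fin.sum_univ_two]; ring

theorem t2_dot_nD (τ : M.Tri) : M.t2 τ ⬝ᵥ M.nD τ = -(M.D τ / M.hD τ) := by
  rw [M.D_eq]
  simp [nD, normal, tangent, t1, t2, dotProduct, Fin.sum_univ_two, hD]; ring

theorem t2_prev (τ : M.Tri) : M.t2 (M.prev τ) = M.t1 τ := by
  ext i; change M.b (M.prev τ) i - M.c (M.prev τ) i = _
  rw [b_prev, c_prev]; rfl

theorem t1_prev_dot_nD (τ : M.Tri) : M.t1 (M.prev τ) ⬝ᵥ M.nD τ = M.D (M.prev τ) / M.hD τ := by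
  have h : M.nD τ = normal (M.c (M.prev τ)) (M.b (M.prev τ)) := by rw [b_prev, c_prev]; rfl
  have h2 : M.hD τ = dist (M.c (M.prev τ)) (M.b (M.prev τ)) := by rw [b_prev, c_prev]; rfl
  rw [M.D_eq, h, h2]
  simp [normal, tangent, t1, t2, dotProduct, Fin.sum_univ_two]; ring

theorem eq_zero_of_frame {τ : M.Tri} {u : Fin 2 → ℝ} (h1 : M.t1 τ ⬝ᵥ u = 0) (h2 : M.t2 τ ⬝ᵥ u = 0) : u = 0 := by
  ext i
  have := M.frame_identity τ u i
  rw [h1, h2] at this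
  simpa using this.symm

/-- The test velocity is λ_a(∂_{t₁}p)t₁ + λ_b(∂_{t₂}p)t₂. On the dual edge along t₁ the first term
is tangential and λ_b vanishes, on the other one conversely; so all normal traces on dual edges are
zero and b_h reduces to weighted squares of the two directional derivatives. -/
theorem pderiv_eq_zero_of_bh {k : ℕ} {p : M.PS} (hp : ∀ τ, (p τ).totalDegree ≤ k)
    (h : ∀ v ∈ M.Vh k, M.bh v p = 0) (τ : M.Tri) (i : Fin 2) : MvPolynomial.pderiv i (p τ) = 0 := by
  let q1 : M.PS := fun τ => ∑ j, MvPolynomial.C (M.t1 τ j) * MvPolynomial.pderiv j (p τ)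
  let q2 : M.PS := fun τ => ∑ j, MvPolynomial.C (M.t2 τ j) * MvPolynomial.pderiv j (p τ)
  let v : M.PV := fun τ i => MvPolynomial.C (M.t1 τ i) * (M.lamA τ * q1 τ) +
    MvPolynomial.C (M.t2 τ i) * (M.lamB τ * q2 τ)
  have hvv : ∀ τ x, M.vv v τ x = (pval (M.lamA τ) x * pval (q1 τ) x) • M.t1 τ +
      (pval (M.lamB τ) x * pval (q2 τ) x) • M.t2 τ := by
    intro τ x; ext i
    simp only [vv, v, pval_add, pval_mul, pval_C, Pi.add_apply, Pi.smul_apply, smul_eq_mul]; ring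
  have hn1 : ∀ τ, ∀ x ∈ segment ℝ (M.c τ) (M.a τ), M.vv v τ x ⬝ᵥ M.nD τ = 0 := by
    intro τ x hx
    rw [hvv, add_dotProduct, smul_dotProduct, smul_dotProduct, M.t1_dot_nD, M.lamB_eq_zero hx]
    simp
  have hn2 : ∀ τ, ∀ x ∈ segment ℝ (M.c τ) (M.a τ), M.vv v (M.prev τ) x ⬝ᵥ M.nD τ = 0 := by
    intro τ x hx
    have hx' : x ∈ segment ℝ (M.c (M.prev τ)) (M.b (M.prev τ)) := by rwa [b_prev, c_prev]
    rw [hvv, add_dotProduct, smul_dotProduct, smul_dotProduct, M.t2_prev, M.t1_dot_nD,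
      M.lamA_eq_zero hx']
    simp
  have hdeg : ∀ (τ : M.Tri) (L : Poly) (t : Fin 2 → ℝ), L.totalDegree ≤ 1 →
      (L * ∑ j, MvPolynomial.C (t j) * MvPolynomial.pderiv j (p τ)).totalDegree ≤ k := by
    intro τ L t hL
    rw [Finset.mul_sum]
    refine MvPolynomial.totalDegree_finsetSum_le fun j _ => ?_
    rw [mul_left_comm]
    exact totalDegree_C_mul_le _ (totalDegree_mul_pderiv_le j hL (hp τ))
  have hv : v ∈ M.Vh k := by
    refine ⟨fun τ i => totalDegree_add_le' (totalDegree_C_mul_le _ (hdeg τ _ _ (M.totalDegree_lam τ).1))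
      (totalDegree_C_mul_le _ (hdeg τ _ _ (M.totalDegree_lam τ).2.1)), fun τ x hx => ?_⟩
    rw [jumpD, sub_dotProduct, hn1 τ x hx, hn2 τ x hx, sub_zero]
  have h1 := h v hv
  have hz : ∑ τ, M.intD τ (fun x => (M.avgD (M.vv v) τ x ⬝ᵥ M.nD τ) * M.jumpD (M.sv p) τ x) = 0 := by
    refine Finset.sum_eq_zero fun τ _ => ?_
    rw [M.intD_congr (h := fun _ => 0)]
    · simp [intD, edgeInt]
    · intro x hx
      rw [avgD, smul_dotProduct, add_dotProduct, hn1 τ x hx, hn2 τ x hx]; simp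
  rw [bh, hz, add_zero, neg_eq_zero] at h1
  have hc : ∀ τ x, M.vv v τ x ⬝ᵥ M.vv (M.gradS p) τ x =
      pval (M.lamA τ) x * pval (q1 τ) x ^ 2 + pval (M.lamB τ) x * pval (q2 τ) x ^ 2 := by
    intro τ x
    rw [hvv]
    simp only [q1, q2, dotProduct, Fin.sum_univ_two, vv, gradS, pval_add, pval_mul, pval_C,
      Pi.add_apply, Pi.smul_apply, smul_eq_mul]
    ring
  simp only [ipV, hc] at h1
  have hnn : ∀ τ, 0 ≤ ∫ x in M.tri τ, pval (M.lamA τ) x * pval (q1 τ) x ^ 2 := fun τ =>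
    setIntegral_nonneg (M.isCompact_tri τ).measurableSet fun x hx =>
      mul_nonneg ((M.mem_tri_iff τ x).1 hx).1 (sq_nonneg _)
  have hnn2 : ∀ τ, 0 ≤ ∫ x in M.tri τ, pval (M.lamB τ) x * pval (q2 τ) x ^ 2 := fun τ =>
    setIntegral_nonneg (M.isCompact_tri τ).measurableSet fun x hx =>
      mul_nonneg ((M.mem_tri_iff τ x).1 hx).2.1 (sq_nonneg _)
  have hsplit : ∀ τ, ∫ x in M.tri τ, (pval (M.lamA τ) x * pval (q1 τ) x ^ 2 + pval (M.lamB τ) x * pval (q2 τ) x ^ 2) =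
      (∫ x in M.tri τ, pval (M.lamA τ) x * pval (q1 τ) x ^ 2) + ∫ x in M.tri τ, pval (M.lamB τ) x * pval (q2 τ) x ^ 2 :=
    fun τ => integral_add (M.integrableOn_tri τ (by fun_prop)) (M.integrableOn_tri τ (by fun_prop))
  simp only [hsplit] at h1
  have h2 := (Finset.sum_eq_zero_iff_of_nonneg fun τ _ => add_nonneg (hnn τ) (hnn2 τ)).1 h1 τ (Finset.mem_univ _)
  have e1 : q1 τ = 0 := M.poly_eq_zero_of_sq_integral (τ := τ) (L := M.lamA τ)
    (fun x hx => ((M.mem_tri_iff τ x).1 hx).1) (fun x hx => hx.1) (by linarith [hnn τ, hnn2 τ])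
  have e2 : q2 τ = 0 := M.poly_eq_zero_of_sq_integral (τ := τ) (L := M.lamB τ)
    (fun x hx => ((M.mem_tri_iff τ x).1 hx).2.1) (fun x hx => hx.2.1) (by linarith [hnn τ, hnn2 τ])
  refine poly_eq_zero_of_isOpen isOpen_univ ⟨0, trivial⟩ fun x _ => ?_
  have hu : (fun j => pval (MvPolynomial.pderiv j (p τ)) x) = 0 := by
    refine M.eq_zero_of_frame (τ := τ) ?_ ?_
    · have := congrArg (fun f => pval f x) e1
      simpa [q1, pval_sum, pval_mul, dotProduct, pval_add] using this
    · have := congrArg (fun f => pval f x) e2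
      simpa [q2, pval_sum, pval_mul, dotProduct, pval_add] using this
  exact congrFun hu i

/-- A field that is constant on each triangle can have any prescribed normal components on the two
dual edges of the triangle: t₁ has no normal component on the first and t₂ none on the second.
Prescribing the jumps φ of the pressure gives ∑ h_e φ² = 0. -/
theorem const_prev_of_bh {k : ℕ} {p : M.PS} (P : M.Tri → ℝ) (hP : ∀ τ x, M.sv p τ x = P τ)
    (h : ∀ v ∈ M.Vh k, M.bh v p = 0) (hgrad : M.gradS p = 0) (τ : M.Tri) : P (M.prev τ) = P τ := by
  let φ : M.Tri → ℝ := fun τ => P τ - P (M.prev τ)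
  let v : M.PV := fun σ i => MvPolynomial.C
    (φ (M.next σ) * (M.hD (M.next σ) / M.D σ) * M.t1 σ i - φ σ * (M.hD σ / M.D σ) * M.t2 σ i)
  have hvv : ∀ σ x, M.vv v σ x = (φ (M.next σ) * (M.hD (M.next σ) / M.D σ)) • M.t1 σ -
      (φ σ * (M.hD σ / M.D σ)) • M.t2 σ := by
    intro σ x; ext i
    simp only [vv, v, pval_C, Pi.sub_apply, Pi.smul_apply, smul_eq_mul]
  have hn1 : ∀ τ x, M.vv v τ x ⬝ᵥ M.nD τ = φ τ := by
    intro τ x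
    have h1 := (M.hD_pos τ).ne'
    have h2 := (M.D_pos τ).ne'
    rw [hvv, sub_dotProduct, smul_dotProduct, smul_dotProduct, M.t1_dot_nD, M.t2_dot_nD]
    simp only [smul_eq_mul]; field_simp; ring
  have hn2 : ∀ τ x, M.vv v (M.prev τ) x ⬝ᵥ M.nD τ = φ τ := by
    intro τ x
    have h1 := (M.hD_pos τ).ne'
    have h2 := (M.D_pos (M.prev τ)).ne'
    rw [hvv, sub_dotProduct, smul_dotProduct, smul_dotProduct, M.t2_prev, M.t1_dot_nD, M.t1_prev_dot_nD,
      next_prev]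
    simp only [smul_eq_mul]; field_simp; ring
  have hv : v ∈ M.Vh k := by
    refine ⟨fun τ i => (MvPolynomial.totalDegree_C _).trans_le (Nat.zero_le _), fun τ x _ => ?_⟩
    rw [jumpD, sub_dotProduct, hn1, hn2, sub_self]
  have h1 := h v hv
  have hip : M.ipV v (M.gradS p) = 0 := by
    have := (M.isLinear_ipV_right v).map_zero
    simpa [hgrad] using this
  rw [bh, hip, neg_zero, zero_add] at h1
  have h2 : ∀ τ, M.intD τ (fun x => (M.avgD (M.vv v) τ x ⬝ᵥ M.nD τ) * M.jumpD (M.sv p) τ x) =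
      M.hD τ * φ τ ^ 2 := by
    intro τ
    have : (fun x => (M.avgD (M.vv v) τ x ⬝ᵥ M.nD τ) * M.jumpD (M.sv p) τ x) = fun _ => φ τ ^ 2 := by
      ext x
      rw [avgD, smul_dotProduct, add_dotProduct, hn1, hn2, jumpD, hP, hP]
      simp only [smul_eq_mul, φ]; ring
    rw [this]
    simp [intD, edgeInt, hD]
  simp only [h2] at h1
  have h3 := (Finset.sum_eq_zero_iff_of_nonneg fun τ _ =>
    mul_nonneg (M.hD_pos τ).le (sq_nonneg (φ τ))).1 h1 τ (Finset.mem_univ _)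
  have h4 := pow_eq_zero_iff two_ne_zero |>.1 ((mul_eq_zero.1 h3).resolve_left (M.hD_pos τ).ne')
  simp only [φ] at h4
  linarith

theorem const_cell {P : M.Tri → ℝ} (h : ∀ τ, P (M.prev τ) = P τ) {τ σ : M.Tri} (hc : τ.1 = σ.1) :
    P τ = P σ := by
  obtain ⟨i, j⟩ := τ
  obtain ⟨i', j'⟩ := σ
  simp only at hc
  subst hc
  have hn : ∀ τ, P (M.next τ) = P τ := fun τ => by rw [← h (M.next τ), prev_next]
  have key : ∀ (m : ℕ) (g : Fin m → ℝ), (∀ j, g (finRotate m j) = g j) → ∀ j j', g j = g j' := by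
    intro m g hg
    rcases m with _ | n
    · exact fun j => j.elim0
    · have h0 : ∀ (l : ℕ) (hl : l < n + 1), g ⟨l, hl⟩ = g 0 := by
        intro l
        induction l with
        | zero => intro _; rfl
        | succ l ih =>
          intro hl
          rw [← ih (by omega), ← hg ⟨l, by omega⟩]
          congr 1
          rw [finRotate_of_lt (by omega)]
      intro j j'
      exact (h0 j j.2).trans (h0 j' j'.2).symm
  exact key _ (fun j => P ⟨i, j⟩) (fun j => hn ⟨i, j⟩) j j'

theorem tri_eq_closure_interior (τ : M.Tri) : closure (interior (M.tri τ)) = M.tri τ := by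
  have h : Convex ℝ (M.tri τ) := convex_convexHull ℝ _
  rw [h.closure_interior_eq_closure_of_nonempty_interior
    ((M.openTri_nonempty τ).mono (M.openTri_subset_interior τ))]
  exact (M.isCompact_tri τ).isClosed.closure_eq

/-- The centre is an interior point of its element, whereas a triangle of another element is the
closure of its interior and meets this element in a null set. -/
theorem c_notMem_tri {τ σ : M.Tri} (h : τ.1 ≠ σ.1) : M.c τ ∉ M.tri σ := by
  intro hc
  have h1 : M.c τ ∈ interior (M.cell τ.1) :=
    interior_mono (fun y hy => hy.1) (M.center_mem τ.1)
  rw [← M.tri_eq_closure_interior] at hc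
  obtain ⟨y, hy1, hy2⟩ := mem_closure_iff.1 hc _ isOpen_interior h1
  have h2 : 0 < volume (interior (M.cell τ.1) ∩ interior (M.tri σ)) :=
    (isOpen_interior.inter isOpen_interior).measure_pos _ ⟨y, hy1, hy2⟩
  refine h2.ne' (measure_mono_null (Set.inter_subset_inter interior_subset interior_subset) ?_)
  rw [M.cell_eq, Set.iUnion_inter]
  refine measure_iUnion_null fun j => M.volume_tri_inter fun h' => h ?_
  rw [← h']

/-- Both triangles would lie to the left of the oriented edge from a to b, so their interiors would
overlap near its midpoint. -/
theorem not_same_side {τ σ : M.Tri} (hne : τ ≠ σ) (ha : M.a τ = M.a σ) (hb : M.b τ = M.b σ) : False := by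
  have hD := M.D_pos τ
  have hDσ := M.D_pos σ
  let y : ℝ → Plane := fun ε => triMap (M.c τ) (M.a τ) (M.b τ) ((1 - ε) / 2) ((1 - ε) / 2)
  have hyc : Continuous y := by
    have : y = fun ε : ℝ => (fun ξ : ℝ × ℝ => triMap (M.c τ) (M.a τ) (M.b τ) ξ.1 ξ.2) ((1 - ε) / 2, (1 - ε) / 2) := rfl
    rw [this]
    exact (continuous_triMap _ _ _).comp (by fun_prop)
  have hC : ∀ x, M.D σ * pval (M.lamC σ) x = M.D τ * pval (M.lamC τ) x := by
    intro x
    rw [lamC, lamC, pval_mul, pval_mul, pval_C, pval_C, mul_inv_cancel_left₀ hD.ne',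
      mul_inv_cancel_left₀ hDσ.ne', pval_crossPoly, pval_crossPoly, ha, hb]
  have hy0 : y 0 = triMap (M.c σ) (M.a σ) (M.b σ) (1 / 2) (1 / 2) := by
    ext i; simp only [y, triMap_apply, ha, hb]; ring
  have e1 : ∀ᶠ ε in 𝓝[>] (0 : ℝ), 0 < pval (M.lamA σ) (y ε) := by
    refine nhdsWithin_le_nhds ((((continuous_pval _).comp hyc).tendsto 0).eventually (lt_mem_nhds ?_))
    rw [Function.comp_apply, hy0, pval_lamA]; norm_num
  have e2 : ∀ᶠ ε in 𝓝[>] (0 : ℝ), 0 < pval (M.lamB σ) (y ε) := by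
    refine nhdsWithin_le_nhds ((((continuous_pval _).comp hyc).tendsto 0).eventually (lt_mem_nhds ?_))
    rw [Function.comp_apply, hy0, pval_lamB]; norm_num
  have e3 : ∀ᶠ ε in 𝓝[>] (0 : ℝ), ε ∈ Set.Ioo (0 : ℝ) 1 := Ioo_mem_nhdsGT one_pos
  obtain ⟨ε, h1, h2, h3, h4⟩ := (e1.and (e2.and e3)).exists
  have hl : pval (M.lamC τ) (y ε) = ε := by rw [pval_lamC]; ring
  refine (M.tri_disjoint hne).ne_of_mem (a := y ε) (b := y ε) ?_ ?_ rfl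
  · refine M.openTri_subset_interior τ ⟨?_, ?_, ?_⟩
    · rw [pval_lamA]; linarith
    · rw [pval_lamB]; linarith
    · rw [hl]; exact h3
  · refine M.openTri_subset_interior σ ⟨h1, h2, ?_⟩
    have := hC (y ε)
    rw [hl] at this
    by_contra hneg
    nlinarith [mul_pos hD h3]

/-- The vertices of the triangulation. -/
def vertices : Set Plane := ⋃ τ, {M.c τ, M.a τ, M.b τ}

theorem vertices_finite : M.vertices.Finite := Set.finite_iUnion fun τ => by simp

/-- By conformity the point is in the hull of the common vertices. It is not a vertex, so at least
two are common. The centres are not common by `c_notMem_tri`; hence a whole primal edge is, and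
`not_same_side` leaves only the opposite orientation, which is the definition of a neighbour. -/
theorem nbr_of_mem_inter {τ σ : M.Tri} (hc : τ.1 ≠ σ.1) {x : Plane} (hτ : x ∈ M.tri τ) (hσ : x ∈ M.tri σ)
    (hx : x ∉ M.vertices) : M.nbr τ = some σ := by
  have hne : τ ≠ σ := fun h => hc (by rw [h])
  have hx' : x ∈ convexHull ℝ (({M.c τ, M.a τ, M.b τ} : Set Plane) ∩ {M.c σ, M.a σ, M.b σ}) :=
    (M.conforming τ σ hne).subset ⟨hτ, hσ⟩
  have hv : ∀ (ρ : M.Tri) (y : Plane), y ∈ ({M.c ρ, M.a ρ, M.b ρ} : Set Plane) → y ∈ M.tri ρ :=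
    fun ρ y hy => subset_convexHull ℝ _ hy
  have h1 : M.c τ ∉ ({M.c σ, M.a σ, M.b σ} : Set Plane) := fun h => M.c_notMem_tri hc (hv σ _ h)
  have h2 : M.c σ ∉ ({M.c τ, M.a τ, M.b τ} : Set Plane) := fun h => M.c_notMem_tri hc.symm (hv τ _ h)
  have hsing : ∀ y, y ∈ M.vertices →
      ¬ (({M.c τ, M.a τ, M.b τ} : Set Plane) ∩ {M.c σ, M.a σ, M.b σ} ⊆ {y}) := by
    intro y hy h
    have := convexHull_mono h hx'
    rw [convexHull_singleton, Set.mem_singleton_iff] at this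
    exact hx (this ▸ hy)
  have hav : M.a τ ∈ M.vertices := Set.mem_iUnion.2 ⟨τ, by simp⟩
  have hbv : M.b τ ∈ M.vertices := Set.mem_iUnion.2 ⟨τ, by simp⟩
  have ha : M.a τ ∈ ({M.c σ, M.a σ, M.b σ} : Set Plane) := by
    by_contra h
    refine hsing _ hbv fun y hy => ?_
    rcases hy.1 with rfl | rfl | rfl
    · exact absurd hy.2 h1
    · exact absurd hy.2 h
    · rfl
  have hb : M.b τ ∈ ({M.c σ, M.a σ, M.b σ} : Set Plane) := by
    by_contra h
    refine hsing _ hav fun y hy => ?_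
    rcases hy.1 with rfl | rfl | rfl
    · exact absurd hy.2 h1
    · rfl
    · exact absurd hy.2 h
  have hac : M.a τ ≠ M.c σ := fun h => h2 (by rw [← h]; simp)
  have hbc : M.b τ ≠ M.c σ := fun h => h2 (by rw [← h]; simp)
  have hab := M.a_ne_b τ
  rcases ha with h | h | h
  · exact absurd h hac
  · rcases hb with h' | h' | h'
    · exact absurd h' hbc
    · exact absurd (h.trans h'.symm) hab
    · exact (M.not_same_side hne h h').elim
  · rcases hb with h' | h' | h'
    · exact absurd h' hbc
    · exact (M.nbr_spec τ σ).2 ⟨h'.symm, h.symm⟩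
    · exact absurd (h.trans h'.symm) hab

/-- A function that is constant on the triangles, the primal elements, and across the primal edges is
constant on a connected domain. -/
theorem const_of_nbr (hΩ : IsPolygonalDomain Ω) {P : M.Tri → ℝ} (h1 : ∀ τ, P (M.prev τ) = P τ)
    (h2 : ∀ τ σ, M.nbr τ = some σ → P τ = P σ) (τ σ : M.Tri) : P τ = P σ := by
  have key : ∀ τ σ x, x ∈ M.tri τ → x ∈ M.tri σ → x ∉ M.vertices → P τ = P σ := by
    intro τ σ x hτ hσ hx
    by_cases hc : τ.1 = σ.1
    · exact M.const_cell h1 hc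
    · exact h2 _ _ (M.nbr_of_mem_inter hc hτ hσ hx)
  by_contra hne
  let A : Set Plane := ⋃ ρ : {ρ : M.Tri // P ρ = P τ}, M.tri ρ
  let B : Set Plane := ⋃ ρ : {ρ : M.Tri // P ρ ≠ P τ}, M.tri ρ
  have hA : IsClosed A := isClosed_iUnion_of_finite fun ρ => (M.isCompact_tri ρ).isClosed
  have hB : IsClosed B := isClosed_iUnion_of_finite fun ρ => (M.isCompact_tri ρ).isClosed
  have hcov : Ω ⊆ A ∪ B := by
    intro x hx
    have := subset_closure hx
    rw [← M.iUnion_tri] at this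
    obtain ⟨ρ, hρ⟩ := Set.mem_iUnion.1 this
    by_cases h : P ρ = P τ
    · exact Or.inl (Set.mem_iUnion.2 ⟨⟨ρ, h⟩, hρ⟩)
    · exact Or.inr (Set.mem_iUnion.2 ⟨⟨ρ, h⟩, hρ⟩)
  have hAB : A ∩ B ⊆ M.vertices := by
    rintro x ⟨hxA, hxB⟩
    obtain ⟨⟨ρ, hρ⟩, hxρ⟩ := Set.mem_iUnion.1 hxA
    obtain ⟨⟨ρ', hρ'⟩, hxρ'⟩ := Set.mem_iUnion.1 hxB
    by_contra hx
    exact hρ' ((key ρ ρ' x hxρ hxρ' hx).symm.trans hρ)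
  have hdense : Dense (M.vertices)ᶜ := M.vertices_finite.countable.dense_compl ℝ
  -- The two closed pieces meet in vertices only. A small ball without the vertices is still
  -- connected, so it lies in one piece, and by density the whole ball does. The interiors of the
  -- pieces then form a disjoint open cover of the connected set Ω.
  have hloc : Ω ⊆ interior A ∪ interior B := by
    intro x hx
    obtain ⟨r, hr, hball⟩ := Metric.isOpen_iff.1 hΩ.isOpen x hx
    have hpre := isPreconnected_ball_diff_finite x hr M.vertices_finite
    have hcl : Metric.ball x r ⊆ closure (Metric.ball x r \ M.vertices) :=
      hdense.open_subset_closure_inter Metric.isOpen_ball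
    have hxb := Metric.ball_mem_nhds x hr
    rcases isPreconnected_iff_subset_of_disjoint_closed.1 hpre A B hA hB
      (fun y hy => hcov (hball hy.1))
      (Set.eq_empty_of_forall_notMem fun y hy => hy.1.2 (hAB hy.2)) with h | h
    · exact Or.inl (mem_interior_iff_mem_nhds.2 (Filter.mem_of_superset hxb
        (hcl.trans (closure_minimal h hA))))
    · exact Or.inr (mem_interior_iff_mem_nhds.2 (Filter.mem_of_superset hxb
        (hcl.trans (closure_minimal h hB))))
  have hdisj : interior A ∩ interior B = ∅ := by
    rw [← interior_inter]
    exact Set.subset_empty_iff.1 ((interior_mono hAB).trans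
      (interior_eq_empty_iff_dense_compl.2 hdense).subset)
  have hconn : IsPreconnected Ω := hΩ.isSimplyConnected.isPathConnected.isConnected.isPreconnected
  have hmem : ∀ ρ : M.Tri, ∃ x, x ∈ Ω ∧ x ∈ interior (M.tri ρ) := fun ρ => by
    obtain ⟨x, hx⟩ := M.openTri_nonempty ρ
    exact ⟨x, M.interior_tri_subset hΩ ρ (M.openTri_subset_interior ρ hx), M.openTri_subset_interior ρ hx⟩
  obtain ⟨x, hxΩ, hxτ⟩ := hmem τ
  obtain ⟨y, hyΩ, hyσ⟩ := hmem σ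
  have hxA : x ∈ interior A := interior_mono
    (fun z hz => Set.mem_iUnion.2 ⟨⟨τ, rfl⟩, hz⟩) hxτ
  have hyB : y ∈ interior B := interior_mono
    (fun z hz => Set.mem_iUnion.2 ⟨⟨σ, fun h => hne h.symm⟩, hz⟩) hyσ
  obtain ⟨z, _, hz⟩ := hconn _ _ isOpen_interior isOpen_interior hloc ⟨x, hxΩ, hxA⟩ ⟨y, hyΩ, hyB⟩
  rw [hdisj] at hz
  exact hz

/-- Uniqueness of the discrete pressure. -/
theorem eq_zero_of_bhStar (hΩ : IsPolygonalDomain Ω) {k : ℕ} {p : M.PS} (hp : p ∈ M.Qh0 k)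
    (h : ∀ v ∈ M.Vh k, M.bhStar p v = 0) : p = 0 := by
  have h' : ∀ v ∈ M.Vh k, M.bh v p = 0 := fun v hv => by
    rw [M.bh_eq_neg_bhStar hv hp.1, h v hv, neg_zero]
  have hg := M.pderiv_eq_zero_of_bh hp.1.1 h'
  let P : M.Tri → ℝ := fun τ => M.sv p τ 0
  have hP : ∀ τ x, M.sv p τ x = P τ := fun τ x => pval_eq_of_pderiv_eq_zero (hg τ) x 0
  have hgrad : M.gradS p = 0 := by ext1 τ; ext1 i; exact hg τ i
  have hconst := M.const_of_nbr hΩ (M.const_prev_of_bh P hP h' hgrad) fun τ σ hn => by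
    have := hp.1.2 τ (by rw [hn]; simp) (M.a τ) (left_mem_segment ℝ _ _)
    simp only [jumpP, hn, hP] at this
    linarith
  ext1 τ
  refine poly_eq_zero_of_isOpen isOpen_univ ⟨0, trivial⟩ fun x _ => ?_
  have h2 := hp.2
  simp only [hP, fun σ => hconst σ τ] at h2
  rw [← M.setIntegral_eq_sum hΩ fun σ => M.integrableOn_tri σ continuous_const] at h2
  rw [setIntegral_const, smul_eq_mul, mul_eq_zero] at h2
  refine (hP τ x).trans (h2.resolve_left (ne_of_gt ?_))
  refine ENNReal.toReal_pos (hΩ.isOpen.measure_pos volume ?_).ne' hΩ.isBounded.measure_lt_top.ne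
  exact hΩ.isSimplyConnected.isPathConnected.nonempty

end Mesh

/-! ### Pushing a neighbourhood of a boundary point into the domain -/

/-- Near `x` the closure of the domain is pushed into the domain by small multiples of a fixed vector,
together with balls of proportional radius. -/
def PushesIn (Ω : Set Plane) (U : Set Plane) (e : Plane) (ε₀ : ℝ) : Prop :=
  ∀ ε, 0 < ε → ε < ε₀ → ∀ y ∈ closure Ω ∩ U, ∀ z ∈ Metric.closedBall (ε • e) ε, y + z ∈ Ω

/-- At a point of Ω a small ball suffices, with zero vector. At a boundary point the shift goes up
the graph, steeply enough to beat its Lipschitz constant. -/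
theorem exists_pushesIn {Ω : Set Plane} (hΩ : IsPolygonalDomain Ω) {x : Plane} (hx : x ∈ closure Ω) :
    ∃ U : Set Plane, IsOpen U ∧ x ∈ U ∧ ∃ e : Plane, ∃ ε₀ > 0, PushesIn Ω U e ε₀ := by
  by_cases hxΩ : x ∈ Ω
  · obtain ⟨r, hr, hball⟩ := Metric.isOpen_iff.1 hΩ.isOpen x hxΩ
    refine ⟨Metric.ball x (r / 2), Metric.isOpen_ball, Metric.mem_ball_self (by positivity), 0, r / 2,
      by positivity, fun ε hε hε' y hy z hz => hball ?_⟩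
    rw [smul_zero, mem_closedBall_zero_iff] at hz
    rw [Metric.mem_ball, dist_eq_norm]
    have h1 := hy.2
    rw [Metric.mem_ball, dist_eq_norm] at h1
    calc ‖y + z - x‖ = ‖(y - x) + z‖ := by congr 1; abel
      _ ≤ ‖y - x‖ + ‖z‖ := norm_add_le _ _
      _ < r := by linarith
  · have hfr : x ∈ frontier Ω := ⟨hx, by rwa [hΩ.isOpen.interior_eq]⟩
    obtain ⟨R, K, γ, hγ, U, hU, hUΩ⟩ := hΩ.lipschitz x hfr
    obtain ⟨r, hr, hball⟩ := Metric.mem_nhds_iff.1 hU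
    have hcl : ∀ y ∈ closure Ω ∩ Metric.ball x r, γ (R y 0) ≤ R y 1 := by
      rintro y ⟨hy, hyb⟩
      have h1 : y ∈ closure (Metric.ball x r ∩ Ω) :=
        Metric.isOpen_ball.inter_closure ⟨hyb, hy⟩
      have hcl : IsClosed {y : Plane | γ (R y 0) ≤ R y 1} := by
        refine isClosed_le (hγ.continuous.comp ?_) ?_
        · exact (EuclideanSpace.proj (𝕜 := ℝ) (0 : Fin 2)).continuous.comp R.continuous
        · exact (EuclideanSpace.proj (𝕜 := ℝ) (1 : Fin 2)).continuous.comp R.continuous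
      exact closure_minimal (fun z hz => ((hUΩ z (hball hz.1)).1 hz.2).le) hcl h1
    have hK := K.2
    -- A vector within ε of ε times this one rises by at least (K + 1)ε, while the graph rises by at
    -- most Kε over its horizontal displacement.
    set e₁ : Plane := EuclideanSpace.single 1 ((K : ℝ) + 2) with he1
    set e : Plane := R.symm e₁ with he
    refine ⟨Metric.ball x (r / 2), Metric.isOpen_ball, Metric.mem_ball_self (by positivity), e,
      r / (2 * (‖e‖ + 1)), by positivity, fun ε hε hε' y hy z hz => ?_⟩
    rw [mem_closedBall_iff_norm] at hz
    have hzn : ‖z‖ ≤ ε * (‖e‖ + 1) := by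
      calc ‖z‖ = ‖(z - ε • e) + ε • e‖ := by rw [sub_add_cancel]
        _ ≤ ‖z - ε • e‖ + ‖ε • e‖ := norm_add_le _ _
        _ ≤ ε + ε * ‖e‖ := by rw [norm_smul, Real.norm_eq_abs, abs_of_pos hε]; linarith
        _ = _ := by ring
    have hzr : ‖z‖ < r / 2 := by
      refine hzn.trans_lt ?_
      have : 0 < ‖e‖ + 1 := by positivity
      rw [lt_div_iff₀ (by positivity)] at hε'
      linarith
    have hyr : ‖y - x‖ < r / 2 := mem_ball_iff_norm.1 hy.2
    have hyz : y + z ∈ Metric.ball x r := by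
      rw [mem_ball_iff_norm]
      calc ‖y + z - x‖ = ‖(y - x) + z‖ := by congr 1; abel
        _ ≤ ‖y - x‖ + ‖z‖ := norm_add_le _ _
        _ < r := by linarith
    rw [hUΩ _ (hball hyz)]
    have h1 := hcl y ⟨hy.1, Metric.ball_subset_ball (by linarith) hy.2⟩
    set d := R (z - ε • e) with hd
    have hdn : ‖d‖ ≤ ε := by rw [hd, R.norm_map]; exact hz
    have hRz : R z = d + ε • e₁ := by
      rw [hd, map_sub, map_smul, he, R.apply_symm_apply, sub_add_cancel]
    have hd0 : |d 0| ≤ ε := (PiLp.norm_apply_le d 0).trans hdn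
    have hd1 : |d 1| ≤ ε := (PiLp.norm_apply_le d 1).trans hdn
    have hz0 : R z 0 = d 0 := by rw [hRz]; simp [he1]
    have hz1 : R z 1 = d 1 + ε * (K + 2) := by rw [hRz]; simp [he1]
    have hlip := hγ.dist_le_mul (R (y + z) 0) (R y 0)
    rw [map_add, Real.dist_eq, Real.dist_eq] at hlip
    rw [map_add]
    simp only [PiLp.add_apply, add_sub_cancel_left] at hlip ⊢
    rw [hz0] at hlip ⊢
    rw [hz1]
    have h2 := (abs_le.1 hlip).2
    have h3 := (abs_le.1 hd1).1
    have h4 : (K : ℝ) * |d 0| ≤ K * ε := by gcongr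
    nlinarith

/-! ### Mollification -/

def mollify (k V : Plane → ℝ) (x : Plane) : ℝ := ∫ t, V t * k (x - t)

theorem contDiff_mollify {k V : Plane → ℝ} (hk : ContDiff ℝ ∞ k) (hkc : HasCompactSupport k) (hV : Integrable V) :
    ContDiff ℝ ∞ (mollify k V) :=
  hkc.contDiff_convolution_right (ContinuousLinearMap.mul ℝ ℝ) hV.locallyIntegrable hk

theorem partialD_mollify {k V : Plane → ℝ} (hk : ContDiff ℝ ∞ k) (hkc : HasCompactSupport k) (hV : Integrable V)
    (i : Fin 2) (x : Plane) : partialD i (mollify k V) x = ∫ t, V t * partialD i k (x - t) := by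
  have hk1 : ContDiff ℝ 1 k := hk.of_le (by exact_mod_cast le_top)
  have h := hkc.hasFDerivAt_convolution_right (ContinuousLinearMap.mul ℝ ℝ) hV.locallyIntegrable hk1 x
  unfold partialD
  have h' : fderiv ℝ (mollify k V) x = _ := h.fderiv
  rw [h', convolution_precompR_apply _ hV.locallyIntegrable (hkc.fderiv ℝ)
    (hk1.continuous_fderiv (by norm_num))]
  rfl

theorem mollify_eq (k V : Plane → ℝ) (x : Plane) : mollify k V x = ∫ t, k t * V (x - t) := by
  unfold mollify
  rw [← integral_sub_left_eq_self _ volume x]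
  simp [mul_comm]

open scoped Pointwise in
theorem tsupport_mollify_subset {k V : Plane → ℝ} {A B : Set Plane} (hA : IsCompact A) (hB : IsCompact B)
    (hV : Function.support V ⊆ A) (hk : Function.support k ⊆ B) : tsupport (mollify k V) ⊆ A + B := by
  refine closure_minimal (fun x hx => ?_) (hA.add hB).isClosed
  have := support_convolution_subset (ContinuousLinearMap.mul ℝ ℝ) (μ := volume) (f := V) (g := k) hx
  exact Set.add_subset_add hV hk this

theorem abs_mollify_le {k V : Plane → ℝ} (hk0 : ∀ x, 0 ≤ k x) (hk : Integrable k) (hk1 : ∫ x, k x = 1) {C : ℝ}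
    (hC : ∀ x, |V x| ≤ C) (x : Plane) : |mollify k V x| ≤ C := by
  rw [mollify_eq, ← Real.norm_eq_abs]
  calc ‖∫ t, k t * V (x - t)‖ ≤ ∫ t, k t * C := by
        refine norm_integral_le_of_norm_le (hk.mul_const C) (Filter.Eventually.of_forall fun t => ?_)
        rw [norm_mul, Real.norm_of_nonneg (hk0 t), Real.norm_eq_abs]
        exact mul_le_mul_of_nonneg_left (hC _) (hk0 t)
    _ = C := by rw [integral_mul_const, hk1, one_mul]

theorem tendsto_mollify {k : ℕ → Plane → ℝ} {V : Plane → ℝ} (hk0 : ∀ n x, 0 ≤ k n x) (hk1 : ∀ n, ∫ x, k n x = 1)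
    (hks : Filter.Tendsto (fun n => Function.support (k n)) Filter.atTop (𝓝 0).smallSets)
    (hV : AEStronglyMeasurable V volume) {x : Plane} (hx : ContinuousAt V x) :
    Filter.Tendsto (fun n => mollify (k n) V x) Filter.atTop (𝓝 (V x)) := by
  have := convolution_tendsto_right (μ := volume) (g := fun _ : ℕ => V) (k := fun _ => x) (x₀ := x) (z₀ := V x)
    (Filter.Eventually.of_forall hk0) (Filter.Eventually.of_forall hk1) hks
    (Filter.Eventually.of_forall fun _ => hV) (hx.tendsto.comp Filter.tendsto_snd) tendsto_const_nhds
  refine this.congr fun n => ?_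
  rw [mollify_eq]
  rfl

/-- A sequence of kernels concentrated near small multiples of a vector. -/
def kernel (e : Plane) (ε : ℝ) (hε : 0 < ε) : ContDiffBump (ε • e) :=
  ⟨ε / 2, ε, by positivity, by linarith⟩

/-- The balls that carry the kernels are centred at εe and shrink to the origin with ε, so the
mollifications converge as usual while each of them is shifted into the domain. -/
theorem exists_kernels (e : Plane) {ε₀ : ℝ} (hε₀ : 0 < ε₀) : ∃ k : ℕ → Plane → ℝ, (∀ n, ContDiff ℝ ∞ (k n)) ∧
    (∀ n, HasCompactSupport (k n)) ∧ (∀ n x, 0 ≤ k n x) ∧ (∀ n, ∫ x, k n x = 1) ∧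
    Filter.Tendsto (fun n => Function.support (k n)) Filter.atTop (𝓝 0).smallSets ∧
    ∀ n, ∃ ε, 0 < ε ∧ ε < ε₀ ∧ Function.support (k n) ⊆ Metric.closedBall (ε • e) ε := by
  have hpos : ∀ n : ℕ, 0 < ε₀ / (n + 2) := fun n => by positivity
  refine ⟨fun n => (kernel e _ (hpos n)).normed volume, fun n => ContDiffBump.contDiff_normed _,
    fun n => ContDiffBump.hasCompactSupport_normed _, fun n x => ContDiffBump.nonneg_normed _ x,
    fun n => ContDiffBump.integral_normed _, ?_, fun n => ⟨ε₀ / (n + 2), hpos n, ?_, ?_⟩⟩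
  · rw [Filter.tendsto_smallSets_iff]
    intro s hs
    obtain ⟨r, hr, hrs⟩ := Metric.mem_nhds_iff.1 hs
    have h1 : Filter.Tendsto (fun n : ℕ => ε₀ / ((n : ℝ) + 2) * (‖e‖ + 1)) Filter.atTop (𝓝 (0 * (‖e‖ + 1))) := by
      refine Filter.Tendsto.mul_const _ (Filter.Tendsto.div_atTop tendsto_const_nhds ?_)
      exact Filter.tendsto_atTop_add_const_right _ _ tendsto_natCast_atTop_atTop
    rw [zero_mul] at h1
    filter_upwards [h1.eventually (gt_mem_nhds hr)] with n hn
    refine Set.Subset.trans ?_ hrs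
    rw [ContDiffBump.support_normed_eq]
    intro z hz
    have hz' : ‖z - (ε₀ / ((n : ℝ) + 2)) • e‖ < ε₀ / ((n : ℝ) + 2) := mem_ball_iff_norm.1 hz
    rw [mem_ball_zero_iff]
    calc ‖z‖ = ‖(z - (ε₀ / ((n : ℝ) + 2)) • e) + (ε₀ / ((n : ℝ) + 2)) • e‖ := by rw [sub_add_cancel]
      _ ≤ ‖z - (ε₀ / ((n : ℝ) + 2)) • e‖ + ‖(ε₀ / ((n : ℝ) + 2)) • e‖ := norm_add_le _ _
      _ ≤ ε₀ / ((n : ℝ) + 2) + ε₀ / ((n : ℝ) + 2) * ‖e‖ := by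
          rw [norm_smul, Real.norm_eq_abs, abs_of_pos (hpos n)]; linarith
      _ < r := by linarith
  · rw [div_lt_iff₀ (by positivity)]
    have : (0 : ℝ) ≤ n := by positivity
    nlinarith
  · rw [ContDiffBump.support_normed_eq]
    exact Metric.ball_subset_closedBall

theorem IsPolygonalDomain.isFiniteMeasure {Ω : Set Plane} (hΩ : IsPolygonalDomain Ω) :
    IsFiniteMeasure (volume.restrict Ω) :=
  isFiniteMeasure_restrict.2 hΩ.isBounded.measure_lt_top.ne

theorem IsPolygonalDomain.integrableOn_of_isL2 {Ω : Set Plane} (hΩ : IsPolygonalDomain Ω) {F : Type*}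
    [NormedAddCommGroup F] {u : Plane → F} (hu : IsL2 Ω u) : IntegrableOn u Ω := by
  have := hΩ.isFiniteMeasure
  exact MemLp.integrable one_le_two hu

theorem integrableOn_apply {A : Set Plane} {u : Plane → Plane} (hu : IntegrableOn u A) (i : Fin 2) :
    IntegrableOn (fun x => u x i) A :=
  (EuclideanSpace.proj (𝕜 := ℝ) i).integrable_comp hu

theorem partialD_comp_sub {k : Plane → ℝ} (hk : ContDiff ℝ 1 k) (i : Fin 2) (x t : Plane) :
    partialD i (fun y => k (x - y)) t = -partialD i k (x - t) := by
  have h1 : HasFDerivAt k (fderiv ℝ k (x - t)) (x - t) := (hk.differentiable (by norm_num) _).hasFDerivAt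
  have h2 : HasFDerivAt (fun y : Plane => x - y) (-ContinuousLinearMap.id ℝ Plane) t :=
    (hasFDerivAt_id t).const_sub x
  have h3 := (h1.comp t h2).fderiv
  unfold partialD
  have h4 : (fun y => k (x - y)) = k ∘ fun y => x - y := rfl
  rw [h4, h3]
  simp

/-! ### Orthogonality of weak gradients and solenoidal discrete velocities. -/

namespace Mesh

variable {Ω : Set Plane} (M : Mesh Ω)

/-- The function on the plane with given restrictions to the interiors of the triangles. -/
def glue (G : M.Tri → Plane → ℝ) (x : Plane) : ℝ := ∑ τ, (interior (M.tri τ)).indicator (G τ) x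

variable {M}

theorem glue_eq {G : M.Tri → Plane → ℝ} {τ : M.Tri} {x : Plane} (hx : x ∈ interior (M.tri τ)) :
    M.glue G x = G τ x := by
  rw [glue, Finset.sum_eq_single τ]
  · exact Set.indicator_of_mem hx _
  · intro σ _ hσ
    exact Set.indicator_of_notMem (fun h => (M.tri_disjoint hσ).ne_of_mem h hx rfl) _
  · simp

theorem mem_of_glue_ne_zero {G : M.Tri → Plane → ℝ} {x : Plane} (h : M.glue G x ≠ 0) :
    ∃ τ, x ∈ interior (M.tri τ) ∧ G τ x ≠ 0 := by
  obtain ⟨τ, _, hτ⟩ := Finset.exists_ne_zero_of_sum_ne_zero h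
  exact ⟨τ, Set.mem_of_indicator_ne_zero hτ, fun h' => hτ (by
    rw [Set.indicator_of_mem (Set.mem_of_indicator_ne_zero hτ), h'])⟩

theorem continuousAt_glue {G : M.Tri → Plane → ℝ} (hG : ∀ τ, Continuous (G τ)) {τ : M.Tri} {x : Plane}
    (hx : x ∈ interior (M.tri τ)) : ContinuousAt (M.glue G) x := by
  refine (hG τ).continuousAt.congr ?_
  filter_upwards [isOpen_interior.mem_nhds hx] with y hy
  exact (glue_eq hy).symm

theorem integral_indicator_tri (τ : M.Tri) (h : Plane → ℝ) :
    ∫ x, (interior (M.tri τ)).indicator h x = ∫ x in M.tri τ, h x := by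
  rw [integral_indicator isOpen_interior.measurableSet, setIntegral_congr_set (M.interior_tri_ae τ)]

theorem integrable_glue {G : M.Tri → Plane → ℝ} (hG : ∀ τ, Continuous (G τ)) : Integrable (M.glue G) :=
  integrable_finsetSum _ fun τ _ => ((M.integrableOn_tri τ (hG τ)).mono_set interior_subset).integrable_indicator
    isOpen_interior.measurableSet

theorem integral_glue_mul {G : M.Tri → Plane → ℝ} {h : Plane → ℝ}
    (hG : ∀ τ, IntegrableOn (fun x => G τ x * h x) (M.tri τ)) :
    ∫ x, M.glue G x * h x = ∑ τ, ∫ x in M.tri τ, G τ x * h x := by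
  have h1 : ∀ x, M.glue G x * h x = ∑ τ, (interior (M.tri τ)).indicator (fun x => G τ x * h x) x := by
    intro x
    rw [glue, Finset.sum_mul]
    refine Finset.sum_congr rfl fun τ _ => ?_
    by_cases hx : x ∈ interior (M.tri τ)
    · rw [Set.indicator_of_mem hx, Set.indicator_of_mem hx]
    · rw [Set.indicator_of_notMem hx, Set.indicator_of_notMem hx, zero_mul]
  simp only [h1]
  rw [integral_finsetSum _ fun τ _ => ((hG τ).mono_set interior_subset).integrable_indicator
    isOpen_interior.measurableSet]
  exact Finset.sum_congr rfl fun τ _ => integral_indicator_tri τ _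

theorem exists_glue_le {G : M.Tri → Plane → ℝ} (hG : ∀ τ, Continuous (G τ)) : ∃ C : ℝ, ∀ x, |M.glue G x| ≤ C := by
  have h : ∀ τ, ∃ C : ℝ, 0 ≤ C ∧ ∀ x ∈ M.tri τ, |G τ x| ≤ C := fun τ => by
    obtain ⟨C, hC⟩ := (M.isCompact_tri τ).exists_bound_of_continuousOn (hG τ).continuousOn
    exact ⟨max C 0, le_max_right _ _, fun x hx => (hC x hx).trans (le_max_left _ _)⟩
  choose C hC0 hC using h
  refine ⟨∑ τ, C τ, fun x => (Finset.abs_sum_le_sum_abs _ _).trans (Finset.sum_le_sum fun τ _ => ?_)⟩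
  by_cases hx : x ∈ interior (M.tri τ)
  · rw [Set.indicator_of_mem hx]; exact hC τ x (interior_subset hx)
  · rw [Set.indicator_of_notMem hx, abs_zero]; exact hC0 τ

theorem integrableOn_mul_glue {A : Set Plane} {u : Plane → ℝ} (hu : IntegrableOn u A) {G : M.Tri → Plane → ℝ}
    (hG : ∀ τ, Continuous (G τ)) : IntegrableOn (fun x => u x * M.glue G x) A := by
  obtain ⟨C, hC⟩ := exists_glue_le hG
  exact Integrable.mul_bdd (c := C) hu (integrable_glue hG).aestronglyMeasurable.restrict
    (Filter.Eventually.of_forall hC)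

variable (M)

/-- The localized velocity and the divergence it acquires. -/
def cutoff (w : M.PV) (η : Plane → ℝ) (i : Fin 2) : Plane → ℝ := M.glue fun τ x => η x * M.vv w τ x i
def cutoffDiv (w : M.PV) (η : Plane → ℝ) : Plane → ℝ := M.glue fun τ x => ∑ i, M.vv w τ x i * partialD i η x

variable {M}

/-- The extension of w by zero is divergence-free on the plane. Tested with ηκ(x − ·), this says
that only the derivative of the cutoff contributes to the divergence of the mollified ηw. -/
theorem Solenoidal.div_mollify {k : ℕ} {w : M.PV} (hs : M.Solenoidal w) (hw : w ∈ M.Vh k) {η κ : Plane → ℝ}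
    (hη : ContDiff ℝ ∞ η) (hκ : ContDiff ℝ ∞ κ) (hκc : HasCompactSupport κ) (x : Plane) :
    ∑ i, partialD i (mollify κ (M.cutoff w η i)) x = mollify κ (M.cutoffDiv w η) x := by
  have hη1 : ContDiff ℝ 1 η := hη.of_le (by exact_mod_cast le_top)
  have hκ1 : ContDiff ℝ 1 κ := hκ.of_le (by exact_mod_cast le_top)
  have hηc := hη1.continuous
  have hκc' := hκ1.continuous
  have hdη := fun i => continuous_partialD hη1 i
  have hdκ := fun i => continuous_partialD hκ1 i
  have hκx : ContDiff ℝ 1 fun t => κ (x - t) := hκ1.comp (contDiff_const.sub contDiff_id)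
  have hc : ∀ i τ, Continuous fun t => η t * M.vv w τ t i * partialD i κ (x - t) := fun i τ =>
    (hηc.mul (continuous_pval _)).mul ((hdκ i).comp (by fun_prop))
  have hd : ∀ τ, Continuous fun t => (∑ i, M.vv w τ t i * partialD i η t) * κ (x - t) := fun τ =>
    (M.continuous_pairing w τ hη1).mul (hκc'.comp (by fun_prop))
  have h1 : ∀ i, partialD i (mollify κ (M.cutoff w η i)) x =
      ∑ τ, ∫ t in M.tri τ, η t * M.vv w τ t i * partialD i κ (x - t) := fun i => by
    rw [partialD_mollify (V := M.cutoff w η i) hκ hκc (integrable_glue fun τ => hηc.mul (continuous_pval _))]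
    exact integral_glue_mul fun τ => M.integrableOn_tri τ (hc i τ)
  have h2 : mollify κ (M.cutoffDiv w η) x =
      ∑ τ, ∫ t in M.tri τ, (∑ i, M.vv w τ t i * partialD i η t) * κ (x - t) :=
    integral_glue_mul fun τ => M.integrableOn_tri τ (hd τ)
  have h3 := hs.sum_eq_zero hw (hη1.mul hκx)
  simp only [h1]
  rw [h2, Finset.sum_comm, ← sub_eq_zero, ← Finset.sum_sub_distrib, ← neg_eq_zero, ← h3, ← Finset.sum_neg_distrib]
  refine Finset.sum_congr rfl fun τ _ => ?_
  rw [← integral_finsetSum _ fun i _ => M.integrableOn_tri τ (hc i τ),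
    ← integral_sub (M.integrableOn_tri τ (continuous_finsetSum _ fun i _ => hc i τ)) (M.integrableOn_tri τ (hd τ)),
    ← integral_neg]
  congr 1
  ext t
  simp only [partialD_mul hη1 hκx, partialD_comp_sub hκ1, Fin.sum_univ_two]
  ring

/-- The support is contained in the sum of closure Ω ∩ supp η and the ball that carries the kernel,
and `PushesIn` puts this sum into Ω. -/
theorem isTest_mollify_cutoff (hΩ : IsPolygonalDomain Ω) {w : M.PV} {η κ : Plane → ℝ} (hη : ContDiff ℝ ∞ η)
    (hκ : ContDiff ℝ ∞ κ) (hκc : HasCompactSupport κ) {U : Set Plane} {e : Plane} {ε ε₀ : ℝ} (hε : 0 < ε)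
    (hε' : ε < ε₀) (hP : PushesIn Ω U e ε₀) (hηU : tsupport η ⊆ U)
    (hκs : Function.support κ ⊆ Metric.closedBall (ε • e) ε) (i : Fin 2) :
    IsTest Ω (mollify κ (M.cutoff w η i)) := by
  have hA : IsCompact (closure Ω ∩ tsupport η) :=
    hΩ.isBounded.isCompact_closure.inter_right (isClosed_tsupport η)
  have hB : IsCompact (Metric.closedBall (ε • e) ε) := isCompact_closedBall _ _
  have hV : Function.support (M.cutoff w η i) ⊆ closure Ω ∩ tsupport η := by
    intro x hx
    obtain ⟨τ, hτ, hne⟩ := mem_of_glue_ne_zero hx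
    exact ⟨M.tri_subset_closure τ (interior_subset hτ), subset_tsupport _ (left_ne_zero_of_mul hne)⟩
  have hsub := tsupport_mollify_subset hA hB hV hκs
  refine ⟨contDiff_mollify hκ hκc (integrable_glue fun τ => hη.continuous.mul (continuous_pval _)),
    (hA.add hB).of_isClosed_subset (isClosed_tsupport _) hsub, fun x hx => ?_⟩
  obtain ⟨y, hy, z, hz, rfl⟩ := hsub hx
  exact hP ε hε hε' y ⟨hy.1, hηU hy.2⟩ z hz

/-- Pairing with a weak gradient, localized. -/
theorem Solenoidal.weakGrad_cutoff (hΩ : IsPolygonalDomain Ω) {k : ℕ} {w : M.PV} (hs : M.Solenoidal w)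
    (hw : w ∈ M.Vh k) {χ : Plane → ℝ} {g : Plane → Plane} (hχ : IntegrableOn χ Ω) (hg : IntegrableOn g Ω)
    (h : IsWeakGrad Ω χ g) {η : Plane → ℝ} (hη : ContDiff ℝ ∞ η) {U : Set Plane} {e : Plane} {ε₀ : ℝ}
    (hε₀ : 0 < ε₀) (hP : PushesIn Ω U e ε₀) (hηU : tsupport η ⊆ U) :
    ∫ x in Ω, χ x * M.cutoffDiv w η x = -∑ i, ∫ x in Ω, g x i * M.cutoff w η i x := by
  obtain ⟨κ, hκ, hκc, hκ0, hκ1, hκs, hκε⟩ := exists_kernels e hε₀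
  have hη1 : ContDiff ℝ 1 η := hη.of_le (by exact_mod_cast le_top)
  have hηc := hη1.continuous
  have hcV : ∀ i τ, Continuous fun x => η x * M.vv w τ x i := fun i τ => hηc.mul (continuous_pval _)
  have hcd : ∀ τ, Continuous fun x => ∑ i, M.vv w τ x i * partialD i η x := fun τ => M.continuous_pairing w τ hη1
  have hκi : ∀ n, Integrable (κ n) := fun n => (hκ n).continuous.integrable_of_hasCompactSupport (hκc n)
  -- Glued functions are bounded, and continuous inside each triangle, hence almost everywhere in Ω.
  -- So their mollifications converge boundedly almost everywhere and dominated convergence applies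
  -- against any integrable u.
  have hlim : ∀ (u : Plane → ℝ), IntegrableOn u Ω → ∀ (G : M.Tri → Plane → ℝ), (∀ τ, Continuous (G τ)) →
      Filter.Tendsto (fun n => ∫ x in Ω, u x * mollify (κ n) (M.glue G) x) Filter.atTop
        (𝓝 (∫ x in Ω, u x * M.glue G x)) := by
    intro u hu G hG
    obtain ⟨C, hC⟩ := exists_glue_le hG
    refine tendsto_integral_of_dominated_convergence (fun x => |u x| * C) (fun n => ?_) (hu.abs.mul_const C)
      (fun n => Filter.Eventually.of_forall fun x => ?_) ?_
    · exact hu.aestronglyMeasurable.mul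
        (contDiff_mollify (hκ n) (hκc n) (integrable_glue hG)).continuous.aestronglyMeasurable
    · rw [norm_mul, Real.norm_eq_abs, Real.norm_eq_abs]
      exact mul_le_mul_of_nonneg_left (abs_mollify_le (hκ0 n) (hκi n) (hκ1 n) hC x) (abs_nonneg _)
    · have hae : ∀ᵐ x ∂(volume.restrict Ω), x ∈ ⋃ τ, interior (M.tri τ) := by
        rw [← Measure.restrict_congr_set (M.iUnion_interior_ae hΩ)]
        exact ae_restrict_mem (MeasurableSet.iUnion fun τ => isOpen_interior.measurableSet)
      filter_upwards [hae] with x hx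
      obtain ⟨τ, hτ⟩ := Set.mem_iUnion.1 hx
      exact (tendsto_mollify hκ0 hκ1 hκs (integrable_glue hG).aestronglyMeasurable
        (continuousAt_glue hG hτ)).const_mul _
  -- The components of the mollified field are test functions in Ω, so the definition of the weak
  -- gradient applies to each of them; summation produces the divergence.
  have hn : ∀ n, ∫ x in Ω, χ x * mollify (κ n) (M.cutoffDiv w η) x =
      -∑ i, ∫ x in Ω, g x i * mollify (κ n) (M.cutoff w η i) x := by
    intro n
    obtain ⟨ε, hε, hε', hsup⟩ := hκε n
    have ht := fun i => isTest_mollify_cutoff (w := w) hΩ hη (hκ n) (hκc n) hε hε' hP hηU hsup i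
    rw [← Finset.sum_neg_distrib]
    simp only [← fun i => h _ (ht i) i]
    rw [← integral_finsetSum]
    · congr 1
      ext x
      rw [← hs.div_mollify hw hη (hκ n) (hκc n), Finset.mul_sum]
    · intro i _
      have hd := continuous_partialD ((ht i).1.of_le (by exact_mod_cast le_top) : ContDiff ℝ 1 _) i
      have hsd : HasCompactSupport (partialD i (mollify (κ n) (M.cutoff w η i))) :=
        (ht i).2.1.of_isClosed_subset (isClosed_tsupport _) (closure_minimal
          (fun x hx => by_contra fun h' => hx (partialD_eq_zero_of_notMem h' i)) (isClosed_tsupport _))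
      obtain ⟨C, hC⟩ := hsd.exists_bound_of_continuous hd
      exact Integrable.mul_bdd (c := C) hχ hd.aestronglyMeasurable (Filter.Eventually.of_forall hC)
  refine tendsto_nhds_unique (hlim χ hχ _ hcd) ?_
  have hR : Filter.Tendsto (fun n => -∑ i, ∫ x in Ω, g x i * mollify (κ n) (M.cutoff w η i) x) Filter.atTop
      (𝓝 (-∑ i, ∫ x in Ω, g x i * M.cutoff w η i x)) :=
    (tendsto_finsetSum _ fun i _ => hlim _ (integrableOn_apply hg i) _ (hcV i)).neg
  exact hR.congr fun n => (hn n).symm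

theorem integrableOn_tri_of_integrableOn (hΩ : IsPolygonalDomain Ω) {F : Type*} [NormedAddCommGroup F]
    {u : Plane → F} (hu : IntegrableOn u Ω) (τ : M.Tri) : IntegrableOn u (M.tri τ) :=
  (hu.congr_set_ae hΩ.closure_ae).mono_set (M.tri_subset_closure τ)

/-- Weak gradients are orthogonal to solenoidal discrete velocities. -/
theorem Solenoidal.weakGrad_eq_zero (hΩ : IsPolygonalDomain Ω) {k : ℕ} {w : M.PV} (hs : M.Solenoidal w)
    (hw : w ∈ M.Vh k) {χ : Plane → ℝ} {g : Plane → Plane} (hχ : IsL2 Ω χ) (hg : IsL2 Ω g)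
    (h : IsWeakGrad Ω χ g) : M.load g w = 0 := by
  have hχ1 := hΩ.integrableOn_of_isL2 hχ
  have hg1 := hΩ.integrableOn_of_isL2 hg
  -- A direction that points into Ω is available only locally. A finite cover of the compact closure
  -- and a subordinate partition of unity split w into pieces that can each be pushed inside.
  choose! U hUo hxU e ε₀ hε₀ hP using fun x (hx : x ∈ closure Ω) => exists_pushesIn hΩ hx
  obtain ⟨t, ht⟩ := hΩ.isBounded.isCompact_closure.elim_finite_subcover (fun x : closure Ω => U x)
    (fun x => hUo x x.2) (fun x hx => Set.mem_iUnion.2 ⟨⟨x, hx⟩, hxU x hx⟩)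
  obtain ⟨f, hf⟩ := SmoothPartitionOfUnity.exists_isSubordinate (modelWithCornersSelf ℝ Plane)
    (s := closure Ω) isClosed_closure (fun x : t => U x) (fun x => hUo x x.1.2) (by
      intro x hx
      obtain ⟨y, hy, hxy⟩ := Set.mem_iUnion₂.1 (ht hx)
      exact Set.mem_iUnion.2 ⟨⟨y, hy⟩, hxy⟩)
  have hfs : ∀ j, ContDiff ℝ ∞ (f j) := fun j => (f j).contMDiff.contDiff
  have hf1 : ∀ j, ContDiff ℝ 1 (f j) := fun j => (hfs j).of_le (by exact_mod_cast le_top)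
  have hsum : ∀ x ∈ Ω, ∑ j, f j x = 1 := fun x hx => by
    rw [← finsum_eq_sum_of_fintype]; exact f.sum_eq_one (subset_closure hx)
  have hdsum : ∀ x ∈ Ω, ∀ i, ∑ j, partialD i (f j) x = 0 := by
    intro x hx i
    have h1 : (fun y => ∑ j, f j y) =ᶠ[𝓝 x] fun _ => (1 : ℝ) := by
      filter_upwards [hΩ.isOpen.mem_nhds hx] with y hy using hsum y hy
    have h2 := h1.fderiv_eq (𝕜 := ℝ)
    rw [fderiv_fun_sum fun j _ => (hf1 j).differentiable (by norm_num) x, fderiv_fun_const] at h2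
    have h3 := congrArg (fun L => L (EuclideanSpace.single i (1 : ℝ))) h2
    simpa [partialD, sum_apply] using h3
  have hcV : ∀ j i τ, Continuous fun x => f j x * M.vv w τ x i := fun j i τ =>
    (hf1 j).continuous.mul (continuous_pval _)
  have hcd : ∀ j τ, Continuous fun x => ∑ i, M.vv w τ x i * partialD i (f j) x := fun j τ =>
    M.continuous_pairing w τ (hf1 j)
  have hlocal := fun j => hs.weakGrad_cutoff hΩ hw hχ1 hg1 h (hfs j) (hε₀ _ j.1.2) (hP _ j.1.2) (hf j)
  have hI1 : ∀ j, IntegrableOn (fun x => χ x * M.cutoffDiv w (f j) x) Ω := fun j =>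
    integrableOn_mul_glue hχ1 (hcd j)
  have hI2 : ∀ j i, IntegrableOn (fun x => g x i * M.cutoff w (f j) i x) Ω := fun j i =>
    integrableOn_mul_glue (integrableOn_apply hg1 i) (hcV j i)
  -- The divergences w·∇η_j of the pieces cancel in the sum, because the η_j add up to 1 on the open
  -- set Ω.
  have h1 : ∑ j, ∫ x in Ω, χ x * M.cutoffDiv w (f j) x = 0 := by
    rw [← integral_finsetSum _ fun j _ => hI1 j]
    refine integral_eq_zero_of_ae ?_
    have hae : ∀ᵐ x ∂(volume.restrict Ω), x ∈ ⋃ τ, interior (M.tri τ) := by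
      rw [← Measure.restrict_congr_set (M.iUnion_interior_ae hΩ)]
      exact ae_restrict_mem (MeasurableSet.iUnion fun τ => isOpen_interior.measurableSet)
    filter_upwards [hae, ae_restrict_mem hΩ.isOpen.measurableSet] with x hx hxΩ
    obtain ⟨τ, hτ⟩ := Set.mem_iUnion.1 hx
    have : ∀ j, M.cutoffDiv w (f j) x = ∑ i, M.vv w τ x i * partialD i (f j) x := fun j => glue_eq hτ
    simp only [this, Pi.zero_apply]
    rw [← Finset.mul_sum, Finset.sum_comm]
    simp only [← Finset.mul_sum, hdsum x hxΩ]
    simp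
  have h2 : ∑ j, ∑ i, ∫ x in Ω, g x i * M.cutoff w (f j) i x = 0 := by
    simp only [hlocal, Finset.sum_neg_distrib, neg_eq_zero] at h1
    exact h1
  simp only [← fun j => integral_finsetSum Finset.univ fun i _ => hI2 j i] at h2
  rw [← integral_finsetSum _ fun j _ => integrable_finsetSum _ fun i _ => hI2 j i,
    M.setIntegral_eq_sum hΩ fun τ => integrableOn_tri_of_integrableOn hΩ
      (integrable_finsetSum _ fun j _ => integrable_finsetSum _ fun i _ => hI2 j i) τ] at h2
  rw [load, ← h2]
  refine Finset.sum_congr rfl fun τ _ => M.setIntegral_tri_congr fun x hx => ?_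
  have hc : ∀ j i, M.cutoff w (f j) i x = f j x * M.vv w τ x i := fun j i => glue_eq hx
  simp only [hc, dotProduct]
  rw [Finset.sum_comm]
  refine Finset.sum_congr rfl fun i _ => ?_
  have := hsum x (M.interior_tri_subset hΩ τ hx)
  rw [← Finset.mul_sum, ← Finset.sum_mul, this, one_mul]

end Mesh

/-- A nondegenerate square linear system is uniquely solvable. -/
theorem existsUnique_of_injective {X : Type*} [AddCommGroup X] [Module ℝ X] [FiniteDimensional ℝ X]
    {A : X → X → ℝ} (h1 : ∀ y, IsLinearMap ℝ fun x => A x y) (h2 : ∀ x, IsLinearMap ℝ fun y => A x y)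
    (hinj : ∀ x, (∀ y, A x y = 0) → x = 0) {ℓ : X → ℝ} (hℓ : IsLinearMap ℝ ℓ) :
    ∃! x, ∀ y, A x y = ℓ y := by
  let T : X →ₗ[ℝ] Module.Dual ℝ X := LinearMap.mk₂ ℝ A (fun x x' y => (h1 y).map_add x x')
    (fun r x y => (h1 y).map_smul r x) (fun x y y' => (h2 x).map_add y y') (fun r x y => (h2 x).map_smul r y)
  have hT : ∀ x y, T x y = A x y := fun _ _ => rfl
  have hTi : Function.Injective T := by
    rw [← LinearMap.ker_eq_bot, LinearMap.ker_eq_bot']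
    exact fun x hx => hinj x fun y => by rw [← hT, hx]; rfl
  have hTs := (LinearMap.injective_iff_surjective_of_finrank_eq_finrank
    (Subspace.dual_finrank_eq (K := ℝ) (V := X)).symm).1 hTi
  obtain ⟨x, hx⟩ := hTs (hℓ.mk' ℓ)
  refine ⟨x, fun y => by rw [← hT, hx]; rfl, fun x' hx' => hTi ?_⟩
  rw [hx]
  exact LinearMap.ext fun y => hx' y

namespace Mesh

variable {Ω : Set Plane} (M : Mesh Ω)

instance (k : ℕ) : FiniteDimensional ℝ (M.HhS k) := by
  let T : M.HhS k →ₗ[ℝ] (M.Tri → Fin 2 → Fin 2 → PolyLE k) :=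
    { toFun := fun H τ i j => ⟨H.1 τ i j, (MvPolynomial.mem_restrictTotalDegree _ _ _).2 (H.2.1 τ i j)⟩
      map_add' := fun _ _ => rfl
      map_smul' := fun _ _ => rfl }
  refine FiniteDimensional.of_injective T fun H G h => Subtype.ext ?_
  ext1 τ; ext1 i; ext1 j
  exact congrArg (fun F => (F τ i j : Poly)) h

instance (k : ℕ) : FiniteDimensional ℝ (M.VhS k) := by
  let T : M.VhS k →ₗ[ℝ] (M.Tri → Fin 2 → PolyLE k) :=
    { toFun := fun H τ i => ⟨H.1 τ i, (MvPolynomial.mem_restrictTotalDegree _ _ _).2 (H.2.1 τ i)⟩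
      map_add' := fun _ _ => rfl
      map_smul' := fun _ _ => rfl }
  refine FiniteDimensional.of_injective T fun H G h => Subtype.ext ?_
  ext1 τ; ext1 i
  exact congrArg (fun F => (F τ i : Poly)) h

instance (k : ℕ) : FiniteDimensional ℝ (M.Qh0S k) := by
  let T : M.Qh0S k →ₗ[ℝ] (M.Tri → PolyLE k) :=
    { toFun := fun H τ => ⟨H.1 τ, (MvPolynomial.mem_restrictTotalDegree _ _ _).2 (H.2.1.1 τ)⟩
      map_add' := fun _ _ => rfl
      map_smul' := fun _ _ => rfl }
  refine FiniteDimensional.of_injective T fun H G h => Subtype.ext ?_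
  ext1 τ
  exact congrArg (fun F => (F τ : Poly)) h

/-! ### The load -/

variable {M}

theorem integrableOn_load (hΩ : IsPolygonalDomain Ω) {f : Plane → Plane} (hf : IsL2 Ω f) (v : M.PV) (τ : M.Tri) :
    IntegrableOn (fun x => (fun i => f x i) ⬝ᵥ M.vv v τ x) (M.tri τ) := by
  have hf1 := integrableOn_tri_of_integrableOn hΩ (hΩ.integrableOn_of_isL2 hf) τ
  simp only [dotProduct]
  exact integrable_finsetSum _ fun i _ => (integrableOn_apply hf1 i).mul_continuousOn
    (continuous_pval _).continuousOn (M.isCompact_tri τ)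

theorem isLinear_load (hΩ : IsPolygonalDomain Ω) {f : Plane → Plane} (hf : IsL2 Ω f) :
    IsLinearMap ℝ fun v : M.PV => M.load f v := by
  refine isLinearMap_sum _ fun τ _ => isLinearMap_setIntegral (integrableOn_load hΩ hf · τ) fun x => ⟨?_, ?_⟩
  · intro v w; rw [vv_add]; simp only [Pi.add_apply, dotProduct_add]
  · intro r v; rw [vv_smul]; simp only [Pi.smul_apply, dotProduct_smul]

theorem load_eq_setIntegral (hΩ : IsPolygonalDomain Ω) {f : Plane → Plane} (hf : IsL2 Ω f) (v : M.PV) :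
    M.load f v = ∫ x in Ω, ∑ i, f x i * M.toField v x i := by
  have hc : ∀ τ, ∀ x ∈ interior (M.tri τ), ∑ i, f x i * M.toField v x i = (fun i => f x i) ⬝ᵥ M.vv v τ x :=
    fun τ x hx => by simp only [M.toField_eq hx, dotProduct]
  rw [M.setIntegral_eq_sum hΩ fun τ => ?_]
  · exact Finset.sum_congr rfl fun τ _ => (M.setIntegral_tri_congr (hc τ)).symm
  · have h1 := (integrableOn_load hΩ hf v τ).mono_set (interior_subset (s := M.tri τ))
    exact (h1.congr_fun (fun x hx => (hc τ x hx).symm) isOpen_interior.measurableSet).congr_set_ae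
      (M.interior_tri_ae τ).symm

theorem load_eq_inner (hΩ : IsPolygonalDomain Ω) {f : Plane → Plane} {v : M.PV}
    (hf : MemLp f 2 (volume.restrict Ω)) (hv : MemLp (M.toField v) 2 (volume.restrict Ω)) :
    M.load f v = inner ℝ (hf.toLp f) (hv.toLp (M.toField v)) := by
  rw [load_eq_setIntegral hΩ hf, L2.inner_def]
  refine integral_congr_ae ?_
  filter_upwards [hf.coeFn_toLp, hv.coeFn_toLp] with x h1 h2
  rw [h1, h2, PiLp.inner_apply]
  exact Finset.sum_congr rfl fun i _ => mul_comm _ _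

theorem load_toField (v : M.PV) : M.load (M.toField v) v = M.ipV v v :=
  Finset.sum_congr rfl fun τ _ => M.setIntegral_tri_congr fun x hx => by
    simp only [M.toField_eq hx, dotProduct]

theorem normL2_toField (hΩ : IsPolygonalDomain Ω) (v : M.PV) : normL2 Ω (M.toField v) = M.normV v := by
  have hv : MemLp (M.toField v) 2 (volume.restrict Ω) := M.isL2_toField hΩ v
  have h := load_eq_inner hΩ hv hv
  rw [real_inner_self_eq_norm_sq, Lp.norm_toLp, load_toField] at h
  rw [normV, h]
  exact (Real.sqrt_sq ENNReal.toReal_nonneg).symm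

theorem load_le (hΩ : IsPolygonalDomain Ω) {f : Plane → Plane} (hf : IsL2 Ω f) (v : M.PV) :
    M.load f v ≤ normL2 Ω f * M.normV v := by
  have hf' : MemLp f 2 (volume.restrict Ω) := hf
  have hv : MemLp (M.toField v) 2 (volume.restrict Ω) := M.isL2_toField hΩ v
  rw [load_eq_inner hΩ hf' hv, ← normL2_toField hΩ]
  refine (real_inner_le_norm _ _).trans_eq ?_
  rw [Lp.norm_toLp, Lp.norm_toLp]; rfl

/-- Only the solenoidal part of the load acts on solenoidal velocities. -/
theorem Solenoidal.load_eq (hΩ : IsPolygonalDomain Ω) {k : ℕ} {w : M.PV} (hs : M.Solenoidal w)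
    (hw : w ∈ M.Vh k) {f f₀ : Plane → Plane} {χ : Plane → ℝ} (h : IsHelmholtzHodge Ω f f₀ χ) :
    M.load f w = M.load f₀ w := by
  obtain ⟨hf₀, hχ, _, g, hg, hgχ, hfg⟩ := h
  have hdec : M.load f w = M.load f₀ w + M.load g w := by
    rw [load, load, load, ← Finset.sum_add_distrib]
    refine Finset.sum_congr rfl fun τ _ => ?_
    rw [← integral_add (integrableOn_load hΩ hf₀.1 w τ) (integrableOn_load hΩ hg w τ)]
    refine integral_congr_ae ?_
    have hae : ∀ᵐ x ∂(volume.restrict (M.tri τ)), f x = f₀ x + g x := by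
      rw [← Measure.restrict_congr_set (M.interior_tri_ae τ)]
      exact ae_restrict_of_ae_restrict_of_subset (M.interior_tri_subset hΩ τ) hfg
    filter_upwards [hae] with x hx
    rw [← add_dotProduct]
    congr 1
    ext i
    simp [hx]
  rw [hdec, hs.weakGrad_eq_zero hΩ hw hχ hg hgχ, add_zero]

/-! ### The linearized problem -/

variable (M)

theorem mass_one_pos (hΩ : IsPolygonalDomain Ω) : 0 < ∑ τ, ∫ x in M.tri τ, M.sv (fun _ => 1) τ x := by
  have h : ∀ τ x, M.sv (fun _ => 1) τ x = 1 := fun τ x => by simp [sv, pval]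
  simp only [h]
  rw [← M.setIntegral_eq_sum hΩ fun σ => M.integrableOn_tri σ continuous_const, setIntegral_const, smul_eq_mul, mul_one]
  refine ENNReal.toReal_pos (hΩ.isOpen.measure_pos volume ?_).ne' hΩ.isBounded.measure_lt_top.ne
  exact hΩ.isSimplyConnected.isPathConnected.nonempty

theorem one_mem_Qh (k : ℕ) : (fun _ => 1 : M.PS) ∈ M.Qh k := by
  refine ⟨fun τ => by simp, fun τ hn x _ => ?_⟩
  obtain ⟨σ, hσ⟩ := Option.ne_none_iff_exists'.1 hn
  simp [jumpP, hσ, sv]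

theorem bh_one (v : M.PV) : M.bh v (fun _ => 1) = 0 := by
  have h1 : M.gradS (fun _ => 1) = 0 := by ext1 τ; ext1 i; simp [gradS]
  have h2 : ∀ τ x, M.jumpD (M.sv fun _ => 1) τ x = 0 := fun τ x => by simp [jumpD, sv]
  have h3 : M.ipV v 0 = 0 := (M.isLinear_ipV_right v).map_zero
  simp [bh, h1, h2, h3, intD, edgeInt]

/-- Constants have neither gradient nor dual jumps, so b_h does not see the mean of q. -/
theorem bh_eq_zero_of_Qh0 (hΩ : IsPolygonalDomain Ω) {k : ℕ} {w : M.PV} (h : ∀ q ∈ M.Qh0 k, M.bh w q = 0) :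
    ∀ q ∈ M.Qh k, M.bh w q = 0 := by
  intro q hq
  set m := (∑ τ, ∫ x in M.tri τ, M.sv q τ x) / ∑ τ, ∫ x in M.tri τ, M.sv (fun _ => 1) τ x with hm
  have h1 : q - m • (fun _ => 1 : M.PS) ∈ M.Qh0 k := by
    refine ⟨(M.QhS k).sub_mem hq ((M.QhS k).smul_mem m (M.one_mem_Qh k)), ?_⟩
    have hl := M.isLinear_mass
    have := (hl.map_sub q (m • fun _ => 1)).trans (congrArg _ (hl.map_smul m fun _ => 1))
    rw [this, smul_eq_mul, hm, div_mul_cancel₀ _ (M.mass_one_pos hΩ).ne', sub_self]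
  have h2 := h _ h1
  have hl := M.isLinear_bh_right w
  have := (hl.map_sub q (m • fun _ => 1)).trans (congrArg _ (hl.map_smul m fun _ => 1))
  rw [this, M.bh_one, smul_zero, sub_zero] at h2
  exact h2

/-- The linearized problem, equation by equation. -/
structure Linearized (k : ℕ) (ν : ℝ) (f : Plane → Plane) (z : M.PV) (S : M.PT) (w : M.PV) (r : M.PS) : Prop where
  mem_Hh : S ∈ M.Hh k
  mem_Vh : w ∈ M.Vh k
  mem_Qh0 : r ∈ M.Qh0 k
  flux : ∀ H ∈ M.Hh k, ν⁻¹ * M.ipT S H + M.BhStar w H = 0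
  momentum : ∀ v ∈ M.Vh k, M.Bh S v + M.Nh z w v + M.bhStar r v = M.load f v
  div : ∀ q ∈ M.Qh k, M.bh w q = 0

theorem isLinSol_iff (hΩ : IsPolygonalDomain Ω) {k : ℕ} {ν : ℝ} {f : Plane → Plane} (hf : IsL2 Ω f) {z w : M.PV} :
    M.IsLinSol k ν f z w ↔ ∃ S r, M.Linearized k ν f z S w r := by
  have e1 := fun S : M.PT => (M.isLinear_ipT_right S).map_zero
  have e2 := fun w : M.PV => (M.isLinear_BhStar_right w).map_zero
  have e3 := fun S : M.PT => (M.isLinear_Bh_right S).map_zero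
  have e4 := fun r : M.PS => (M.isLinear_bhStar_right r).map_zero
  have e5 := fun w : M.PV => (M.isLinear_bh_right w).map_zero
  have e6 := (M.isLinear_Nh_right z w).map_zero
  have e7 := (isLinear_load (M := M) hΩ hf).map_zero
  have z1 := (M.HhS k).zero_mem
  have z2 := (M.VhS k).zero_mem
  have z3 := (M.QhS k).zero_mem
  constructor
  · rintro ⟨hw, S, hS, r, hr, h⟩
    refine ⟨S, r, hS, hw, hr, fun H hH => ?_, fun v hv => ?_, fun q hq => ?_⟩
    · have := h H hH 0 z2 0 z3
      simp only [Ah, e3, e4, e5, e6, e7, add_zero] at this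
      exact this
    · have := h 0 z1 v hv 0 z3
      simp only [Ah, e1, e2, e5, mul_zero, zero_add, add_zero] at this
      linarith
    · have := h 0 z1 0 z2 q hq
      simp only [Ah, e1, e2, e3, e4, e6, e7, mul_zero, zero_add, add_zero] at this
      exact this
  · rintro ⟨S, r, h⟩
    refine ⟨h.mem_Vh, S, h.mem_Hh, r, h.mem_Qh0, fun H hH v hv q hq => ?_⟩
    have h1 := h.flux H hH
    have h2 := h.momentum v hv
    have h3 := h.div q hq
    rw [Ah, h1, h3]
    linarith

variable {M}

theorem Linearized.solenoidal {k : ℕ} {ν : ℝ} {f : Plane → Plane} {z : M.PV} {S : M.PT} {w : M.PV} {r : M.PS}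
    (h : M.Linearized k ν f z S w r) : M.Solenoidal w :=
  M.solenoidal_of_bh_eq_zero h.mem_Vh h.div

theorem isSolution_iff (hΩ : IsPolygonalDomain Ω) {k : ℕ} {ν : ℝ} {f : Plane → Plane} {G : M.PT} {u : M.PV} {p : M.PS} :
    M.IsSolution k ν f G u p ↔ M.Linearized k ν f u G u p := by
  constructor
  · rintro ⟨h1, h2, h3, h4, h5, h6⟩
    exact ⟨h1, h2, h3, h4, h5, M.bh_eq_zero_of_Qh0 hΩ h6⟩
  · rintro ⟨h1, h2, h3, h4, h5, h6⟩
    exact ⟨h1, h2, h3, h4, h5, fun q hq => h6 q hq.1⟩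

/-- The energy identity, for the difference of the convective terms and the load as a right-hand side. -/
theorem energy_identity {k : ℕ} {ν : ℝ} {S : M.PT} {w : M.PV} {r : M.PS} (hS : S ∈ M.Hh k) (hw : w ∈ M.Vh k)
    (hr : r ∈ M.Qh0 k) {X : ℝ} (h1 : ∀ H ∈ M.Hh k, ν⁻¹ * M.ipT S H + M.BhStar w H = 0)
    (h2 : M.Bh S w + M.bhStar r w = X) (h3 : ∀ q ∈ M.Qh0 k, M.bh w q = 0) :
    ν⁻¹ * M.normT S ^ 2 = X := by
  have e1 := h1 S hS
  have e2 := M.Bh_eq_neg_BhStar hS hw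
  have e3 := h3 r hr
  rw [M.bh_eq_neg_bhStar hw hr.1] at e3
  rw [normT, Real.sq_sqrt (M.ipT_self_nonneg S)]
  linarith

theorem ipT_le (G H : M.PT) : M.ipT G H ≤ M.normT G * M.normT H := by
  have hadd := fun A B C => (M.isLinear_ipT_left C).map_add A B
  have hsm := fun (r : ℝ) A C => (M.isLinear_ipT_left C).map_smul r A
  by_cases hH : M.ipT H H = 0
  · have hH0 : H = 0 := M.eq_zero_of_normT (by rw [normT, hH, Real.sqrt_zero])
    rw [hH0, (M.isLinear_ipT_right G).map_zero]
    exact mul_nonneg (Real.sqrt_nonneg _) (Real.sqrt_nonneg _)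
  · have hpos := lt_of_le_of_ne (M.ipT_self_nonneg H) (Ne.symm hH)
    have h := M.ipT_self_nonneg ((M.ipT H H) • G + (-M.ipT G H) • H)
    have e1 : M.ipT ((M.ipT H H) • G + (-M.ipT G H) • H) ((M.ipT H H) • G + (-M.ipT G H) • H) =
        M.ipT H H * (M.ipT H H * M.ipT G G - M.ipT G H ^ 2) := by
      simp only [hadd, hsm, M.ipT_comm _ (_ + _), smul_eq_mul, M.ipT_comm H G]
      ring
    rw [e1] at h
    have h2 := nonneg_of_mul_nonneg_right h hpos
    rw [normT, normT, ← Real.sqrt_mul (M.ipT_self_nonneg G)]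
    exact Real.le_sqrt_of_sq_le (by linarith)

/-- The inf-sup condition bounds the velocity by its flux. -/
theorem InfSup.normh_le (hΩ : IsPolygonalDomain Ω) {k : ℕ} {C ν : ℝ} (hν : 0 < ν) (h : M.InfSup k C) {S : M.PT} {w : M.PV}
    (hw : w ∈ M.Vh k) (h1 : ∀ H ∈ M.Hh k, ν⁻¹ * M.ipT S H + M.BhStar w H = 0) :
    C * M.normh w ≤ ν⁻¹ * M.normT S := by
  have h0 : 0 ≤ M.normT S := Real.sqrt_nonneg _
  refine InfSup.mul_normh_le M hΩ h hw (by positivity) fun H hH => ?_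
  rw [M.Bh_eq_neg_BhStar hH hw]
  have e1 := h1 H hH
  have e2 := mul_le_mul_of_nonneg_left (ipT_le S H) (inv_nonneg.2 hν.le)
  linarith

/-- Trial and test space coincide and are finite-dimensional, so it is enough that zero data have
only the zero solution. The energy identity with the nonnegative convective term gives S = 0, the
inf-sup condition then w = 0, and the momentum equation finally the pressure. -/
theorem exists_linearized (hΩ : IsPolygonalDomain Ω) {k : ℕ} {ν : ℝ} (hν : 0 < ν) {f : Plane → Plane} (hf : IsL2 Ω f)
    {z : M.PV} (hz : z ∈ M.VhDiv k) :
    ∃! s : M.PT × M.PV × M.PS, M.Linearized k ν f z s.1 s.2.1 s.2.2 := by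
  obtain ⟨κ, hκ0, hκ⟩ := M.exists_shape
  obtain ⟨C, hC, hinf⟩ := exists_infSup hΩ k κ hκ0
  have hinf := hinf M hκ
  let X := M.HhS k × M.VhS k × M.Qh0S k
  let A : X → X → ℝ := fun x y => ν⁻¹ * M.ipT x.1 y.1 + M.BhStar x.2.1 y.1 +
    (M.Bh x.1 y.2.1 + M.Nh z x.2.1 y.2.1 + M.bhStar x.2.2 y.2.1) + M.bh x.2.1 y.2.2
  have hmul : ∀ {g : X → ℝ}, IsLinearMap ℝ g → IsLinearMap ℝ fun x => ν⁻¹ * g x := fun {g} hg =>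
    ⟨fun x y => by rw [hg.map_add, mul_add], fun r x => by rw [hg.map_smul, smul_eq_mul, smul_eq_mul]; ring⟩
  have hA1 : ∀ y, IsLinearMap ℝ fun x => A x y := fun y =>
    isLinearMap_add (isLinearMap_add (isLinearMap_add
      (hmul ((M.isLinear_ipT_left y.1).comp_of (g := fun x : X => (x.1 : M.PT)) (fun _ _ => rfl) fun _ _ => rfl))
      ((M.isLinear_BhStar_left y.1).comp_of (g := fun x : X => (x.2.1 : M.PV)) (fun _ _ => rfl) fun _ _ => rfl))
      (isLinearMap_add (isLinearMap_add
        ((M.isLinear_Bh_left y.2.1).comp_of (g := fun x : X => (x.1 : M.PT)) (fun _ _ => rfl) fun _ _ => rfl)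
        ((M.isLinear_Nh_mid z y.2.1).comp_of (g := fun x : X => (x.2.1 : M.PV)) (fun _ _ => rfl) fun _ _ => rfl))
        ((M.isLinear_bhStar_left y.2.1).comp_of (g := fun x : X => (x.2.2 : M.PS)) (fun _ _ => rfl) fun _ _ => rfl)))
      ((M.isLinear_bh_left y.2.2).comp_of (g := fun x : X => (x.2.1 : M.PV)) (fun _ _ => rfl) fun _ _ => rfl)
  have hA2 : ∀ x, IsLinearMap ℝ fun y => A x y := fun x =>
    isLinearMap_add (isLinearMap_add (isLinearMap_add
      (hmul ((M.isLinear_ipT_right x.1).comp_of (g := fun x : X => (x.1 : M.PT)) (fun _ _ => rfl) fun _ _ => rfl))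
      ((M.isLinear_BhStar_right x.2.1).comp_of (g := fun x : X => (x.1 : M.PT)) (fun _ _ => rfl) fun _ _ => rfl))
      (isLinearMap_add (isLinearMap_add
        ((M.isLinear_Bh_right x.1).comp_of (g := fun x : X => (x.2.1 : M.PV)) (fun _ _ => rfl) fun _ _ => rfl)
        ((M.isLinear_Nh_right z x.2.1).comp_of (g := fun x : X => (x.2.1 : M.PV)) (fun _ _ => rfl) fun _ _ => rfl))
        ((M.isLinear_bhStar_right x.2.2).comp_of (g := fun x : X => (x.2.1 : M.PV)) (fun _ _ => rfl) fun _ _ => rfl)))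
      ((M.isLinear_bh_right x.2.1).comp_of (g := fun x : X => (x.2.2 : M.PS)) (fun _ _ => rfl) fun _ _ => rfl)
  have hℓ : IsLinearMap ℝ fun y : X => M.load f y.2.1 :=
    (isLinear_load hΩ hf).comp_of (g := fun x : X => (x.2.1 : M.PV)) (fun _ _ => rfl) fun _ _ => rfl
  have e1 := fun S : M.PT => (M.isLinear_ipT_right S).map_zero
  have e2 := fun w : M.PV => (M.isLinear_BhStar_right w).map_zero
  have e3 := fun S : M.PT => (M.isLinear_Bh_right S).map_zero
  have e4 := fun r : M.PS => (M.isLinear_bhStar_right r).map_zero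
  have e5 := fun w : M.PV => (M.isLinear_bh_right w).map_zero
  have e6 := fun w : M.PV => (M.isLinear_Nh_right z w).map_zero
  have e7 := (isLinear_load (M := M) hΩ hf).map_zero
  -- A single equation for all test triples is three equations, by putting two of the tests equal to
  -- zero. Pressures of mean zero occur as trial and as test functions, which makes the system
  -- square.
  have split : ∀ (x : X) (F : M.PV → ℝ), F 0 = 0 → ((∀ y : X, A x y = F y.2.1) ↔
      (∀ H ∈ M.Hh k, ν⁻¹ * M.ipT x.1 H + M.BhStar x.2.1 H = 0) ∧
      (∀ v ∈ M.Vh k, M.Bh x.1 v + M.Nh z x.2.1 v + M.bhStar x.2.2 v = F v) ∧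
      ∀ q ∈ M.Qh0 k, M.bh x.2.1 q = 0) := by
    intro x F hF
    constructor
    · refine fun h => ⟨fun H hH => ?_, fun v hv => ?_, fun q hq => ?_⟩
      · have := h (⟨H, hH⟩, 0, 0)
        simp only [A, ZeroMemClass.coe_zero, e3, e4, e5, e6, hF, add_zero] at this
        exact this
      · have := h (0, ⟨v, hv⟩, 0)
        simp only [A, ZeroMemClass.coe_zero, e1, e2, e5, mul_zero, zero_add, add_zero] at this
        exact this
      · have := h (0, 0, ⟨q, hq⟩)
        simp only [A, ZeroMemClass.coe_zero, e1, e2, e3, e4, e6, hF, mul_zero, zero_add, add_zero] at this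
        exact this
    · rintro ⟨h1, h2, h3⟩ y
      simp only [A, h1 _ y.1.2, h2 _ y.2.1.2, h3 _ y.2.2.2, zero_add, add_zero]
  have hinj : ∀ x, (∀ y, A x y = 0) → x = 0 := by
    intro x hx
    obtain ⟨h1, h2, h3⟩ := (split x (fun _ => 0) rfl).1 hx
    have hE := energy_identity x.1.2 x.2.1.2 x.2.2.2 (X := -M.Nh z x.2.1 x.2.1) h1
      (by linarith [h2 _ x.2.1.2]) h3
    have hN := M.Nh_self_nonneg hz.1 (M.isDivFree_piecewiseDivFree hΩ hz.2) x.2.1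
    have hS2 : M.normT x.1 ^ 2 ≤ 0 := by
      have hi : 0 < ν⁻¹ := inv_pos.2 hν
      by_contra hcon
      nlinarith [mul_pos hi (not_le.1 hcon)]
    have hS0 : M.normT x.1 = 0 := pow_eq_zero_iff two_ne_zero |>.1 (le_antisymm hS2 (sq_nonneg _))
    have hS : (x.1 : M.PT) = 0 := M.eq_zero_of_normT hS0
    have hw1 := hinf.normh_le hΩ hν x.2.1.2 h1
    rw [hS0, mul_zero] at hw1
    have hw : (x.2.1 : M.PV) = 0 := M.eq_zero_of_normh hΩ x.2.1.2
      (le_antisymm (nonpos_of_mul_nonpos_right hw1 hC) (M.normh_nonneg _))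
    -- With S = 0 and w = 0 the momentum equation reads b_h^*(r, v) = 0 for all v.
    have hr : (x.2.2 : M.PS) = 0 := by
      refine M.eq_zero_of_bhStar hΩ x.2.2.2 fun v hv => ?_
      have := h2 v hv
      rw [hS, hw, (M.isLinear_Bh_left v).map_zero, (M.isLinear_Nh_mid z v).map_zero, zero_add, zero_add] at this
      exact this
    exact Prod.ext (Subtype.ext hS) (Prod.ext (Subtype.ext hw) (Subtype.ext hr))
  obtain ⟨x, hx, hux⟩ := existsUnique_of_injective hA1 hA2 hinj hℓ
  have hx' := (split x (M.load f) e7).1 hx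
  refine ⟨(x.1, x.2.1, x.2.2), ⟨x.1.2, x.2.1.2, x.2.2.2, hx'.1, hx'.2.1, M.bh_eq_zero_of_Qh0 hΩ hx'.2.2⟩, ?_⟩
  rintro ⟨S, w, r⟩ ⟨h1, h2, h3, h4, h5, h6⟩
  have := hux (⟨S, h1⟩, ⟨w, h2⟩, ⟨r, h3⟩) ((split _ (M.load f) e7).2 ⟨h4, h5, fun q hq => h6 q hq.1⟩)
  rw [← this]

theorem existsUnique_isLinSol (hΩ : IsPolygonalDomain Ω) {k : ℕ} {ν : ℝ} (hν : 0 < ν) {f : Plane → Plane} (hf : IsL2 Ω f)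
    {z : M.PV} (hz : z ∈ M.VhDiv k) : ∃! w, M.IsLinSol k ν f z w := by
  obtain ⟨s, hs, hu⟩ := exists_linearized hΩ hν hf hz
  refine ⟨s.2.1, (M.isLinSol_iff hΩ hf).2 ⟨_, _, hs⟩, fun w hw => ?_⟩
  obtain ⟨S, r, h⟩ := (M.isLinSol_iff hΩ hf).1 hw
  rw [← hu (S, w, r) h]

theorem isLinSol_Th (hΩ : IsPolygonalDomain Ω) {k : ℕ} {ν : ℝ} (hν : 0 < ν) {f : Plane → Plane} (hf : IsL2 Ω f)
    {z : M.PV} (hz : z ∈ M.VhDiv k) : M.IsLinSol k ν f z (M.Th k ν f z) :=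
  Classical.epsilon_spec (existsUnique_isLinSol hΩ hν hf hz).exists

theorem Linearized.mem_VhDiv (hΩ : IsPolygonalDomain Ω) {k : ℕ} {ν : ℝ} {f : Plane → Plane} {z : M.PV} {S : M.PT}
    {w : M.PV} {r : M.PS} (h : M.Linearized k ν f z S w r) : w ∈ M.VhDiv k :=
  ⟨h.mem_Vh, h.solenoidal.isDivFree hΩ h.mem_Vh⟩

theorem Th_mem_VhDiv (hΩ : IsPolygonalDomain Ω) {k : ℕ} {ν : ℝ} (hν : 0 < ν) {f : Plane → Plane} (hf : IsL2 Ω f)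
    {z : M.PV} (hz : z ∈ M.VhDiv k) : M.Th k ν f z ∈ M.VhDiv k := by
  obtain ⟨S, r, h⟩ := (M.isLinSol_iff hΩ hf).1 (isLinSol_Th hΩ hν hf hz)
  exact h.mem_VhDiv hΩ

/-- Fixed points of the linearized solution map are the velocities of solutions of the scheme. -/
theorem fixedPoint_iff (hΩ : IsPolygonalDomain Ω) {k : ℕ} {ν : ℝ} (hν : 0 < ν) {f : Plane → Plane} (hf : IsL2 Ω f)
    (u : M.PV) : (u ∈ M.VhDiv k ∧ M.Th k ν f u = u) ↔ ∃ G p, M.IsSolution k ν f G u p := by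
  simp only [isSolution_iff hΩ]
  constructor
  · rintro ⟨hu, hT⟩
    have h := isLinSol_Th hΩ hν hf hu
    rw [hT] at h
    exact (M.isLinSol_iff hΩ hf).1 h
  · rintro ⟨G, p, h⟩
    have hu := h.mem_VhDiv hΩ
    exact ⟨hu, (existsUnique_isLinSol hΩ hν hf hu).unique (isLinSol_Th hΩ hν hf hu)
      ((M.isLinSol_iff hΩ hf).2 ⟨G, p, h⟩)⟩

end Mesh

/-- Banach's fixed point theorem in a ball of a finite-dimensional inner product space. -/
theorem exists_fixedPoint_of_core {X : Type*} [AddCommGroup X] [Module ℝ X] [FiniteDimensional ℝ X]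
    (core : InnerProductSpace.Core ℝ X) {N : X → ℝ} (hN0 : ∀ x, 0 ≤ N x) (hN : ∀ x, core.inner x x = N x ^ 2)
    (Y : Submodule ℝ X) {F : X → X} {ρ K : ℝ} (hρ : 0 ≤ ρ) (hK0 : 0 ≤ K) (hK1 : K < 1)
    (hF : ∀ v ∈ Y, N v ≤ ρ → F v ∈ Y ∧ N (F v) ≤ ρ)
    (hlip : ∀ u ∈ Y, ∀ v ∈ Y, N u ≤ ρ → N v ≤ ρ → N (F u - F v) ≤ K * N (u - v)) :
    ∃ u ∈ Y, N u ≤ ρ ∧ F u = u := by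
  -- The norm of this structure is N; finite dimension makes the space complete and the subspace
  -- closed.
  let _ : NormedAddCommGroup X := core.toNormedAddCommGroup
  let _ : InnerProductSpace ℝ X := InnerProductSpace.ofCore core.toCore
  have hnorm : ∀ v : X, ‖v‖ = N v := fun v => by
    have h1 : ‖v‖ ^ 2 = N v ^ 2 := by
      rw [← real_inner_self_eq_norm_sq, ← hN]
    exact (sq_eq_sq₀ (norm_nonneg _) (hN0 _)).1 h1
  have : CompleteSpace X := FiniteDimensional.complete ℝ _
  simp only [← hnorm] at hF hlip ⊢
  let s : Set X := {v | v ∈ Y ∧ ‖v‖ ≤ ρ}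
  have hsc : IsClosed s := Y.closed_of_finiteDimensional.inter (isClosed_le continuous_norm continuous_const)
  have hmaps : Set.MapsTo F s s := fun v hv => hF v hv.1 hv.2
  have hcontr : ContractingWith ⟨K, hK0⟩ (hmaps.restrict F s s) := by
    refine ⟨by exact_mod_cast hK1, LipschitzWith.of_dist_le_mul fun u v => ?_⟩
    change dist (F u) (F v) ≤ K * dist (u : X) v
    rw [dist_eq_norm, dist_eq_norm]
    exact hlip _ u.2.1 _ v.2.1 u.2.2 v.2.2
  have h0 : (0 : X) ∈ s := ⟨Y.zero_mem, by rw [norm_zero]; exact hρ⟩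
  obtain ⟨u, hu, hfix, -⟩ := hcontr.exists_fixedPoint' hsc.isComplete hmaps h0 (edist_ne_top _ _)
  exact ⟨u, hu.1, hu.2, hfix⟩

namespace Mesh

variable {Ω : Set Plane} (M : Mesh Ω)

/-! ### A priori estimates for the linearized problem -/

variable {M}

/-- Two inequalities combine: ν⁻¹‖S‖² ≤ (f₀, w) ≤ C_P‖f₀‖‖w‖_h from the energy identity, and C_B
ν‖w‖_h ≤ ‖S‖ from the inf-sup condition; one factor ‖w‖_h cancels. The gradient part of f drops out
because w is solenoidal. -/
theorem Linearized.normh_le (hΩ : IsPolygonalDomain Ω) {k : ℕ} {ν : ℝ} (hν : 0 < ν) {f f₀ : Plane → Plane}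
    {χ : Plane → ℝ} (hHH : IsHelmholtzHodge Ω f f₀ χ) {z : M.PV} (hz : z ∈ M.VhDiv k) {S : M.PT} {w : M.PV} {r : M.PS}
    (h : M.Linearized k ν f z S w r) {C_B C_P : ℝ} (hCB : 0 < C_B) (hCP : 0 < C_P) (hB : M.InfSup k C_B)
    (hP : M.Poincare k C_P) : M.normh w ≤ (C_B ^ 2)⁻¹ * ν⁻¹ * (C_P * normL2 Ω f₀) := by
  have hE := energy_identity h.mem_Hh h.mem_Vh h.mem_Qh0 (X := M.load f w - M.Nh z w w) h.flux
    (by linarith [h.momentum w h.mem_Vh]) fun q hq => h.div q hq.1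
  have hN := M.Nh_self_nonneg hz.1 (M.isDivFree_piecewiseDivFree hΩ hz.2) w
  have hl := load_le hΩ hHH.1.1 w
  rw [h.solenoidal.load_eq hΩ h.mem_Vh hHH] at hE
  have hp := hP w h.mem_Vh
  have hw := hB.normh_le hΩ hν h.mem_Vh h.flux
  have hn : 0 ≤ normL2 Ω f₀ := ENNReal.toReal_nonneg
  have hS : 0 ≤ M.normT S := Real.sqrt_nonneg _
  have hw0 := M.normh_nonneg w
  set W := M.normh w
  set s := M.normT S
  set X := normL2 Ω f₀
  have h1 : ν⁻¹ * s ^ 2 ≤ X * (C_P * W) := by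
    have := mul_le_mul_of_nonneg_left hp hn
    linarith
  have h2 : C_B * ν * W ≤ s := by
    have := mul_le_mul_of_nonneg_left hw hν.le
    rw [mul_inv_cancel_left₀ hν.ne'] at this
    linarith
  have h3 : (C_B * ν * W) ^ 2 ≤ s ^ 2 := pow_le_pow_left₀ (by positivity) h2 2
  have h4 : C_B ^ 2 * ν * W * W ≤ (C_P * X) * W := by
    have h5 := mul_le_mul_of_nonneg_left h3 (inv_nonneg.2 hν.le)
    have h6 : ν⁻¹ * (C_B * ν * W) ^ 2 = C_B ^ 2 * ν * W * W := by field_simp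
    rw [h6] at h5
    linarith
  rcases hw0.eq_or_lt with h0 | h0
  · rw [← h0]; positivity
  · have h7 := le_of_mul_le_mul_right h4 h0
    rw [← mul_inv, inv_mul_eq_div, le_div_iff₀ (by positivity)]
    linarith

/-- In the difference of the two problems the load cancels, and the convective terms are N_h(z₂; w₂,
·) − N_h(z₁; w₂, ·) − N_h(z₁; w₁ − w₂, ·). Tested with w₁ − w₂ the last one has the good sign, and
the first two are an increment in the first argument, bounded by the Lipschitz constant. The rest is
as for the a priori bound. -/
theorem Linearized.normh_sub_le (hΩ : IsPolygonalDomain Ω) {k : ℕ} {ν : ℝ} (hν : 0 < ν) {f : Plane → Plane}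
    {z₁ z₂ : M.PV} (hz₁ : z₁ ∈ M.VhDiv k) (hz₂ : z₂ ∈ M.VhDiv k) {S₁ S₂ : M.PT} {w₁ w₂ : M.PV} {r₁ r₂ : M.PS}
    (h₁ : M.Linearized k ν f z₁ S₁ w₁ r₁) (h₂ : M.Linearized k ν f z₂ S₂ w₂ r₂) {C_B C_N : ℝ} (hCB : 0 < C_B)
    (hCN : 0 ≤ C_N) (hB : M.InfSup k C_B) (hN : M.NhLipschitz k C_N) :
    C_B ^ 2 * ν * M.normh (w₁ - w₂) ≤ C_N * M.normh (z₂ - z₁) * M.normh w₂ := by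
  have hS := (M.HhS k).sub_mem h₁.mem_Hh h₂.mem_Hh
  have hw := (M.VhS k).sub_mem h₁.mem_Vh h₂.mem_Vh
  have hr := (M.Qh0S k).sub_mem h₁.mem_Qh0 h₂.mem_Qh0
  have hflux : ∀ H ∈ M.Hh k, ν⁻¹ * M.ipT (S₁ - S₂) H + M.BhStar (w₁ - w₂) H = 0 := fun H hH => by
    rw [(M.isLinear_ipT_left H).map_sub, (M.isLinear_BhStar_left H).map_sub]
    linarith [h₁.flux H hH, h₂.flux H hH]
  have hdiv : ∀ q ∈ M.Qh0 k, M.bh (w₁ - w₂) q = 0 := fun q hq => by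
    rw [(M.isLinear_bh_left q).map_sub, h₁.div q hq.1, h₂.div q hq.1, sub_zero]
  have hNw := M.Nh_self_nonneg hz₁.1 (M.isDivFree_piecewiseDivFree hΩ hz₁.2) (w₁ - w₂)
  have hNs := (M.isLinear_Nh_mid z₁ (w₁ - w₂)).map_sub w₁ w₂
  have hmom : M.Bh (S₁ - S₂) (w₁ - w₂) + M.bhStar (r₁ - r₂) (w₁ - w₂) =
      M.Nh z₂ w₂ (w₁ - w₂) - M.Nh z₁ w₁ (w₁ - w₂) := by
    rw [(M.isLinear_Bh_left (w₁ - w₂)).map_sub, (M.isLinear_bhStar_left (w₁ - w₂)).map_sub]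
    linarith [h₁.momentum _ hw, h₂.momentum _ hw]
  have hE := energy_identity hS hw hr hflux hmom hdiv
  have hL := hN z₂ hz₂.1 z₁ hz₁.1 w₂ h₂.mem_Vh (w₁ - w₂) hw
  have hb := hB.normh_le hΩ hν hw hflux
  have hS0 : 0 ≤ M.normT (S₁ - S₂) := Real.sqrt_nonneg _
  have hw0 := M.normh_nonneg (w₁ - w₂)
  set W := M.normh (w₁ - w₂)
  set s := M.normT (S₁ - S₂)
  have h1 : ν⁻¹ * s ^ 2 ≤ C_N * M.normh (z₂ - z₁) * M.normh w₂ * W := by linarith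
  have h2 : C_B * ν * W ≤ s := by
    have := mul_le_mul_of_nonneg_left hb hν.le
    rw [mul_inv_cancel_left₀ hν.ne'] at this
    linarith
  have h3 : (C_B * ν * W) ^ 2 ≤ s ^ 2 := pow_le_pow_left₀ (by positivity) h2 2
  have h4 : C_B ^ 2 * ν * W * W ≤ C_N * M.normh (z₂ - z₁) * M.normh w₂ * W := by
    have h5 := mul_le_mul_of_nonneg_left h3 (inv_nonneg.2 hν.le)
    have h6 : ν⁻¹ * (C_B * ν * W) ^ 2 = C_B ^ 2 * ν * W * W := by field_simp
    rw [h6] at h5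
    linarith
  rcases hw0.eq_or_lt with h0 | h0
  · rw [← h0, mul_zero]
    exact mul_nonneg (mul_nonneg hCN (M.normh_nonneg _)) (M.normh_nonneg _)
  · exact le_of_mul_le_mul_right h4 h0

/-! ### The discrete velocities as a Hilbert space -/

variable (M)

/-- The polarization of ‖·‖_h²; it turns the discrete velocities into a Hilbert space in which the
fixed point theorem is applied. -/
def innerh (u v : M.PV) : ℝ :=
  M.ipT (M.gradV u) (M.gradV v)
    + (∑ τ ∈ M.plus, (M.hP τ)⁻¹ * M.intP τ (fun x => M.jumpP (M.vv u) τ x ⬝ᵥ M.jumpP (M.vv v) τ x))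
    + ∑ τ, (M.hD τ)⁻¹ * M.intD τ (fun x => (M.jumpD (M.vv u) τ x ⬝ᵥ M.tD τ) * (M.jumpD (M.vv v) τ x ⬝ᵥ M.tD τ))

theorem innerh_self (v : M.PV) : M.innerh v v = M.normh v ^ 2 := by
  rw [normh_sq]
  unfold innerh jumpEnergy
  simp only [← sq, inv_hP_mul_intP, inv_hD_mul_intD, add_assoc]

theorem innerh_comm (u v : M.PV) : M.innerh u v = M.innerh v u := by
  unfold innerh
  rw [M.ipT_comm]
  simp only [dotProduct_comm (M.jumpP (M.vv u) _ _), mul_comm (M.jumpD (M.vv u) _ _ ⬝ᵥ _)]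

theorem isLinear_innerh_left (v : M.PV) : IsLinearMap ℝ fun u => M.innerh u v := by
  have hmul : ∀ {g : M.PV → ℝ} (r : ℝ), IsLinearMap ℝ g → IsLinearMap ℝ fun x => r * g x := fun {g} r hg =>
    ⟨fun x y => by rw [hg.map_add, mul_add], fun s x => by rw [hg.map_smul, smul_eq_mul, smul_eq_mul]; ring⟩
  refine isLinearMap_add (isLinearMap_add ((M.isLinear_ipT_left _).comp_of M.gradV_add M.gradV_smul)
    (isLinearMap_sum _ fun τ _ => hmul _ ?_)) (isLinearMap_sum _ fun τ _ => hmul _ ?_)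
  · refine isLinearMap_edgeInt _ _ (fun u => ?_) fun x => ⟨?_, ?_⟩
    · exact continuous_dotProduct (M.continuous_jumpP (M.continuous_vv u) τ) (M.continuous_jumpP (M.continuous_vv v) τ)
    · intro a b; rw [vv_add, jumpP_add, add_dotProduct]
    · intro r a; rw [vv_smul, jumpP_smul, smul_dotProduct]
  · refine isLinearMap_edgeInt _ _ (fun u => ?_) fun x => ⟨?_, ?_⟩
    · exact (continuous_dotProduct (M.continuous_jumpD (M.continuous_vv u) τ) continuous_const).mul
        (continuous_dotProduct (M.continuous_jumpD (M.continuous_vv v) τ) continuous_const)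
    · intro a b; rw [vv_add, jumpD_add, add_dotProduct, add_mul]
    · intro r a; rw [vv_smul, jumpD_smul, smul_dotProduct, smul_mul_assoc]

@[reducible]
def innerCore (hΩ : IsPolygonalDomain Ω) (k : ℕ) : InnerProductSpace.Core ℝ (M.VhS k) where
  inner u v := M.innerh u v
  conj_inner_symm u v := M.innerh_comm v u
  re_inner_nonneg u := (sq_nonneg _).trans_eq (M.innerh_self u).symm
  add_left u v w := (M.isLinear_innerh_left w).map_add u v
  smul_left u v r := (M.isLinear_innerh_left v).map_smul r u
  definite u h := Subtype.ext (M.eq_zero_of_normh hΩ u.2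
    (pow_eq_zero_iff two_ne_zero |>.1 ((M.innerh_self u).symm.trans h)))

/-- The discretely incompressible velocities. -/
def kerS (k : ℕ) : Submodule ℝ (M.VhS k) where
  carrier := {w | ∀ q ∈ M.Qh k, M.bh w q = 0}
  zero_mem' q _ := (M.isLinear_bh_left q).map_zero
  add_mem' {v w} hv hw q hq := ((M.isLinear_bh_left q).map_add v w).trans (by rw [hv q hq, hw q hq, add_zero])
  smul_mem' r v hv q hq := ((M.isLinear_bh_left q).map_smul r v).trans (by rw [hv q hq, smul_zero])

/-- Banach's fixed point theorem in a ball of discretely incompressible velocities. -/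
theorem exists_fixedPoint (hΩ : IsPolygonalDomain Ω) {k : ℕ} {T : M.PV → M.PV} {ρ K : ℝ} (hρ : 0 ≤ ρ) (hK0 : 0 ≤ K)
    (hK1 : K < 1) (hT : ∀ z ∈ M.Wh k ρ, T z ∈ M.Vh k ∧ (∀ q ∈ M.Qh k, M.bh (T z) q = 0) ∧ M.normh (T z) ≤ ρ)
    (hlip : ∀ z₁ ∈ M.Wh k ρ, ∀ z₂ ∈ M.Wh k ρ, M.normh (T z₁ - T z₂) ≤ K * M.normh (z₁ - z₂)) :
    ∃ u ∈ M.Wh k ρ, T u = u := by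
  classical
  -- The iteration takes place in the kernel of b_h. Its elements also have vanishing normal traces
  -- on ∂Ω, so it is in general smaller than V_h^div, but it contains the values of T on the ball,
  -- and the fixed point with them.
  have hW : ∀ v ∈ M.kerS k, M.normh v ≤ ρ → (v : M.PV) ∈ M.Wh k ρ := fun v hv hvρ =>
    ⟨⟨v.2, (M.solenoidal_of_bh_eq_zero v.2 hv).isDivFree hΩ v.2⟩, hvρ⟩
  -- The default value 0 is never taken in the ball, where T v is in V_h.
  let F : M.VhS k → M.VhS k := fun v => if h : T v ∈ M.Vh k then ⟨T v, h⟩ else 0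
  have hF : ∀ v ∈ M.kerS k, M.normh v ≤ ρ → (F v : M.PV) = T v := fun v hv hvρ => by
    simp only [F, dif_pos (hT v (hW v hv hvρ)).1]
  obtain ⟨u, hu, huρ, hfix⟩ := exists_fixedPoint_of_core (M.innerCore hΩ k) (N := fun v => M.normh v)
    (fun v => M.normh_nonneg _) (fun v => M.innerh_self v) (M.kerS k) (F := F) hρ hK0 hK1
    (fun v hv hvρ => by
      obtain ⟨_, h2, h3⟩ := hT v (hW v hv hvρ)
      rw [← hF v hv hvρ] at h2 h3
      exact ⟨h2, h3⟩)
    (fun u hu v hv huρ hvρ => by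
      rw [Submodule.coe_sub, Submodule.coe_sub, hF u hu huρ, hF v hv hvρ]
      exact hlip _ (hW u hu huρ) _ (hW v hv hvρ))
  exact ⟨u, hW u hu huρ, by rw [← hF u hu huρ, hfix]⟩

/-! ### Contraction and unique solvability. -/

variable {M}

theorem normh_sub_comm (u v : M.PV) : M.normh (u - v) = M.normh (v - u) := by
  have h : M.innerh (u - v) (u - v) = M.innerh (v - u) (v - u) := by
    have h1 : u - v = (-1 : ℝ) • (v - u) := by simp
    rw [h1, (M.isLinear_innerh_left _).map_smul, M.innerh_comm, (M.isLinear_innerh_left _).map_smul]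
    simp
  rw [innerh_self, innerh_self] at h
  exact (sq_eq_sq₀ (M.normh_nonneg _) (M.normh_nonneg _)).1 h

/-- The lower bound on ρ makes T_h map V_h^div into the ball, and the upper bound makes the
contraction factor C_N ρ / (C_B² ν) less than 1. The Lipschitz estimate holds on the whole ball, so
it also gives uniqueness there. Flux and pressure are then unique because the linearized problem at
the fixed point has one solution. -/
theorem uniquelySolvable (hΩ : IsPolygonalDomain Ω) {k : ℕ} {C_B C_N C_P : ℝ} (hCB : 0 < C_B) (hCN : 0 < C_N)
    (hCP : 0 < C_P) (hB : M.InfSup k C_B) (hN : M.NhLipschitz k C_N) (hP : M.Poincare k C_P) {ν : ℝ} (hν : 0 < ν)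
    {f f₀ : Plane → Plane} {χ : Plane → ℝ} (hf : IsL2 Ω f) (hHH : IsHelmholtzHodge Ω f f₀ χ) {ρ : ℝ}
    (hρ : (C_B ^ 2)⁻¹ * ν⁻¹ * (C_P * normL2 Ω f₀) ≤ ρ) (hρ' : ρ < C_B ^ 2 * C_N⁻¹ * ν) :
    M.UniquelySolvable k ν f ρ := by
  have hn : 0 ≤ normL2 Ω f₀ := ENNReal.toReal_nonneg
  have hρ0 : 0 ≤ ρ := le_trans (by positivity) hρ
  set K := C_N * ρ / (C_B ^ 2 * ν) with hK
  have hpos : 0 < C_B ^ 2 * ν := by positivity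
  have hK0 : 0 ≤ K := by positivity
  have hK1 : K < 1 := by
    rw [hK, div_lt_one hpos]
    calc C_N * ρ < C_N * (C_B ^ 2 * C_N⁻¹ * ν) := mul_lt_mul_of_pos_left hρ' hCN
      _ = C_B ^ 2 * ν := by field_simp
  have hlin : ∀ z ∈ M.VhDiv k, ∃ S r, M.Linearized k ν f z S (M.Th k ν f z) r := fun z hz =>
    (M.isLinSol_iff hΩ hf).1 (isLinSol_Th hΩ hν hf hz)
  have hbound : ∀ z ∈ M.VhDiv k, M.normh (M.Th k ν f z) ≤ ρ := fun z hz => by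
    obtain ⟨S, r, h⟩ := hlin z hz
    exact (h.normh_le hΩ hν hHH hz hCB hCP hB hP).trans hρ
  have hlip : ∀ z₁ ∈ M.Wh k ρ, ∀ z₂ ∈ M.Wh k ρ,
      M.normh (M.Th k ν f z₁ - M.Th k ν f z₂) ≤ K * M.normh (z₁ - z₂) := by
    intro z₁ hz₁ z₂ hz₂
    obtain ⟨S₁, r₁, h₁⟩ := hlin z₁ hz₁.1
    obtain ⟨S₂, r₂, h₂⟩ := hlin z₂ hz₂.1
    have h := h₁.normh_sub_le hΩ hν hz₁.1 hz₂.1 h₂ hCB hCN.le hB hN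
    rw [normh_sub_comm z₂ z₁] at h
    have h3 : C_N * M.normh (z₁ - z₂) * M.normh (M.Th k ν f z₂) ≤ C_N * M.normh (z₁ - z₂) * ρ :=
      mul_le_mul_of_nonneg_left (hbound z₂ hz₂.1) (mul_nonneg hCN.le (M.normh_nonneg _))
    rw [hK, div_mul_eq_mul_div, le_div_iff₀ hpos]
    linarith
  obtain ⟨u, hu, hTu⟩ := M.exists_fixedPoint hΩ hρ0 hK0 hK1 (T := M.Th k ν f) (fun z hz => by
    obtain ⟨S, r, h⟩ := hlin z hz.1
    exact ⟨h.mem_Vh, h.div, hbound z hz.1⟩) hlip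
  have huniq : ∀ v, v ∈ M.Wh k ρ → M.Th k ν f v = v → v = u := by
    intro v hv hTv
    have h := hlip v hv u hu
    rw [hTv, hTu] at h
    have h0 : M.normh (v - u) = 0 := by
      have := M.normh_nonneg (v - u)
      nlinarith
    exact sub_eq_zero.1 (M.eq_zero_of_normh hΩ ((M.VhS k).sub_mem hv.1.1 hu.1.1) h0)
  refine ⟨⟨u, ⟨hu, hTu⟩, fun v hv => huniq v hv.1 hv.2⟩, ?_⟩
  obtain ⟨G, p, hs⟩ := (fixedPoint_iff hΩ hν hf u).1 ⟨hu.1, hTu⟩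
  refine ⟨(G, u, p), ⟨hs, hu⟩, ?_⟩
  rintro ⟨G', u', p'⟩ ⟨hs', hu'⟩
  have hTu' := ((fixedPoint_iff hΩ hν hf u').2 ⟨G', p', hs'⟩).2
  have huu : u' = u := huniq u' hu' hTu'
  subst huu
  exact (exists_linearized hΩ hν hf hu.1).unique ((isSolution_iff hΩ).1 hs') ((isSolution_iff hΩ).1 hs)

/-! ### Monotonicity in the constants -/

theorem InfSup.mono {k : ℕ} {C C' : ℝ} (h : M.InfSup k C) (hC : C' ≤ C) : M.InfSup k C' :=
  (EReal.coe_le_coe_iff.2 hC).trans h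

theorem Nh_zero_left (v w : M.PV) : M.Nh 0 v w = 0 := by
  have h : M.vv 0 = 0 := by ext τ x i; simp [vv]
  have h2 : ∀ τ x, M.avgP (0 : M.Tri → Plane → Fin 2 → ℝ) τ x = 0 := fun τ x => by
    unfold avgP; split <;> simp
  simp [Nh, h, h2, avgD, intP, intD, edgeInt]

theorem NhLipschitz.nhBound {k : ℕ} {C : ℝ} (h : M.NhLipschitz k C) : M.NhBound k C := by
  intro z hz v hv w hw
  have := h z hz 0 (M.VhS k).zero_mem v hv w hw
  rwa [Nh_zero_left, sub_zero, sub_zero] at this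

end Mesh

end SDG

end

/-! ### The main theorem. -/

theorem mainTheorem2 (Ω : Set SDG.Plane) (hΩ : SDG.IsPolygonalDomain Ω) (k : ℕ) :
    -- The map `T_h` is well defined on `V_h^div`, with values in `V_h^div`, and its fixed points
    -- are the velocities of the solutions of the nonlinear scheme.
    (∀ (M : SDG.Mesh Ω) (ν : ℝ), 0 < ν → ∀ f : SDG.Plane → SDG.Plane, SDG.IsL2 Ω f →
      (∀ z ∈ M.VhDiv k, (∃! w, M.IsLinSol k ν f z w) ∧ M.Th k ν f z ∈ M.VhDiv k) ∧
      (∀ u, (u ∈ M.VhDiv k ∧ M.Th k ν f u = u) ↔ ∃ G p, M.IsSolution k ν f G u p)) ∧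
    -- Constants that depend only on the domain, the degree and the mesh regularity.
    (∀ ρE ρB : ℝ, 0 < ρE → 0 < ρB →
      ∃ C_B C_N : ℝ, 0 < C_B ∧ 0 < C_N ∧
        ∀ M : SDG.Mesh Ω, M.Regular ρE ρB →
          M.InfSup k C_B ∧ M.NhBound k C_N ∧
          ∀ ν : ℝ, 0 < ν →
            ∀ (f f₀ : SDG.Plane → SDG.Plane) (χ : SDG.Plane → ℝ),
              SDG.IsL2 Ω f → SDG.IsHelmholtzHodge Ω f f₀ χ →
              SDG.normL2 Ω f₀ < C_B ^ 4 * C_N⁻¹ * ν ^ 2 →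
              ∀ ρ : ℝ, (C_B ^ 2)⁻¹ * ν⁻¹ * SDG.normL2 Ω f₀ ≤ ρ → ρ < C_B ^ 2 * C_N⁻¹ * ν →
                M.UniquelySolvable k ν f ρ) ∧
    -- Any admissible constants on any mesh, with the discrete Poincaré constant made explicit.
    (∀ (M : SDG.Mesh Ω) (C_B C_N C_P : ℝ), 0 < C_B → 0 < C_N → 0 < C_P →
      M.InfSup k C_B → M.NhLipschitz k C_N → M.Poincare k C_P →
        ∀ ν : ℝ, 0 < ν →
          ∀ (f f₀ : SDG.Plane → SDG.Plane) (χ : SDG.Plane → ℝ),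
            SDG.IsL2 Ω f → SDG.IsHelmholtzHodge Ω f f₀ χ →
            C_P * SDG.normL2 Ω f₀ < C_B ^ 4 * C_N⁻¹ * ν ^ 2 →
            ∀ ρ : ℝ, (C_B ^ 2)⁻¹ * ν⁻¹ * (C_P * SDG.normL2 Ω f₀) ≤ ρ →
              ρ < C_B ^ 2 * C_N⁻¹ * ν →
              M.UniquelySolvable k ν f ρ) := by
  refine ⟨fun M ν hν f hf => ⟨fun z hz => ⟨SDG.Mesh.existsUnique_isLinSol hΩ hν hf hz,
    SDG.Mesh.Th_mem_VhDiv hΩ hν hf hz⟩, fun u => SDG.Mesh.fixedPoint_iff hΩ hν hf u⟩, fun ρE ρB hE hB => ?_,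
    fun M C_B C_N C_P hCB hCN hCP hB hN hP ν hν f f₀ χ hf hHH _ ρ hρ hρ' =>
      SDG.Mesh.uniquelySolvable hΩ hCB hCN hCP hB hN hP hν hf hHH hρ hρ'⟩
  have hκ : 0 < (ρE * ρB)⁻¹ := by positivity
  obtain ⟨C, hC, hinf⟩ := SDG.Mesh.exists_infSup hΩ k _ hκ
  obtain ⟨C_N, C_P, hCN, hCP, hNP⟩ := SDG.Mesh.exists_Nh_le hΩ k _ hκ
  have h1 : 0 < 1 + C_P := by positivity
  have hle : C / (1 + C_P) ≤ C := div_le_self hC.le (by linarith)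
  have hpos : 0 < C / (1 + C_P) := by positivity
  -- The Poincaré constant is absorbed into the inf-sup constant. A smaller C_B is still admissible,
  -- and it only shrinks the interval for ρ, so the general result for the constants C, C_N, C_P
  -- applies.
  refine ⟨C / (1 + C_P), C_N, hpos, hCN, fun M hM => ?_⟩
  have hs := hM.shape M hE hB
  obtain ⟨hN, hP⟩ := hNP M hs
  refine ⟨(hinf M hs).mono hle, hN.nhBound, fun ν hν f f₀ χ hf hHH _ ρ hρ hρ' =>
    SDG.Mesh.uniquelySolvable hΩ hC hCN hCP (hinf M hs) hN hP hν hf hHH (le_trans ?_ hρ) (hρ'.trans_le ?_)⟩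
  · have hn : 0 ≤ SDG.normL2 Ω f₀ := ENNReal.toReal_nonneg
    -- This is C_P ≤ (1 + C_P)².
    have h2 : (C ^ 2)⁻¹ * C_P ≤ ((C / (1 + C_P)) ^ 2)⁻¹ := by
      rw [div_pow, inv_div, inv_mul_eq_div]
      gcongr
      nlinarith
    calc (C ^ 2)⁻¹ * ν⁻¹ * (C_P * SDG.normL2 Ω f₀) = (C ^ 2)⁻¹ * C_P * (ν⁻¹ * SDG.normL2 Ω f₀) := by ring
      _ ≤ ((C / (1 + C_P)) ^ 2)⁻¹ * (ν⁻¹ * SDG.normL2 Ω f₀) :=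
        mul_le_mul_of_nonneg_right h2 (mul_nonneg (inv_nonneg.2 hν.le) hn)
      _ = _ := by ring
  · gcongr
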